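/- **Setting.** Let $k>0$ and let $\boldsymbol g$ be a smooth Lorentzian metric on $\{(u,v): 0\le v<u\}\times S^2$ in double null gauge, $$\boldsymbol g=-4\boldsymbol\Omega^2\,du\,dv+\slashed{\boldsymbol g}_{AB}(d\theta^A-\boldsymbol b^A du)(d\theta^B-\boldsymbol b^B du),\qquad \boldsymbol\Omega>0,$$ with $\slashed{\boldsymbol g}$ a Riemannian metric on each sphere $S^2_{u,v}$. Let $r^\star=v-u$, $t=u+v$, $\mathcal I=\{u=v\ge 0\}\times S^2$, and let $\gamma$ be the round metric of the unit sphere. Put $e_3=\boldsymbol\Omega^{-1}(\partial_u+\boldsymbol b^A\partial_A)$, $e_4=\boldsymbol\Omega^{-1}\partial_v$, $e_A=\partial_{\theta^A}$. With $\boldsymbol W$ the Weyl tensor of $\boldsymbol g$ and ${}^\star\boldsymbol W$ its Hodge dual, define the $S^2_{u,v}$-tensors $$\boldsymbol\alpha_{AB}=\boldsymbol W(e_A,e_4,e_B,e_4),\quad \underline{\boldsymbol\alpha}_{AB}=\boldsymbol W(e_A,e_3,e_B,e_3),\quad \boldsymbol\beta_A=\tfrac12\boldsymbol W(e_A,e_4,e_3,e_4),\quad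 \underline{\boldsymbol\beta}_A=\tfrac12\boldsymbol W(e_A,e_3,e_3,e_4),\quad \boldsymbol\sigma=\tfrac14{}^\star\boldsymbol W(e_4,e_3,e_4,e_3).$$ Let $\slashed{\boldsymbol\nabla}_3,\slashed{\boldsymbol\nabla}_4$ be the projections to the spheres $S^2_{u,v}$ of the covariant derivatives of $\boldsymbol g$ in the directions $e_3,e_4$. **Proposition 2.2.** Assume that 1. $\mathrm{Ric}(\boldsymbol g)=-3k^2\boldsymbol g$; 2. $\boldsymbol g$ is asymptotically Anti-de Sitter: $(v-u)^2\boldsymbol\Omega^2$ extends smoothly to $\mathcal I$ as a positive function, and $\boldsymbol\Omega^{-2}\boldsymbol g$ extends smoothly to $\mathcal I$ as a nondegenerate metric (that is, $\boldsymbol\Omega^{-2}\slashed{\boldsymbol g}$ and $\boldsymbol b$ extend smoothly, the former as a Riemannian metric on the spheres); 3. the metric induced by $\boldsymbol\Omega^{-2}\boldsymbol g$ on $\mathcal I$, $$\boldsymbol g^{(3)}_{\mathcal I}=-dt^2+\frac{\slashed{\boldsymbol g}_{AB}}{\boldsymbol\Omega^2}\Big(d\theta^A-\boldsymbol b^A\frac{dt}{2}\Big)\Big(d\theta^B-\boldsymbol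 b^B\frac{dt}{2}\Big),$$ is conformal to the Lorentzian cylinder $(\mathbb R\times S^2,-k^2dt^2+\gamma)$, i.e. on $\{t>0\}$ it is a positive multiple of the pullback of the cylinder metric under a smooth map into $\mathbb R\times S^2$ (for instance, under the identity or under a diffeomorphism onto an open subset). Then the following limits at $\mathcal I$ exist and satisfy $$\lim_{v\to u}(r^\star)^{-3}\boldsymbol\alpha=\lim_{v\to u}(r^\star)^{-3}\underline{\boldsymbol\alpha},\qquad \lim_{v\to u}(r^\star)^{-3}\boldsymbol\beta=-\lim_{v\to u}(r^\star)^{-3}\underline{\boldsymbol\beta},\qquad \lim_{v\to u}(r^\star)^{-3}\boldsymbol\sigma=0,$$ $$\lim_{v\to u}\big[\boldsymbol\Omega\slashed{\boldsymbol\nabla}_4-\boldsymbol\Omega\slashed{\boldsymbol\nabla}_3\big]\big((r^\star)^{-3}\boldsymbol\alpha\big)=-\lim_{v\to u}\big[\boldsymbol\Omega\slashed{\boldsymbol\nabla}_4-\boldsymbol\Omega\slashed{\boldsymbol\nabla}_3\big]\big((r^\star)^{-3}\underline{\boldsymbol\alpha}\big).$$ Here the limits are taken at every point of $\mathcal I$,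 jointly in all the variables from the region $0<v<u$, and tensors are understood through their components in any local $\slashed{\boldsymbol g}$-orthonormal frame $(E_1,E_2)$ of the spheres for which $(r^\star)^{-1}E_a$ extends continuously to $\mathcal I$. -/

import Mathlib

open scoped ContDiff Topology

noncomputable section

namespace AAdS

/-! ### Curvature of a metric given by its components in a coordinate system

Index conventions: `Γ^κ_{μν}`, `R(∂_μ, ∂_ν) ∂_l = R^κ_{lμν} ∂_κ`, `Ric_{μν} = R^κ_{μκν}`
(round spheres have positive Ricci curvature). -/

/-- Points (and vectors) of an `n`-dimensional coordinate space. -/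
abbrev Coord (n : ℕ) := Fin n → ℝ

/-- The components of a metric as functions of the coordinates. -/
abbrev MetricField (n : ℕ) := Coord n → Matrix (Fin n) (Fin n) ℝ

variable {n : ℕ}

/-- Partial derivative in the `μ`-th coordinate. -/
def pd (μ : Fin n) (f : Coord n → ℝ) (x : Coord n) : ℝ :=
  fderiv ℝ f x (Pi.single μ 1)

/-- Christoffel symbols `Γ^κ_{μν}` of the Levi-Civita connection. -/
def christoffel (g : MetricField n) (κ μ ν : Fin n) (x : Coord n) : ℝ :=
  (1 / 2) * ∑ σ, (g x)⁻¹ κ σ *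
    (pd μ (fun y => g y σ ν) x + pd ν (fun y => g y σ μ) x - pd σ (fun y => g y μ ν) x)

/-- The curvature tensor `R^κ_{lμν}`. -/
def riemannUp (g : MetricField n) (κ l μ ν : Fin n) (x : Coord n) : ℝ :=
  pd μ (christoffel g κ ν l) x - pd ν (christoffel g κ μ l) x +
    ∑ σ, (christoffel g κ μ σ x * christoffel g σ ν l x
      - christoffel g κ ν σ x * christoffel g σ μ l x)

/-- The curvature tensor with all indices down, `R_{κlμν} = g(∂_κ, R(∂_μ, ∂_ν) ∂_l)`. -/
def riemann (g : MetricField n) (κ l μ ν : Fin n) (x : Coord n) : ℝ :=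
  ∑ σ, g x κ σ * riemannUp g σ l μ ν x

/-- The Ricci tensor. -/
def ricci (g : MetricField n) (μ ν : Fin n) (x : Coord n) : ℝ :=
  ∑ κ, riemannUp g κ μ κ ν x

/-- The scalar curvature. -/
def scalarCurvature (g : MetricField n) (x : Coord n) : ℝ :=
  ∑ μ, ∑ ν, (g x)⁻¹ μ ν * ricci g μ ν x

/-- The Weyl tensor `W_{κlμν}` of a metric in dimension four. -/
def weyl (g : MetricField 4) (κ l μ ν : Fin 4) (x : Coord 4) : ℝ :=
  riemann g κ l μ ν x
    - (1 / 2) * (g x κ μ * ricci g l ν x - g x κ ν * ricci g l μ x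
        - g x l μ * ricci g κ ν x + g x l ν * ricci g κ μ x)
    + (1 / 6) * scalarCurvature g x * (g x κ μ * g x l ν - g x κ ν * g x l μ)

/-- The Levi-Civita symbol: the sign of `(i, j, k, l)` if it is a permutation, and `0` otherwise. -/
def leviCivitaSymbol (i j k l : Fin 4) : ℝ :=
  Matrix.det (Matrix.of fun a b : Fin 4 => if ![i, j, k, l] a = b then (1 : ℝ) else 0)

/-- The volume form of a Lorentzian metric (oriented by the coordinates). -/
def volumeForm (g : MetricField 4) (i j k l : Fin 4) (x : Coord 4) : ℝ :=
  Real.sqrt |(g x).det| * leviCivitaSymbol i j k l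

/-- The Hodge dual `⋆W_{κlμν} = (1/2) ε_{κl}^{στ} W_{στμν}` of the Weyl tensor. -/
def weylDual (g : MetricField 4) (κ l μ ν : Fin 4) (x : Coord 4) : ℝ :=
  (1 / 2) * ∑ σ, ∑ τ, ∑ σ₁, ∑ τ₁,
    volumeForm g κ l σ₁ τ₁ x * (g x)⁻¹ σ₁ σ * (g x)⁻¹ τ₁ τ * weyl g σ τ μ ν x

/-- Evaluation of a covariant 4-tensor on four vectors. -/
def eval4 (T : Fin 4 → Fin 4 → Fin 4 → Fin 4 → ℝ) (X Y Z V : Coord 4) : ℝ :=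
  ∑ κ, ∑ l, ∑ μ, ∑ ν, T κ l μ ν * X κ * Y l * Z μ * V ν

/-- Evaluation of a covariant 2-tensor on a sphere. -/
def eval2 (θ : Matrix (Fin 2) (Fin 2) ℝ) (X Y : Coord 2) : ℝ :=
  ∑ A, ∑ B, θ A B * X A * Y B

/-- Evaluation of a one-form on a sphere. -/
def eval1 (ξ : Coord 2) (X : Coord 2) : ℝ := ∑ A, ξ A * X A

/-! ### Double null gauge in local coordinates `(u, v, θ¹, θ²)`

The coordinates are numbered `x 0 = u`, `x 1 = v`, `x 2 = θ¹`, `x 3 = θ²`. -/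

/-- The index of the coordinate `θ^A`. -/
def ang : Fin 2 → Fin 4 := ![2, 3]

/-- The angular coordinates of a point. -/
def angles (x : Coord 4) : Coord 2 := fun A => x (ang A)

/-- The function `r⋆ = v - u`. -/
def rstar (x : Coord 4) : ℝ := x 1 - x 0

/-- Coordinate components of the lapse `Ω`, of the metric on the spheres and of the shift `b`. -/
structure NullGauge where
  Om : Coord 4 → ℝ
  gs : Coord 4 → Matrix (Fin 2) (Fin 2) ℝ
  b : Coord 4 → Coord 2

namespace NullGauge

variable (N : NullGauge)

/-- `(dθ^A - b^A du)(X)`. As `X - (dθ^A - b^A du)(X) ∂_A` is a combination of `e₃` and `e₄`,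
these are the components of the projection of `X` to the spheres. -/
def proj (x : Coord 4) (X : Coord 4) : Coord 2 := fun A => X (ang A) - N.b x A * X 0

/-- The components of `g = -4 Ω² du dv + gs_{AB} (dθ^A - b^A du) (dθ^B - b^B du)`,
where `du dv = (1/2) (du ⊗ dv + dv ⊗ du)`. -/
def metric : MetricField 4 := fun x => Matrix.of fun μ ν =>
  let X : Coord 4 := Pi.single μ 1
  let Y : Coord 4 := Pi.single ν 1
  eval2 (N.gs x) (N.proj x X) (N.proj x Y) - 2 * N.Om x ^ 2 * (X 0 * Y 1 + X 1 * Y 0)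

/-- `e₃ = Ω⁻¹ (∂_u + b^A ∂_A)`. -/
def e3 (x : Coord 4) : Coord 4 := (N.Om x)⁻¹ • ![1, 0, N.b x 0, N.b x 1]

/-- `e₄ = Ω⁻¹ ∂_v`. -/
def e4 (x : Coord 4) : Coord 4 := (N.Om x)⁻¹ • ![0, 1, 0, 0]

/-- `e_A = ∂_{θ^A}`. -/
def eA (A : Fin 2) : Coord 4 := Pi.single (ang A) 1

/-- The Weyl tensor of the spacetime metric evaluated on four vectors. -/
def W (x : Coord 4) (X Y Z V : Coord 4) : ℝ :=
  eval4 (fun κ l μ ν => weyl N.metric κ l μ ν x) X Y Z V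

/-- The Hodge dual of the Weyl tensor evaluated on four vectors. -/
def starW (x : Coord 4) (X Y Z V : Coord 4) : ℝ :=
  eval4 (fun κ l μ ν => weylDual N.metric κ l μ ν x) X Y Z V

/-- `α_{AB} = W(e_A, e₄, e_B, e₄)`. -/
def alpha (x : Coord 4) : Matrix (Fin 2) (Fin 2) ℝ :=
  Matrix.of fun A B => N.W x (eA A) (N.e4 x) (eA B) (N.e4 x)

/-- `α̲_{AB} = W(e_A, e₃, e_B, e₃)`. -/
def alphaBar (x : Coord 4) : Matrix (Fin 2) (Fin 2) ℝ :=
  Matrix.of fun A B => N.W x (eA A) (N.e3 x) (eA B) (N.e3 x)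

/-- `β_A = (1/2) W(e_A, e₄, e₃, e₄)`. -/
def beta (x : Coord 4) : Coord 2 :=
  fun A => (1 / 2) * N.W x (eA A) (N.e4 x) (N.e3 x) (N.e4 x)

/-- `β̲_A = (1/2) W(e_A, e₃, e₃, e₄)`. -/
def betaBar (x : Coord 4) : Coord 2 :=
  fun A => (1 / 2) * N.W x (eA A) (N.e3 x) (N.e3 x) (N.e4 x)

/-- `σ = (1/4) ⋆W(e₄, e₃, e₄, e₃)`. -/
def sigma (x : Coord 4) : ℝ :=
  (1 / 4) * N.starW x (N.e4 x) (N.e3 x) (N.e4 x) (N.e3 x)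

/-- The spacetime covariant derivative `∇_X e_A` at the point `x`. -/
def covA (x : Coord 4) (X : Coord 4) (A : Fin 2) : Coord 4 :=
  fun κ => ∑ μ, X μ * christoffel N.metric κ μ (ang A) x

/-- The projected covariant derivative of a covariant 2-tensor `θ` on the spheres:
`(∇̸_X θ)(e_A, e_B) = X(θ(e_A, e_B)) - θ(Π ∇_X e_A, e_B) - θ(e_A, Π ∇_X e_B)`,
with `Π` the projection to the spheres. -/
def slashNabla (X : Coord 4 → Coord 4) (θ : Coord 4 → Matrix (Fin 2) (Fin 2) ℝ)
    (x : Coord 4) : Matrix (Fin 2) (Fin 2) ℝ :=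
  Matrix.of fun A B =>
    fderiv ℝ (fun y => θ y A B) x (X x)
      - ∑ C, N.proj x (N.covA x (X x) A) C * θ x C B
      - ∑ C, N.proj x (N.covA x (X x) B) C * θ x A C

/-- The operator `Ω ∇̸₄ - Ω ∇̸₃` on covariant 2-tensors on the spheres. -/
def nabla43 (θ : Coord 4 → Matrix (Fin 2) (Fin 2) ℝ) (x : Coord 4) :
    Matrix (Fin 2) (Fin 2) ℝ :=
  N.Om x • N.slashNabla N.e4 θ x - N.Om x • N.slashNabla N.e3 θ x

end NullGauge

/-! ### The unit sphere, its charts, and fields on it -/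

/-- Euclidean three-space. -/
abbrev E3 := EuclideanSpace ℝ (Fin 3)

/-- The unit sphere `S²`. -/
abbrev S2 := Metric.sphere (0 : E3) 1

/-- Local coordinates `(θ¹, θ²)` on the sphere, given by a smooth local parametrisation.
Values of `toSphere` outside the open set `dom` are irrelevant. -/
structure SphereChart where
  dom : Set (Coord 2)
  toSphere : Coord 2 → S2
  isOpen_dom : IsOpen dom
  injOn : Set.InjOn toSphere dom
  smooth : ContDiffOn ℝ ∞ (fun θ => (toSphere θ : E3)) dom
  immersion : ∀ θ ∈ dom, LinearIndependent ℝ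
    (fun A : Fin 2 => fderiv ℝ (fun ϑ => (toSphere ϑ : E3)) θ (Pi.single A 1))

namespace SphereChart

variable (c : SphereChart)

/-- The coordinate vector `∂_{θ^A}` as a tangent vector of `S² ⊂ ℝ³`. -/
def tangent (θ : Coord 2) (A : Fin 2) : E3 :=
  fderiv ℝ (fun ϑ => (c.toSphere ϑ : E3)) θ (Pi.single A 1)

/-- The coordinate components of the round metric. -/
def round (θ : Coord 2) : Matrix (Fin 2) (Fin 2) ℝ :=
  Matrix.of fun A B => inner ℝ (c.tangent θ A) (c.tangent θ B)

/-- The components `X^A` of a tangent vector `X = X^A ∂_{θ^A}` of the sphere. -/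
def vecComp (θ : Coord 2) (X : E3) : Coord 2 :=
  (c.round θ)⁻¹.mulVec fun B => inner ℝ (c.tangent θ B) X

/-- A function of `(u, v)` and a point of the sphere, in coordinates. -/
def scalar (f : ℝ → ℝ → S2 → ℝ) (x : Coord 4) : ℝ :=
  f (x 0) (x 1) (c.toSphere (angles x))

/-- A vector field on the spheres, in coordinates. -/
def vector (b : ℝ → ℝ → S2 → E3) (x : Coord 4) : Coord 2 :=
  c.vecComp (angles x) (b (x 0) (x 1) (c.toSphere (angles x)))

/-- A field of bilinear forms on the spheres, in coordinates. -/
def form (h : ℝ → ℝ → S2 → LinearMap.BilinForm ℝ E3) (x : Coord 4) :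
    Matrix (Fin 2) (Fin 2) ℝ :=
  Matrix.of fun A B => h (x 0) (x 1) (c.toSphere (angles x))
    (c.tangent (angles x) A) (c.tangent (angles x) B)

/-- The coordinates of the points of `D × S²` that are covered by the chart. -/
def region (D : Set (ℝ × ℝ)) : Set (Coord 4) :=
  {x | (x 0, x 1) ∈ D ∧ angles x ∈ c.dom}

end SphereChart

/-- The range of `(u, v)` on the exterior region, with the boundary at infinity excluded. -/
def exterior : Set (ℝ × ℝ) := {p | 0 ≤ p.2 ∧ p.2 < p.1}

/-- The range of `(u, v)` on the exterior region, with the boundary `u = v` at infinity included. -/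
def exteriorWithBoundary : Set (ℝ × ℝ) := {p | 0 ≤ p.2 ∧ p.2 ≤ p.1}

/-- The interior of the range of `(u, v)`. -/
def exteriorInterior : Set (ℝ × ℝ) := {p | 0 < p.2 ∧ p.2 < p.1}

/-- Smoothness on `D × S²` (up to those boundary points that belong to `D`). -/
def SmoothScalar (D : Set (ℝ × ℝ)) (f : ℝ → ℝ → S2 → ℝ) : Prop :=
  ∀ c : SphereChart, ContDiffOn ℝ ∞ (c.scalar f) (c.region D)

/-- Smoothness on `D × S²` of a vector field on the spheres. -/
def SmoothVector (D : Set (ℝ × ℝ)) (b : ℝ → ℝ → S2 → E3) : Prop :=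
  ∀ (c : SphereChart) (A : Fin 2), ContDiffOn ℝ ∞ (fun x => c.vector b x A) (c.region D)

/-- Smoothness on `D × S²` of a field of bilinear forms on the spheres. -/
def SmoothForm (D : Set (ℝ × ℝ)) (h : ℝ → ℝ → S2 → LinearMap.BilinForm ℝ E3) : Prop :=
  ∀ (c : SphereChart) (A B : Fin 2), ContDiffOn ℝ ∞ (fun x => c.form h x A B) (c.region D)

/-! ### Metrics in double null gauge on `{0 ≤ v < u} × S²` -/

/-- A smooth Lorentzian metric `-4 Ω² du dv + gs_{AB} (dθ^A - b^A du) (dθ^B - b^B du)` on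
`{0 ≤ v < u} × S²`. Tangent vectors of the sphere at `p` are the vectors of `ℝ³` orthogonal to
`p`, and only the values of `gs u v p` on them matter. -/
structure DoubleNullMetric where
  Om : ℝ → ℝ → S2 → ℝ
  gs : ℝ → ℝ → S2 → LinearMap.BilinForm ℝ E3
  b : ℝ → ℝ → S2 → E3
  Om_pos : ∀ u v p, (u, v) ∈ exterior → 0 < Om u v p
  gs_symm : ∀ u v (p : S2) (X Y : E3), (u, v) ∈ exterior →
    inner ℝ (p : E3) X = 0 → inner ℝ (p : E3) Y = 0 → gs u v p X Y = gs u v p Y X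
  gs_pos : ∀ u v (p : S2) (X : E3), (u, v) ∈ exterior →
    inner ℝ (p : E3) X = 0 → X ≠ 0 → 0 < gs u v p X X
  b_tangent : ∀ u v (p : S2), (u, v) ∈ exterior → inner ℝ (p : E3) (b u v p) = 0
  smooth_Om : SmoothScalar exterior Om
  smooth_gs : SmoothForm exterior gs
  smooth_b : SmoothVector exterior b

/-- The metric in the local coordinates of a chart of the sphere. -/
def SphereChart.gauge (c : SphereChart) (g : DoubleNullMetric) : NullGauge where
  Om := c.scalar g.Om
  gs := c.form g.gs
  b := c.vector g.b

namespace DoubleNullMetric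

/-- The Einstein equations `Ric(g) = -3 k² g`. (By continuity they then hold for `v = 0` too.) -/
def IsEinstein (g : DoubleNullMetric) (k : ℝ) : Prop :=
  ∀ c : SphereChart, ∀ x ∈ c.region exteriorInterior, ∀ μ ν : Fin 4,
    ricci (c.gauge g).metric μ ν x = -3 * k ^ 2 * (c.gauge g).metric x μ ν

/-- `g` is asymptotically Anti-de Sitter: `(v-u)² Ω²` and the rescaled metric
`Ω⁻² g = -4 du dv + h_{AB} (dθ^A - b^A du) (dθ^B - b^B du)`, `h = Ω⁻² gs`, extend smoothly to
`u = v`, with a positive extension of `(v-u)² Ω²` and a nondegenerate extended metric. By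
continuity the extension is unique. -/
structure ConformalExtension (g : DoubleNullMetric) where
  lapse : ℝ → ℝ → S2 → ℝ
  h : ℝ → ℝ → S2 → LinearMap.BilinForm ℝ E3
  shift : ℝ → ℝ → S2 → E3
  lapse_eq : ∀ u v p, (u, v) ∈ exterior → lapse u v p = (v - u) ^ 2 * g.Om u v p ^ 2
  h_eq : ∀ u v (p : S2) (X Y : E3), (u, v) ∈ exterior →
    inner ℝ (p : E3) X = 0 → inner ℝ (p : E3) Y = 0 →
    h u v p X Y = g.gs u v p X Y / g.Om u v p ^ 2
  shift_eq : ∀ u v p, (u, v) ∈ exterior → shift u v p = g.b u v p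
  smooth_lapse : SmoothScalar exteriorWithBoundary lapse
  smooth_h : SmoothForm exteriorWithBoundary h
  smooth_shift : SmoothVector exteriorWithBoundary shift
  lapse_pos : ∀ u p, 0 ≤ u → 0 < lapse u u p
  h_pos : ∀ u (p : S2) (X : E3), 0 ≤ u → inner ℝ (p : E3) X = 0 → X ≠ 0 → 0 < h u u p X X
  shift_tangent : ∀ u (p : S2), 0 ≤ u → inner ℝ (p : E3) (shift u u p) = 0

variable {g : DoubleNullMetric}

/-- The induced metric `-dt² + h_{AB} (dθ^A - b^A dt/2) (dθ^B - b^B dt/2)` on the boundary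
`u = v = t/2`, at the point `(t, p)`, evaluated on the vectors `τ ∂_t + X` and `τ₁ ∂_t + X₁`
with `X`, `X₁` tangent to the sphere. -/
def ConformalExtension.boundaryMetric (E : g.ConformalExtension) (t : ℝ) (p : S2)
    (τ : ℝ) (X : E3) (τ₁ : ℝ) (X₁ : E3) : ℝ :=
  -(τ * τ₁) + E.h (t / 2) (t / 2) p
    (X - (τ / 2) • E.shift (t / 2) (t / 2) p) (X₁ - (τ₁ / 2) • E.shift (t / 2) (t / 2) p)

/-- The boundary metric is conformal to the cylinder `(ℝ × S², -k² dt² + γ)`: it is a positive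
multiple of the pullback of the cylinder metric under a smooth map `(t, p) ↦ (F t p, Q t p)`,
which is then a local diffeomorphism. The case of the identity map, where the two metrics are in
the same conformal class, is included. -/
def ConformalExtension.ConformalToCylinder (E : g.ConformalExtension) (k : ℝ) : Prop :=
  ∃ (F : ℝ → S2 → ℝ) (Q : ℝ → S2 → S2) (lam : ℝ → S2 → ℝ),
    (∀ t p, 0 < t → 0 < lam t p) ∧
    ∀ c : SphereChart,
      let O : Set (Coord 3) := {y | 0 < y 0 ∧ Fin.tail y ∈ c.dom}
      let Fc : Coord 3 → ℝ := fun y => F (y 0) (c.toSphere (Fin.tail y))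
      let Qc : Coord 3 → E3 := fun y => (Q (y 0) (c.toSphere (Fin.tail y)) : E3)
      ContDiffOn ℝ ∞ Fc O ∧ ContDiffOn ℝ ∞ Qc O ∧
      ∀ y ∈ O, ∀ V V₁ : Coord 3,
        E.boundaryMetric (y 0) (c.toSphere (Fin.tail y))
            (V 0) (∑ A, Fin.tail V A • c.tangent (Fin.tail y) A)
            (V₁ 0) (∑ A, Fin.tail V₁ A • c.tangent (Fin.tail y) A)
          = lam (y 0) (c.toSphere (Fin.tail y)) *
            (-k ^ 2 * (fderiv ℝ Fc y V * fderiv ℝ Fc y V₁)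
              + inner ℝ (fderiv ℝ Qc y V) (fderiv ℝ Qc y V₁))

end DoubleNullMetric

/-- `e 0, e 1` is a local orthonormal frame of the spheres (in coordinate components) that is
regular up to the boundary: `(r⋆)⁻¹ e` extends continuously to `u = v`. -/
def IsRegularFrame (c : SphereChart) (g : DoubleNullMetric)
    (e : Coord 4 → Fin 2 → Coord 2) : Prop :=
  (∀ x ∈ c.region exteriorInterior, ∀ a a₁ : Fin 2,
    eval2 ((c.gauge g).gs x) (e x a) (e x a₁) = if a = a₁ then 1 else 0) ∧
  ∃ f : Coord 4 → Fin 2 → Coord 2, ContinuousOn f (c.region exteriorWithBoundary) ∧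
    ∀ x ∈ c.region exteriorInterior, e x = rstar x • f x

/-- The filter of approach to a point `z` of the boundary `u = v` from the region `0 < v < u`. -/
def approach (c : SphereChart) (z : Coord 4) : Filter (Coord 4) := 𝓝[c.region exteriorInterior] z

end AAdS

end

open scoped Matrix

noncomputable section

namespace AAdS

section

/-! ### Tensor calculus over a ring with commuting derivations -/

/-! The argument lives on the compactified metric `ĝ = Ω⁻² g`, which in the coordinates `ρ = r⋆`,
`t`, `θ` is `dρ² - dt² + h (dθ + b (dρ - dt)/2)²` and is smooth up to `ρ = 0`. Put `s = Ω⁻¹ = ψ ρ`.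
The Einstein equation for `g = s⁻² ĝ` is equivalent to a system that stays regular at `ρ = 0`: `∇²s
= φ ĝ - s P` and `|ds|² = k² + 2 s φ`, with `P` the Schouten tensor of `ĝ` (`conformal_einstein`).
The Ricci identity for `∇s` turns it into `W(∇s, b, c, d) = s C_{cdb}` with the Cotton tensor `C`
(`W_grad`), and the second Bianchi identity gives `div W = C` (`div_W`).

At `ρ = 0` the system, together with the fact that the coordinate vector `∂_v` is a null gradient of
`ĝ` and hence geodesic, forces `φ = 0`, `dψ = 0` and a totally geodesic boundary
(`Collar.β_φ_and_D_ψ`). Since `s C` vanishes there, `W` has no component along the unit normal `N`;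
what remains is a trace-free curvature tensor in dimension three, so `W = 0` on the boundary
(`Collar.β_W`). The relevant object is therefore `W/ρ`, with boundary value `∂_ρ W`. One
`ρ`-derivative of `W(∇s) = s C` identifies the part of `W/ρ` with a single `N` with `C`, which
tangentially is the Cotton tensor of the boundary metric.

Conformal flatness removes it: the cylinder maps to the light cone of `ℝ^{2,3}` by `(τ, p) ↦ (cos
kτ, sin kτ, p)`, rescaling a map into the cone rescales the induced metric, and the Gauss and
Codazzi equations show that a metric induced from the cone has zero Cotton tensor
(`cotton_eq_zero_of_lightCone`). So `W/ρ` is purely electric at the boundary. With the null vectors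
`T ± N`, the combinations `α - α̲`, `β + β̲` and `σ` are built from components with exactly one `N`,
which gives the first three limits.

For the last one, a second `ρ`-derivative of `W(∇s) = s C` combined with `div W = C` yields a
transport equation: the electric part of `W/ρ` has zero covariant derivative along `N`
(`Collar.Cone.normalD_electric`). The algebraic identity `α + α̲ = 4 E - 2 (tr E) h` passes this on
to `α + α̲`. Finally `Ω e₄ - Ω e₃ = 2 N`, and the factor `r⋆⁻³` and the conformal weights combine so
that `Ω∇̸₄ - Ω∇̸₃` becomes this normal derivative in the limit.

The tensor calculus is carried out over commutative rings with commuting derivations, with a ring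
homomorphism as restriction to the boundary. The rings are then those of smooth functions on a
chart, and limits follow from Cauchy's mean value theorem along the lines of constant `t` and `θ`.
Conformal flatness is known for `t > 0` only; the point `t = 0` is reached by continuity. -/

/-- A metric with its inverse and its Levi-Civita connection `Γ κ μ ν = Γ^κ_{μν}`, over a
commutative ring with commuting derivations. -/
structure Geometry (A : Type*) [CommRing A] [Algebra ℝ A] (ι : Type*) [Fintype ι]
    [DecidableEq ι] where
  D : ι → Derivation ℝ A A
  g : ι → ι → A
  gi : ι → ι → A
  Γ : ι → ι → ι → A
  comm : ∀ μ ν f, D μ (D ν f) = D ν (D μ f)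
  g_symm : ∀ a b, g a b = g b a
  gi_symm : ∀ a b, gi a b = gi b a
  g_gi : ∀ a c, ∑ b, g a b * gi b c = if a = c then 1 else 0
  Γ_symm : ∀ a b c, Γ a b c = Γ a c b
  compat : ∀ c a b, D c (g a b) = ∑ d, (Γ d c a * g d b + Γ d c b * g a d)

section MatrixDerivation

variable {A : Type*} [CommRing A] [Algebra ℝ A] {ι : Type*} (d : Derivation ℝ A A)

theorem map_derivation_mul [Fintype ι] (M N : Matrix ι ι A) :
    (M * N).map d = M.map d * N + M * N.map d := by
  ext i j
  simp only [Matrix.map_apply, Matrix.mul_apply, Matrix.add_apply, map_sum, Derivation.leibniz,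
    smul_eq_mul, ← Finset.sum_add_distrib]
  exact Finset.sum_congr rfl fun k _ => by ring

theorem map_derivation_add (M N : Matrix ι ι A) : (M + N).map d = M.map d + N.map d := by
  ext i j; simp

theorem map_derivation_sub (M N : Matrix ι ι A) : (M - N).map d = M.map d - N.map d := by
  ext i j; simp

theorem map_derivation_transpose (M : Matrix ι ι A) : Mᵀ.map d = (M.map d)ᵀ := rfl

theorem map_derivation_comm (d₁ : Derivation ℝ A A) (h : ∀ f, d (d₁ f) = d₁ (d f))
    (M : Matrix ι ι A) : (M.map d₁).map d = (M.map d).map d₁ := by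
  ext i j; simp [h]

end MatrixDerivation

namespace Geometry

variable {A : Type*} [CommRing A] [Algebra ℝ A] {ι : Type*} [Fintype ι] [DecidableEq ι]
  (M : Geometry A ι)

/-- The metric as a matrix. -/
def gMat : Matrix ι ι A := Matrix.of M.g

/-- The inverse metric as a matrix. -/
def giMat : Matrix ι ι A := Matrix.of M.gi

/-- The connection matrix `Γ^a_{cb}`. -/
def ΓMat (c : ι) : Matrix ι ι A := Matrix.of fun a b => M.Γ a c b

/-- The curvature `R^κ_{lμν}`. -/
def R (κ l μ ν : ι) : A :=
  M.D μ (M.Γ κ ν l) - M.D ν (M.Γ κ μ l) +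
    ∑ σ, (M.Γ κ μ σ * M.Γ σ ν l - M.Γ κ ν σ * M.Γ σ μ l)

/-- The curvature with all indices down. -/
def Rm (κ l μ ν : ι) : A := ∑ σ, M.g κ σ * M.R σ l μ ν

/-- The curvature as a matrix-valued two-form. -/
def RMat (μ ν : ι) : Matrix ι ι A := Matrix.of fun κ l => M.R κ l μ ν

theorem RMat_eq (μ ν : ι) : M.RMat μ ν = (M.ΓMat ν).map (M.D μ) - (M.ΓMat μ).map (M.D ν)
    + M.ΓMat μ * M.ΓMat ν - M.ΓMat ν * M.ΓMat μ := by
  ext κ l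
  simp only [RMat, R, ΓMat, Matrix.of_apply, Matrix.sub_apply, Matrix.add_apply,
    Matrix.map_apply, Matrix.mul_apply, Finset.sum_sub_distrib]
  ring

theorem gMat_mul_giMat : M.gMat * M.giMat = 1 := by
  ext a c
  simp [Matrix.mul_apply, gMat, giMat, M.g_gi, Matrix.one_apply]

theorem giMat_mul_gMat : M.giMat * M.gMat = 1 :=
  mul_eq_one_comm.1 M.gMat_mul_giMat

theorem gi_g (a c : ι) : ∑ b, M.gi a b * M.g b c = if a = c then 1 else 0 := by
  have := congrFun (congrFun M.giMat_mul_gMat a) c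
  simpa [Matrix.mul_apply, gMat, giMat, Matrix.one_apply] using this

theorem gMat_map (c : ι) : M.gMat.map (M.D c) = (M.ΓMat c)ᵀ * M.gMat + M.gMat * M.ΓMat c := by
  ext a b
  simp only [gMat, ΓMat, Matrix.map_apply, Matrix.of_apply, Matrix.add_apply, Matrix.mul_apply,
    Matrix.transpose_apply, M.compat, Finset.sum_add_distrib]
  congr 1
  exact Finset.sum_congr rfl fun k _ => mul_comm _ _

theorem giMat_map (c : ι) :
    M.giMat.map (M.D c) = -(M.giMat * (M.ΓMat c)ᵀ + M.ΓMat c * M.giMat) := by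
  have h0 : (M.gMat * M.giMat).map (M.D c) = 0 := by
    rw [M.gMat_mul_giMat]; ext i j
    by_cases h : i = j <;> simp [h]
  rw [map_derivation_mul, gMat_map] at h0
  have h1 := congrArg (fun X => M.giMat * X) h0
  simp only [mul_add, add_mul, mul_zero, ← mul_assoc, M.giMat_mul_gMat, one_mul] at h1
  rw [mul_assoc _ M.gMat M.giMat, M.gMat_mul_giMat, mul_one] at h1
  rw [← sub_eq_zero, ← h1]; abel

theorem compat_gi (c a b : ι) :
    M.D c (M.gi a b) = -∑ d, (M.Γ a c d * M.gi d b + M.Γ b c d * M.gi a d) := by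
  have := congrFun (congrFun (M.giMat_map c) a) b
  simp only [giMat, ΓMat, Matrix.map_apply, Matrix.of_apply, Matrix.neg_apply, Matrix.add_apply,
    Matrix.mul_apply, Matrix.transpose_apply] at this
  rw [this, Finset.sum_add_distrib, add_comm]
  congr 2
  exact Finset.sum_congr rfl fun k _ => mul_comm _ _

theorem R_antisymm (κ l μ ν : ι) : M.R κ l μ ν = -M.R κ l ν μ := by
  simp only [R, Finset.sum_sub_distrib]; ring

theorem R_bianchi (κ l μ ν : ι) : M.R κ l μ ν + M.R κ μ ν l + M.R κ ν l μ = 0 := by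
  have h (μ ν l : ι) : ∑ σ, M.Γ κ μ σ * M.Γ σ ν l = ∑ σ, M.Γ κ μ σ * M.Γ σ l ν :=
    Finset.sum_congr rfl fun σ _ => by rw [M.Γ_symm σ ν l]
  simp only [R, Finset.sum_sub_distrib]
  rw [M.Γ_symm κ ν l, M.Γ_symm κ μ l, M.Γ_symm κ ν μ, h μ ν l, h ν μ l, h l ν μ]
  ring

theorem Rm_antisymm_right (a b c d : ι) : M.Rm a b c d = -M.Rm a b d c := by
  simp only [Rm, ← Finset.sum_neg_distrib]
  exact Finset.sum_congr rfl fun σ _ => by rw [M.R_antisymm]; ring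

theorem Rm_bianchi (a b c d : ι) : M.Rm a b c d + M.Rm a c d b + M.Rm a d b c = 0 := by
  simp only [Rm, ← Finset.sum_add_distrib]
  exact Finset.sum_eq_zero fun σ _ => by rw [← mul_add, ← mul_add, M.R_bianchi, mul_zero]

/-- Two derivatives commute on the metric matrix. Expanding both orders by metric compatibility
leaves exactly `Rᵀ g + g R = 0`. -/
theorem Rm_antisymm_left (a b c d : ι) : M.Rm a b c d = -M.Rm b a c d := by
  have h : (M.RMat c d)ᵀ * M.gMat + M.gMat * M.RMat c d = 0 := by
    have e : ((M.gMat).map (M.D d)).map (M.D c) = ((M.gMat).map (M.D c)).map (M.D d) :=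
      map_derivation_comm _ _ (M.comm c d) _
    simp only [gMat_map, map_derivation_add, map_derivation_mul, map_derivation_transpose] at e
    rw [← sub_eq_zero] at e
    rw [← e, RMat_eq]
    simp only [Matrix.transpose_add, Matrix.transpose_sub, Matrix.transpose_mul]
    noncomm_ring
  have h1 := congrFun (congrFun h b) a
  simp only [RMat, gMat, Matrix.add_apply, Matrix.mul_apply, Matrix.transpose_apply,
    Matrix.of_apply, Matrix.zero_apply] at h1
  simp only [Rm]
  rw [eq_neg_iff_add_eq_zero, ← h1]
  congr 1
  exact Finset.sum_congr rfl fun σ _ => by rw [M.g_symm a σ, mul_comm]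

/-- The octahedron argument: a signed sum of four first Bianchi identities leaves twice the
difference of the two sides, hence the need to cancel `2`. -/
theorem Rm_pair [IsAddTorsionFree A] (a b c d : ι) : M.Rm a b c d = M.Rm c d a b := by
  have h1 := M.Rm_bianchi a b c d
  have h2 := M.Rm_bianchi b c d a
  have h3 := M.Rm_bianchi c d a b
  have h4 := M.Rm_bianchi d a b c
  have l := M.Rm_antisymm_left
  have r := M.Rm_antisymm_right
  have : (2 : ℕ) • M.Rm a b c d = (2 : ℕ) • M.Rm c d a b := by
    simp only [two_nsmul]
    rw [l b a c d] at h2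
    rw [l c a b d, r a c b d, l c b d a] at h3
    rw [l d a b c, l d b c a, r b d c a, l d c a b] at h4
    linear_combination h1 - h2 - h3 + h4
  exact nsmul_right_injective two_ne_zero this

end Geometry

end

/-! ### Covariant derivatives, the second Bianchi identity and the Ricci identity. -/

section

namespace Geometry

variable {A : Type*} [CommRing A] [Algebra ℝ A] {ι : Type*} [Fintype ι] [DecidableEq ι]
  (M : Geometry A ι)

/-- The covariant derivative of a covariant 2-tensor. -/
def cov2 (T : ι → ι → A) (e a b : ι) : A :=
  M.D e (T a b) - ∑ f, M.Γ f e a * T f b - ∑ f, M.Γ f e b * T a f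

/-- The covariant derivative of a covariant 4-tensor. -/
def cov4 (T : ι → ι → ι → ι → A) (e a b c d : ι) : A :=
  M.D e (T a b c d) - ∑ f, M.Γ f e a * T f b c d - ∑ f, M.Γ f e b * T a f c d
    - ∑ f, M.Γ f e c * T a b f d - ∑ f, M.Γ f e d * T a b c f

/-- The Hessian of a function. -/
def hess (s : A) (c b : ι) : A := M.D c (M.D b s) - ∑ e, M.Γ e c b * M.D e s

/-- The squared length of the gradient of a function. -/
def gradSq (s : A) : A := ∑ a, ∑ b, M.gi a b * M.D a s * M.D b s

/-- The Kulkarni-Nomizu product of the metric with a symmetric 2-tensor. -/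
def kn (P : ι → ι → A) (a b c d : ι) : A :=
  M.g a c * P b d - M.g a d * P b c + P a c * M.g b d - P a d * M.g b c

theorem cov2_g (e a b : ι) : M.cov2 M.g e a b = 0 := by
  rw [cov2, M.compat, Finset.sum_add_distrib]; ring

theorem cov4_add (S T : ι → ι → ι → ι → A) (e a b c d : ι) :
    M.cov4 (fun a b c d => S a b c d + T a b c d) e a b c d
      = M.cov4 S e a b c d + M.cov4 T e a b c d := by
  simp only [cov4, map_add, mul_add, Finset.sum_add_distrib]; ring

theorem cov4_sub (S T : ι → ι → ι → ι → A) (e a b c d : ι) :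
    M.cov4 (fun a b c d => S a b c d - T a b c d) e a b c d
      = M.cov4 S e a b c d - M.cov4 T e a b c d := by
  simp only [cov4, map_sub, mul_sub, Finset.sum_sub_distrib]; ring

theorem cov4_mul_acbd (S T : ι → ι → A) (e a b c d : ι) :
    M.cov4 (fun a b c d => S a c * T b d) e a b c d
      = M.cov2 S e a c * T b d + S a c * M.cov2 T e b d := by
  simp only [cov4, cov2, Derivation.leibniz, smul_eq_mul, mul_sub, sub_mul, Finset.mul_sum,
    Finset.sum_mul, mul_assoc, mul_left_comm]
  ring

theorem cov4_mul_adbc (S T : ι → ι → A) (e a b c d : ι) :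
    M.cov4 (fun a b c d => S a d * T b c) e a b c d
      = M.cov2 S e a d * T b c + S a d * M.cov2 T e b c := by
  simp only [cov4, cov2, Derivation.leibniz, smul_eq_mul, mul_sub, sub_mul, Finset.mul_sum,
    Finset.sum_mul, mul_assoc, mul_left_comm]
  ring

/-- The metric is parallel, so the product rule only differentiates `P`. -/
theorem cov4_kn (P : ι → ι → A) (e a b c d : ι) :
    M.cov4 (M.kn P) e a b c d = M.kn (M.cov2 P e) a b c d := by
  have h : M.kn P = fun a b c d =>
      (((fun a b c d => M.g a c * P b d) a b c d - (fun a b c d => M.g a d * P b c) a b c d)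
        + (fun a b c d => P a c * M.g b d) a b c d) - (fun a b c d => P a d * M.g b c) a b c d :=
    rfl
  rw [h, cov4_sub, cov4_add, cov4_sub, cov4_mul_acbd, cov4_mul_adbc, cov4_mul_acbd,
    cov4_mul_adbc]
  simp only [cov2_g, kn]; ring

/-- The inverse metric is parallel, so traces commute with covariant derivatives. The proof
differentiates the vanishing trace and rearranges the connection terms. -/
theorem trace_cov4 (T : ι → ι → ι → ι → A)
    (h : ∀ b c, ∑ a, ∑ e, M.gi a e * T a b c e = 0) (d b c : ι) :
    ∑ a, ∑ e, M.gi a e * M.cov4 T d a b c e = 0 := by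
  have h0 := congrArg (M.D d) (h b c)
  simp only [map_sum, map_zero, Derivation.leibniz, smul_eq_mul, M.compat_gi,
    Finset.sum_add_distrib] at h0
  have hb : ∑ f, M.Γ f d b * ∑ a, ∑ e, M.gi a e * T a f c e = 0 := by simp [h]
  have hc : ∑ f, M.Γ f d c * ∑ a, ∑ e, M.gi a e * T a b f e = 0 := by simp [h]
  have e1 : ∑ a, ∑ e, M.gi a e * ∑ f, M.Γ f d b * T a f c e = 0 := by
    rw [← hb]; simp only [Finset.mul_sum]
    conv_rhs => rw [Finset.sum_comm]; enter [2, a]; rw [Finset.sum_comm]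
    exact Finset.sum_congr rfl fun a _ => Finset.sum_congr rfl fun e _ =>
      Finset.sum_congr rfl fun f _ => by ring
  have e2 : ∑ a, ∑ e, M.gi a e * ∑ f, M.Γ f d c * T a b f e = 0 := by
    rw [← hc]; simp only [Finset.mul_sum]
    conv_rhs => rw [Finset.sum_comm]; enter [2, a]; rw [Finset.sum_comm]
    exact Finset.sum_congr rfl fun a _ => Finset.sum_congr rfl fun e _ =>
      Finset.sum_congr rfl fun f _ => by ring
  have e3 : ∑ a, ∑ e, M.gi a e * ∑ f, M.Γ f d a * T f b c e
      = ∑ a, ∑ e, T a b c e * ∑ f, M.Γ a d f * M.gi f e := by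
    simp only [Finset.mul_sum]
    conv_rhs => enter [2, a]; rw [Finset.sum_comm]
    conv_rhs => rw [Finset.sum_comm]
    conv_rhs => enter [2, a]; rw [Finset.sum_comm]
    exact Finset.sum_congr rfl fun a _ => Finset.sum_congr rfl fun e _ =>
      Finset.sum_congr rfl fun f _ => by ring
  have e4 : ∑ a, ∑ e, M.gi a e * ∑ f, M.Γ f d e * T a b c f
      = ∑ a, ∑ e, T a b c e * ∑ f, M.Γ e d f * M.gi a f := by
    simp only [Finset.mul_sum]
    refine Finset.sum_congr rfl fun a _ => ?_
    conv_rhs => rw [Finset.sum_comm]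
    exact Finset.sum_congr rfl fun e _ => Finset.sum_congr rfl fun f _ => by ring
  simp only [cov4, mul_sub, Finset.sum_sub_distrib]
  simp only [mul_neg, mul_add, Finset.sum_neg_distrib, Finset.sum_add_distrib] at h0
  rw [e1, e2, e3, e4]
  linear_combination h0

/-- The second Bianchi identity. -/
theorem cov4_Rm_bianchi (e a b c d : ι) :
    M.cov4 M.Rm e a b c d + M.cov4 M.Rm c a b d e + M.cov4 M.Rm d a b e c = 0 := by
  -- `X` is the covariant derivative of the curvature on its endomorphism indices only. Its cyclic
  -- sum is the Bianchi identity for the matrix-valued curvature form; the connection terms on the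
  -- form indices cancel by the symmetry of `Γ` (`hs`).
  set X : ι → ι → ι → Matrix ι ι A := fun e c d =>
    (M.RMat c d).map (M.D e) + M.ΓMat e * M.RMat c d - M.RMat c d * M.ΓMat e with hX
  have hcyc : X e c d + X c d e + X d e c = 0 := by
    have h1 (μ ν κ) : ((M.ΓMat κ).map (M.D ν)).map (M.D μ)
        = ((M.ΓMat κ).map (M.D μ)).map (M.D ν) := map_derivation_comm _ _ (M.comm μ ν) _
    simp only [hX, RMat_eq, map_derivation_add, map_derivation_sub, map_derivation_mul]
    rw [h1 e c d, h1 e d c, h1 c d e]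
    noncomm_ring
  have hcov (e c d) : M.cov4 M.Rm e a b c d = (M.gMat * X e c d) a b
      - ∑ f, M.Γ f e c * M.Rm a b f d - ∑ f, M.Γ f e d * M.Rm a b c f := by
    have hm (c d) : M.gMat * M.RMat c d = Matrix.of fun a b => M.Rm a b c d := by
      ext; simp [gMat, RMat, Rm, Matrix.mul_apply]
    have h2 : M.gMat * X e c d = (M.gMat * M.RMat c d).map (M.D e)
        - (M.ΓMat e)ᵀ * (M.gMat * M.RMat c d) - (M.gMat * M.RMat c d) * M.ΓMat e := by
      rw [map_derivation_mul, gMat_map]; simp only [hX]; noncomm_ring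
    rw [h2, hm]
    simp only [cov4, Matrix.sub_apply, Matrix.map_apply, Matrix.of_apply, Matrix.mul_apply,
      Matrix.transpose_apply, ΓMat]
    simp only [mul_comm (M.Rm _ _ _ _)]
  have hz : (M.gMat * X e c d) a b + (M.gMat * X c d e) a b + (M.gMat * X d e c) a b = 0 := by
    rw [← Matrix.add_apply, ← Matrix.add_apply, ← mul_add, ← mul_add, hcyc]; simp
  have hs (e c d) : ∑ f, M.Γ f e c * M.Rm a b d f = -∑ f, M.Γ f c e * M.Rm a b f d := by
    rw [← Finset.sum_neg_distrib]
    exact Finset.sum_congr rfl fun f _ => by rw [M.Γ_symm, M.Rm_antisymm_right]; ring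
  rw [hcov, hcov, hcov]
  linear_combination hz - hs e d c - hs c e d - hs d c e

/-- The Ricci identity for a gradient. -/
theorem hess_ricci_identity (s : A) (b c d : ι) :
    (M.D c (M.hess s d b) - ∑ e, M.Γ e c b * M.hess s d e)
      - (M.D d (M.hess s c b) - ∑ e, M.Γ e d b * M.hess s c e)
      = -∑ a, M.R a b c d * M.D a s := by
  have h1 (c d : ι) : ∑ e, M.Γ e c b * ∑ f, M.Γ f d e * M.D f s
      = ∑ a, (∑ σ, M.Γ a d σ * M.Γ σ c b) * M.D a s := by
    simp only [Finset.mul_sum, Finset.sum_mul]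
    rw [Finset.sum_comm]
    exact Finset.sum_congr rfl fun f _ => Finset.sum_congr rfl fun e _ => by ring
  simp only [hess, R, map_sub, map_sum, Derivation.leibniz, smul_eq_mul, mul_sub,
    Finset.sum_sub_distrib, Finset.sum_add_distrib, add_mul, sub_mul]
  rw [h1, h1, M.comm c d (M.D b s)]
  simp only [mul_comm (M.D _ s)]
  ring

end Geometry

end

/-! ### Schouten, Weyl and Cotton tensors, and the equations for the conformal factor of an Einstein
metric. -/

section

/-- Real scalars make division by nonzero integers possible; this is what allows factors of two to
be cancelled throughout. -/
theorem isAddTorsionFree_of_algebra (A : Type*) [CommRing A] [Algebra ℝ A] :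
    IsAddTorsionFree A where
  nsmul_right_injective n hn a b h := by
    have hn' : (n : ℝ) ≠ 0 := by exact_mod_cast hn
    have h' : (n : ℝ) • a = (n : ℝ) • b := by simpa [Nat.cast_smul_eq_nsmul] using h
    simpa [smul_smul, inv_mul_cancel₀ hn'] using congrArg (fun x => (n : ℝ)⁻¹ • x) h'

namespace Geometry

variable {A : Type*} [CommRing A] [Algebra ℝ A] {ι : Type*} [Fintype ι] [DecidableEq ι]
  (M : Geometry A ι)

/-- The Ricci tensor. -/
def Ric (b d : ι) : A := ∑ a, M.R a b a d

/-- The scalar curvature. -/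
def scal : A := ∑ b, ∑ d, M.gi b d * M.Ric b d

/-- The Cotton tensor built from a 2-tensor `P`. -/
def cotton (P : ι → ι → A) (c d b : ι) : A := M.cov2 P c d b - M.cov2 P d c b

theorem sum_gi_g_mul (a : ι) (f : ι → A) : ∑ b, ∑ c, M.gi a b * M.g b c * f c = f a := by
  rw [Finset.sum_comm]
  simp only [← Finset.sum_mul, M.gi_g]
  simp

theorem sum_g_gi_mul (a : ι) (f : ι → A) : ∑ b, ∑ c, M.g a b * M.gi b c * f c = f a := by
  rw [Finset.sum_comm]
  simp only [← Finset.sum_mul, M.g_gi]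
  simp

theorem R_eq_sum_Rm (a b c d : ι) : M.R a b c d = ∑ e, M.gi a e * M.Rm e b c d := by
  simp only [Rm, Finset.mul_sum, ← mul_assoc]
  exact (M.sum_gi_g_mul a fun f => M.R f b c d).symm

theorem Ric_eq_sum_Rm (b d : ι) : M.Ric b d = ∑ a, ∑ e, M.gi a e * M.Rm e b a d := by
  simp only [Ric, R_eq_sum_Rm]

theorem Ric_symm (b d : ι) : M.Ric b d = M.Ric d b := by
  have := isAddTorsionFree_of_algebra A
  rw [Ric_eq_sum_Rm, Ric_eq_sum_Rm, Finset.sum_comm]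
  exact Finset.sum_congr rfl fun a _ => Finset.sum_congr rfl fun e _ => by
    rw [M.gi_symm e a, M.Rm_pair a b e d]

theorem cotton_eq (P : ι → ι → A) (c d b : ι) : M.cotton P c d b =
    (M.D c (P d b) - ∑ f, M.Γ f c b * P d f) - (M.D d (P c b) - ∑ f, M.Γ f d b * P c f) := by
  simp only [cotton, cov2, M.Γ_symm _ c d]; ring

theorem cotton_antisymm (P : ι → ι → A) (c d b : ι) : M.cotton P c d b = -M.cotton P d c b := by
  simp only [cotton]; ring

/-- The connection terms from differentiating the inverse metric complete the second derivatives of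
`s` to its Hessian. -/
theorem D_gradSq (s : A) (c : ι) :
    M.D c (M.gradSq s) = 2 * ∑ a, ∑ b, M.gi a b * M.D a s * M.hess s c b := by
  have e1 : ∑ a, ∑ b, M.gi a b * M.D a s * ∑ f, M.Γ f c b * M.D f s
      = ∑ a, ∑ b, (∑ f, M.Γ b c f * M.gi a f) * M.D a s * M.D b s := by
    simp only [Finset.mul_sum, Finset.sum_mul]
    refine Finset.sum_congr rfl fun a _ => ?_
    rw [Finset.sum_comm]
    exact Finset.sum_congr rfl fun e _ => Finset.sum_congr rfl fun f _ => by ring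
  have e2 : ∑ a, ∑ b, (∑ f, M.Γ a c f * M.gi f b) * M.D a s * M.D b s
      = ∑ a, ∑ b, (∑ f, M.Γ b c f * M.gi a f) * M.D a s * M.D b s := by
    rw [Finset.sum_comm]
    exact Finset.sum_congr rfl fun a _ => Finset.sum_congr rfl fun b _ => by
      simp only [M.gi_symm _ a]; ring
  have e3 : ∑ a, ∑ b, M.gi a b * M.D c (M.D a s) * M.D b s
      = ∑ a, ∑ b, M.gi a b * M.D a s * M.D c (M.D b s) := by
    rw [Finset.sum_comm]
    exact Finset.sum_congr rfl fun a _ => Finset.sum_congr rfl fun b _ => by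
      rw [M.gi_symm b a]; ring
  have e4 : M.D c (M.gradSq s) = ∑ a, ∑ b, M.gi a b * M.D c (M.D a s) * M.D b s
      + ∑ a, ∑ b, M.gi a b * M.D a s * M.D c (M.D b s)
      - ∑ a, ∑ b, (∑ f, M.Γ a c f * M.gi f b) * M.D a s * M.D b s
      - ∑ a, ∑ b, (∑ f, M.Γ b c f * M.gi a f) * M.D a s * M.D b s := by
    simp only [gradSq, map_sum, Derivation.leibniz, smul_eq_mul, compat_gi,
      ← Finset.sum_add_distrib, ← Finset.sum_sub_distrib]
    refine Finset.sum_congr rfl fun a _ => Finset.sum_congr rfl fun b _ => ?_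
    rw [Finset.sum_add_distrib]; ring
  rw [e4, e2, e3]
  simp only [hess, mul_sub, Finset.sum_sub_distrib, e1]
  ring

theorem cov4_antisymm_right (T : ι → ι → ι → ι → A) (h : ∀ a b c d, T a b c d = -T a b d c)
    (e a b c d : ι) : M.cov4 T e a b c d = -M.cov4 T e a b d c := by
  have e1 : ∑ f, M.Γ f e a * T f b c d = -∑ f, M.Γ f e a * T f b d c := by
    rw [← Finset.sum_neg_distrib]; exact Finset.sum_congr rfl fun f _ => by rw [h]; ring
  have e2 : ∑ f, M.Γ f e b * T a f c d = -∑ f, M.Γ f e b * T a f d c := by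
    rw [← Finset.sum_neg_distrib]; exact Finset.sum_congr rfl fun f _ => by rw [h]; ring
  have e3 : ∑ f, M.Γ f e c * T a b f d = -∑ f, M.Γ f e c * T a b d f := by
    rw [← Finset.sum_neg_distrib]; exact Finset.sum_congr rfl fun f _ => by rw [h]; ring
  have e4 : ∑ f, M.Γ f e d * T a b c f = -∑ f, M.Γ f e d * T a b f c := by
    rw [← Finset.sum_neg_distrib]; exact Finset.sum_congr rfl fun f _ => by rw [h]; ring
  rw [cov4, cov4, h a b c d, e1, e2, e3, e4, map_neg]
  ring

section Weyl

variable (M : Geometry A (Fin 4))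

/-- The Schouten tensor in dimension four. -/
def schouten (b d : Fin 4) : A :=
  algebraMap ℝ A (1 / 2) * (M.Ric b d - algebraMap ℝ A (1 / 6) * M.scal * M.g b d)

/-- The Weyl tensor in dimension four. -/
def W (a b c d : Fin 4) : A := M.Rm a b c d - M.kn M.schouten a b c d

theorem schouten_symm (b d : Fin 4) : M.schouten b d = M.schouten d b := by
  rw [schouten, schouten, M.Ric_symm, M.g_symm]

theorem W_antisymm_left (a b c d : Fin 4) : M.W a b c d = -M.W b a c d := by
  rw [W, W, M.Rm_antisymm_left]; simp only [kn]; ring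

theorem W_antisymm_right (a b c d : Fin 4) : M.W a b c d = -M.W a b d c := by
  rw [W, W, M.Rm_antisymm_right]; simp only [kn]; ring

theorem W_pair (a b c d : Fin 4) : M.W a b c d = M.W c d a b := by
  have := isAddTorsionFree_of_algebra A
  simp only [W, kn]
  rw [M.Rm_pair, M.g_symm a c, M.g_symm a d, M.g_symm b d, M.g_symm b c, M.schouten_symm a c,
    M.schouten_symm a d, M.schouten_symm b d, M.schouten_symm b c]
  ring

theorem trace_kn (P : Fin 4 → Fin 4 → A) (b d : Fin 4) :
    ∑ a, ∑ c, M.gi a c * M.kn P a b c d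
      = 2 * P b d + (∑ a, ∑ c, M.gi a c * P a c) * M.g b d := by
  have h1 : ∑ a, ∑ c, M.gi a c * (M.g a c * P b d) = 4 * P b d := by
    have : ∀ a, ∑ c, M.gi a c * (M.g a c * P b d) = P b d := fun a => by
      have h := M.gi_g a a
      simp only [if_true] at h
      simp only [← mul_assoc, ← Finset.sum_mul, M.g_symm a, h, one_mul]
    simp [this]
  have h2 : ∑ a, ∑ c, M.gi a c * (M.g a d * P b c) = P b d := by
    have := M.sum_g_gi_mul d fun c => P b c
    rw [← this]
    exact Finset.sum_congr rfl fun a _ => Finset.sum_congr rfl fun c _ => by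
      rw [M.g_symm a d]; ring
  have h3 : ∑ a, ∑ c, M.gi a c * (P a d * M.g b c) = P b d := by
    have := M.sum_g_gi_mul b fun a => P a d
    rw [← this, Finset.sum_comm]
    exact Finset.sum_congr rfl fun a _ => Finset.sum_congr rfl fun c _ => by
      rw [M.gi_symm c a]; ring
  have h4 : ∑ a, ∑ c, M.gi a c * (P a c * M.g b d)
      = (∑ a, ∑ c, M.gi a c * P a c) * M.g b d := by
    simp only [Finset.sum_mul, mul_assoc]
  simp only [kn, mul_add, mul_sub, Finset.sum_add_distrib, Finset.sum_sub_distrib, h1, h2, h3, h4]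
  ring

theorem trace_g : ∑ a, ∑ c, M.gi a c * M.g a c = 4 := by
  have : ∀ a, ∑ c, M.gi a c * M.g a c = 1 := fun a => by
    have h := M.gi_g a a
    simp only [if_true] at h
    simpa only [M.g_symm a] using h
  simp [this]

/-- In dimension four the Schouten tensor solves `Ric = 2 P + (tr P) g`, and the right side is the
trace of its Kulkarni-Nomizu product with the metric. -/
theorem W_trace (b d : Fin 4) : ∑ a, ∑ c, M.gi a c * M.W a b c d = 0 := by
  have hR : ∑ a, ∑ c, M.gi a c * M.Rm a b c d = M.Ric b d := by
    rw [Ric_eq_sum_Rm, Finset.sum_comm]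
    exact Finset.sum_congr rfl fun a _ => Finset.sum_congr rfl fun e _ => by rw [M.gi_symm]
  have hJ : ∑ a, ∑ c, M.gi a c * M.schouten a c
      = algebraMap ℝ A (1 / 2) * (1 - 4 * algebraMap ℝ A (1 / 6)) * M.scal := by
    have (a c : Fin 4) : M.gi a c * M.schouten a c
        = algebraMap ℝ A (1 / 2) * (M.gi a c * M.Ric a c)
          - algebraMap ℝ A (1 / 2) * algebraMap ℝ A (1 / 6) * M.scal * (M.gi a c * M.g a c) := by
      rw [schouten]; ring
    simp only [this, Finset.sum_sub_distrib, ← Finset.mul_sum, M.trace_g]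
    rw [scal]; ring
  have h2 : 2 * algebraMap ℝ A (1 / 2) = 1 := by
    rw [← map_ofNat (algebraMap ℝ A) 2, ← map_mul, ← map_one (algebraMap ℝ A)]; norm_num
  have h6 : 6 * algebraMap ℝ A (1 / 6) = 1 := by
    rw [← map_ofNat (algebraMap ℝ A) 6, ← map_mul, ← map_one (algebraMap ℝ A)]; norm_num
  simp only [W, mul_sub, Finset.sum_sub_distrib, hR, trace_kn, hJ]
  rw [schouten]
  set x := algebraMap ℝ A (1 / 2)
  set y := algebraMap ℝ A (1 / 6)
  linear_combination (-M.Ric b d) * h2 + x * M.scal * M.g b d * h6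

/-- If `∇²s = φ g - s P` with the Schouten tensor `P` and `|ds|² = κ + 2 s φ` for a constant `κ`,
then `W(∇s, b, c, d) = s C_{cdb}` with the Cotton tensor `C`. -/
theorem W_grad (s φ : A) (κ : ℝ) (hs : ∀ x, s * x = 0 → x = 0)
    (hH : ∀ c b, M.hess s c b = φ * M.g c b - s * M.schouten c b)
    (hκ : M.gradSq s = algebraMap ℝ A κ + 2 * s * φ) (b c d : Fin 4) :
    ∑ a, ∑ e, M.gi a e * M.D e s * M.W a b c d = s * M.cotton M.schouten c d b := by
  have := isAddTorsionFree_of_algebra A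
  set Q : Fin 4 → A := fun c => ∑ a, ∑ e, M.gi a e * M.D e s * M.schouten a c with hQ
  have hg (c) : ∑ a, ∑ e, M.gi a e * M.D e s * M.g a c = M.D c s := by
    rw [← M.sum_g_gi_mul c fun e => M.D e s]
    exact Finset.sum_congr rfl fun a _ => Finset.sum_congr rfl fun e _ => by
      rw [M.g_symm a c]; ring
  -- Differentiate `|ds|² = κ + 2 s φ`, insert the Hessian equation on the left, and divide by `2
  -- s`.
  have hφ (c) : M.D c φ = -Q c := by
    have h1 := M.D_gradSq s c
    rw [hκ] at h1
    have h2 : ∑ a, ∑ b, M.gi a b * M.D a s * M.hess s c b = φ * M.D c s - s * Q c := by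
      rw [← hg c, hQ, Finset.mul_sum, Finset.mul_sum, ← Finset.sum_sub_distrib, Finset.sum_comm]
      refine Finset.sum_congr rfl fun a _ => ?_
      rw [Finset.mul_sum, Finset.mul_sum, ← Finset.sum_sub_distrib]
      exact Finset.sum_congr rfl fun e _ => by
        rw [hH, M.gi_symm e a, M.g_symm c a, M.schouten_symm c a]; ring
    rw [h2] at h1
    have h20 : M.D c 2 = 0 := by simpa using (M.D c).map_natCast 2
    simp only [map_add, Derivation.map_algebraMap, Derivation.leibniz, smul_eq_mul, zero_add,
      h20] at h1
    have h3 : (2 : ℕ) • (s * (M.D c φ + Q c)) = (2 : ℕ) • 0 := by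
      rw [nsmul_eq_mul]; push_cast; linear_combination h1
    have := hs _ (nsmul_right_injective two_ne_zero h3)
    linear_combination this
  -- Decompose the curvature acting on `ds` into its Weyl and Schouten parts. The terms in `Q` will
  -- cancel against `dφ = -Q`.
  have hR : ∑ a, M.R a b c d * M.D a s = ∑ a, ∑ e, M.gi a e * M.D e s * M.W a b c d
      + (M.D c s * M.schouten d b - M.D d s * M.schouten c b
        + Q c * M.g d b - Q d * M.g c b) := by
    have h1 : ∑ a, M.R a b c d * M.D a s = ∑ a, ∑ e, M.gi a e * M.D e s * M.Rm a b c d := by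
      simp only [R_eq_sum_Rm, Finset.sum_mul]
      rw [Finset.sum_comm]
      exact Finset.sum_congr rfl fun a _ => Finset.sum_congr rfl fun e _ => by
        rw [M.gi_symm e a]; ring
    rw [h1, ← hg c, ← hg d, hQ, M.g_symm d b, M.g_symm c b, M.schouten_symm d b,
      M.schouten_symm c b]
    simp only [Finset.sum_mul, ← Finset.sum_add_distrib, ← Finset.sum_sub_distrib, W, kn]
    exact Finset.sum_congr rfl fun a _ => Finset.sum_congr rfl fun e _ => by ring
  have hI := M.hess_ricci_identity s b c d
  rw [hR] at hI
  have hL (c d) : M.D c (M.hess s d b) - ∑ e, M.Γ e c b * M.hess s d e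
      = M.D c φ * M.g d b - M.D c s * M.schouten d b
        + φ * (M.D c (M.g d b) - ∑ e, M.Γ e c b * M.g d e)
        - s * (M.D c (M.schouten d b) - ∑ e, M.Γ e c b * M.schouten d e) := by
    have : ∑ e, M.Γ e c b * M.hess s d e = φ * (∑ e, M.Γ e c b * M.g d e)
        - s * ∑ e, M.Γ e c b * M.schouten d e := by
      simp only [hH, Finset.mul_sum, ← Finset.sum_sub_distrib]
      exact Finset.sum_congr rfl fun e _ => by ring
    rw [this, hH]
    simp only [map_sub, Derivation.leibniz, smul_eq_mul]
    ring
  -- The coefficient of the undifferentiated `φ` is the antisymmetrised derivative of the metric,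
  -- which is zero.
  have hCg := M.cotton_eq M.g c d b
  rw [cotton, cov2_g, cov2_g] at hCg
  rw [hL, hL, hφ, hφ] at hI
  rw [cotton_eq]
  linear_combination hI + φ * hCg

/-- The trace of `s C` is a trace of `W(∇s, ·, ·, ·)`, which is zero, and `s` can be cancelled. This
replaces the contracted Bianchi identity. -/
theorem sum_gi_cotton (s φ : A) (κ : ℝ) (hs : ∀ x, s * x = 0 → x = 0)
    (hH : ∀ c b, M.hess s c b = φ * M.g c b - s * M.schouten c b)
    (hκ : M.gradSq s = algebraMap ℝ A κ + 2 * s * φ) (c : Fin 4) :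
    ∑ b, ∑ d, M.gi b d * M.cotton M.schouten c d b = 0 := by
  apply hs
  rw [Finset.mul_sum]
  simp only [Finset.mul_sum, mul_left_comm s, ← M.W_grad s φ κ hs hH hκ]
  have h (a e : Fin 4) :
      ∑ b, ∑ d, M.gi b d * (M.gi a e * M.D e s * M.W a b c d) = 0 := by
    have h1 := M.W_trace a c
    have : ∑ b, ∑ d, M.gi b d * (M.gi a e * M.D e s * M.W a b c d)
        = (M.gi a e * M.D e s) * ∑ b, ∑ d, M.gi b d * M.W b a d c := by
      simp only [Finset.mul_sum]
      exact Finset.sum_congr rfl fun b _ => Finset.sum_congr rfl fun d _ => by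
        rw [M.W_antisymm_left b a, M.W_antisymm_right a b]; ring
    rw [this, h1, mul_zero]
  have h2 : ∑ b, ∑ d, ∑ a, ∑ e, M.gi b d * (M.gi a e * M.D e s * M.W a b c d)
      = ∑ a, ∑ e, ∑ b, ∑ d, M.gi b d * (M.gi a e * M.D e s * M.W a b c d) := by
    simp only [Fin.sum_univ_four]; ring
  rw [h2]
  simp [h]

/-- The divergence of the Weyl tensor is the Cotton tensor. -/
theorem div_W (s φ : A) (κ : ℝ) (hs : ∀ x, s * x = 0 → x = 0)
    (hH : ∀ c b, M.hess s c b = φ * M.g c b - s * M.schouten c b)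
    (hκ : M.gradSq s = algebraMap ℝ A κ + 2 * s * φ) (b c d : Fin 4) :
    ∑ a, ∑ e, M.gi a e * M.cov4 M.W e a b c d = M.cotton M.schouten c d b := by
  set C := M.cotton M.schouten with hC
  have hW (e a b c d) : M.cov4 M.W e a b c d
      = M.cov4 M.Rm e a b c d - M.kn (M.cov2 M.schouten e) a b c d := by
    rw [← cov4_kn, ← cov4_sub]; rfl
  have hP (e a b) : M.cov2 M.schouten e a b = M.cov2 M.schouten e b a := by
    rw [cov2, cov2, M.schouten_symm b a, funext fun f => congrArg (M.Γ f e a * ·)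
      (M.schouten_symm f b), funext fun f => congrArg (M.Γ f e b * ·) (M.schouten_symm a f)]
    ring
  -- The second Bianchi identity with `Rm = W + g ∧ P`: the cyclic sum of `∇W` is a combination of
  -- products of `g` and the Cotton tensor.
  have hB (a e) : M.cov4 M.W e a b c d = -M.cov4 M.W c a b d e + M.cov4 M.W d a b c e
      - (M.g a c * C e d b + M.g a d * C c e b + M.g a e * C d c b)
      + (M.g b c * C e d a + M.g b d * C c e a + M.g b e * C d c a) := by
    have h1 := M.cov4_antisymm_right M.W M.W_antisymm_right d a b e c
    have h2 := M.cov4_Rm_bianchi e a b c d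
    rw [← neg_eq_iff_eq_neg.2 h1, hW, hW, hW]
    simp only [hC, cotton, kn]
    rw [hP d b e, hP c b e, hP e b d, hP c b d, hP e b c, hP d b c,
      hP e a c, hP c a e, hP e a d, hP d a e, hP c a d, hP d a c]
    linear_combination h2
  -- The two other terms of the cyclic sum are traces of `∇W` in the first and the last slot of `W`,
  -- and vanish.
  have t1 := M.trace_cov4 M.W (fun b c => by
    have h := M.W_trace b c
    rw [← neg_eq_zero, ← h, ← Finset.sum_neg_distrib]
    refine Finset.sum_congr rfl fun a _ => ?_
    rw [← Finset.sum_neg_distrib]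
    exact Finset.sum_congr rfl fun e _ => by rw [M.W_antisymm_right]; ring)
  have c1 := M.sum_gi_cotton s φ κ hs hH hκ
  have k1 (c : Fin 4) (f : Fin 4 → A) : ∑ a, ∑ e, M.gi a e * (M.g a c * f e) = f c := by
    rw [← M.sum_g_gi_mul c f]
    exact Finset.sum_congr rfl fun a _ => Finset.sum_congr rfl fun e _ => by
      rw [M.g_symm a c]; ring
  have k2 (x : A) : ∑ a, ∑ e, M.gi a e * (M.g a e * x) = 4 * x := by
    rw [← M.trace_g]; simp only [Finset.sum_mul, mul_assoc]
  have k3 (x : A) (c : Fin 4) : ∑ a, ∑ e, M.gi a e * (x * C e c a) = 0 := by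
    rw [← mul_zero x, ← neg_zero, ← c1 c, ← Finset.sum_neg_distrib, Finset.mul_sum]
    refine Finset.sum_congr rfl fun a _ => ?_
    rw [← Finset.sum_neg_distrib, Finset.mul_sum]
    exact Finset.sum_congr rfl fun e _ => by rw [hC, M.cotton_antisymm _ c e]; ring
  have k4 (x : A) (c : Fin 4) : ∑ a, ∑ e, M.gi a e * (x * C c e a) = 0 := by
    rw [← mul_zero x, ← c1 c, Finset.mul_sum]
    refine Finset.sum_congr rfl fun a _ => ?_
    rw [Finset.mul_sum]
    exact Finset.sum_congr rfl fun e _ => by ring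
  have k5 : ∑ a, ∑ e, M.gi a e * (M.g b e * C d c a) = C d c b := by
    rw [← k1 b fun a => C d c a, Finset.sum_comm]
    exact Finset.sum_congr rfl fun a _ => Finset.sum_congr rfl fun e _ => by
      rw [M.gi_symm, M.g_symm]
  have t2 := t1 c b d
  have t3 := t1 d b c
  simp only [hB, mul_add, mul_sub, mul_neg, Finset.sum_add_distrib, Finset.sum_sub_distrib,
    Finset.sum_neg_distrib, t2, t3, k1 c fun e => C e d b, k1 d fun e => C c e b, k2, k3, k4, k5]
  -- Collecting the traces, `C` occurs with the coefficient `-(1 + 1 - 4) - 1 = 1`, the dimension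
  -- minus three.
  have hCs : C d c b = -C c d b := M.cotton_antisymm _ d c b
  rw [hCs]
  ring

end Weyl

end Geometry

end

/-! ### Conformal change of the connection and of the curvature. -/

section

namespace Geometry

variable {A : Type*} [CommRing A] [Algebra ℝ A] {ι : Type*} [Fintype ι] [DecidableEq ι]
  (M : Geometry A ι)

/-- The gradient of a function. -/
def grad (s : A) (a : ι) : A := ∑ e, M.gi a e * M.D e s

/-- The change of the connection under the conformal change `g ↦ s⁻² g`, with `si = s⁻¹`. -/
def confΓ (s si : A) (a b c : ι) : A :=
  -si * ((if a = b then 1 else 0) * M.D c s + (if a = c then 1 else 0) * M.D b s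
    - M.g b c * M.grad s a)

theorem sum_mul_confΓ_up (s si : A) (f : ι → A) (b c : ι) : ∑ a, f a * M.confΓ s si a b c
    = -si * (f b * M.D c s + f c * M.D b s - M.g b c * ∑ a, f a * M.grad s a) := by
  have (a : ι) : f a * M.confΓ s si a b c = -si * ((if a = b then f a * M.D c s else 0)
      + (if a = c then f a * M.D b s else 0) - M.g b c * (f a * M.grad s a)) := by
    rw [confΓ]; split_ifs <;> ring
  simp only [this, ← Finset.mul_sum, Finset.sum_sub_distrib, Finset.sum_add_distrib,
    Finset.sum_ite_eq', Finset.mem_univ, if_true]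

theorem sum_mul_confΓ_down (s si : A) (f : ι → A) (a b : ι) : ∑ c, f c * M.confΓ s si a b c
    = -si * ((if a = b then 1 else 0) * ∑ c, f c * M.D c s + f a * M.D b s
      - (∑ c, f c * M.g b c) * M.grad s a) := by
  have (c : ι) : f c * M.confΓ s si a b c = -si * ((if a = b then 1 else 0) * (f c * M.D c s)
      + (if a = c then f c * M.D b s else 0) - f c * M.g b c * M.grad s a) := by
    rw [confΓ]; split_ifs <;> ring
  simp only [this, ← Finset.mul_sum, Finset.sum_sub_distrib, Finset.sum_add_distrib,
    Finset.sum_ite_eq, Finset.mem_univ, if_true, ← Finset.sum_mul]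

theorem sum_g_grad (s : A) (b : ι) : ∑ a, M.g b a * M.grad s a = M.D b s := by
  simp only [grad, Finset.mul_sum, ← mul_assoc]
  exact M.sum_g_gi_mul b fun e => M.D e s

theorem sum_D_grad (s : A) : ∑ a, M.D a s * M.grad s a = M.gradSq s := by
  simp only [grad, gradSq, Finset.mul_sum]
  exact Finset.sum_congr rfl fun a _ => Finset.sum_congr rfl fun e _ => by ring

theorem derivation_inv (d : Derivation ℝ A A) {s si : A} (h : s * si = 1) :
    d si = -si ^ 2 * d s := by
  have h1 := congrArg d h
  simp only [Derivation.leibniz, smul_eq_mul, Derivation.map_one_eq_zero] at h1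
  linear_combination si * h1 - d si * h

theorem hess_symm (s : A) (a b : ι) : M.hess s a b = M.hess s b a := by
  rw [hess, hess, M.comm]; simp only [M.Γ_symm _ a b]

theorem D_grad (s : A) (μ κ : ι) : M.D μ (M.grad s κ) + ∑ σ, M.Γ κ μ σ * M.grad s σ
    = ∑ e, M.gi κ e * M.hess s μ e := by
  have e1 : ∑ e, M.gi κ e * ∑ f, M.Γ f μ e * M.D f s
      = ∑ e, (∑ d, M.Γ e μ d * M.gi κ d) * M.D e s := by
    simp only [Finset.mul_sum, Finset.sum_mul]
    rw [Finset.sum_comm]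
    exact Finset.sum_congr rfl fun a _ => Finset.sum_congr rfl fun e _ => by ring
  have e2 : ∑ σ, M.Γ κ μ σ * ∑ e, M.gi σ e * M.D e s
      = ∑ e, (∑ d, M.Γ κ μ d * M.gi d e) * M.D e s := by
    simp only [Finset.mul_sum, Finset.sum_mul]
    rw [Finset.sum_comm]
    exact Finset.sum_congr rfl fun a _ => Finset.sum_congr rfl fun e _ => by ring
  simp only [grad, hess, mul_sub, Finset.sum_sub_distrib, e1, e2]
  simp only [map_sum, Derivation.leibniz, smul_eq_mul, compat_gi, Finset.sum_add_distrib,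
    mul_comm (M.D _ s)]
  simp only [add_mul, Finset.sum_add_distrib, neg_mul, Finset.sum_neg_distrib]
  ring

/-- The conformally changed metric `s⁻² g` with its Levi-Civita connection. -/
def conformal (s si : A) (h : s * si = 1) : Geometry A ι where
  D := M.D
  g a b := si ^ 2 * M.g a b
  gi a b := s ^ 2 * M.gi a b
  Γ a b c := M.Γ a b c + M.confΓ s si a b c
  comm := M.comm
  g_symm a b := by rw [M.g_symm]
  gi_symm a b := by rw [M.gi_symm]
  g_gi a c := by
    have : ∀ b, si ^ 2 * M.g a b * (s ^ 2 * M.gi b c) = M.g a b * M.gi b c := fun b => by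
      linear_combination (M.g a b * M.gi b c) * (s * si + 1) * h
    simp only [this, M.g_gi]
  Γ_symm a b c := by
    rw [M.Γ_symm, confΓ, confΓ, M.g_symm b c]; ring
  compat c a b := by
    have h1 := M.sum_mul_confΓ_up s si (fun d => M.g b d) c a
    have h2 := M.sum_mul_confΓ_up s si (fun d => M.g a d) c b
    simp only [sum_g_grad] at h1 h2
    have h3 : ∑ d, ((M.Γ d c a + M.confΓ s si d c a) * (si ^ 2 * M.g d b)
        + (M.Γ d c b + M.confΓ s si d c b) * (si ^ 2 * M.g a d))
        = si ^ 2 * (∑ d, (M.Γ d c a * M.g d b + M.Γ d c b * M.g a d)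
          + ∑ d, M.g b d * M.confΓ s si d c a + ∑ d, M.g a d * M.confΓ s si d c b) := by
      rw [← Finset.sum_add_distrib, ← Finset.sum_add_distrib, Finset.mul_sum]
      exact Finset.sum_congr rfl fun d _ => by rw [M.g_symm d b]; ring
    rw [h3, h1, h2, ← M.compat]
    simp only [Derivation.leibniz, smul_eq_mul, Derivation.leibniz_pow, derivation_inv _ h,
      nsmul_eq_mul, M.g_symm b a, M.g_symm b c, M.g_symm a c]
    push_cast
    ring

/-- The curvature changes by the antisymmetrised covariant derivative of the difference tensor
`confΓ` plus its commutator. All but the Hessian and gradient terms cancel. -/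
theorem R_conformal (s si : A) (h : s * si = 1) (κ l μ ν : ι) :
    (M.conformal s si h).R κ l μ ν = M.R κ l μ ν
      + si * ((if κ = μ then 1 else 0) * M.hess s ν l - (if κ = ν then 1 else 0) * M.hess s μ l
        + M.g ν l * (∑ e, M.gi κ e * M.hess s μ e) - M.g μ l * ∑ e, M.gi κ e * M.hess s ν e)
      - si ^ 2 * M.gradSq s * ((if κ = μ then 1 else 0) * M.g ν l
        - (if κ = ν then 1 else 0) * M.g μ l) := by
  -- This is the covariant derivative of the difference tensor without the connection term on the
  -- slot `ν`; that term is symmetric in `μ, ν` and disappears on antisymmetrising, as do the bare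
  -- second derivatives of `s`.
  have hE (μ ν : ι) : M.D μ (M.confΓ s si κ ν l) + ∑ σ, M.Γ κ μ σ * M.confΓ s si σ ν l
      - ∑ σ, M.Γ σ μ l * M.confΓ s si κ ν σ
      = -si * ((if κ = ν then 1 else 0) * M.hess s μ l + (if κ = l then 1 else 0) *
          M.D μ (M.D ν s) + M.Γ κ μ ν * M.D l s - (∑ σ, M.Γ σ μ ν * M.g σ l) * M.grad s κ
          - M.g ν l * ∑ e, M.gi κ e * M.hess s μ e)
        - si * M.D μ s * M.confΓ s si κ ν l := by
    rw [sum_mul_confΓ_up, sum_mul_confΓ_down, ← M.D_grad]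
    have hg : ∑ c, M.Γ c μ l * M.g ν c = M.D μ (M.g ν l) - ∑ σ, M.Γ σ μ ν * M.g σ l := by
      rw [M.compat, Finset.sum_add_distrib]; ring
    have h0 : M.D μ (M.confΓ s si κ ν l) = -si * ((if κ = ν then 1 else 0) * M.D μ (M.D l s)
        + (if κ = l then 1 else 0) * M.D μ (M.D ν s) - M.D μ (M.g ν l) * M.grad s κ
        - M.g ν l * M.D μ (M.grad s κ)) - si * M.D μ s * M.confΓ s si κ ν l := by
      have hi (p : Prop) [Decidable p] : M.D μ (if p then 1 else 0 : A) = 0 := by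
        split_ifs <;> simp
      simp only [confΓ, map_sub, map_add, map_neg, Derivation.leibniz, smul_eq_mul, hi,
        derivation_inv _ h]
      ring
    rw [hg, h0, hess]
    ring
  have hCC (μ ν : ι) : ∑ σ, M.confΓ s si κ μ σ * M.confΓ s si σ ν l
      = -si * (M.confΓ s si κ μ ν * M.D l s + M.confΓ s si κ μ l * M.D ν s
        - M.g ν l * (-si * ((if κ = μ then 1 else 0) * M.gradSq s + M.grad s κ * M.D μ s
          - M.D μ s * M.grad s κ))) := by
    rw [M.sum_mul_confΓ_up s si (fun σ => M.confΓ s si κ μ σ)]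
    have h1 : ∑ c, M.grad s c * M.D c s = M.gradSq s := by
      rw [← sum_D_grad]; exact Finset.sum_congr rfl fun c _ => mul_comm _ _
    have h2 : ∑ c, M.grad s c * M.g μ c = M.D μ s := by
      rw [← sum_g_grad]; exact Finset.sum_congr rfl fun c _ => mul_comm _ _
    have h3 : ∑ a, M.confΓ s si κ μ a * M.grad s a = ∑ a, M.grad s a * M.confΓ s si κ μ a :=
      Finset.sum_congr rfl fun c _ => mul_comm _ _
    rw [h3, M.sum_mul_confΓ_down s si (M.grad s) κ μ, h1, h2]
  have hR : (M.conformal s si h).R κ l μ ν = M.R κ l μ ν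
      + (M.D μ (M.confΓ s si κ ν l) + ∑ σ, M.Γ κ μ σ * M.confΓ s si σ ν l
        - ∑ σ, M.Γ σ μ l * M.confΓ s si κ ν σ)
      - (M.D ν (M.confΓ s si κ μ l) + ∑ σ, M.Γ κ ν σ * M.confΓ s si σ μ l
        - ∑ σ, M.Γ σ ν l * M.confΓ s si κ μ σ)
      + ∑ σ, M.confΓ s si κ μ σ * M.confΓ s si σ ν l
      - ∑ σ, M.confΓ s si κ ν σ * M.confΓ s si σ μ l := by
    simp only [R, conformal, map_add, add_mul, mul_add, Finset.sum_add_distrib,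
      Finset.sum_sub_distrib, mul_comm (M.confΓ s si κ _ _) (M.Γ _ _ _)]
    ring
  have hs : ∑ σ, M.Γ σ ν μ * M.g σ l = ∑ σ, M.Γ σ μ ν * M.g σ l :=
    Finset.sum_congr rfl fun σ _ => by rw [M.Γ_symm]
  rw [hR, hE, hE, hCC, hCC, hs, M.comm ν μ, M.Γ_symm κ ν μ]
  simp only [confΓ, M.g_symm ν μ]
  ring

end Geometry

end

/-! ### Einstein metrics in a conformal class, and linear changes of coordinates. -/

section

namespace Geometry

variable {A : Type*} [CommRing A] [Algebra ℝ A]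

section Einstein

variable (M : Geometry A (Fin 4)) (s si : A) (h : s * si = 1)

theorem Ric_conformal (l ν : Fin 4) : (M.conformal s si h).Ric l ν = M.Ric l ν
    + si * (2 * M.hess s l ν + (∑ a, ∑ e, M.gi a e * M.hess s a e) * M.g l ν)
    - 3 * si ^ 2 * M.gradSq s * M.g l ν := by
  have h1 : ∑ κ, M.g κ l * ∑ e, M.gi κ e * M.hess s ν e = M.hess s ν l := by
    simp only [Finset.mul_sum, ← mul_assoc]
    rw [← M.sum_g_gi_mul l fun e => M.hess s ν e]
    exact Finset.sum_congr rfl fun a _ => Finset.sum_congr rfl fun e _ => by rw [M.g_symm a l]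
  have h2 (f : Fin 4 → A) : ∑ κ, (if κ = ν then (1 : A) else 0) * f κ = f ν := by simp
  have e : (M.conformal s si h).Ric l ν = M.Ric l ν
      + si * (4 * M.hess s ν l - ∑ κ, (if κ = ν then (1 : A) else 0) * M.hess s κ l
        + M.g ν l * (∑ a, ∑ e, M.gi a e * M.hess s a e)
        - ∑ κ, M.g κ l * ∑ e, M.gi κ e * M.hess s ν e)
      - si ^ 2 * M.gradSq s * (4 * M.g ν l
        - ∑ κ, (if κ = ν then (1 : A) else 0) * M.g κ l) := by
    simp only [Ric, R_conformal, if_true, one_mul, Finset.sum_add_distrib,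
      Finset.sum_sub_distrib, ← Finset.mul_sum, Finset.sum_const, Finset.card_univ,
      Fintype.card_fin, nsmul_eq_mul]
    push_cast
    ring
  rw [e, h1, h2, h2, M.hess_symm s ν l, M.g_symm ν l]
  ring

/-- The conformal formula for `Ric` expresses the Ricci tensor of the background by `∇²s` and a
multiple of the metric. Taking the trace gives the scalar curvature, hence the Schouten tensor. The
last conjunct says that the Einstein metric has curvature equal to its Weyl part plus constant
curvature `-k²`. -/
theorem conformal_einstein (k : ℝ) (hE : ∀ b d, (M.conformal s si h).Ric b d
      = algebraMap ℝ A (-3 * k ^ 2) * (si ^ 2 * M.g b d)) :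
    ∃ φ : A, (∀ c b, M.hess s c b = φ * M.g c b - s * M.schouten c b) ∧
      M.gradSq s = algebraMap ℝ A (k ^ 2) + 2 * s * φ ∧
      ∀ a b c d, (M.conformal s si h).Rm a b c d = si ^ 2 * M.W a b c d
        - algebraMap ℝ A (k ^ 2) * ((si ^ 2 * M.g a c) * (si ^ 2 * M.g b d)
          - (si ^ 2 * M.g a d) * (si ^ 2 * M.g b c)) := by
  set Δ := ∑ a, ∑ e, M.gi a e * M.hess s a e with hΔ
  set K := algebraMap ℝ A (k ^ 2) with hK
  have hK3 : algebraMap ℝ A (-3 * k ^ 2) = -3 * K := by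
    rw [map_mul, map_neg, map_ofNat]
  have h2 : 2 * algebraMap ℝ A (1 / 2) = 1 := by
    rw [← map_ofNat (algebraMap ℝ A) 2, ← map_mul, ← map_one (algebraMap ℝ A)]; norm_num
  have h6 : 6 * algebraMap ℝ A (1 / 6) = 1 := by
    rw [← map_ofNat (algebraMap ℝ A) 6, ← map_mul, ← map_one (algebraMap ℝ A)]; norm_num
  set x := algebraMap ℝ A (1 / 2) with hx
  set y := algebraMap ℝ A (1 / 6) with hy
  have hRic (b d) : M.Ric b d = -2 * si * M.hess s b d
      - (si * Δ - 3 * si ^ 2 * M.gradSq s + 3 * K * si ^ 2) * M.g b d := by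
    have := hE b d
    rw [Ric_conformal, hK3] at this
    linear_combination this
  have hS : M.scal = -6 * si * Δ + 12 * si ^ 2 * (M.gradSq s - K) := by
    have (b d : Fin 4) : M.gi b d * M.Ric b d = -2 * si * (M.gi b d * M.hess s b d)
        - (si * Δ - 3 * si ^ 2 * M.gradSq s + 3 * K * si ^ 2) * (M.gi b d * M.g b d) := by
      rw [hRic]; ring
    simp only [scal, this, Finset.sum_sub_distrib, ← Finset.mul_sum, M.trace_g]
    rw [← hΔ]; ring
  have hP (b d) : M.schouten b d
      = -si * M.hess s b d + x * si ^ 2 * (M.gradSq s - K) * M.g b d := by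
    rw [schouten, hRic, hS]
    linear_combination (-si * M.hess s b d) * h2 + (x * si * Δ * M.g b d - 2 * x * si ^ 2 * (M.gradSq s - K) * M.g b d) * h6
  -- `φ = (|ds|² - k²) / (2 s)`, as the second equation dictates.
  refine ⟨x * si * (M.gradSq s - K), fun c b => ?_, ?_, fun a b c d => ?_⟩
  · rw [hP]
    linear_combination (-M.hess s c b + x * si * (M.gradSq s - K) * M.g c b) * h
  · linear_combination (-(M.gradSq s - K)) * (h2 + 2 * x * h)
  · have key (R p q u v : Fin 4 → A) (α β γ δ G : A) :
        ∑ f, si ^ 2 * M.g a f * (R f + si * (p f * α - q f * β + γ * u f - δ * v f)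
          - si ^ 2 * G * (p f * γ - q f * δ))
        = si ^ 2 * (∑ f, M.g a f * R f + si * ((∑ f, M.g a f * p f) * α
          - (∑ f, M.g a f * q f) * β + γ * (∑ f, M.g a f * u f) - δ * (∑ f, M.g a f * v f))
          - si ^ 2 * G * ((∑ f, M.g a f * p f) * γ - (∑ f, M.g a f * q f) * δ)) := by
      simp only [Finset.sum_mul, Finset.mul_sum, ← Finset.sum_add_distrib,
        ← Finset.sum_sub_distrib]
      exact Finset.sum_congr rfl fun f _ => by ring
    have h1 (a c : Fin 4) : ∑ f, M.g a f * ∑ e, M.gi f e * M.hess s c e = M.hess s c a := by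
      simp only [Finset.mul_sum, ← mul_assoc]
      exact M.sum_g_gi_mul a fun e => M.hess s c e
    have h3 (a c : Fin 4) : ∑ f, M.g a f * (if f = c then 1 else 0 : A) = M.g a c := by simp
    have e : (M.conformal s si h).Rm a b c d = si ^ 2 * (∑ f, M.g a f * M.R f b c d
        + si * ((∑ f, M.g a f * (if f = c then 1 else 0 : A)) * M.hess s d b
          - (∑ f, M.g a f * (if f = d then 1 else 0 : A)) * M.hess s c b
          + M.g d b * (∑ f, M.g a f * ∑ e, M.gi f e * M.hess s c e)
          - M.g c b * (∑ f, M.g a f * ∑ e, M.gi f e * M.hess s d e))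
        - si ^ 2 * M.gradSq s * ((∑ f, M.g a f * (if f = c then 1 else 0 : A)) * M.g d b
          - (∑ f, M.g a f * (if f = d then 1 else 0 : A)) * M.g c b)) := by
      rw [Rm]
      simp only [R_conformal]
      exact key _ _ _ _ _ _ _ _ _ _
    rw [e, h1, h1, h3, h3, W, Rm]
    simp only [kn, hP, M.g_symm d b, M.g_symm c b, M.hess_symm s d b, M.hess_symm s c b,
      M.hess_symm s c a, M.hess_symm s d a]
    linear_combination (si ^ 4 * (M.gradSq s - K) * (M.g a c * M.g b d - M.g a d * M.g b c)) * h2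

end Einstein

theorem symm_conj {B ι : Type*} [CommRing B] [Fintype ι] {P G : Matrix ι ι B} (h : Gᵀ = G) :
    (P * G * Pᵀ)ᵀ = P * G * Pᵀ := by
  rw [Matrix.transpose_mul, Matrix.transpose_mul, Matrix.transpose_transpose, h, mul_assoc]

section ChangeOfCoordinates

variable {ι : Type*} [Fintype ι]

/-- A linear combination of derivations. -/
def combD (D : ι → Derivation ℝ A A) (c : ι → ℝ) : Derivation ℝ A A := ∑ μ, c μ • D μ

theorem combD_apply (D : ι → Derivation ℝ A A) (c : ι → ℝ) (f : A) :
    combD D c f = ∑ μ, c μ • D μ f := by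
  rw [combD, ← Derivation.coeFnAddMonoidHom_apply, map_sum]
  simp [Derivation.coeFnAddMonoidHom_apply]

theorem map_combD (D : ι → Derivation ℝ A A) (c : ι → ℝ) (X : Matrix ι ι A) :
    X.map (combD D c) = ∑ μ, c μ • X.map (D μ) := by
  ext i j
  simp only [Matrix.map_apply, combD_apply, Matrix.sum_apply, Matrix.smul_apply]

theorem map_derivation_const_mul (d : Derivation ℝ A A) (J : Matrix ι ι ℝ) (X : Matrix ι ι A) :
    (J.map (algebraMap ℝ A) * X).map d = J.map (algebraMap ℝ A) * X.map d := by
  rw [map_derivation_mul]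
  have : (J.map (algebraMap ℝ A)).map d = 0 := by ext i j; simp
  rw [this, zero_mul, zero_add]

theorem map_derivation_mul_const (d : Derivation ℝ A A) (J : Matrix ι ι ℝ) (X : Matrix ι ι A) :
    (X * J.map (algebraMap ℝ A)).map d = X.map d * J.map (algebraMap ℝ A) := by
  rw [map_derivation_mul]
  have : (J.map (algebraMap ℝ A)).map d = 0 := by ext i j; simp
  rw [this, mul_zero, add_zero]

theorem compat_of_matrix (d : Derivation ℝ A A) (G Γ : Matrix ι ι A)
    (h : G.map d = Γᵀ * G + G * Γ) (a b : ι) :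
    d (G a b) = ∑ e, (Γ e a * G e b + Γ e b * G a e) := by
  have := congrFun (congrFun h a) b
  rw [Matrix.map_apply] at this
  rw [this, Matrix.add_apply, Matrix.mul_apply, Matrix.mul_apply, ← Finset.sum_add_distrib]
  exact Finset.sum_congr rfl fun e _ => by rw [Matrix.transpose_apply, mul_comm (G a e)]

theorem conj_apply (J : Matrix ι ι ℝ) (X : Matrix ι ι A) (a b : ι) :
    (J.map (algebraMap ℝ A) * X * Jᵀ.map (algebraMap ℝ A)) a b
      = ∑ κ, ∑ l, (J a κ * J b l) • X κ l := by
  simp only [Matrix.mul_apply, Matrix.map_apply, Matrix.transpose_apply, Finset.sum_mul,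
    Algebra.smul_def, map_mul]
  rw [Finset.sum_comm]
  exact Finset.sum_congr rfl fun κ _ => Finset.sum_congr rfl fun l _ => by ring

variable [DecidableEq ι] (M : Geometry A ι)

/-- The connection matrices after a linear change of coordinates. -/
def changeΓ (J Ji : Matrix ι ι ℝ) (a : ι) : Matrix ι ι A :=
  ∑ μ, J a μ • (Jiᵀ.map (algebraMap ℝ A) * M.ΓMat μ * Jᵀ.map (algebraMap ℝ A))

theorem map_mul_map_eq_one {J Ji : Matrix ι ι ℝ} (h : J * Ji = 1) :
    J.map (algebraMap ℝ A) * Ji.map (algebraMap ℝ A) = 1 := by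
  rw [← Matrix.map_mul, h]; simp

theorem compat_change {J Ji : Matrix ι ι ℝ} (h : J * Ji = 1) (c : ι) :
    (J.map (algebraMap ℝ A) * M.gMat * Jᵀ.map (algebraMap ℝ A)).map (combD M.D (J c))
      = (M.changeΓ J Ji c)ᵀ * (J.map (algebraMap ℝ A) * M.gMat * Jᵀ.map (algebraMap ℝ A))
        + (J.map (algebraMap ℝ A) * M.gMat * Jᵀ.map (algebraMap ℝ A)) * M.changeΓ J Ji c := by
  have e' : Ji.map (algebraMap ℝ A) * J.map (algebraMap ℝ A) = 1 :=
    map_mul_map_eq_one (mul_eq_one_comm.1 h)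
  have e'' : Jᵀ.map (algebraMap ℝ A) * Jiᵀ.map (algebraMap ℝ A) = 1 :=
    map_mul_map_eq_one (by rw [← Matrix.transpose_mul, mul_eq_one_comm.1 h,
      Matrix.transpose_one])
  rw [map_combD, changeΓ, Matrix.transpose_sum, Finset.sum_mul, Finset.mul_sum,
    ← Finset.sum_add_distrib]
  refine Finset.sum_congr rfl fun μ _ => ?_
  rw [map_derivation_mul_const, map_derivation_const_mul, gMat_map, Matrix.transpose_smul,
    smul_mul_assoc, mul_smul_comm, ← smul_add]
  congr 1
  simp only [Matrix.transpose_mul, ← Matrix.transpose_map, Matrix.transpose_transpose]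
  calc _ = J.map (algebraMap ℝ A) * (M.ΓMat μ)ᵀ * 1 * M.gMat * Jᵀ.map (algebraMap ℝ A)
      + J.map (algebraMap ℝ A) * M.gMat * 1 * M.ΓMat μ * Jᵀ.map (algebraMap ℝ A) := by
        noncomm_ring
    _ = _ := by rw [← e']; nth_rw 2 [e']; rw [← e'']; noncomm_ring

/-- A linear change of coordinates: `∂'_a = ∑ J a μ ∂_μ`. -/
def change (J Ji : Matrix ι ι ℝ) (h : J * Ji = 1) : Geometry A ι where
  D a := combD M.D (J a)
  g a b := (J.map (algebraMap ℝ A) * M.gMat * Jᵀ.map (algebraMap ℝ A)) a b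
  gi a b := (Jiᵀ.map (algebraMap ℝ A) * M.giMat * Ji.map (algebraMap ℝ A)) a b
  Γ κ a b := M.changeΓ J Ji a κ b
  comm μ ν f := by
    simp only [combD_apply, map_sum, Derivation.map_smul, Finset.smul_sum]
    rw [Finset.sum_comm]
    exact Finset.sum_congr rfl fun a _ => Finset.sum_congr rfl fun b _ => by
      rw [M.comm, smul_comm]
  g_symm a b := congrFun (congrFun (symm_conj (P := J.map (algebraMap ℝ A)) (G := M.gMat)
    (by ext i j; exact M.g_symm j i)) b) a
  gi_symm a b := congrFun (congrFun (symm_conj (P := Jiᵀ.map (algebraMap ℝ A)) (G := M.giMat)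
    (by ext i j; exact M.gi_symm j i)) b) a
  g_gi a c := by
    have e : J.map (algebraMap ℝ A) * Ji.map (algebraMap ℝ A) = 1 := map_mul_map_eq_one h
    have e'' : Jᵀ.map (algebraMap ℝ A) * Jiᵀ.map (algebraMap ℝ A) = 1 :=
      map_mul_map_eq_one (by rw [← Matrix.transpose_mul, mul_eq_one_comm.1 h,
        Matrix.transpose_one])
    have : J.map (algebraMap ℝ A) * M.gMat * Jᵀ.map (algebraMap ℝ A) *
        (Jiᵀ.map (algebraMap ℝ A) * M.giMat * Ji.map (algebraMap ℝ A)) = 1 := by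
      calc _ = J.map (algebraMap ℝ A) * (M.gMat * (Jᵀ.map (algebraMap ℝ A) *
            Jiᵀ.map (algebraMap ℝ A)) * M.giMat) * Ji.map (algebraMap ℝ A) := by
              simp only [mul_assoc]
        _ = _ := by rw [e'', mul_one, M.gMat_mul_giMat, mul_one, e]
    have := congrFun (congrFun this a) c
    rwa [Matrix.mul_apply, Matrix.one_apply] at this
  Γ_symm κ a b := by
    simp only [changeΓ, Matrix.sum_apply, Matrix.smul_apply, Matrix.mul_apply,
      Matrix.transpose_apply, Matrix.map_apply, ΓMat, Matrix.of_apply, Finset.smul_sum,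
      Finset.sum_mul]
    rw [Finset.sum_comm]
    refine Finset.sum_congr rfl fun μ _ => Finset.sum_congr rfl fun ν _ =>
      Finset.sum_congr rfl fun σ _ => ?_
    rw [M.Γ_symm, Algebra.smul_def, Algebra.smul_def]; ring
  compat c a b := compat_of_matrix _ _ _ (M.compat_change h c) a b

/-- The Jacobian is constant, so the derivations annihilate it and the connection matrices are
conjugated without an inhomogeneous term. -/
theorem RMat_change {J Ji : Matrix ι ι ℝ} (h : J * Ji = 1) (a b : ι) :
    (M.change J Ji h).RMat a b = ∑ μ, ∑ ν, (J a μ * J b ν) •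
      (Jiᵀ.map (algebraMap ℝ A) * M.RMat μ ν * Jᵀ.map (algebraMap ℝ A)) := by
  have e'' : Jᵀ.map (algebraMap ℝ A) * Jiᵀ.map (algebraMap ℝ A) = 1 :=
    map_mul_map_eq_one (by rw [← Matrix.transpose_mul, mul_eq_one_comm.1 h,
      Matrix.transpose_one])
  have hΓ (a : ι) : (M.change J Ji h).ΓMat a = M.changeΓ J Ji a := rfl
  have hD (a b : ι) : ((M.change J Ji h).ΓMat b).map ((M.change J Ji h).D a)
      = ∑ μ, ∑ ν, (J a μ * J b ν) • (Jiᵀ.map (algebraMap ℝ A) * (M.ΓMat ν).map (M.D μ)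
        * Jᵀ.map (algebraMap ℝ A)) := by
    rw [hΓ]
    change (M.changeΓ J Ji b).map (combD M.D (J a)) = _
    rw [map_combD]
    refine Finset.sum_congr rfl fun μ _ => ?_
    have : (M.changeΓ J Ji b).map (M.D μ) = ∑ ν, J b ν • (Jiᵀ.map (algebraMap ℝ A) *
        (M.ΓMat ν).map (M.D μ) * Jᵀ.map (algebraMap ℝ A)) := by
      simp only [← map_derivation_const_mul, ← map_derivation_mul_const, changeΓ]
      ext i j
      simp only [Matrix.map_apply, Matrix.sum_apply, Matrix.smul_apply, map_sum,
        Derivation.map_smul]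
    rw [this, Finset.smul_sum]
    simp only [smul_smul]
  have hΓΓ (a b : ι) : (M.change J Ji h).ΓMat a * (M.change J Ji h).ΓMat b
      = ∑ μ, ∑ ν, (J a μ * J b ν) • (Jiᵀ.map (algebraMap ℝ A) * (M.ΓMat μ * M.ΓMat ν)
        * Jᵀ.map (algebraMap ℝ A)) := by
    rw [hΓ, hΓ, changeΓ, changeΓ, Finset.sum_mul]
    refine Finset.sum_congr rfl fun μ _ => ?_
    rw [Finset.mul_sum]
    refine Finset.sum_congr rfl fun ν _ => ?_
    rw [smul_mul_assoc, mul_smul_comm, smul_smul]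
    congr 1
    calc _ = Jiᵀ.map (algebraMap ℝ A) * M.ΓMat μ * (Jᵀ.map (algebraMap ℝ A) *
          Jiᵀ.map (algebraMap ℝ A)) * M.ΓMat ν * Jᵀ.map (algebraMap ℝ A) := by
            simp only [mul_assoc]
      _ = _ := by rw [e'', mul_one]; simp only [mul_assoc]
  have hsw (F : ι → ι → Matrix ι ι A) : ∑ μ, ∑ ν, (J b μ * J a ν) • F μ ν
      = ∑ μ, ∑ ν, (J a μ * J b ν) • F ν μ := by
    rw [Finset.sum_comm]; simp only [mul_comm]
  rw [RMat_eq, hD, hD, hΓΓ, hΓΓ, hsw, hsw]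
  simp only [← Finset.sum_add_distrib, ← Finset.sum_sub_distrib, ← smul_add, ← smul_sub]
  refine Finset.sum_congr rfl fun μ _ => Finset.sum_congr rfl fun ν _ => ?_
  rw [RMat_eq]
  congr 1
  noncomm_ring

theorem Ric_change {J Ji : Matrix ι ι ℝ} (h : J * Ji = 1) (b d : ι) :
    (M.change J Ji h).Ric b d = ∑ μ, ∑ ν, (J b μ * J d ν) • M.Ric μ ν := by
  have h1 (a) : (M.change J Ji h).R a b a d
      = ∑ μ, ∑ ν, ∑ σ, ∑ ρ, (Ji ρ a * J a μ * (J d ν * J b σ)) • M.R ρ σ μ ν := by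
    have := congrFun (congrFun (M.RMat_change h a d) a) b
    rw [RMat, Matrix.of_apply] at this
    rw [this]
    simp only [Matrix.sum_apply, Matrix.smul_apply, Matrix.mul_apply, Matrix.map_apply,
      Matrix.transpose_apply, RMat, Matrix.of_apply, Finset.sum_mul, Finset.smul_sum]
    simp only [Algebra.smul_def, map_mul]
    exact Finset.sum_congr rfl fun μ _ => Finset.sum_congr rfl fun ν _ =>
      Finset.sum_congr rfl fun σ _ => Finset.sum_congr rfl fun ρ _ => by ring
  have h0 : Ji * J = 1 := mul_eq_one_comm.1 h
  have h2 (μ ρ : ι) : ∑ a, Ji ρ a * J a μ = if ρ = μ then 1 else 0 := by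
    rw [← Matrix.mul_apply, h0, Matrix.one_apply]
  have h3 (μ ν σ ρ : ι) : ∑ a, (Ji ρ a * J a μ * (J d ν * J b σ)) • M.R ρ σ μ ν
      = if ρ = μ then (J d ν * J b σ) • M.R ρ σ μ ν else 0 := by
    rw [← Finset.sum_smul, ← Finset.sum_mul, h2]; split_ifs <;> simp
  have h4 : (M.change J Ji h).Ric b d
      = ∑ μ, ∑ ν, ∑ σ, ∑ ρ, ∑ a, (Ji ρ a * J a μ * (J d ν * J b σ)) • M.R ρ σ μ ν := by
    simp only [Ric, h1]
    rw [Finset.sum_comm]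
    refine Finset.sum_congr rfl fun μ _ => ?_
    rw [Finset.sum_comm]
    refine Finset.sum_congr rfl fun ν _ => ?_
    rw [Finset.sum_comm]
    exact Finset.sum_congr rfl fun σ _ => Finset.sum_comm
  rw [h4]
  simp only [h3, Finset.sum_ite_eq', Finset.mem_univ, if_true]
  simp only [Ric, Finset.smul_sum]
  rw [Finset.sum_comm]
  conv_lhs => enter [2, x]; rw [Finset.sum_comm]
  rw [Finset.sum_comm]
  exact Finset.sum_congr rfl fun μ _ => Finset.sum_congr rfl fun ν _ =>
    Finset.sum_congr rfl fun a _ => by rw [mul_comm]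

theorem Rm_change {J Ji : Matrix ι ι ℝ} (h : J * Ji = 1) (a b c d : ι) :
    (M.change J Ji h).Rm a b c d = ∑ κ, ∑ l, ∑ μ, ∑ ν,
      (J a κ * J b l * J c μ * J d ν) • M.Rm κ l μ ν := by
  have e'' : Jᵀ.map (algebraMap ℝ A) * Jiᵀ.map (algebraMap ℝ A) = 1 :=
    map_mul_map_eq_one (by rw [← Matrix.transpose_mul, mul_eq_one_comm.1 h,
      Matrix.transpose_one])
  have h1 : (M.change J Ji h).gMat * (M.change J Ji h).RMat c d = ∑ μ, ∑ ν, (J c μ * J d ν) •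
      (J.map (algebraMap ℝ A) * (M.gMat * M.RMat μ ν) * Jᵀ.map (algebraMap ℝ A)) := by
    have hg : (M.change J Ji h).gMat
        = J.map (algebraMap ℝ A) * M.gMat * Jᵀ.map (algebraMap ℝ A) := rfl
    rw [RMat_change, hg, Finset.mul_sum]
    refine Finset.sum_congr rfl fun μ _ => ?_
    rw [Finset.mul_sum]
    refine Finset.sum_congr rfl fun ν _ => ?_
    rw [mul_smul_comm]
    congr 1
    calc _ = J.map (algebraMap ℝ A) * M.gMat * (Jᵀ.map (algebraMap ℝ A) *
          Jiᵀ.map (algebraMap ℝ A)) * M.RMat μ ν * Jᵀ.map (algebraMap ℝ A) := by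
            simp only [mul_assoc]
      _ = _ := by rw [e'', mul_one]; simp only [mul_assoc]
  have hm (M : Geometry A ι) (a b c d) : M.Rm a b c d = (M.gMat * M.RMat c d) a b := by
    simp [gMat, RMat, Rm, Matrix.mul_apply]
  rw [hm, h1]
  simp only [Matrix.sum_apply, Matrix.smul_apply, conj_apply, ← hm, Finset.smul_sum, smul_smul]
  calc _ = ∑ μ, ∑ κ, ∑ ν, ∑ l, (J c μ * J d ν * (J a κ * J b l)) • M.Rm κ l μ ν :=
        Finset.sum_congr rfl fun μ _ => Finset.sum_comm
    _ = ∑ κ, ∑ μ, ∑ l, ∑ ν, (J c μ * J d ν * (J a κ * J b l)) • M.Rm κ l μ ν := by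
        rw [Finset.sum_comm]
        exact Finset.sum_congr rfl fun κ _ => Finset.sum_congr rfl fun μ _ => Finset.sum_comm
    _ = _ := Finset.sum_congr rfl fun κ _ => by
        rw [Finset.sum_comm]
        exact Finset.sum_congr rfl fun l _ => Finset.sum_congr rfl fun μ _ =>
          Finset.sum_congr rfl fun ν _ => by congr 1; ring

end ChangeOfCoordinates

end Geometry

end

section

/-! ### Isometric immersions of three-manifolds into a light cone -/

section LightCone

variable {B : Type*} [CommRing B] [Algebra ℝ B] {V : Type*}

/-- The componentwise action of a derivation. -/
def vecD (d : Derivation ℝ B B) (X : V → B) : V → B := fun v => d (X v)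

theorem vecD_sub (d : Derivation ℝ B B) (X Y : V → B) : vecD d (X - Y) = vecD d X - vecD d Y := by
  ext v; simp [vecD]

theorem vecD_smul (d : Derivation ℝ B B) (X : V → B) (b : B) :
    vecD d (b • X) = d b • X + b • vecD d X := by
  ext v; simp [vecD]; ring

theorem vecD_sum (d : Derivation ℝ B B) {κ : Type*} (t : Finset κ) (Y : κ → V → B) :
    vecD d (∑ k ∈ t, Y k) = ∑ k ∈ t, vecD d (Y k) := by
  ext v; simp [vecD]

variable [Fintype V] (η : V → ℝ)

/-- A diagonal bilinear form. -/
def diagForm (X Y : V → B) : B := ∑ v, algebraMap ℝ B (η v) * X v * Y v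

theorem diagForm_comm (X Y : V → B) : diagForm η X Y = diagForm η Y X :=
  Finset.sum_congr rfl fun v _ => by ring

theorem diagForm_add (X Y Y' : V → B) :
    diagForm η X (Y + Y') = diagForm η X Y + diagForm η X Y' := by
  simp only [diagForm, Pi.add_apply, mul_add, Finset.sum_add_distrib]

theorem diagForm_sub (X Y Y' : V → B) :
    diagForm η X (Y - Y') = diagForm η X Y - diagForm η X Y' := by
  simp only [diagForm, Pi.sub_apply, mul_sub, Finset.sum_sub_distrib]

theorem diagForm_smul (X Y : V → B) (b : B) :
    diagForm η X (b • Y) = b * diagForm η X Y := by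
  simp only [diagForm, Pi.smul_apply, smul_eq_mul, Finset.mul_sum]
  exact Finset.sum_congr rfl fun v _ => by ring

theorem diagForm_sum {κ : Type*} (t : Finset κ) (X : V → B) (Y : κ → V → B) :
    diagForm η X (∑ k ∈ t, Y k) = ∑ k ∈ t, diagForm η X (Y k) := by
  simp only [diagForm, Finset.sum_apply, Finset.mul_sum]
  exact Finset.sum_comm

theorem diagForm_zero (X : V → B) : diagForm η X 0 = 0 := by simp [diagForm]

theorem derivation_diagForm (d : Derivation ℝ B B) (X Y : V → B) :
    d (diagForm η X Y) = diagForm η (vecD d X) Y + diagForm η X (vecD d Y) := by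
  simp only [diagForm, map_sum, Derivation.leibniz, smul_eq_mul, Derivation.map_algebraMap, vecD,
    ← Finset.sum_add_distrib]
  exact Finset.sum_congr rfl fun v _ => by ring

/-- A vector orthogonal to a null pair and to vectors with a nondegenerate Gram matrix vanishes, if
their number is the dimension. -/
theorem eq_zero_of_orthogonal {η : Fin 2 ⊕ Fin 3 → ℝ} (hη : ∀ v, η v * η v = 1)
    {Z Y : Fin 2 ⊕ Fin 3 → B} {X : Fin 3 → Fin 2 ⊕ Fin 3 → B} {m mi : Fin 3 → Fin 3 → B}
    (hZ : diagForm η Z Z = 0) (hY : diagForm η Y Y = 0) (hZY : diagForm η Z Y = 1)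
    (hZX : ∀ i, diagForm η Z (X i) = 0) (hYX : ∀ i, diagForm η Y (X i) = 0)
    (hX : ∀ i j, diagForm η (X i) (X j) = m i j)
    (hm : ∀ i j, ∑ k, m i k * mi k j = if i = j then 1 else 0)
    {w : Fin 2 ⊕ Fin 3 → B} (h1 : diagForm η Z w = 0) (h2 : diagForm η Y w = 0)
    (h3 : ∀ i, diagForm η (X i) w = 0) : w = 0 := by
  -- The five vectors are the rows of a square matrix whose Gram matrix is a hyperbolic block plus
  -- `m`.
  set r : Fin 2 ⊕ Fin 3 → Fin 2 ⊕ Fin 3 → B := Sum.elim ![Z, Y] X with hr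
  set Q : Matrix (Fin 2 ⊕ Fin 3) (Fin 2 ⊕ Fin 3) B := Matrix.of r with hQ
  set E : Matrix (Fin 2 ⊕ Fin 3) (Fin 2 ⊕ Fin 3) B :=
    Matrix.diagonal fun v => algebraMap ℝ B (η v) with hE
  have happ (i j) : (Q * E * Qᵀ) i j = diagForm η (r i) (r j) := by
    rw [Matrix.mul_apply]
    refine Finset.sum_congr rfl fun v _ => ?_
    rw [hE, Matrix.mul_diagonal, Matrix.transpose_apply, hQ, Matrix.of_apply, Matrix.of_apply]
    ring
  have hgram : Q * E * Qᵀ = Matrix.fromBlocks !![0, 1; 1, 0] 0 0 (Matrix.of m) := by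
    ext i j
    rw [happ]
    rcases i with i | i <;> rcases j with j | j
    · fin_cases i <;> fin_cases j <;> simp [hr, hZ, hY, hZY, diagForm_comm η Y Z]
    · fin_cases i <;> simp [hr, hZX, hYX]
    · fin_cases j <;> simp [hr, diagForm_comm η (X i), hZX, hYX]
    · simp [hr, hX]
  -- Invertibility of the Gram matrix gives a right inverse of `Q`, and over a commutative ring a
  -- one-sided inverse of a square matrix is two-sided.
  have hinv : Q * (E * Qᵀ * Matrix.fromBlocks !![0, 1; 1, 0] 0 0 (Matrix.of mi)) = 1 := by
    rw [← mul_assoc, ← mul_assoc, hgram, Matrix.fromBlocks_multiply]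
    have e : (Matrix.of m * Matrix.of mi : Matrix (Fin 3) (Fin 3) B) = 1 := by
      ext i j; simp [Matrix.mul_apply, hm, Matrix.one_apply]
    have e2 : (!![0, 1; 1, 0] * !![0, 1; 1, 0] : Matrix (Fin 2) (Fin 2) B) = 1 := by
      ext i j; fin_cases i <;> fin_cases j <;> simp
    simp [e, e2]
  have hw : Q *ᵥ (E *ᵥ w) = 0 := by
    have (i : Fin 2 ⊕ Fin 3) : (Q *ᵥ (E *ᵥ w)) i = diagForm η (r i) w := by
      rw [Matrix.mulVec, dotProduct]
      refine Finset.sum_congr rfl fun v _ => ?_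
      rw [hE, Matrix.mulVec_diagonal, hQ, Matrix.of_apply]
      ring
    ext i
    rw [this]
    rcases i with i | i
    · fin_cases i <;> simp [hr, h1, h2]
    · simp [hr, h3]
  have hEw : E *ᵥ w = 0 := by
    rw [← Matrix.one_mulVec (E *ᵥ w), ← mul_eq_one_comm.1 hinv, ← Matrix.mulVec_mulVec, hw,
      Matrix.mulVec_zero]
  ext v
  have h4 := congrFun hEw v
  simp only [hE, Matrix.mulVec_diagonal, Pi.zero_apply] at h4
  have h5 : algebraMap ℝ B (η v) * (algebraMap ℝ B (η v) * w v) = w v := by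
    rw [← mul_assoc, ← map_mul, hη, map_one, one_mul]
  rw [← h5, h4, mul_zero, Pi.zero_apply]

end LightCone

end

/-! ### Gauss and Codazzi equations for immersions into the light cone. -/

section

section LightCone

variable {B : Type*} [CommRing B] [Algebra ℝ B]

theorem two_mul_cancel {x y : B} (h : 2 * x = 2 * y) : x = y := by
  have := isAddTorsionFree_of_algebra B
  exact nsmul_right_injective two_ne_zero (by simpa [nsmul_eq_mul] using h)

/-- In dimension three a symmetric 2-tensor is determined by its Kulkarni-Nomizu product with the
metric. -/
theorem Geometry.eq_zero_of_kn_eq_zero (M : Geometry B (Fin 3)) {T : Fin 3 → Fin 3 → B}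
    (h : ∀ a b c d, M.kn T a b c d = 0) (b d : Fin 3) : T b d = 0 := by
  have htr : ∑ a, ∑ c, M.gi a c * M.g a c = 3 := by
    have : ∀ a, ∑ c, M.gi a c * M.g a c = 1 := fun a => by
      have h := M.gi_g a a
      simp only [if_true] at h
      simpa only [M.g_symm a] using h
    simp [this]
  set τ := ∑ a, ∑ c, M.gi a c * T a c with hτ
  have h1 (b d) : ∑ a, ∑ c, M.gi a c * M.kn T a b c d = T b d + τ * M.g b d := by
    have e2 : ∑ a, ∑ c, M.gi a c * (M.g a d * T b c) = T b d := by
      have := M.sum_g_gi_mul d fun c => T b c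
      rw [← this]
      exact Finset.sum_congr rfl fun a _ => Finset.sum_congr rfl fun c _ => by
        rw [M.g_symm a d]; ring
    have e3 : ∑ a, ∑ c, M.gi a c * (T a d * M.g b c) = T b d := by
      have := M.sum_g_gi_mul b fun a => T a d
      rw [← this, Finset.sum_comm]
      exact Finset.sum_congr rfl fun a _ => Finset.sum_congr rfl fun c _ => by
        rw [M.gi_symm c a]; ring
    have e1 : ∑ a, ∑ c, M.gi a c * (M.g a c * T b d) = 3 * T b d := by
      rw [← htr]; simp only [Finset.sum_mul, mul_assoc]
    have e4 : ∑ a, ∑ c, M.gi a c * (T a c * M.g b d) = τ * M.g b d := by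
      simp only [hτ, Finset.sum_mul, mul_assoc]
    simp only [Geometry.kn, mul_add, mul_sub, Finset.sum_add_distrib, Finset.sum_sub_distrib, e1,
      e2, e3, e4]
    ring
  have h2 (b d) : T b d = -τ * M.g b d := by
    have := h1 b d
    simp only [h, mul_zero, Finset.sum_const_zero] at this
    linear_combination -this
  -- Here `T = -τ g`, and its trace reads `τ = -3 τ`, that is, `4 τ = 0`.
  have h3 : τ = 0 := by
    have e : τ = -τ * 3 := by
      conv_lhs => rw [hτ]
      rw [← htr, Finset.mul_sum]
      refine Finset.sum_congr rfl fun a _ => ?_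
      rw [Finset.mul_sum]
      exact Finset.sum_congr rfl fun c _ => by rw [h2]; ring
    apply two_mul_cancel; apply two_mul_cancel
    linear_combination e
  rw [h2, h3]; ring

variable {V : Type*} (M : Geometry B (Fin 3)) (Z : V → B)

/-- The derivatives of an immersion. -/
def immD (i : Fin 3) : V → B := vecD (M.D i) Z

/-- The second fundamental form of an immersion. -/
def immII (i j : Fin 3) : V → B :=
  vecD (M.D i) (immD M Z j) - ∑ k, M.Γ k i j • immD M Z k

theorem immII_symm (i j : Fin 3) : immII M Z i j = immII M Z j i := by
  have : vecD (M.D i) (immD M Z j) = vecD (M.D j) (immD M Z i) := by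
    ext v; exact M.comm i j (Z v)
  rw [immII, immII, this]
  simp only [M.Γ_symm _ i j]

/-- The Gauss and Codazzi equations in vector form. -/
theorem gauss_codazzi (i j k : Fin 3) : ∑ l, M.R l k i j • immD M Z l
    + ∑ l, M.Γ l j k • immII M Z i l - ∑ l, M.Γ l i k • immII M Z j l
    + vecD (M.D i) (immII M Z j k) - vecD (M.D j) (immII M Z i k) = 0 := by
  have hc : vecD (M.D i) (vecD (M.D j) (immD M Z k)) = vecD (M.D j) (vecD (M.D i) (immD M Z k)) := by
    ext v; exact M.comm i j _
  have h1 (i j : Fin 3) : vecD (M.D i) (immII M Z j k) = vecD (M.D i) (vecD (M.D j) (immD M Z k))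
      - ∑ l, M.D i (M.Γ l j k) • immD M Z l
      - ∑ l, M.Γ l j k • immII M Z i l
      - ∑ l, (∑ σ, M.Γ l i σ * M.Γ σ j k) • immD M Z l := by
    have h2 : ∑ l, (∑ σ, M.Γ l i σ * M.Γ σ j k) • immD M Z l
        = ∑ l, M.Γ l j k • ∑ σ, M.Γ σ i l • immD M Z σ := by
      simp only [Finset.sum_smul, Finset.smul_sum, smul_smul]
      rw [Finset.sum_comm]
      exact Finset.sum_congr rfl fun a _ => Finset.sum_congr rfl fun b _ => by rw [mul_comm]
    rw [h2, immII, vecD_sub, vecD_sum]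
    simp only [vecD_smul, Finset.sum_add_distrib, sub_sub]
    congr 1
    rw [add_assoc]
    congr 1
    rw [← Finset.sum_add_distrib]
    exact Finset.sum_congr rfl fun l _ => by rw [← smul_add, immII, sub_add_cancel]
  have hR : ∑ l, M.R l k i j • immD M Z l = ∑ l, M.D i (M.Γ l j k) • immD M Z l
      - ∑ l, M.D j (M.Γ l i k) • immD M Z l
      + ∑ l, (∑ σ, M.Γ l i σ * M.Γ σ j k) • immD M Z l
      - ∑ l, (∑ σ, M.Γ l j σ * M.Γ σ i k) • immD M Z l := by
    simp only [← Finset.sum_add_distrib, ← Finset.sum_sub_distrib, ← add_smul, ← sub_smul]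
    refine Finset.sum_congr rfl fun l _ => ?_
    rw [Geometry.R, Finset.sum_sub_distrib]
    congr 1; ring
  rw [h1, h1, hR, hc]
  abel

variable {η : V → ℝ} {M Z}

theorem diagForm_immD_self [Fintype V] (hZ : diagForm η Z Z = 0) (i : Fin 3) : diagForm η Z (immD M Z i) = 0 := by
  have h := derivation_diagForm η (M.D i) Z Z
  rw [hZ, map_zero, diagForm_comm η (vecD _ _)] at h
  exact two_mul_cancel (by rw [mul_zero]; rw [immD]; linear_combination -h)

/-- A tensor symmetric in the first two and antisymmetric in the last two indices vanishes. -/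
theorem eq_zero_of_symm_of_antisymm {ι : Type*} {a : ι → ι → ι → B}
    (h1 : ∀ i j k, a i j k = a j i k) (h2 : ∀ i j k, a i j k = -a i k j) (i j k : ι) :
    a i j k = 0 := by
  apply two_mul_cancel
  rw [mul_zero]
  linear_combination h2 i j k - h1 i k j - h2 k i j + h1 k j i + h2 j k i - h1 j i k

/-- Uniqueness of the Levi-Civita connection: the difference of the two sides is symmetric in the
first two indices and, by metric compatibility, antisymmetric in the last two. -/
theorem diagForm_vecD_immD [Fintype V] (hm : ∀ i j, diagForm η (immD M Z i) (immD M Z j) = M.g i j)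
    (i j k : Fin 3) :
    diagForm η (immD M Z k) (vecD (M.D i) (immD M Z j)) = ∑ d, M.Γ d i j * M.g d k := by
  set a : Fin 3 → Fin 3 → Fin 3 → B := fun i j k =>
    diagForm η (immD M Z k) (vecD (M.D i) (immD M Z j)) - ∑ d, M.Γ d i j * M.g d k with ha
  have h1 (i j k) : a i j k = a j i k := by
    have : vecD (M.D i) (immD M Z j) = vecD (M.D j) (immD M Z i) := by
      ext v; exact M.comm i j (Z v)
    simp only [ha, this, M.Γ_symm _ i j]
  have h2 (i j k) : a i j k = -a i k j := by
    have h := M.compat i j k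
    rw [← hm, derivation_diagForm, diagForm_comm η (vecD _ _), Finset.sum_add_distrib] at h
    simp only [ha, M.g_symm _ j] at h ⊢
    linear_combination h
  exact sub_eq_zero.1 (eq_zero_of_symm_of_antisymm h1 h2 i j k)

theorem diagForm_immD_immII [Fintype V] (hm : ∀ i j, diagForm η (immD M Z i) (immD M Z j) = M.g i j)
    (i j k : Fin 3) : diagForm η (immD M Z k) (immII M Z i j) = 0 := by
  rw [immII, diagForm_sub, diagForm_sum, diagForm_vecD_immD hm]
  simp only [diagForm_smul, hm, M.g_symm k, sub_self]

/-- Differentiate `⟨Z, ∂_j Z⟩ = 0`. The null position vector is itself normal to the immersion, with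
second fundamental form `-g`. -/
theorem diagForm_self_immII [Fintype V] (hZ : diagForm η Z Z = 0)
    (hm : ∀ i j, diagForm η (immD M Z i) (immD M Z j) = M.g i j) (i j : Fin 3) :
    diagForm η Z (immII M Z i j) = -M.g i j := by
  have h := derivation_diagForm η (M.D i) Z (immD M Z j)
  rw [diagForm_immD_self hZ, map_zero] at h
  change 0 = diagForm η (immD M Z i) _ + _ at h
  rw [hm] at h
  rw [immII, diagForm_sub, diagForm_sum]
  simp only [diagForm_smul, diagForm_immD_self hZ, mul_zero, Finset.sum_const_zero]
  linear_combination -h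

end LightCone

/-- A metric in dimension three that is induced from a light cone of `ℝ⁵` is conformally flat: if
its curvature is the Kulkarni-Nomizu product of `P` and the metric, then the Cotton tensor of `P`
vanishes. -/
theorem cotton_eq_zero_of_lightCone {B : Type*} [CommRing B] [Algebra ℝ B]
    (M : Geometry B (Fin 3)) {η : Fin 2 ⊕ Fin 3 → ℝ} (hη : ∀ v, η v * η v = 1)
    {Z : Fin 2 ⊕ Fin 3 → B} (hZ : diagForm η Z Z = 0)
    (hm : ∀ i j, diagForm η (immD M Z i) (immD M Z j) = M.g i j)
    {P : Fin 3 → Fin 3 → B} (hR : ∀ a b c d, M.Rm a b c d = M.kn P a b c d) (i j k : Fin 3) :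
    M.cotton P i j k = 0 := by
  have h13 : 3 * algebraMap ℝ B (1 / 3) = 1 := by
    rw [← map_ofNat (algebraMap ℝ B) 3, ← map_mul, ← map_one (algebraMap ℝ B)]; norm_num
  have h2 : 2 * algebraMap ℝ B (1 / 2) = 1 := by
    rw [← map_ofNat (algebraMap ℝ B) 2, ← map_mul, ← map_one (algebraMap ℝ B)]; norm_num
  have hZI := diagForm_self_immII hZ hm
  have hXI := diagForm_immD_immII hm
  have hZX := diagForm_immD_self (M := M) hZ
  have htr : ∑ a, ∑ c, M.gi a c * M.g a c = 3 := by
    have : ∀ a, ∑ c, M.gi a c * M.g a c = 1 := fun a => by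
      have h := M.gi_g a a
      simp only [if_true] at h
      simpa only [M.g_symm a] using h
    simp [this]
  -- a transversal null vector
  obtain ⟨Y, hZY, hYY, hYX⟩ : ∃ Y : Fin 2 ⊕ Fin 3 → B, diagForm η Z Y = 1 ∧ diagForm η Y Y = 0 ∧
      ∀ i, diagForm η Y (immD M Z i) = 0 := by
    -- The mean curvature vector is normal, and the factor `-1/3` normalises its product with `Z` to
    -- one, as `⟨Z, II⟩ = -g` has trace `-3`.
    set H := -algebraMap ℝ B (1 / 3) • ∑ i, ∑ j, M.gi i j • immII M Z i j with hH
    have hZH : diagForm η Z H = 1 := by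
      simp only [hH, diagForm_smul, diagForm_sum, hZI, mul_neg, Finset.sum_neg_distrib, htr]
      linear_combination h13
    have hXH (i) : diagForm η (immD M Z i) H = 0 := by
      simp only [hH, diagForm_smul, diagForm_sum, hXI, mul_zero, Finset.sum_const_zero]
    have hHZ : diagForm η H Z = 1 := by rw [diagForm_comm, hZH]
    clear_value H
    -- Subtracting a multiple of the null vector `Z` makes `H` null without changing its other
    -- products.
    refine ⟨H - (algebraMap ℝ B (1 / 2) * diagForm η H H) • Z, ?_, ?_, fun i => ?_⟩
    · rw [diagForm_sub, diagForm_smul, hZ, hZH]; ring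
    · rw [diagForm_sub, diagForm_smul, diagForm_comm η _ H, diagForm_comm η _ Z, diagForm_sub,
        diagForm_sub, diagForm_smul, diagForm_smul, hZ, hZH, hHZ]
      linear_combination (-diagForm η H H) * h2
    · rw [diagForm_comm, diagForm_sub, diagForm_smul, hXH, diagForm_comm η _ Z, hZX]; ring
  set p : Fin 3 → Fin 3 → B := fun i j => diagForm η Y (immII M Z i j) with hp
  have hYZ : diagForm η Y Z = 1 := by rw [diagForm_comm, hZY]
  have hXZ (i) : diagForm η (immD M Z i) Z = 0 := by rw [diagForm_comm, hZX]
  have hXY (i) : diagForm η (immD M Z i) Y = 0 := by rw [diagForm_comm, hYX]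
  have hps (i j) : p i j = p j i := by simp only [hp, immII_symm M Z i j]
  -- The second fundamental form is normal, the normal space is spanned by the null pair `Z`, `Y`,
  -- and its products with both are known.
  have hII (i j) : immII M Z i j = p i j • Z - M.g i j • Y := by
    rw [← sub_eq_zero]
    refine eq_zero_of_orthogonal hη hZ hYY hZY hZX hYX hm M.g_gi ?_ ?_ fun k => ?_
    · rw [diagForm_sub, diagForm_sub, diagForm_smul, diagForm_smul, hZI, hZ, hZY]; ring
    · rw [diagForm_sub, diagForm_sub, diagForm_smul, diagForm_smul, hYZ, hYY, hp]; ring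
    · rw [diagForm_sub, diagForm_sub, diagForm_smul, diagForm_smul, hXI, hXZ, hXY]; ring
  have hGC := gauss_codazzi M Z
  have hIIX (a b c d) : diagForm η (immII M Z c d) (immII M Z a b)
      = -p c d * M.g a b - M.g c d * p a b := by
    rw [hII a b, diagForm_sub, diagForm_smul, diagForm_smul, diagForm_comm η _ Z, hZI,
      diagForm_comm η _ Y]
    ring
  -- The Gauss equation: the tangential part of the integrability condition. Comparison with `hR`
  -- then gives `P = -p`, because in dimension three the Kulkarni-Nomizu product with the metric is
  -- injective.
  have hG (a b c d) : M.Rm a b c d = M.kn (fun i j => -p i j) a b c d := by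
    have h := congrArg (diagForm η (immD M Z a)) (hGC c d b)
    simp only [diagForm_sub, diagForm_add, diagForm_sum, diagForm_smul, hm, hXI, mul_zero,
      Finset.sum_const_zero, diagForm_zero] at h
    have hd (i j k l) : diagForm η (immD M Z l) (vecD (M.D i) (immII M Z j k))
        = -diagForm η (immII M Z i l) (immII M Z j k) := by
      have h1 := derivation_diagForm η (M.D i) (immD M Z l) (immII M Z j k)
      have h2 : vecD (M.D i) (immD M Z l) = immII M Z i l + ∑ k, M.Γ k i l • immD M Z k := by
        rw [immII, sub_add_cancel]
      rw [hXI, map_zero, h2, diagForm_comm η (_ + _), diagForm_add, diagForm_sum] at h1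
      simp only [diagForm_smul, diagForm_comm η (immII M Z j k) (immD M Z _), hXI, mul_zero,
        Finset.sum_const_zero] at h1
      rw [diagForm_comm η (immII M Z i l)]
      linear_combination -h1
    rw [hd, hd, hIIX, hIIX] at h
    have hRm : M.Rm a b c d = ∑ l, M.R l b c d * M.g a l :=
      Finset.sum_congr rfl fun l _ => mul_comm _ _
    rw [hRm]
    simp only [Geometry.kn]
    rw [hps c a, hps d a, M.g_symm c a, M.g_symm d a, hps d b, hps c b, M.g_symm d b,
      M.g_symm c b] at h
    linear_combination h
  have hP (a b) : P a b = -p a b := by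
    have := M.eq_zero_of_kn_eq_zero (T := fun i j => P i j - -p i j) (fun a b c d => by
      have h1 := hR a b c d
      rw [hG] at h1
      simp only [Geometry.kn] at h1 ⊢
      linear_combination -h1) a b
    exact sub_eq_zero.1 this
  -- The Codazzi equation along `Y`. Since `Y` is null and orthogonal to the immersion, `⟨Y, ∂Y⟩`
  -- and `⟨Y, ∂Z⟩` vanish, so it is the symmetry of `∇p` and involves no further normal connection.
  have hC := congrArg (diagForm η Y) (hGC i j k)
  have hd (i j k) : diagForm η Y (vecD (M.D i) (immII M Z j k)) = M.D i (p j k) := by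
    have hYY' : diagForm η Y (vecD (M.D i) Y) = 0 := by
      have h := derivation_diagForm η (M.D i) Y Y
      rw [hYY, map_zero, diagForm_comm η (vecD _ _)] at h
      exact two_mul_cancel (by rw [mul_zero]; linear_combination -h)
    have hYX' : diagForm η Y (vecD (M.D i) Z) = 0 := hYX i
    rw [hII, vecD_sub, vecD_smul, vecD_smul, diagForm_sub, diagForm_add, diagForm_add]
    simp only [diagForm_smul, hYZ, hYY, hYY', hYX']
    ring
  simp only [diagForm_sub, diagForm_add, diagForm_sum, diagForm_smul, hYX, mul_zero,
    Finset.sum_const_zero, diagForm_zero, hd] at hC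
  rw [Geometry.cotton_eq]
  simp only [hP, map_neg, mul_neg, Finset.sum_neg_distrib]
  linear_combination -hC

end

/-! ### The boundary is totally geodesic. -/

section

/-- A compact metric near its boundary `ρ = 0` (index `0` is the coordinate `ρ`, index `1` the
time), with the restriction `β` of functions to the boundary, for which the metric
`(ψ ρ)⁻² g` is Einstein. -/
structure Collar {A : Type*} [CommRing A] [Algebra ℝ A] (M : Geometry A (Fin 4))
    (B : Type*) [CommRing B] [Algebra ℝ B] where
  β : A →+* B
  δ : Fin 3 → Derivation ℝ B B
  ρ : A
  ψ : A
  ψi : A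
  φ : A
  κ : ℝ
  β_D : ∀ i f, β (M.D i.succ f) = δ i (β f)
  δ_comm : ∀ i j f, δ i (δ j f) = δ j (δ i f)
  gi_zero_zero : M.gi 0 0 = 1
  gi_zero_one : M.gi 0 1 = 0
  gi_sub : ∀ a, M.gi 0 a - M.gi 1 a = if a = 0 ∨ a = 1 then 1 else 0
  β_ρ : β ρ = 0
  D_ρ : ∀ a, M.D a ρ = if a = 0 then 1 else 0
  ψ_mul : ψ * ψi = 1
  regular : ∀ x, ψ * ρ * x = 0 → x = 0
  hess_eq : ∀ c b, M.hess (ψ * ρ) c b = φ * M.g c b - ψ * ρ * M.schouten c b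
  gradSq_eq : M.gradSq (ψ * ρ) = algebraMap ℝ A κ + 2 * (ψ * ρ) * φ

namespace Collar

variable {A : Type*} [CommRing A] [Algebra ℝ A] {M : Geometry A (Fin 4)}
  {B : Type*} [CommRing B] [Algebra ℝ B] (K : Collar M B)

include K in
-- The derivative of `|dρ|² = 1`.
theorem Γ_zero_normal (c : Fin 4) : ∑ d, M.Γ 0 c d * M.gi 0 d = 0 := by
  have h := M.compat_gi c 0 0
  rw [K.gi_zero_zero, Derivation.map_one_eq_zero] at h
  apply two_mul_cancel
  rw [mul_zero]
  simp only [M.gi_symm _ 0, Finset.sum_add_distrib] at h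
  linear_combination h

include K in
-- The vector `L = gi 0 - gi 1` is the gradient of `ρ - t`, is null, and is the constant coordinate
-- vector `∂_ρ + ∂_t`. A null gradient is geodesic, and `∇_L L = 0` has these components.
theorem Γ_null_null (a : Fin 4) : M.Γ a 0 0 + 2 * M.Γ a 0 1 + M.Γ a 1 1 = 0 := by
  have hD (c b) : M.D c (M.gi 0 b - M.gi 1 b) = 0 := by
    rw [K.gi_sub]; split_ifs <;> simp
  have hs (f : Fin 4 → A) : ∑ d, f d * (M.gi 0 d - M.gi 1 d) = f 0 + f 1 := by
    simp [K.gi_sub, Fin.sum_univ_four]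
  have hU (c) : (M.Γ 0 c 0 - M.Γ 1 c 0) + (M.Γ 0 c 1 - M.Γ 1 c 1) = 0 := by
    have h0 : M.D c ((M.gi 0 0 - M.gi 1 0) - (M.gi 0 1 - M.gi 1 1)) = 0 := by
      rw [map_sub, hD, hD, sub_zero]
    have h1 := hs fun d => M.Γ 0 c d - M.Γ 1 c d
    apply two_mul_cancel
    rw [← h1, mul_zero]
    simp only [map_sub, M.compat_gi, Finset.sum_add_distrib] at h0
    simp only [M.gi_symm _ 0] at h0
    simp only [M.gi_symm _ 1] at h0
    simp only [sub_mul, mul_sub, Finset.sum_sub_distrib]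
    linear_combination -h0
  have hV (c) : M.Γ a c 0 + M.Γ a c 1 = -∑ d, (M.Γ 0 c d - M.Γ 1 c d) * M.gi d a := by
    have h1 := hs fun d => M.Γ a c d
    rw [← h1]
    have h0 := hD c a
    simp only [map_sub, M.compat_gi, Finset.sum_add_distrib] at h0
    simp only [sub_mul, mul_sub, Finset.sum_sub_distrib]
    linear_combination -h0
  have h := congrArg₂ (· + ·) (hV 0) (hV 1)
  have e : ∑ d, (M.Γ 0 0 d - M.Γ 1 0 d) * M.gi d a + ∑ d, (M.Γ 0 1 d - M.Γ 1 1 d) * M.gi d a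
      = 0 := by
    rw [← Finset.sum_add_distrib]
    refine Finset.sum_eq_zero fun d _ => ?_
    have := hU d
    rw [M.Γ_symm 0 0 d, M.Γ_symm 1 0 d, M.Γ_symm 0 1 d, M.Γ_symm 1 1 d]
    linear_combination M.gi d a * this
  rw [M.Γ_symm a 1 0] at h
  linear_combination h - e

theorem β_hess (c b : Fin 4) :
    -K.β K.ψ * K.β (M.Γ 0 c b) + (if b = 0 then K.β (M.D c K.ψ) else 0)
      + (if c = 0 then K.β (M.D b K.ψ) else 0) = K.β K.φ * K.β (M.g c b) := by
  have h := congrArg K.β (K.hess_eq c b)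
  have e : ∑ x, M.Γ x c b * (if x = 0 then 1 else 0) = M.Γ 0 c b := by simp
  simp only [Geometry.hess, Derivation.leibniz, smul_eq_mul, K.D_ρ, map_sub, map_add, map_mul,
    K.β_ρ, mul_add, Finset.sum_add_distrib, mul_left_comm _ K.ψ, mul_left_comm _ K.ρ,
    ← Finset.mul_sum, e] at h
  split_ifs at h ⊢ <;> simp at h ⊢ <;> linear_combination h

theorem β_ψ_mul : K.β K.ψ * K.β K.ψi = 1 := by rw [← map_mul, K.ψ_mul, map_one]

/-- The boundary is totally geodesic and the conformal factor is constant to second order. -/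
theorem β_φ_and_D_ψ : K.β K.φ = 0 ∧ ∀ a, K.β (M.D a K.ψ) = 0 := by
  -- Contract the boundary Hessian equation with the normal, which removes the connection term. The
  -- tangential derivatives of `ψ` vanish and `2 ∂_ρ ψ = φ`.
  have h1 (c) : K.β (M.D c K.ψ) + (if c = 0 then ∑ b, K.β (M.gi 0 b) * K.β (M.D b K.ψ) else 0)
      = K.β K.φ * (if c = 0 then 1 else 0) := by
    have e1 : ∑ b, K.β (M.Γ 0 c b) * K.β (M.gi 0 b) = 0 := by
      rw [← map_zero K.β, ← K.Γ_zero_normal c, map_sum]; simp only [map_mul]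
    have e2 : ∑ b, K.β (M.g c b) * K.β (M.gi 0 b) = if c = 0 then 1 else 0 := by
      have := congrArg K.β (M.g_gi c 0)
      rw [map_sum] at this
      simp only [map_mul, M.gi_symm _ 0] at this
      rw [this]; split_ifs <;> simp
    have h : ∑ b, K.β (M.gi 0 b) * (-K.β K.ψ * K.β (M.Γ 0 c b)
        + (if b = 0 then K.β (M.D c K.ψ) else 0) + (if c = 0 then K.β (M.D b K.ψ) else 0))
        = ∑ b, K.β (M.gi 0 b) * (K.β K.φ * K.β (M.g c b)) :=
      Finset.sum_congr rfl fun b _ => by rw [K.β_hess]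
    rw [← e2]
    have e3 : ∑ b, K.β (M.gi 0 b) * (K.β K.φ * K.β (M.g c b))
        = K.β K.φ * ∑ b, K.β (M.g c b) * K.β (M.gi 0 b) := by
      rw [Finset.mul_sum]; exact Finset.sum_congr rfl fun b _ => by ring
    have e4 : ∑ b, K.β (M.gi 0 b) * (-K.β K.ψ * K.β (M.Γ 0 c b))
        = -K.β K.ψ * ∑ b, K.β (M.Γ 0 c b) * K.β (M.gi 0 b) := by
      rw [Finset.mul_sum]; exact Finset.sum_congr rfl fun b _ => by ring
    have e5 : ∑ b, K.β (M.gi 0 b) * (if c = 0 then K.β (M.D b K.ψ) else 0)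
        = if c = 0 then ∑ b, K.β (M.gi 0 b) * K.β (M.D b K.ψ) else 0 := by
      split_ifs <;> simp
    have e6 : ∑ b, K.β (M.gi 0 b) * (if b = 0 then K.β (M.D c K.ψ) else 0)
        = K.β (M.D c K.ψ) := by
      simp [K.gi_zero_zero]
    rw [e3] at h
    simp only [mul_add, Finset.sum_add_distrib, e4, e1, e5, e6] at h
    linear_combination h
  have h2 (i : Fin 3) : K.β (M.D i.succ K.ψ) = 0 := by
    have := h1 i.succ
    simpa [Fin.succ_ne_zero] using this
  have h3 : 2 * K.β (M.D 0 K.ψ) = K.β K.φ := by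
    have := h1 0
    simp only [if_true, Fin.sum_univ_succ (n := 3), h2, K.gi_zero_zero, map_one, mul_zero,
      Finset.sum_const_zero] at this
    linear_combination this
  -- In the null direction `∂_ρ + ∂_t` both the metric and the connection term drop out, so `2 ∂_ρ ψ
  -- = 0`. Together with `h3` this gives `φ = 0`.
  have h4 : K.β K.φ = 0 := by
    have ha := K.β_hess 0 0
    have hb := K.β_hess 0 1
    have hc := K.β_hess 1 1
    have h1' := h2 0
    have hg : M.g 0 0 + 2 * M.g 0 1 + M.g 1 1 = 0 := by
      have e (c) : ∑ b, M.g c b * (M.gi b 0 - M.gi b 1)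
          = (if c = 0 then 1 else 0) - (if c = 1 then 1 else 0) := by
        simp only [mul_sub, Finset.sum_sub_distrib, M.g_gi]
      have e' (b) : M.gi b 0 - M.gi b 1 = M.gi 0 b - M.gi 1 b := by
        rw [M.gi_symm b 0, M.gi_symm b 1]
      simp only [e', K.gi_sub] at e
      have e0 := e 0
      have e1 := e 1
      simp [Fin.sum_univ_four] at e0 e1
      rw [M.g_symm 1 0] at e1
      linear_combination e0 + e1
    have hg' := congrArg K.β hg
    have hΓ := congrArg K.β (K.Γ_null_null 0)
    simp only [map_add, map_mul, map_ofNat, map_zero] at hg' hΓ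
    simp at ha hb hc h1'
    rw [h1'] at hb
    linear_combination -h3 + ha + 2 * hb + hc + K.β K.φ * hg' + K.β K.ψ * hΓ
  refine ⟨h4, Fin.cases ?_ h2⟩
  apply two_mul_cancel
  rw [h3, h4, mul_zero]

theorem β_D_ψ (a : Fin 4) : K.β (M.D a K.ψ) = 0 := K.β_φ_and_D_ψ.2 a

/-- With `φ` and `dψ` zero, the boundary Hessian equation reduces to `ψ Γ⁰ = 0` and `ψ` is
invertible. For tangential indices this is the vanishing of the second fundamental form. -/
theorem β_Γ_zero (c b : Fin 4) : K.β (M.Γ 0 c b) = 0 := by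
  have h := K.β_hess c b
  rw [K.β_φ_and_D_ψ.1, K.β_D_ψ, K.β_D_ψ] at h
  simp only [ite_self, add_zero, zero_mul] at h
  linear_combination -K.β K.ψi * h - K.β (M.Γ 0 c b) * K.β_ψ_mul

theorem β_D_normal (e f : Fin 4) :
    K.β (M.D e (M.gi 0 f)) = -∑ d, K.β (M.Γ f e d) * K.β (M.gi 0 d) := by
  rw [M.compat_gi]
  simp only [map_neg, map_sum, map_add, map_mul, K.β_Γ_zero, zero_mul, zero_add]

end Collar

end

/-! ### The Weyl tensor vanishes on the boundary. -/

section

/-- In dimension three a curvature-like tensor with vanishing Ricci contraction vanishes. -/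
theorem eq_zero_of_ricci_eq_zero {B : Type*} [CommRing B] [Algebra ℝ B]
    {T : Fin 3 → Fin 3 → Fin 3 → Fin 3 → B} {m γ : Fin 3 → Fin 3 → B}
    (hl : ∀ a b c d, T a b c d = -T b a c d) (hr : ∀ a b c d, T a b c d = -T a b d c)
    (hp : ∀ a b c d, T a b c d = T c d a b) (hγ : ∀ a b, γ a b = γ b a)
    (hm : ∀ a c, ∑ b, m a b * γ b c = if a = c then 1 else 0)
    (hT : ∀ b d, ∑ a, ∑ c, γ a c * T a b c d = 0) (a b c d : Fin 3) : T a b c d = 0 := by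
  have hl0 (a c d) : T a a c d = 0 :=
    two_mul_cancel (by linear_combination hl a a c d)
  have hr0 (a b c) : T a b c c = 0 :=
    two_mul_cancel (by linear_combination hr a b c c)
  have hdet : (Matrix.of m).det * (Matrix.of γ).det = 1 := by
    rw [← Matrix.det_mul, ← Matrix.det_one (n := Fin 3)]
    congr 1
    ext i j
    simp [Matrix.mul_apply, hm, Matrix.one_apply]
  set D := (Matrix.of γ).det with hD
  have hz {x : B} (h : 2 * D * x = 0) : x = 0 := by
    apply two_mul_cancel
    linear_combination (Matrix.of m).det * h - 2 * x * hdet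
  have g10 := hγ 1 0
  have g20 := hγ 2 0
  have g21 := hγ 2 1
  have l10 := hl 1 0
  have l20 := hl 2 0
  have l21 := hl 2 1
  have r10 (a b) := hr a b 1 0
  have r20 (a b) := hr a b 2 0
  have r21 (a b) := hr a b 2 1
  have p1 := hp 0 2 0 1
  have p2 := hp 1 2 0 1
  have p3 := hp 1 2 0 2
  simp only [Matrix.det_fin_three, Matrix.of_apply, g10, g20, g21] at hD
  -- In dimension three a curvature tensor is the double dual of its Einstein tensor: each
  -- component, times `2 det γ`, is `γ^{ab} R - 2 Ric^{ab}` for a suitable index pair, up to sign.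
  -- The determinant is a unit by `hdet`.
  have key (a b : Fin 3) (S : B) (h : 2 * D * S = γ a b * (∑ j, ∑ l,
      (∑ a, ∑ c, γ a c * T a j c l) * γ j l)
      - 2 * ∑ j, ∑ l, γ a j * (∑ a, ∑ c, γ a c * T a j c l) * γ l b) : S = 0 := by
    apply hz
    rw [h]
    simp [hT]
  have t0101 : T 0 1 0 1 = 0 := key 2 2 _ (by
    simp only [Fin.sum_univ_three, hl0, hr0, l10, l20, l21, r10, r20, r21, p1, p2, p3, g10, g20,
      g21, hD]; ring)
  have t0102 : T 0 1 0 2 = 0 := neg_eq_zero.1 <| key 2 1 _ (by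
    simp only [Fin.sum_univ_three, hl0, hr0, l10, l20, l21, r10, r20, r21, p1, p2, p3, g10, g20,
      g21, hD]; ring)
  have t0112 : T 0 1 1 2 = 0 := key 2 0 _ (by
    simp only [Fin.sum_univ_three, hl0, hr0, l10, l20, l21, r10, r20, r21, p1, p2, p3, g10, g20,
      g21, hD]; ring)
  have t0202 : T 0 2 0 2 = 0 := key 1 1 _ (by
    simp only [Fin.sum_univ_three, hl0, hr0, l10, l20, l21, r10, r20, r21, p1, p2, p3, g10, g20,
      g21, hD]; ring)
  have t0212 : T 0 2 1 2 = 0 := neg_eq_zero.1 <| key 1 0 _ (by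
    simp only [Fin.sum_univ_three, hl0, hr0, l10, l20, l21, r10, r20, r21, p1, p2, p3, g10, g20,
      g21, hD]; ring)
  have t1212 : T 1 2 1 2 = 0 := key 0 0 _ (by
    simp only [Fin.sum_univ_three, hl0, hr0, l10, l20, l21, r10, r20, r21, p1, p2, p3, g10, g20,
      g21, hD]; ring)
  fin_cases a <;> fin_cases b <;> fin_cases c <;> fin_cases d <;>
    simp [hl0, hr0, l10, l20, l21, r10, r20, r21, p1, p2, p3, t0101, t0102, t0112, t0202, t0212,
      t1212]

namespace Collar

variable {A : Type*} [CommRing A] [Algebra ℝ A] {M : Geometry A (Fin 4)}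
  {B : Type*} [CommRing B] [Algebra ℝ B] (K : Collar M B)

/-- The unit normal of the boundary. -/
def N (a : Fin 4) : B := K.β (M.gi 0 a)

theorem N_zero : K.N 0 = 1 := by rw [N, K.gi_zero_zero, map_one]

/-- The inverse of the metric of the boundary. -/
def γ (i j : Fin 3) : B := K.β (M.gi i.succ j.succ) - K.N i.succ * K.N j.succ

theorem γ_symm (i j : Fin 3) : K.γ i j = K.γ j i := by
  rw [γ, γ, M.gi_symm]; ring

theorem sum_N (f : Fin 4 → B) : ∑ a, K.N a * f a = f 0 + ∑ i : Fin 3, K.N i.succ * f i.succ := by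
  rw [Fin.sum_univ_succ, N_zero, one_mul]

/-- `γ` is the Schur complement of the entry `gi 0 0 = 1` in the inverse metric, and so inverts the
tangential block of the metric. -/
theorem g_γ (i k : Fin 3) :
    ∑ j : Fin 3, K.β (M.g i.succ j.succ) * K.γ j k = if i = k then 1 else 0 := by
  have h1 := congrArg K.β (M.g_gi i.succ k.succ)
  have h2 := congrArg K.β (M.g_gi i.succ 0)
  rw [map_sum, Fin.sum_univ_succ] at h1 h2
  simp only [map_mul, Fin.succ_inj, Fin.succ_ne_zero, if_false, map_zero, apply_ite K.β, map_one,
    M.gi_symm _ 0] at h1 h2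
  rw [← h1]
  simp only [γ, mul_sub, Finset.sum_sub_distrib, ← mul_assoc, ← Finset.sum_mul]
  simp only [N, K.gi_zero_zero, map_one] at h2 ⊢
  linear_combination (-K.β (M.gi 0 k.succ)) * h2

/-- On the boundary the inverse metric is `N ⊗ N + γ`, and `γ` has only tangential components. -/
theorem sum_gi (F : Fin 4 → Fin 4 → B) : ∑ a, ∑ c, K.β (M.gi a c) * F a c
    = ∑ a, ∑ c, K.N a * K.N c * F a c + ∑ i : Fin 3, ∑ j : Fin 3, K.γ i j * F i.succ j.succ := by
  have h (a c : Fin 4) : K.β (M.gi a c) * F a c - K.N a * K.N c * F a c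
      = if a = 0 ∨ c = 0 then 0 else K.β (M.gi a c) * F a c - K.N a * K.N c * F a c := by
    split_ifs with h
    · rcases h with rfl | rfl
      · rw [N_zero, N]; ring
      · rw [N_zero, M.gi_symm, N]; ring
    · rfl
  rw [← sub_eq_iff_eq_add', ← Finset.sum_sub_distrib]
  simp only [← Finset.sum_sub_distrib]
  rw [Finset.sum_congr rfl fun a _ => Finset.sum_congr rfl fun c _ => h a c]
  simp [Fin.sum_univ_succ (n := 3), Fin.succ_ne_zero, γ, sub_mul]

theorem eq_zero_of_N {f : Fin 4 → B} (h : ∑ a, K.N a * f a = 0) (h' : ∀ i : Fin 3, f i.succ = 0)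
    (a : Fin 4) : f a = 0 := by
  refine Fin.cases ?_ h' a
  simpa [K.sum_N, h'] using h

theorem grad_conf (a : Fin 4) : M.grad (K.ψ * K.ρ) a = K.ψ * M.gi a 0 + K.ρ * M.grad K.ψ a := by
  have : ∑ e, M.gi a e * (if e = 0 then 1 else 0) = M.gi a 0 := by simp
  simp only [Geometry.grad, Derivation.leibniz, smul_eq_mul, K.D_ρ, mul_add,
    Finset.sum_add_distrib, mul_left_comm _ K.ψ, mul_left_comm _ K.ρ, ← Finset.mul_sum, this]

theorem grad_W (b c d : Fin 4) : ∑ a, M.grad (K.ψ * K.ρ) a * M.W a b c d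
    = K.ψ * K.ρ * M.cotton M.schouten c d b := by
  rw [← M.W_grad _ _ _ K.regular K.hess_eq K.gradSq_eq]
  simp only [Geometry.grad, Finset.sum_mul]

/-- On the boundary `∇s = ψ N` with `ψ` invertible, while the right side of `W(∇s) = s C` carries
the factor `ρ = 0`. -/
theorem N_W (b c d : Fin 4) : ∑ a, K.N a * K.β (M.W a b c d) = 0 := by
  have h := congrArg K.β (K.grad_W b c d)
  simp only [grad_conf, map_sum, map_mul, map_add, K.β_ρ, zero_mul, mul_zero, add_zero, mul_assoc,
    ← Finset.mul_sum] at h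
  simp only [N, M.gi_symm 0]
  linear_combination K.β K.ψi * h
    - (∑ a, K.β (M.gi a 0) * K.β (M.W a b c d)) * K.β_ψ_mul

/-- The Weyl tensor vanishes on the boundary. -/
theorem β_W (a b c d : Fin 4) : K.β (M.W a b c d) = 0 := by
  have h1 := K.N_W
  -- The full trace of `W` is zero and its normal part has just been removed, so the tangential part
  -- is trace-free for `γ`.
  have h2 (b d) : ∑ i : Fin 3, ∑ j : Fin 3, K.γ i j * K.β (M.W i.succ b j.succ d) = 0 := by
    have h := congrArg K.β (M.W_trace b d)
    simp only [map_sum, map_mul, map_zero] at h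
    rw [K.sum_gi fun a c => K.β (M.W a b c d), Finset.sum_comm] at h
    simpa only [mul_assoc, mul_left_comm (K.N _) (K.N _), ← Finset.mul_sum, h1, mul_zero,
      Finset.sum_const_zero, zero_add] using h
  have h3 (i j k l : Fin 3) : K.β (M.W i.succ j.succ k.succ l.succ) = 0 :=
    eq_zero_of_ricci_eq_zero
      (T := fun i j k l : Fin 3 => K.β (M.W i.succ j.succ k.succ l.succ))
      (m := fun i j : Fin 3 => K.β (M.g i.succ j.succ))
      (fun _ _ _ _ => by rw [M.W_antisymm_left, map_neg])
      (fun _ _ _ _ => by rw [M.W_antisymm_right, map_neg])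
      (fun _ _ _ _ => by rw [M.W_pair]) K.γ_symm K.g_γ (fun _ _ => h2 _ _) i j k l
  have n1 (b c d) : ∑ a, K.N a * K.β (M.W b a c d) = 0 := by
    have := h1 b c d
    rw [← neg_eq_zero, ← Finset.sum_neg_distrib, ← this]
    exact Finset.sum_congr rfl fun a _ => by rw [M.W_antisymm_left, map_neg]; ring
  have n2 (a b d) : ∑ c, K.N c * K.β (M.W a b c d) = 0 := by
    simpa only [M.W_pair _ _ a b] using h1 d a b
  have n3 (a b c) : ∑ d, K.N d * K.β (M.W a b c d) = 0 := by
    simpa only [M.W_pair _ _ a b] using n1 c a b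
  refine K.eq_zero_of_N (f := fun a => K.β (M.W a b c d)) (h1 b c d) (fun i => ?_) a
  refine K.eq_zero_of_N (f := fun b => K.β (M.W _ b c d)) (n1 _ c d) (fun j => ?_) b
  refine K.eq_zero_of_N (f := fun c => K.β (M.W _ _ c d)) (n2 _ _ d) (fun k => ?_) c
  exact K.eq_zero_of_N (f := fun d => K.β (M.W _ _ _ d)) (n3 _ _ _) (fun l => h3 _ _ _ _) d

end Collar

end

/-! ### Intrinsic geometry of the boundary and the Cotton tensor. -/

section

namespace Collar

variable {A : Type*} [CommRing A] [Algebra ℝ A] {M : Geometry A (Fin 4)}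
  {B : Type*} [CommRing B] [Algebra ℝ B] (K : Collar M B)

/-- The geometry of the boundary. -/
def boundary : Geometry B (Fin 3) where
  D := K.δ
  g i j := K.β (M.g i.succ j.succ)
  gi := K.γ
  Γ k i j := K.β (M.Γ k.succ i.succ j.succ)
  comm := K.δ_comm
  g_symm _ _ := by rw [M.g_symm]
  gi_symm := K.γ_symm
  g_gi := K.g_γ
  Γ_symm _ _ _ := by rw [M.Γ_symm]
  compat c a b := by
    rw [← K.β_D, M.compat, map_sum, Fin.sum_univ_succ]
    simp only [map_add, map_mul, K.β_Γ_zero, zero_mul, zero_add]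

/-- The Gauss equation with zero second fundamental form: every term passing through the index `0`
contains some `Γ⁰`. -/
theorem R_boundary (κ l μ ν : Fin 3) :
    K.boundary.R κ l μ ν = K.β (M.R κ.succ l.succ μ.succ ν.succ) := by
  simp only [Geometry.R, boundary, map_add, map_sub, map_sum, map_mul, ← K.β_D,
    Fin.sum_univ_succ (n := 3), K.β_Γ_zero, mul_zero, sub_zero, zero_add]

theorem β_R_zero (l μ ν : Fin 3) : K.β (M.R 0 l.succ μ.succ ν.succ) = 0 := by
  simp only [Geometry.R, map_add, map_sub, map_sum, map_mul, K.β_D, K.β_Γ_zero, map_zero,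
    zero_mul, sub_zero, Finset.sum_const_zero, add_zero]

/-- Since `W` vanishes on the boundary, the curvature there is the Kulkarni-Nomizu product with `P`.
This identifies the tangential part of `P` as the Schouten tensor of the boundary, as
`cotton_eq_zero_of_lightCone` requires. -/
theorem Rm_boundary (κ l μ ν : Fin 3) :
    K.boundary.Rm κ l μ ν
      = K.boundary.kn (fun i j => K.β (M.schouten i.succ j.succ)) κ l μ ν := by
  have h1 : K.boundary.Rm κ l μ ν = K.β (M.Rm κ.succ l.succ μ.succ ν.succ) := by
    simp only [Geometry.Rm, R_boundary, map_add, map_sum, map_mul, Fin.sum_univ_succ (n := 3), K.β_R_zero,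
      mul_zero, zero_add]
    rfl
  have h2 := K.β_W κ.succ l.succ μ.succ ν.succ
  rw [Geometry.W, map_sub, sub_eq_zero] at h2
  rw [h1, h2]
  simp only [Geometry.kn, map_add, map_sub, map_mul]
  rfl

theorem cotton_boundary (i j k : Fin 3) :
    K.boundary.cotton (fun i j => K.β (M.schouten i.succ j.succ)) i j k
      = K.β (M.cotton M.schouten i.succ j.succ k.succ) := by
  simp only [Geometry.cotton, Geometry.cov2, map_add, map_sub, map_sum, map_mul, K.β_D,
    Fin.sum_univ_succ (n := 3), K.β_Γ_zero, zero_mul, zero_add]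
  rfl

/-- The conformal flatness of the boundary, by an immersion into a light cone. -/
structure Cone where
  η : Fin 2 ⊕ Fin 3 → ℝ
  Z : Fin 2 ⊕ Fin 3 → B
  η_sq : ∀ v, η v * η v = 1
  null : diagForm η Z Z = 0
  metric : ∀ i j, diagForm η (vecD (K.δ i) Z) (vecD (K.δ j) Z) = K.β (M.g i.succ j.succ)

variable {K} in
theorem Cone.β_cotton (L : K.Cone) (i j k : Fin 3) :
    K.β (M.cotton M.schouten i.succ j.succ k.succ) = 0 := by
  rw [← cotton_boundary]
  exact cotton_eq_zero_of_lightCone K.boundary L.η_sq L.null L.metric K.Rm_boundary i j k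

/-- Apply `∂_ρ` to `W(∇s) = s C` at the boundary: on the left the derivative must fall on `W`, on
the right on `ρ`. -/
theorem N_κ_W_eq (b c d : Fin 4) : ∑ a, K.N a * K.β (M.D 0 (M.W a b c d))
    = K.β (M.cotton M.schouten c d b) := by
  have h := congrArg (fun x => K.β (M.D 0 x)) (K.grad_W b c d)
  simp only [map_sum, Derivation.leibniz, smul_eq_mul, map_add, map_mul, K.β_W, K.β_ρ, zero_mul,
    add_zero, zero_add, K.D_ρ, if_true, mul_one, grad_conf, mul_assoc,
    ← Finset.mul_sum] at h
  simp only [N, M.gi_symm 0]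
  linear_combination K.β K.ψi * h
    - (∑ a, K.β (M.gi a 0) * K.β (M.D 0 (M.W a b c d))
      - K.β (M.cotton M.schouten c d b)) * K.β_ψ_mul

/-- The evolution of the Weyl tensor normal to the boundary. -/
theorem N_second_W (b c d : Fin 4) :
    ∑ a, K.N a * K.β (M.D 0 (M.D 0 (M.W a b c d)))
      = 2 * ∑ a, ∑ e, K.β (M.gi a e) * (K.β (M.D e (M.D 0 (M.W a b c d)))
        - ∑ f, K.β (M.Γ f e a) * K.β (M.D 0 (M.W f b c d))
        - ∑ f, K.β (M.Γ f e b) * K.β (M.D 0 (M.W a f c d))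
        - ∑ f, K.β (M.Γ f e c) * K.β (M.D 0 (M.W a b f d))
        - ∑ f, K.β (M.Γ f e d) * K.β (M.D 0 (M.W a b c f))) := by
  have hDW (e a b c d) : K.β (M.D e (M.W a b c d))
      = if e = 0 then K.β (M.D 0 (M.W a b c d)) else 0 := by
    refine Fin.cases ?_ (fun i => ?_) e
    · simp
    · rw [K.β_D, K.β_W, map_zero, if_neg (Fin.succ_ne_zero i)]
  set X := M.cotton M.schouten c d b with hX
  have hdiv : X = ∑ a, ∑ e, M.gi a e * M.cov4 M.W e a b c d :=
    (M.div_W _ _ _ K.regular K.hess_eq K.gradSq_eq b c d).symm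
  -- The second `ρ`-derivative of `W(∇s) = s C`. Boundary values of `W`, `ρ` and `dψ` are zero,
  -- which leaves the terms of `h1`.
  have h := congrArg (fun x => K.β (M.D 0 (M.D 0 x))) (K.grad_W b c d)
  have h1 : ∑ a, (K.β K.ψ * K.β (M.gi a 0) * K.β (M.D 0 (M.D 0 (M.W a b c d)))
      + 2 * (K.β K.ψ * K.β (M.D 0 (M.gi a 0)) * K.β (M.D 0 (M.W a b c d))))
      = 2 * (K.β K.ψ * K.β (M.D 0 X)) := by
    have hg (a) : K.β (M.grad K.ψ a) = 0 := by
      simp only [Geometry.grad, map_sum, map_mul, K.β_D_ψ, mul_zero, Finset.sum_const_zero]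
    simp only [map_sum, Derivation.leibniz, smul_eq_mul, map_add, map_mul, K.β_W, K.β_ρ, zero_mul,
      mul_zero, add_zero, zero_add, K.D_ρ, if_true, mul_one, grad_conf, K.β_D_ψ, hg] at h
    refine Eq.trans (Finset.sum_congr rfl fun a _ => ?_) (h.trans (by ring))
    ring
  have h2 : K.β (M.D 0 X) = ∑ a, (K.β (M.D 0 (M.gi a 0)) * K.β (M.D 0 (M.W a b c d))
      + ∑ e, K.β (M.gi a e) * (K.β (M.D e (M.D 0 (M.W a b c d)))
        - ∑ f, K.β (M.Γ f e a) * K.β (M.D 0 (M.W f b c d))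
        - ∑ f, K.β (M.Γ f e b) * K.β (M.D 0 (M.W a f c d))
        - ∑ f, K.β (M.Γ f e c) * K.β (M.D 0 (M.W a b f d))
        - ∑ f, K.β (M.Γ f e d) * K.β (M.D 0 (M.W a b c f)))) := by
    obtain ⟨w, hw⟩ : ∃ w : Fin 4 → Fin 4 → Fin 4 → Fin 4 → B,
        ∀ a b c d, K.β (M.D 0 (M.W a b c d)) = w a b c d := ⟨_, fun _ _ _ _ => rfl⟩
    simp only [hw] at hDW
    rw [hdiv]
    simp only [Geometry.cov4, map_sum, Derivation.leibniz, smul_eq_mul, map_add, map_sub, map_mul,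
      K.β_W, hDW, zero_mul, mul_zero, add_zero, sub_zero, Finset.sum_const_zero, M.comm 0, if_true]
    refine Finset.sum_congr rfl fun a _ => ?_
    rw [Finset.sum_add_distrib, add_comm]
    congr 1
    simp [mul_comm]
  have h3 : ∑ a, K.β (M.gi a 0) * K.β (M.D 0 (M.D 0 (M.W a b c d)))
      + 2 * ∑ a, K.β (M.D 0 (M.gi a 0)) * K.β (M.D 0 (M.W a b c d)) = 2 * K.β (M.D 0 X) := by
    have e : K.β K.ψ * (∑ a, K.β (M.gi a 0) * K.β (M.D 0 (M.D 0 (M.W a b c d)))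
      + 2 * ∑ a, K.β (M.D 0 (M.gi a 0)) * K.β (M.D 0 (M.W a b c d)))
      = K.β K.ψ * (2 * K.β (M.D 0 X)) := by
      rw [mul_left_comm (K.β K.ψ) 2, ← h1, mul_add, Finset.mul_sum, Finset.mul_sum, Finset.mul_sum,
        ← Finset.sum_add_distrib]
      exact Finset.sum_congr rfl fun a _ => by ring
    linear_combination K.β K.ψi * e
      - (∑ a, K.β (M.gi a 0) * K.β (M.D 0 (M.D 0 (M.W a b c d)))
      + 2 * ∑ a, K.β (M.D 0 (M.gi a 0)) * K.β (M.D 0 (M.W a b c d))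
      - 2 * K.β (M.D 0 X)) * K.β_ψ_mul
  rw [h2, Finset.sum_add_distrib] at h3
  simp only [N, M.gi_symm 0]
  linear_combination h3

end Collar

end

/-! ### The transport equation for the electric part of the Weyl tensor. -/

section

namespace Collar

variable {A : Type*} [CommRing A] [Algebra ℝ A] {M : Geometry A (Fin 4)}
  {B : Type*} [CommRing B] [Algebra ℝ B] (K : Collar M B)

/-- The derivative in the normal direction of `f / ρ` for functions `f` vanishing on the boundary,
multiplied by two. -/
def normalD (f : A) : B := 2 * ∑ e, K.N e * K.β (M.D e (M.D 0 f)) - K.β (M.D 0 (M.D 0 f))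

theorem β_D_of_β_eq_zero {f : A} (hf : K.β f = 0) (e : Fin 4) :
    K.β (M.D e f) = if e = 0 then K.β (M.D 0 f) else 0 := by
  refine Fin.cases ?_ (fun i => ?_) e
  · simp
  · rw [K.β_D, hf, map_zero, if_neg (Fin.succ_ne_zero i)]

theorem normalD_mul (f : A) {h : A} (hh : K.β h = 0) : K.normalD (f * h)
    = K.β f * K.normalD h + 2 * (∑ e, K.N e * K.β (M.D e f)) * K.β (M.D 0 h) := by
  have h1 (e) : K.N e * K.β (M.D e (M.D 0 (f * h))) = K.β f * (K.N e * K.β (M.D e (M.D 0 h)))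
      + K.N e * K.β (M.D e f) * K.β (M.D 0 h)
      + if e = 0 then K.β (M.D 0 f) * K.β (M.D 0 h) else 0 := by
    simp only [Derivation.leibniz, smul_eq_mul, map_add, map_mul, hh, zero_mul]
    rw [K.β_D_of_β_eq_zero hh e]
    split_ifs with he
    · rw [he, K.N_zero]; ring
    · ring
  have h2 : K.β (M.D 0 (M.D 0 (f * h))) = K.β f * K.β (M.D 0 (M.D 0 h))
      + 2 * (K.β (M.D 0 f) * K.β (M.D 0 h)) := by
    simp only [Derivation.leibniz, smul_eq_mul, map_add, map_mul, hh]; ring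
  simp only [normalD, h1, h2, Finset.sum_add_distrib, ← Finset.mul_sum, ← Finset.sum_mul,
    Finset.sum_ite_eq', Finset.mem_univ, if_true]
  ring

theorem normalD_sum {ι : Type*} (t : Finset ι) (f : ι → A) :
    K.normalD (∑ i ∈ t, f i) = ∑ i ∈ t, K.normalD (f i) := by
  simp only [normalD, map_sum, Finset.mul_sum, Finset.sum_sub_distrib]
  rw [Finset.sum_comm]

theorem normalD_add (f h : A) : K.normalD (f + h) = K.normalD f + K.normalD h := by
  simp only [normalD, map_add, mul_add, Finset.sum_add_distrib]; ring

theorem normalD_sub (f h : A) : K.normalD (f - h) = K.normalD f - K.normalD h := by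
  simp only [normalD, map_sub, mul_sub, Finset.sum_sub_distrib]; ring

variable {K}

/-- `W/ρ` has no magnetic part at the boundary, because its components with one normal and three
tangential slots form the Cotton tensor of the conformally flat boundary. -/
theorem Cone.N_κ_W (L : K.Cone) (i j k : Fin 3) :
    ∑ a, K.N a * K.β (M.D 0 (M.W a i.succ j.succ k.succ)) = 0 := by
  rw [N_κ_W_eq, L.β_cotton]

theorem Cone.κ_W_N (L : K.Cone) (i j k : Fin 3) :
    ∑ a, K.N a * K.β (M.D 0 (M.W i.succ j.succ a k.succ)) = 0 := by
  simpa only [M.W_pair _ _ i.succ j.succ] using L.N_κ_W k i j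

variable (K) in
theorem sum_N_Γ (e : Fin 4) (u : Fin 4 → B) : ∑ a, K.N a * ∑ f, K.β (M.Γ f e a) * u f
    = -∑ f, K.β (M.D e (M.gi 0 f)) * u f := by
  simp only [K.β_D_normal, neg_mul, Finset.sum_neg_distrib, neg_neg, Finset.mul_sum,
    Finset.sum_mul]
  rw [Finset.sum_comm]
  exact Finset.sum_congr rfl fun f _ => Finset.sum_congr rfl fun a _ => by rw [N]; ring

/-- The electric part of the Weyl tensor. -/
def _root_.AAdS.Geometry.electric (M : Geometry A (Fin 4)) (b d : Fin 4) : A :=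
  ∑ a, ∑ c, M.gi 0 a * M.gi 0 c * M.W a b c d

variable (K) in
theorem β_electric (b d : Fin 4) : K.β (M.electric b d) = 0 := by
  simp only [Geometry.electric, map_sum, map_mul, K.β_W, mul_zero, Finset.sum_const_zero]

variable (K) in
theorem κ_electric (b d : Fin 4) : K.β (M.D 0 (M.electric b d))
    = ∑ a, ∑ c, K.N a * K.N c * K.β (M.D 0 (M.W a b c d)) := by
  simp only [Geometry.electric, map_sum, Derivation.leibniz, smul_eq_mul, map_add, map_mul, K.β_W,
    zero_mul, add_zero, N]

/-- The tangential part of the divergence of the Weyl tensor. -/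
theorem Cone.tangential_div (L : K.Cone) (p q i j : Fin 3) :
    ∑ c, K.N c * (K.β (M.D q.succ (M.D 0 (M.W p.succ i.succ c j.succ)))
        - ∑ f, K.β (M.Γ f q.succ p.succ) * K.β (M.D 0 (M.W f i.succ c j.succ))
        - ∑ f, K.β (M.Γ f q.succ i.succ) * K.β (M.D 0 (M.W p.succ f c j.succ))
        - ∑ f, K.β (M.Γ f q.succ c) * K.β (M.D 0 (M.W p.succ i.succ f j.succ))
        - ∑ f, K.β (M.Γ f q.succ j.succ) * K.β (M.D 0 (M.W p.succ i.succ c f))) = 0 := by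
  -- Differentiate the vanishing of the magnetic part in a tangential direction.
  have h1 : ∑ c, K.N c * K.β (M.D q.succ (M.D 0 (M.W p.succ i.succ c j.succ)))
      = -∑ c, K.β (M.D q.succ (M.gi 0 c)) * K.β (M.D 0 (M.W p.succ i.succ c j.succ)) := by
    have h := congrArg (K.δ q) (L.κ_W_N p i j)
    simp only [map_sum, Derivation.leibniz, smul_eq_mul, map_zero, Finset.sum_add_distrib] at h
    simp only [K.β_D, N] at h ⊢
    rw [eq_neg_iff_add_eq_zero, ← h]
    congr 1
    exact Finset.sum_congr rfl fun c _ => mul_comm _ _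
  -- The connection terms in tangential slots again meet only magnetic components: the index `f = 0`
  -- is excluded by `Γ⁰ = 0`.
  have hswap (u : Fin 4 → B) (v : Fin 4 → Fin 4 → B) (hu : u 0 = 0)
      (hv : ∀ f : Fin 3, ∑ c, K.N c * v f.succ c = 0) :
      ∑ c, K.N c * ∑ f, u f * v f c = 0 := by
    have : ∑ c, K.N c * ∑ f, u f * v f c = ∑ f, u f * ∑ c, K.N c * v f c := by
      simp only [Finset.mul_sum]
      rw [Finset.sum_comm]
      exact Finset.sum_congr rfl fun f _ => Finset.sum_congr rfl fun c _ => by ring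
    rw [this, Fin.sum_univ_succ, hu]
    simp only [hv, mul_zero, zero_mul, Finset.sum_const_zero, add_zero]
  have h2 := hswap (fun f => K.β (M.Γ f q.succ p.succ))
    (fun f c => K.β (M.D 0 (M.W f i.succ c j.succ))) (K.β_Γ_zero _ _) fun f => L.κ_W_N f i j
  have h3 := hswap (fun f => K.β (M.Γ f q.succ i.succ))
    (fun f c => K.β (M.D 0 (M.W p.succ f c j.succ))) (K.β_Γ_zero _ _) fun f => L.κ_W_N p f j
  have h4 := K.sum_N_Γ q.succ fun f => K.β (M.D 0 (M.W p.succ i.succ f j.succ))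
  have h5 := hswap (fun f => K.β (M.Γ f q.succ j.succ))
    (fun f c => K.β (M.D 0 (M.W p.succ i.succ c f))) (K.β_Γ_zero _ _) fun f => L.κ_W_N p i f
  simp only [mul_sub, Finset.sum_sub_distrib]
  linear_combination h1 - h2 - h3 - h4 - h5

/-- Contract the evolution equation once more with the normal and split the trace as `N ⊗ N + γ`.
The `γ` part is the tangential divergence of the magnetic part, which vanishes, so only `∇_N` is
left. -/
theorem Cone.N_N_second_W (L : K.Cone) (i j : Fin 3) :
    ∑ a, ∑ c, K.N a * K.N c * K.β (M.D 0 (M.D 0 (M.W a i.succ c j.succ)))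
      = 2 * ∑ e, K.N e * ∑ a, ∑ c, K.N a * K.N c *
        (K.β (M.D e (M.D 0 (M.W a i.succ c j.succ)))
        - ∑ f, K.β (M.Γ f e a) * K.β (M.D 0 (M.W f i.succ c j.succ))
        - ∑ f, K.β (M.Γ f e i.succ) * K.β (M.D 0 (M.W a f c j.succ))
        - ∑ f, K.β (M.Γ f e c) * K.β (M.D 0 (M.W a i.succ f j.succ))
        - ∑ f, K.β (M.Γ f e j.succ) * K.β (M.D 0 (M.W a i.succ c f))) := by
  set Y : Fin 4 → Fin 4 → Fin 4 → B := fun e a c => K.β (M.D e (M.D 0 (M.W a i.succ c j.succ)))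
        - ∑ f, K.β (M.Γ f e a) * K.β (M.D 0 (M.W f i.succ c j.succ))
        - ∑ f, K.β (M.Γ f e i.succ) * K.β (M.D 0 (M.W a f c j.succ))
        - ∑ f, K.β (M.Γ f e c) * K.β (M.D 0 (M.W a i.succ f j.succ))
        - ∑ f, K.β (M.Γ f e j.succ) * K.β (M.D 0 (M.W a i.succ c f)) with hY
  have h1 (c) : ∑ a, K.N a * K.β (M.D 0 (M.D 0 (M.W a i.succ c j.succ)))
      = 2 * ∑ a, ∑ e, K.β (M.gi a e) * Y e a c := K.N_second_W i.succ c j.succ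
  have h2 (p q : Fin 3) : ∑ c, K.N c * Y q.succ p.succ c = 0 := L.tangential_div p q i j
  have h3 := K.sum_gi fun a e => ∑ c, K.N c * Y e a c
  simp only [h2, mul_zero, Finset.sum_const_zero, add_zero] at h3
  change _ = 2 * ∑ e, K.N e * ∑ a, ∑ c, K.N a * K.N c * Y e a c
  clear_value Y
  have h4 : ∑ a, ∑ c, K.N a * K.N c * K.β (M.D 0 (M.D 0 (M.W a i.succ c j.succ)))
      = ∑ c, K.N c * ∑ a, K.N a * K.β (M.D 0 (M.D 0 (M.W a i.succ c j.succ))) := by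
    rw [Finset.sum_comm]
    simp only [Finset.mul_sum]
    exact Finset.sum_congr rfl fun c _ => Finset.sum_congr rfl fun a _ => by ring
  have h5 : ∑ c, K.N c * (2 * ∑ a, ∑ e, K.β (M.gi a e) * Y e a c)
      = 2 * ∑ a, ∑ e, K.β (M.gi a e) * ∑ c, K.N c * Y e a c := by
    simp only [Finset.mul_sum]
    rw [Finset.sum_comm]
    refine Finset.sum_congr rfl fun a _ => ?_
    rw [Finset.sum_comm]
    exact Finset.sum_congr rfl fun e _ => Finset.sum_congr rfl fun c _ => by ring
  rw [h4]
  simp only [h1]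
  rw [h5, h3]
  congr 1
  rw [Finset.sum_comm]
  refine Finset.sum_congr rfl fun e _ => ?_
  simp only [Finset.mul_sum]
  exact Finset.sum_congr rfl fun a _ => Finset.sum_congr rfl fun c _ => by ring

/-- The transport equation for the electric part of the Weyl tensor at the boundary. -/
theorem Cone.normalD_electric (L : K.Cone) (i j : Fin 3) :
    K.normalD (M.electric i.succ j.succ) = 2 * ∑ e, K.N e *
      (∑ f, K.β (M.Γ f e i.succ) * K.β (M.D 0 (M.electric f j.succ))
        + ∑ f, K.β (M.Γ f e j.succ) * K.β (M.D 0 (M.electric i.succ f))) := by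
  -- The product rule for `E = N N W`, whose last factor vanishes on the boundary.
  have h0 : K.normalD (M.electric i.succ j.succ) = ∑ a, ∑ c, (K.N a * K.N c *
      K.normalD (M.W a i.succ c j.succ) + 2 * (∑ e, K.N e * (K.β (M.D e (M.gi 0 a)) * K.N c
        + K.N a * K.β (M.D e (M.gi 0 c)))) * K.β (M.D 0 (M.W a i.succ c j.succ))) := by
    rw [Geometry.electric, normalD_sum]
    refine Finset.sum_congr rfl fun a _ => ?_
    rw [normalD_sum]
    refine Finset.sum_congr rfl fun c _ => ?_
    rw [K.normalD_mul _ (K.β_W _ _ _ _), map_mul]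
    congr 3
    refine Finset.sum_congr rfl fun e _ => ?_
    simp only [Derivation.leibniz, smul_eq_mul, map_add, map_mul, N]
    ring
  have h1 := L.N_N_second_W i j
  -- The connection terms in the contracted slots are the derivatives of `N` (`sum_N_Γ`). Those in
  -- the two free slots act on the electric part itself and become the right side of the claim.
  have h2 (e) : ∑ a, ∑ c, K.N a * K.N c *
      (K.β (M.D e (M.D 0 (M.W a i.succ c j.succ)))
        - ∑ f, K.β (M.Γ f e a) * K.β (M.D 0 (M.W f i.succ c j.succ))
        - ∑ f, K.β (M.Γ f e i.succ) * K.β (M.D 0 (M.W a f c j.succ))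
        - ∑ f, K.β (M.Γ f e c) * K.β (M.D 0 (M.W a i.succ f j.succ))
        - ∑ f, K.β (M.Γ f e j.succ) * K.β (M.D 0 (M.W a i.succ c f)))
      = ∑ a, ∑ c, K.N a * K.N c * K.β (M.D e (M.D 0 (M.W a i.succ c j.succ)))
        + ∑ a, ∑ c, (K.β (M.D e (M.gi 0 a)) * K.N c
          + K.N a * K.β (M.D e (M.gi 0 c))) * K.β (M.D 0 (M.W a i.succ c j.succ))
        - (∑ f, K.β (M.Γ f e i.succ) * K.β (M.D 0 (M.electric f j.succ))
        + ∑ f, K.β (M.Γ f e j.succ) * K.β (M.D 0 (M.electric i.succ f))) := by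
    have e1 : ∑ a, ∑ c, K.N a * K.N c *
        ∑ f, K.β (M.Γ f e a) * K.β (M.D 0 (M.W f i.succ c j.succ))
        = -∑ a, ∑ c, K.β (M.D e (M.gi 0 a)) * K.N c * K.β (M.D 0 (M.W a i.succ c j.succ)) := by
      rw [Finset.sum_comm]
      conv_rhs => rw [Finset.sum_comm, ← Finset.sum_neg_distrib]
      refine Finset.sum_congr rfl fun c _ => ?_
      have := K.sum_N_Γ e fun f => K.β (M.D 0 (M.W f i.succ c j.succ))
      have h := congrArg (fun x => K.N c * x) this
      simp only [mul_neg, Finset.mul_sum] at h ⊢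
      refine Eq.trans ?_ (h.trans ?_)
      · exact Finset.sum_congr rfl fun a _ => Finset.sum_congr rfl fun f _ => by ring
      · rw [neg_inj]
        exact Finset.sum_congr rfl fun a _ => by ring
    have e2 : ∑ a, ∑ c, K.N a * K.N c *
        ∑ f, K.β (M.Γ f e c) * K.β (M.D 0 (M.W a i.succ f j.succ))
        = -∑ a, ∑ c, K.N a * K.β (M.D e (M.gi 0 c)) * K.β (M.D 0 (M.W a i.succ c j.succ)) := by
      rw [← Finset.sum_neg_distrib]
      refine Finset.sum_congr rfl fun a _ => ?_
      have := K.sum_N_Γ e fun f => K.β (M.D 0 (M.W a i.succ f j.succ))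
      have h := congrArg (fun x => K.N a * x) this
      simp only [mul_neg, Finset.mul_sum] at h ⊢
      refine Eq.trans ?_ (h.trans ?_)
      · exact Finset.sum_congr rfl fun a _ => Finset.sum_congr rfl fun f _ => by ring
      · rw [neg_inj]
        exact Finset.sum_congr rfl fun a _ => by ring
    have e3 (u : Fin 4 → B) (v : Fin 4 → Fin 4 → Fin 4 → B) :
        ∑ a, ∑ c, K.N a * K.N c * ∑ f, u f * v f a c
          = ∑ f, u f * ∑ a, ∑ c, K.N a * K.N c * v f a c := by
      simp only [Finset.mul_sum]
      rw [Finset.sum_comm' (t' := Finset.univ) (s' := fun _ => Finset.univ) (by simp)]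
      rw [Finset.sum_congr rfl fun a _ => Finset.sum_comm, Finset.sum_comm]
      refine Finset.sum_congr rfl fun f _ => ?_
      rw [Finset.sum_comm]
      exact Finset.sum_congr rfl fun a _ => Finset.sum_congr rfl fun c _ => by ring
    simp only [mul_sub, add_mul, Finset.sum_sub_distrib, Finset.sum_add_distrib]
    rw [e1, e2, e3 (fun f => K.β (M.Γ f e i.succ)) fun f a c => K.β (M.D 0 (M.W a f c j.succ)),
      e3 (fun f => K.β (M.Γ f e j.succ)) fun f a c => K.β (M.D 0 (M.W a i.succ c f))]
    simp only [κ_electric]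
    ring
  simp only [h2] at h1
  rw [h0]
  have h3 : ∑ a, ∑ c, K.N a * K.N c * K.normalD (M.W a i.succ c j.succ)
      = 2 * ∑ e, K.N e * ∑ a, ∑ c, K.N a * K.N c * K.β (M.D e (M.D 0 (M.W a i.succ c j.succ)))
        - ∑ a, ∑ c, K.N a * K.N c * K.β (M.D 0 (M.D 0 (M.W a i.succ c j.succ))) := by
    simp only [normalD, mul_sub, Finset.sum_sub_distrib]
    congr 1
    simp only [Finset.mul_sum]
    rw [Finset.sum_comm, Finset.sum_congr rfl fun c _ => Finset.sum_comm, Finset.sum_comm]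
    refine Finset.sum_congr rfl fun e _ => ?_
    rw [Finset.sum_comm]
    exact Finset.sum_congr rfl fun a _ => Finset.sum_congr rfl fun c _ => by ring
  have h4 : ∑ a, ∑ c, 2 * (∑ e, K.N e * (K.β (M.D e (M.gi 0 a)) * K.N c
        + K.N a * K.β (M.D e (M.gi 0 c)))) * K.β (M.D 0 (M.W a i.succ c j.succ))
      = 2 * ∑ e, K.N e * ∑ a, ∑ c, (K.β (M.D e (M.gi 0 a)) * K.N c
          + K.N a * K.β (M.D e (M.gi 0 c))) * K.β (M.D 0 (M.W a i.succ c j.succ)) := by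
    simp only [Finset.mul_sum, Finset.sum_mul]
    rw [Finset.sum_comm, Finset.sum_congr rfl fun c _ => Finset.sum_comm, Finset.sum_comm]
    refine Finset.sum_congr rfl fun e _ => ?_
    rw [Finset.sum_comm]
    exact Finset.sum_congr rfl fun a _ => Finset.sum_congr rfl fun c _ => by ring
  simp only [Finset.sum_add_distrib] at h4 ⊢
  rw [h3, h4, h1]
  simp only [mul_sub, mul_add, Finset.sum_sub_distrib, Finset.sum_add_distrib]
  ring

end Collar

end

/-! ### Algebra of the Weyl tensor in the frame of normal, time and angular vectors. -/

section

/-- The contraction of a covariant 4-tensor with four vectors. -/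
def contr4 {A : Type*} [CommRing A] (T : Fin 4 → Fin 4 → Fin 4 → Fin 4 → A)
    (X Y Z V : Fin 4 → A) : A :=
  ∑ a, ∑ b, ∑ c, ∑ d, T a b c d * X a * Y b * Z c * V d

section contr4

variable {A : Type*} [CommRing A] (T : Fin 4 → Fin 4 → Fin 4 → Fin 4 → A)

theorem contr4_add₂ (X Y Y' Z V : Fin 4 → A) :
    contr4 T X (Y + Y') Z V = contr4 T X Y Z V + contr4 T X Y' Z V := by
  simp only [contr4, Pi.add_apply, mul_add, add_mul, Finset.sum_add_distrib]

theorem contr4_add₃ (X Y Z Z' V : Fin 4 → A) :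
    contr4 T X Y (Z + Z') V = contr4 T X Y Z V + contr4 T X Y Z' V := by
  simp only [contr4, Pi.add_apply, mul_add, add_mul, Finset.sum_add_distrib]

theorem contr4_add₄ (X Y Z V V' : Fin 4 → A) :
    contr4 T X Y Z (V + V') = contr4 T X Y Z V + contr4 T X Y Z V' := by
  simp only [contr4, Pi.add_apply, mul_add, Finset.sum_add_distrib]

theorem contr4_neg₁ (X Y Z V : Fin 4 → A) : contr4 T (-X) Y Z V = -contr4 T X Y Z V := by
  simp only [contr4, Pi.neg_apply, mul_neg, neg_mul, Finset.sum_neg_distrib]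

theorem contr4_neg₂ (X Y Z V : Fin 4 → A) : contr4 T X (-Y) Z V = -contr4 T X Y Z V := by
  simp only [contr4, Pi.neg_apply, mul_neg, neg_mul, Finset.sum_neg_distrib]

theorem contr4_neg₃ (X Y Z V : Fin 4 → A) : contr4 T X Y (-Z) V = -contr4 T X Y Z V := by
  simp only [contr4, Pi.neg_apply, mul_neg, neg_mul, Finset.sum_neg_distrib]

theorem contr4_neg₄ (X Y Z V : Fin 4 → A) : contr4 T X Y Z (-V) = -contr4 T X Y Z V := by
  simp only [contr4, Pi.neg_apply, mul_neg, Finset.sum_neg_distrib]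

variable {T}

theorem contr4_antisymm_left (h : ∀ a b c d, T a b c d = -T b a c d) (X Y Z V : Fin 4 → A) :
    contr4 T X Y Z V = -contr4 T Y X Z V := by
  simp only [contr4, ← Finset.sum_neg_distrib]
  rw [Finset.sum_comm]
  exact Finset.sum_congr rfl fun a _ => Finset.sum_congr rfl fun b _ =>
    Finset.sum_congr rfl fun c _ => Finset.sum_congr rfl fun d _ => by rw [h]; ring

theorem contr4_antisymm_right (h : ∀ a b c d, T a b c d = -T a b d c) (X Y Z V : Fin 4 → A) :
    contr4 T X Y Z V = -contr4 T X Y V Z := by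
  simp only [contr4, ← Finset.sum_neg_distrib]
  refine Finset.sum_congr rfl fun a _ => Finset.sum_congr rfl fun b _ => ?_
  rw [Finset.sum_comm]
  exact Finset.sum_congr rfl fun c _ => Finset.sum_congr rfl fun d _ => by rw [h]; ring

theorem contr4_pair (h : ∀ a b c d, T a b c d = T c d a b) (X Y Z V : Fin 4 → A) :
    contr4 T X Y Z V = contr4 T Z V X Y := by
  have e (F : Fin 4 → Fin 4 → Fin 4 → Fin 4 → A) :
      ∑ a, ∑ b, ∑ c, ∑ d, F a b c d = ∑ c, ∑ d, ∑ a, ∑ b, F a b c d := by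
    rw [Finset.sum_congr rfl fun a _ => Finset.sum_comm, Finset.sum_comm]
    refine Finset.sum_congr rfl fun c _ => ?_
    rw [Finset.sum_congr rfl fun a _ => Finset.sum_comm, Finset.sum_comm]
  rw [contr4, e]
  exact Finset.sum_congr rfl fun a _ => Finset.sum_congr rfl fun b _ =>
    Finset.sum_congr rfl fun c _ => Finset.sum_congr rfl fun d _ => by rw [h]; ring

end contr4

theorem sum_four {B : Type*} [AddCommMonoid B] (f : Fin 4 → B) :
    ∑ a, f a = f 0 + f 1 + ∑ A : Fin 2, f A.succ.succ := by
  rw [Fin.sum_univ_succ, Fin.sum_univ_succ, ← add_assoc]; rfl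

/-- Trace-freeness of a Weyl tensor as a linear system: `n` and `T` are the normal and the time
components on the sphere, `χ` the purely angular component, `q` the one on the normal-time plane.
The trace of the angular equations determines `χ`, which then gives `T`. -/
theorem time_components {A : Type*} [CommRing A] [Algebra ℝ A]
    {h00 h01 h11 H00 H01 H11 n00 n01 n11 T00 T01 T11 χ q : A}
    (i00 : h00 * H00 + h01 * H01 = 1) (i01 : h00 * H01 + h01 * H11 = 0)
    (i10 : h01 * H00 + h11 * H01 = 0) (i11 : h01 * H01 + h11 * H11 = 1)
    (t00 : n00 - T00 + H11 * χ = 0) (t01 : n01 - T01 + H01 * -χ = 0)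
    (t11 : n11 - T11 + H00 * χ = 0)
    (t1 : 0 - q + (H00 * n00 + H01 * n01 + (H01 * n01 + H11 * n11)) = 0)
    (t2 : q - 0 + (H00 * T00 + H01 * T01 + (H01 * T01 + H11 * T11)) = 0) :
    T00 = n00 - (H00 * n00 + H01 * n01 + (H01 * n01 + H11 * n11)) * h00 ∧
    T01 = n01 - (H00 * n00 + H01 * n01 + (H01 * n01 + H11 * n11)) * h01 ∧
    T11 = n11 - (H00 * n00 + H01 * n01 + (H01 * n01 + H11 * n11)) * h11 := by
  have hχ : χ * (H00 * H11 - H01 * H01)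
      = -(H00 * n00 + H01 * n01 + (H01 * n01 + H11 * n11)) := by
    apply two_mul_cancel
    linear_combination H00 * t00 + 2 * H01 * t01 + H11 * t11 + t1 + t2
  refine ⟨?_, ?_, ?_⟩
  · linear_combination -t00 + h00 * hχ - χ * H11 * i00 + χ * H01 * i01
  · linear_combination -t01 + h01 * hχ + χ * H01 * i11 - χ * H11 * i10
  · linear_combination -t11 + h11 * hχ - χ * H00 * i11 + χ * H01 * i10

namespace Geometry

variable {A : Type*} [CommRing A] [Algebra ℝ A] (M : Geometry A (Fin 4))

/-- The Weyl tensor evaluated on four vectors. -/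
def Wv (X Y Z V : Fin 4 → A) : A := contr4 M.W X Y Z V

theorem Wv_swap_left (X Y Z V : Fin 4 → A) : M.Wv X Y Z V = -M.Wv Y X Z V :=
  contr4_antisymm_left M.W_antisymm_left X Y Z V

theorem Wv_swap_right (X Y Z V : Fin 4 → A) : M.Wv X Y Z V = -M.Wv X Y V Z :=
  contr4_antisymm_right M.W_antisymm_right X Y Z V

theorem Wv_pair (X Y Z V : Fin 4 → A) : M.Wv X Y Z V = M.Wv Z V X Y :=
  contr4_pair M.W_pair X Y Z V

theorem Wv_self_left (X Z V : Fin 4 → A) : M.Wv X X Z V = 0 :=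
  two_mul_cancel (by linear_combination M.Wv_swap_left X X Z V)

theorem Wv_self_right (X Y Z : Fin 4 → A) : M.Wv X Y Z Z = 0 :=
  two_mul_cancel (by linear_combination M.Wv_swap_right X Y Z Z)

/-- The coordinate vectors. -/
abbrev ev (a : Fin 4) : Fin 4 → A := Pi.single a 1

/-- The unit normal of the surfaces `ρ = const`. -/
abbrev normal : Fin 4 → A := M.gi 0

/-- The unit vector orthogonal to the surfaces of constant time in the surfaces `ρ = const`. -/
def time : Fin 4 → A := -M.gi 1

theorem electric_eq (b d : Fin 4) : M.electric b d = M.Wv M.normal (ev b) M.normal (ev d) := by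
  simp only [electric, Wv, contr4]
  refine Finset.sum_congr rfl fun a _ => ?_
  rw [Finset.sum_comm]
  refine Finset.sum_congr rfl fun c _ => ?_
  simp [ev, Pi.single_apply]
  ring

theorem electric_symm (b d : Fin 4) : M.electric b d = M.electric d b := by
  rw [electric_eq, electric_eq, M.Wv_pair]

/-- The trace of the Weyl tensor, evaluated on vectors. -/
theorem Wv_trace (Y V : Fin 4 → A) : ∑ a, ∑ c, M.gi a c * M.Wv (ev a) Y (ev c) V = 0 := by
  have h (a c : Fin 4) : M.gi a c * M.Wv (ev a) Y (ev c) V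
      = ∑ b, ∑ d, M.gi a c * M.W a b c d * (Y b * V d) := by
    simp only [Wv, contr4, ev, Pi.single_apply, Finset.mul_sum]
    rw [Finset.sum_eq_single a (by simp +contextual) (by simp)]
    refine Finset.sum_congr rfl fun b _ => ?_
    rw [Finset.sum_eq_single c (by simp +contextual) (by simp)]
    exact Finset.sum_congr rfl fun d _ => by simp; ring
  simp only [h]
  have e (F : Fin 4 → Fin 4 → Fin 4 → Fin 4 → A) :
      ∑ a, ∑ c, ∑ b, ∑ d, F a c b d = ∑ b, ∑ d, ∑ a, ∑ c, F a c b d := by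
    rw [Finset.sum_congr rfl fun a _ => Finset.sum_comm, Finset.sum_comm]
    refine Finset.sum_congr rfl fun c _ => ?_
    rw [Finset.sum_congr rfl fun a _ => Finset.sum_comm, Finset.sum_comm]
  rw [e]
  exact Finset.sum_eq_zero fun b _ => Finset.sum_eq_zero fun d _ => by
    simp only [← Finset.sum_mul, M.W_trace, zero_mul]

theorem Wv_expand₁₃ (X Y Z V : Fin 4 → A) :
    M.Wv X Y Z V = ∑ a, ∑ c, X a * Z c * M.Wv (ev a) Y (ev c) V := by
  have h (a c : Fin 4) : X a * Z c * M.Wv (ev a) Y (ev c) V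
      = ∑ b, ∑ d, M.W a b c d * X a * Y b * Z c * V d := by
    simp only [Wv, contr4, ev, Pi.single_apply, Finset.mul_sum]
    rw [Finset.sum_eq_single a (by simp +contextual) (by simp)]
    refine Finset.sum_congr rfl fun b _ => ?_
    rw [Finset.sum_eq_single c (by simp +contextual) (by simp)]
    exact Finset.sum_congr rfl fun d _ => by simp; ring
  simp only [h]
  rw [Wv, contr4]
  exact Finset.sum_congr rfl fun a _ => Finset.sum_comm

end Geometry

namespace Collar

variable {A : Type*} [CommRing A] [Algebra ℝ A] {M : Geometry A (Fin 4)}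
  {B : Type*} [CommRing B] [Algebra ℝ B] (K : Collar M B)

include K in
theorem gi_one_one : M.gi 1 1 = -1 := by
  have := K.gi_sub 1
  rw [K.gi_zero_one] at this
  simp at this
  linear_combination -this

include K in
theorem gi_one_ang (C : Fin 2) : M.gi 1 C.succ.succ = M.gi 0 C.succ.succ := by
  have := K.gi_sub C.succ.succ
  rw [if_neg] at this
  · linear_combination -this
  · fin_cases C <;> decide

include K in
theorem g_null (C : Fin 2) : M.g C.succ.succ 0 + M.g C.succ.succ 1 = 0 := by
  have e : ∑ b, M.g C.succ.succ b * (M.gi b 0 - M.gi b 1) = 0 := by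
    simp only [mul_sub, Finset.sum_sub_distrib, M.g_gi]
    rw [if_neg (Fin.succ_ne_zero _), if_neg (by fin_cases C <;> decide), sub_zero]
  have e' (b) : M.gi b 0 - M.gi b 1 = M.gi 0 b - M.gi 1 b := by
    rw [M.gi_symm b 0, M.gi_symm b 1]
  simp only [e', K.gi_sub] at e
  rw [sum_four] at e
  simpa [Fin.succ_ne_zero, Fin.succ_succ_ne_one] using e

include K in
-- The null vector `∂_ρ + ∂_t` is orthogonal to the spheres and `gi 0`, `gi 1` have equal angular
-- components, so the contributions of the indices `0` and `1` cancel.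
theorem ang_g_gi (C D : Fin 2) : ∑ E : Fin 2, M.g C.succ.succ E.succ.succ *
    M.gi E.succ.succ D.succ.succ = if C = D then 1 else 0 := by
  have h := M.g_gi C.succ.succ D.succ.succ
  rw [sum_four, K.gi_one_ang] at h
  simp only [Fin.succ_inj] at h
  linear_combination h - M.gi 0 D.succ.succ * K.g_null C

include K in
-- The inverse metric is `N ⊗ N - T ⊗ T` plus the inverse metric of the spheres: `N` and `T` are an
-- orthonormal pair with `T` timelike.
theorem sum_gi_split (F : Fin 4 → Fin 4 → A) : ∑ a, ∑ c, M.gi a c * F a c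
    = ∑ a, ∑ c, M.gi 0 a * M.gi 0 c * F a c - ∑ a, ∑ c, M.gi 1 a * M.gi 1 c * F a c
      + ∑ C : Fin 2, ∑ E : Fin 2, M.gi C.succ.succ E.succ.succ * F C.succ.succ E.succ.succ := by
  have s (C : Fin 2) : M.gi C.succ.succ 0 = M.gi 0 C.succ.succ := M.gi_symm _ _
  have s' (C : Fin 2) : M.gi C.succ.succ 1 = M.gi 0 C.succ.succ := by
    rw [M.gi_symm, K.gi_one_ang]
  simp only [sum_four, K.gi_zero_zero, K.gi_zero_one, M.gi_symm 1 0, K.gi_one_one, K.gi_one_ang,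
    Finset.sum_add_distrib, s, s', mul_neg, neg_mul, Finset.sum_neg_distrib]
  ring_nf

/-- The mass of the electric part on the spheres. -/
def tr (_ : Collar M B) : A :=
  ∑ C : Fin 2, ∑ E : Fin 2, M.gi C.succ.succ E.succ.succ * M.electric C.succ.succ E.succ.succ

/-- The components of the Weyl tensor along the time direction. -/
theorem Wv_time (C E : Fin 2) :
    M.Wv M.time (Geometry.ev C.succ.succ) M.time (Geometry.ev E.succ.succ)
      = M.electric C.succ.succ E.succ.succ - K.tr * M.g C.succ.succ E.succ.succ := by
  have hneg (Y V) : M.Wv M.time Y M.time V = M.Wv (M.gi 1) Y (M.gi 1) V := by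
    rw [Geometry.time, Geometry.Wv, contr4_neg₁, contr4_neg₃, neg_neg]; rfl
  -- Trace-freeness of `W` in the split form of the inverse metric.
  have htr (Y V : Fin 4 → A) : M.Wv M.normal Y M.normal V - M.Wv (M.gi 1) Y (M.gi 1) V
      + ∑ C : Fin 2, ∑ E : Fin 2, M.gi C.succ.succ E.succ.succ
        * M.Wv (Geometry.ev C.succ.succ) Y (Geometry.ev E.succ.succ) V = 0 := by
    rw [M.Wv_expand₁₃ M.normal, M.Wv_expand₁₃ (M.gi 1), ← K.sum_gi_split, M.Wv_trace]
  have hs (X Y Z V : Fin 4 → A) : M.Wv X Y Z V = M.Wv Y X V Z := by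
    rw [M.Wv_swap_left, M.Wv_swap_right, neg_neg]
  set e : Fin 2 → Fin 4 → A := fun C => Geometry.ev C.succ.succ with he
  set H : Fin 2 → Fin 2 → A := fun C E => M.gi C.succ.succ E.succ.succ with hH
  set h : Fin 2 → Fin 2 → A := fun C E => M.g C.succ.succ E.succ.succ with hh
  have hHs : H 1 0 = H 0 1 := M.gi_symm _ _
  have hhs : h 1 0 = h 0 1 := M.g_symm _ _
  have i00 := K.ang_g_gi 0 0
  have i01 := K.ang_g_gi 0 1
  have i10 := K.ang_g_gi 1 0
  have i11 := K.ang_g_gi 1 1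
  -- The traces on `(N, N)`, `(T, T)` and the three angular pairs are the equations of
  -- `time_components`.
  have t1 := htr M.normal M.normal
  have t2 := htr (M.gi 1) (M.gi 1)
  have t3 (C E) := htr (e C) (e E)
  have hE (C E : Fin 2) : M.electric C.succ.succ E.succ.succ = M.Wv M.normal (e C) M.normal (e E) :=
    M.electric_eq _ _
  rw [hneg]
  change M.Wv (M.gi 1) (e C) (M.gi 1) (e E) = M.electric C.succ.succ E.succ.succ - K.tr * h C E
  simp only [tr, hE]
  change ∑ E, h 0 E * H E 0 = _ at i00
  change ∑ E, h 0 E * H E 1 = _ at i01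
  change ∑ E, h 1 E * H E 0 = _ at i10
  change ∑ E, h 1 E * H E 1 = _ at i11
  change _ + ∑ C, ∑ E, H C E * M.Wv (e C) _ (e E) _ = 0 at t1 t2
  change ∀ C E, _ + ∑ C', ∑ E', H C' E' * M.Wv (e C') (e C) (e E') (e E) = 0 at t3
  change _ = _ - (∑ C, ∑ E, H C E * _) * _
  simp only [hs (e _) M.normal (e _) M.normal] at t1
  simp only [hs (e _) (M.gi 1) (e _) (M.gi 1)] at t2
  rw [hs M.normal (M.gi 1) M.normal (M.gi 1)] at t2
  rw [M.Wv_self_left] at t1 t2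
  have sN : M.Wv M.normal (e 1) M.normal (e 0) = M.Wv M.normal (e 0) M.normal (e 1) :=
    M.Wv_pair _ _ _ _
  have sT : M.Wv (M.gi 1) (e 1) (M.gi 1) (e 0) = M.Wv (M.gi 1) (e 0) (M.gi 1) (e 1) :=
    M.Wv_pair _ _ _ _
  have c1 : M.Wv (e 1) (e 0) (e 1) (e 0) = M.Wv (e 0) (e 1) (e 0) (e 1) := hs _ _ _ _
  have c2 : M.Wv (e 1) (e 0) (e 0) (e 1) = -M.Wv (e 0) (e 1) (e 0) (e 1) := M.Wv_swap_left _ _ _ _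
  have t00 := t3 0 0
  have t01 := t3 0 1
  have t11 := t3 1 1
  simp only [Fin.sum_univ_two, M.Wv_self_left, M.Wv_self_right, hHs, hhs, c1, c2, if_true,
    zero_ne_one, one_ne_zero, if_false, mul_zero, add_zero, zero_add] at t00 t01 t11 i00 i01 i10 i11
  simp only [Fin.sum_univ_two, hHs, sN, sT] at t1 t2 ⊢
  obtain ⟨r0, r1, r2⟩ := time_components i00 i01 i10 i11 t00 t01 t11 t1 t2
  fin_cases C <;> fin_cases E
  · exact r0
  · exact r1
  · change M.Wv (M.gi 1) (e 1) (M.gi 1) (e 0) = M.Wv M.normal (e 1) M.normal (e 0) - _ * h 1 0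
    rw [sN, sT, hhs]; exact r1
  · exact r2

end Collar

end

/-! ### Null components of the Weyl tensor at the boundary. -/

section

namespace Geometry

variable {A : Type*} [CommRing A] [Algebra ℝ A] (M : Geometry A (Fin 4))

/-- The outgoing null vector. -/
abbrev nullOut : Fin 4 → A := M.time + M.normal

/-- The ingoing null vector. -/
abbrev nullIn : Fin 4 → A := M.time + -M.normal

theorem Wv_swap (X Y Z V : Fin 4 → A) : M.Wv X Y Z V = M.Wv Y X V Z := by
  rw [M.Wv_swap_left, M.Wv_swap_right, neg_neg]

theorem Wv_add₂ (X Y Y' Z V : Fin 4 → A) :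
    M.Wv X (Y + Y') Z V = M.Wv X Y Z V + M.Wv X Y' Z V := contr4_add₂ _ _ _ _ _ _

theorem Wv_add₃ (X Y Z Z' V : Fin 4 → A) :
    M.Wv X Y (Z + Z') V = M.Wv X Y Z V + M.Wv X Y Z' V := contr4_add₃ _ _ _ _ _ _

theorem Wv_add₄ (X Y Z V V' : Fin 4 → A) :
    M.Wv X Y Z (V + V') = M.Wv X Y Z V + M.Wv X Y Z V' := contr4_add₄ _ _ _ _ _ _

theorem Wv_neg₂ (X Y Z V : Fin 4 → A) : M.Wv X (-Y) Z V = -M.Wv X Y Z V := contr4_neg₂ _ _ _ _ _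

theorem Wv_neg₃ (X Y Z V : Fin 4 → A) : M.Wv X Y (-Z) V = -M.Wv X Y Z V := contr4_neg₃ _ _ _ _ _

theorem Wv_neg₄ (X Y Z V : Fin 4 → A) : M.Wv X Y Z (-V) = -M.Wv X Y Z V := contr4_neg₄ _ _ _ _ _

theorem Wv_out (X Z : Fin 4 → A) : M.Wv X M.nullOut Z M.nullOut
    = M.Wv M.time X M.time Z + M.Wv M.normal X M.normal Z
      + (M.Wv M.normal X M.time Z + M.Wv M.normal Z M.time X) := by
  rw [M.Wv_add₂, M.Wv_add₄, M.Wv_add₄, M.Wv_swap X M.time, M.Wv_swap X M.normal,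
    M.Wv_swap X M.time, M.Wv_swap X M.normal, M.Wv_pair M.time X M.normal Z]
  ring

theorem Wv_in (X Z : Fin 4 → A) : M.Wv X M.nullIn Z M.nullIn
    = M.Wv M.time X M.time Z + M.Wv M.normal X M.normal Z
      - (M.Wv M.normal X M.time Z + M.Wv M.normal Z M.time X) := by
  rw [M.Wv_add₂, M.Wv_add₄, M.Wv_add₄, M.Wv_neg₂, M.Wv_neg₂, M.Wv_neg₄, M.Wv_neg₄,
    M.Wv_swap X M.time, M.Wv_swap X M.normal,
    M.Wv_swap X M.time, M.Wv_swap X M.normal, M.Wv_pair M.time X M.normal Z]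
  ring

theorem Wv_in_out (X Y : Fin 4 → A) :
    M.Wv X Y M.nullIn M.nullOut = -2 * M.Wv M.normal M.time X Y := by
  rw [M.Wv_add₃, M.Wv_add₄, M.Wv_add₄, M.Wv_neg₃, M.Wv_neg₃, M.Wv_self_right, M.Wv_self_right,
    M.Wv_swap_right X Y M.time, M.Wv_pair X Y]
  ring

end Geometry

namespace Collar

variable {A : Type*} [CommRing A] [Algebra ℝ A] {M : Geometry A (Fin 4)}
  {B : Type*} [CommRing B] [Algebra ℝ B] {K : Collar M B}

variable (K) in
theorem β_Wv (X Y Z V : Fin 4 → A) : K.β (M.Wv X Y Z V) = 0 := by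
  simp only [Geometry.Wv, contr4, map_sum, map_mul, K.β_W, zero_mul, Finset.sum_const_zero]

variable (K) in
theorem κ_Wv (X Y Z V : Fin 4 → A) : K.β (M.D 0 (M.Wv X Y Z V))
    = ∑ a, ∑ b, ∑ c, ∑ d, K.β (M.D 0 (M.W a b c d)) * K.β (X a) * K.β (Y b) * K.β (Z c)
      * K.β (V d) := by
  simp only [Geometry.Wv, contr4, map_sum, Derivation.leibniz, smul_eq_mul, map_mul, map_add,
    K.β_W, zero_mul, zero_add]
  exact Finset.sum_congr rfl fun a _ => Finset.sum_congr rfl fun b _ =>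
    Finset.sum_congr rfl fun c _ => Finset.sum_congr rfl fun d _ => by ring

/-- Vectors with zero component `0` are tangent to the boundary, so this is the vanishing of the
magnetic part in frame-independent form. -/
theorem Cone.κ_Wv_normal (L : K.Cone) {X Y Z : Fin 4 → A} (hX : X 0 = 0) (hY : Y 0 = 0)
    (hZ : Z 0 = 0) : K.β (M.D 0 (M.Wv M.normal X Y Z)) = 0 := by
  rw [κ_Wv, Finset.sum_comm]
  refine Finset.sum_eq_zero fun b _ => ?_
  rw [Finset.sum_comm]
  refine Finset.sum_eq_zero fun c _ => ?_
  rw [Finset.sum_comm]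
  refine Finset.sum_eq_zero fun d _ => ?_
  rcases Fin.eq_zero_or_eq_succ b with rfl | ⟨i, rfl⟩
  · simp [hX]
  rcases Fin.eq_zero_or_eq_succ c with rfl | ⟨j, rfl⟩
  · simp [hY]
  rcases Fin.eq_zero_or_eq_succ d with rfl | ⟨k, rfl⟩
  · simp [hZ]
  have h := congrArg (fun x => K.β (X i.succ) * K.β (Y j.succ) * K.β (Z k.succ) * x)
    (L.N_κ_W i j k)
  simp only [mul_zero, Finset.mul_sum] at h
  rw [← h]
  exact Finset.sum_congr rfl fun a _ => by rw [N]; ring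

theorem ev_ang_zero {A : Type*} [CommRing A] (C : Fin 2) :
    (Geometry.ev C.succ.succ : Fin 4 → A) 0 = 0 := by
  simp [Geometry.ev, Fin.succ_ne_zero, eq_comm]

include K in
theorem time_zero : M.time 0 = 0 := by
  rw [Geometry.time, Pi.neg_apply, M.gi_symm, K.gi_zero_one, neg_zero]

/-- Expanding `T ± N`, the difference of the two sides consists of terms with exactly one normal. -/
theorem Cone.κ_out_eq_in (L : K.Cone) (C E : Fin 2) :
    K.β (M.D 0 (M.Wv (Geometry.ev C.succ.succ) M.nullOut (Geometry.ev E.succ.succ) M.nullOut))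
      = K.β (M.D 0 (M.Wv (Geometry.ev C.succ.succ) M.nullIn (Geometry.ev E.succ.succ) M.nullIn)) := by
  rw [M.Wv_out, M.Wv_in]
  simp only [map_add, map_sub, L.κ_Wv_normal (ev_ang_zero _) K.time_zero (ev_ang_zero _)]
  ring

/-- The sum of the two components is `-4 W(N, T, ∂_C, T)`, which has a single normal slot. -/
theorem Cone.κ_out_in_out (L : K.Cone) (C : Fin 2) :
    K.β (M.D 0 (M.Wv (Geometry.ev C.succ.succ) M.nullOut M.nullIn M.nullOut))
      = -K.β (M.D 0 (M.Wv (Geometry.ev C.succ.succ) M.nullIn M.nullIn M.nullOut)) := by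
  rw [eq_neg_iff_add_eq_zero, ← map_add, ← map_add]
  have : M.Wv (Geometry.ev C.succ.succ) M.nullOut M.nullIn M.nullOut
      + M.Wv (Geometry.ev C.succ.succ) M.nullIn M.nullIn M.nullOut
      = (-4 : ℝ) • M.Wv M.normal M.time (Geometry.ev C.succ.succ) M.time := by
    rw [M.Wv_in_out, M.Wv_in_out, Geometry.nullOut, Geometry.nullIn, M.Wv_add₄, M.Wv_add₄,
      M.Wv_neg₄, Algebra.smul_def, map_neg,
      map_ofNat]
    ring
  rw [this, Derivation.map_smul, Algebra.smul_def, map_mul,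
    L.κ_Wv_normal K.time_zero (ev_ang_zero _) K.time_zero, mul_zero]

/-- The component is `-2 W(N, T, ∂_C, ∂_E)`, again with a single normal slot. -/
theorem Cone.κ_ang_ang (L : K.Cone) (C E : Fin 2) :
    K.β (M.D 0 (M.Wv (Geometry.ev C.succ.succ) (Geometry.ev E.succ.succ) M.nullIn M.nullOut))
      = 0 := by
  have : M.Wv (Geometry.ev C.succ.succ) (Geometry.ev E.succ.succ) M.nullIn M.nullOut
      = (-2 : ℝ) • M.Wv M.normal M.time (Geometry.ev C.succ.succ) (Geometry.ev E.succ.succ) := by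
    rw [M.Wv_in_out, Algebra.smul_def, map_neg, map_ofNat]
  rw [this, Derivation.map_smul, Algebra.smul_def, map_mul,
    L.κ_Wv_normal K.time_zero (ev_ang_zero _) (ev_ang_zero _), mul_zero]

variable (K) in
-- The terms with a single normal cancel in the sum, and `Wv_time` expresses the time components by
-- the electric part and its trace.
theorem out_add_in (C E : Fin 2) :
    M.Wv (Geometry.ev C.succ.succ) M.nullOut (Geometry.ev E.succ.succ) M.nullOut
      + M.Wv (Geometry.ev C.succ.succ) M.nullIn (Geometry.ev E.succ.succ) M.nullIn
      = 4 * M.electric C.succ.succ E.succ.succ - 2 * M.g C.succ.succ E.succ.succ * K.tr := by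
  rw [M.Wv_out, M.Wv_in, K.Wv_time, M.electric_eq]
  ring

variable (K) in
/-- The connection coefficients of the spheres in the normal direction. -/
def G (C E : Fin 2) : B := ∑ e, K.N e * K.β (M.Γ E.succ.succ e C.succ.succ)

variable (K) in
-- The components `0` and `1` of `∇_N ∂_C` are derivatives of the constants `gi 0 0` and `gi 0 1`,
-- so on the boundary only angular coefficients remain and the transport equation closes on the
-- spheres.
theorem sum_N_Γ_ang (C : Fin 2) (u : Fin 4 → B) :
    ∑ e, K.N e * ∑ f, K.β (M.Γ f e C.succ.succ) * u f = ∑ E, K.G C E * u E.succ.succ := by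
  have hG (f) : ∑ e, K.N e * K.β (M.Γ f e C.succ.succ)
      = -K.β (M.D C.succ.succ (M.gi 0 f)) := by
    rw [β_D_normal, neg_neg]
    exact Finset.sum_congr rfl fun e _ => by rw [M.Γ_symm, N]; ring
  have h : ∑ e, K.N e * ∑ f, K.β (M.Γ f e C.succ.succ) * u f
      = ∑ f, (∑ e, K.N e * K.β (M.Γ f e C.succ.succ)) * u f := by
    simp only [Finset.mul_sum, Finset.sum_mul]
    rw [Finset.sum_comm]
    exact Finset.sum_congr rfl fun e _ => Finset.sum_congr rfl fun f _ => by ring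
  rw [h, sum_four, hG 0, hG 1, K.gi_zero_zero, K.gi_zero_one]
  simp [G]

theorem Cone.normalD_electric_ang (L : K.Cone) (C E : Fin 2) :
    K.normalD (M.electric C.succ.succ E.succ.succ)
      = 2 * (∑ F, K.G C F * K.β (M.D 0 (M.electric F.succ.succ E.succ.succ))
        + ∑ F, K.G E F * K.β (M.D 0 (M.electric C.succ.succ F.succ.succ))) := by
  rw [L.normalD_electric]
  simp only [mul_add, Finset.sum_add_distrib]
  rw [K.sum_N_Γ_ang C fun f => K.β (M.D 0 (M.electric f E.succ.succ)),
    K.sum_N_Γ_ang E fun f => K.β (M.D 0 (M.electric C.succ.succ f))]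

variable (K) in
theorem sum_N_D_g (C E : Fin 2) : ∑ e, K.N e * K.β (M.D e (M.g C.succ.succ E.succ.succ))
    = ∑ F, (K.G C F * K.β (M.g F.succ.succ E.succ.succ)
      + K.G E F * K.β (M.g C.succ.succ F.succ.succ)) := by
  simp only [M.compat, map_sum, map_add, map_mul, Finset.sum_add_distrib, mul_add]
  rw [K.sum_N_Γ_ang C fun f => K.β (M.g f E.succ.succ),
    K.sum_N_Γ_ang E fun f => K.β (M.g C.succ.succ f)]

variable (K) in
-- Differentiate `h H = 1` along the normal and insert the derivative of `h`, in matrix form.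
theorem sum_N_D_gi (C E : Fin 2) : ∑ e, K.N e * K.β (M.D e (M.gi C.succ.succ E.succ.succ))
    = -∑ F, (K.β (M.gi C.succ.succ F.succ.succ) * K.G F E
      + K.G F C * K.β (M.gi F.succ.succ E.succ.succ)) := by
  set h : Matrix (Fin 2) (Fin 2) B := Matrix.of fun C E => K.β (M.g C.succ.succ E.succ.succ)
  set H : Matrix (Fin 2) (Fin 2) B := Matrix.of fun C E => K.β (M.gi C.succ.succ E.succ.succ)
  set G : Matrix (Fin 2) (Fin 2) B := Matrix.of K.G
  set dh : Matrix (Fin 2) (Fin 2) B :=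
    Matrix.of fun C E => ∑ e, K.N e * K.β (M.D e (M.g C.succ.succ E.succ.succ))
  set dH : Matrix (Fin 2) (Fin 2) B :=
    Matrix.of fun C E => ∑ e, K.N e * K.β (M.D e (M.gi C.succ.succ E.succ.succ))
  have hH : h * H = 1 := by
    ext C E
    have := congrArg K.β (K.ang_g_gi C E)
    simpa [Matrix.mul_apply, Matrix.one_apply, h, H, apply_ite K.β] using this
  have hH' : H * h = 1 := mul_eq_one_comm.1 hH
  have h1 : dh = G * h + h * Gᵀ := by
    ext C E
    simp only [dh, G, h, Matrix.of_apply, Matrix.add_apply, Matrix.mul_apply,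
      Matrix.transpose_apply, sum_N_D_g, Finset.sum_add_distrib]
    congr 1
    exact Finset.sum_congr rfl fun F _ => mul_comm _ _
  have h2 : dh * H + h * dH = 0 := by
    ext C E
    have hc (e : Fin 4) := congrArg (fun x => K.N e * K.β (M.D e x)) (K.ang_g_gi C E)
    have h3 : ∑ e, K.N e * K.β (M.D e (∑ F : Fin 2, M.g C.succ.succ F.succ.succ *
        M.gi F.succ.succ E.succ.succ)) = 0 :=
      Finset.sum_eq_zero fun e _ => by rw [hc]; split_ifs <;> simp
    simp only [map_sum, Derivation.leibniz, smul_eq_mul, map_add, map_mul, Finset.mul_sum] at h3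
    rw [Finset.sum_comm] at h3
    simp only [dh, dH, H, h, Matrix.of_apply, Matrix.add_apply, Matrix.mul_apply,
      Matrix.zero_apply, ← Finset.sum_add_distrib, Finset.sum_mul, Finset.mul_sum]
    rw [← h3]
    exact Finset.sum_congr rfl fun F _ => Finset.sum_congr rfl fun e _ => by ring
  have h3 : dH = -(H * G + Gᵀ * H) := by
    have : dH = H * (h * dH) := by rw [← mul_assoc, hH', one_mul]
    rw [this, eq_neg_of_add_eq_zero_right h2, h1]
    have e : H * -((G * h + h * Gᵀ) * H) = -(H * G * (h * H) + (H * h) * Gᵀ * H) := by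
      noncomm_ring
    rw [e, hH, hH', mul_one, one_mul]
  have h4 := congrFun (congrFun h3 C) E
  simpa only [dH, H, G, Matrix.of_apply, Matrix.add_apply, Matrix.neg_apply, Matrix.mul_apply,
      Matrix.transpose_apply, Finset.sum_add_distrib] using h4

variable (K) in
theorem β_tr : K.β K.tr = 0 := by
  simp only [tr, map_sum, map_mul, K.β_electric, mul_zero, Finset.sum_const_zero]

/-- The connection terms from the transport of the electric part cancel those from the derivative of
the inverse metric. -/
theorem Cone.normalD_tr (L : K.Cone) : K.normalD K.tr = 0 := by
  have hs : K.β (M.D 0 (M.electric (1 : Fin 2).succ.succ (0 : Fin 2).succ.succ))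
      = K.β (M.D 0 (M.electric (0 : Fin 2).succ.succ (1 : Fin 2).succ.succ)) := by
    rw [M.electric_symm]
  have hH : K.β (M.gi (1 : Fin 2).succ.succ (0 : Fin 2).succ.succ)
      = K.β (M.gi (0 : Fin 2).succ.succ (1 : Fin 2).succ.succ) := by
    rw [M.gi_symm]
  simp only [tr, normalD_sum]
  simp only [K.normalD_mul _ (K.β_electric _ _), K.sum_N_D_gi, L.normalD_electric_ang]
  simp only [Fin.sum_univ_two, hs, hH]
  ring

/-- The transport equation at the boundary for the sum of the null components. -/
theorem Cone.normalD_out_add_in (L : K.Cone) (Y : Fin 2 → Fin 2 → A)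
    (hY : ∀ C E, Y C E
      = M.Wv (Geometry.ev C.succ.succ) M.nullOut (Geometry.ev E.succ.succ) M.nullOut
        + M.Wv (Geometry.ev C.succ.succ) M.nullIn (Geometry.ev E.succ.succ) M.nullIn)
    (C E : Fin 2) : K.normalD (Y C E) = 2 * (∑ F, K.G C F * K.β (M.D 0 (Y F E))
      + ∑ F, K.G E F * K.β (M.D 0 (Y C F))) := by
  have h1 (C E) : Y C E = 4 * M.electric C.succ.succ E.succ.succ
      - 2 * M.g C.succ.succ E.succ.succ * K.tr := by rw [hY, K.out_add_in]
  have h2 (n : ℕ) [n.AtLeastTwo] (e) : M.D e (OfNat.ofNat n : A) = 0 := by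
    exact (congrArg (M.D e) (Nat.cast_ofNat (R := A) (n := n)).symm).trans ((M.D e).map_natCast _)
  have h3 (C E) : K.β (M.D 0 (Y C E)) = 4 * K.β (M.D 0 (M.electric C.succ.succ E.succ.succ))
      - 2 * K.β (M.g C.succ.succ E.succ.succ) * K.β (M.D 0 K.tr) := by
    rw [h1]
    simp only [map_sub, Derivation.leibniz, smul_eq_mul, h2, map_add, map_mul, map_ofNat, K.β_tr,
      zero_mul, mul_zero, add_zero]
  -- The trace has zero normal derivative, so the term `h tr E` only contributes the derivative of
  -- `h`, which obeys the same transport law as the electric part.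
  have h4 : K.normalD (Y C E) = 4 * K.normalD (M.electric C.succ.succ E.succ.succ)
      - 4 * (∑ e, K.N e * K.β (M.D e (M.g C.succ.succ E.succ.succ))) * K.β (M.D 0 K.tr) := by
    have : 2 * M.g C.succ.succ E.succ.succ * K.tr
        = 2 * (M.g C.succ.succ E.succ.succ * K.tr) := mul_assoc _ _ _
    rw [h1, normalD_sub, this, K.normalD_mul _ (K.β_electric _ _), K.normalD_mul 2 (by
      rw [map_mul, K.β_tr, mul_zero]), K.normalD_mul _ K.β_tr, L.normalD_tr]
    simp only [h2, map_zero, map_ofNat, mul_zero, Finset.sum_const_zero]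
    ring
  rw [h4, K.sum_N_D_g, L.normalD_electric_ang]
  simp only [h3, Fin.sum_univ_two]
  ring

end Collar

end

/-! ### The algebra of smooth functions on a domain with boundary. -/

section

section SmoothFunctions

variable {E : Type*} [NormedAddCommGroup E] [NormedSpace ℝ E]
  {E' : Type*} [NormedAddCommGroup E'] [NormedSpace ℝ E']

/-- The extension by zero of a function on a set. -/
def extend {E : Type*} (S : Set E) (f : S → ℝ) : E → ℝ := Function.extend Subtype.val f 0

theorem extend_apply {E : Type*} {S : Set E} (f : S → ℝ) {x : E} (hx : x ∈ S) :
    extend S f x = f ⟨x, hx⟩ :=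
  Subtype.val_injective.extend_apply f 0 ⟨x, hx⟩

/-- The smooth functions on a set. -/
def smoothAlg (S : Set E) : Subalgebra ℝ (S → ℝ) where
  carrier := {f | ContDiffOn ℝ ∞ (extend S f) S}
  mul_mem' {f h} hf hh := (ContDiffOn.mul hf hh).congr fun x hx => by
    simp only [Pi.mul_apply, extend_apply _ hx]
  add_mem' {f h} hf hh := (ContDiffOn.add hf hh).congr fun x hx => by
    simp only [Pi.add_apply, extend_apply _ hx]
  algebraMap_mem' r := (contDiffOn_const (c := r)).congr fun x hx => by
    rw [extend_apply _ hx]; rfl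

/-- The domains with enough interior points for calculus. -/
structure IsRegularDomain (S : Set E) : Prop where
  uniqueDiff : UniqueDiffOn ℝ S
  subset_closure : S ⊆ closure (interior S)

theorem IsRegularDomain.of_isOpen {S : Set E} (h : IsOpen S) : IsRegularDomain S :=
  ⟨IsOpen.uniqueDiffOn (𝕜 := ℝ) h, by rw [h.interior_eq]; exact _root_.subset_closure⟩

variable {S : Set E} {S' : Set E'}

/-- The type of smooth functions on a set. -/
def SmoothFn (S : Set E) : Type _ := smoothAlg S

instance : CommRing (SmoothFn S) := inferInstanceAs (CommRing (smoothAlg S))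

instance : Algebra ℝ (SmoothFn S) := inferInstanceAs (Algebra ℝ (smoothAlg S))

namespace SmoothFn

/-- Evaluation at a point. -/
def evalAt (x : S) : SmoothFn S →ₐ[ℝ] ℝ := (Pi.evalAlgHom ℝ _ x).comp (smoothAlg S).val

/-- A smooth function as a function on the ambient space. -/
def fn (f : SmoothFn S) : E → ℝ := extend S f.1

theorem fn_apply (f : SmoothFn S) (x : S) : f.fn x = evalAt x f := extend_apply _ x.2

theorem fn_apply' (f : SmoothFn S) {x : E} (hx : x ∈ S) : f.fn x = evalAt ⟨x, hx⟩ f :=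
  extend_apply _ hx

theorem contDiffOn (f : SmoothFn S) : ContDiffOn ℝ ∞ f.fn S := f.2

theorem continuousOn (f : SmoothFn S) : ContinuousOn f.fn S := f.contDiffOn.continuousOn

theorem differentiableWithinAt (f : SmoothFn S) (x : S) :
    DifferentiableWithinAt ℝ f.fn S x :=
  (f.contDiffOn x x.2).differentiableWithinAt (by simp)

@[ext]
theorem ext {f h : SmoothFn S} (H : ∀ x, evalAt x f = evalAt x h) : f = h :=
  Subtype.ext (funext H)

/-- The restriction of a function that is smooth on a set. -/
def of (F : E → ℝ) (hF : ContDiffOn ℝ ∞ F S) : SmoothFn S :=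
  ⟨fun x => F x, hF.congr fun _ hx => extend_apply _ hx⟩

@[simp]
theorem evalAt_of (F : E → ℝ) (hF : ContDiffOn ℝ ∞ F S) (x : S) : evalAt x (of F hF) = F x := rfl

theorem fn_of (F : E → ℝ) (hF : ContDiffOn ℝ ∞ F S) : Set.EqOn (of F hF).fn F S :=
  fun _ hx => extend_apply _ hx

/-- The inverse of a function without zeros. -/
def inv (f : SmoothFn S) (hf : ∀ x, evalAt x f ≠ 0) : SmoothFn S :=
  of (fun x => (f.fn x)⁻¹) (f.contDiffOn.inv fun x hx => by rw [f.fn_apply' hx]; exact hf _)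

theorem mul_inv (f : SmoothFn S) (hf : ∀ x, evalAt x f ≠ 0) : f * f.inv hf = 1 := by
  ext x
  rw [map_mul, map_one, inv, evalAt_of, fn_apply, mul_inv_cancel₀ (hf x)]

/-- The derivative in a constant direction. -/
def dir (hS : IsRegularDomain S) (V : E) : Derivation ℝ (SmoothFn S) (SmoothFn S) :=
  Derivation.mk'
    { toFun := fun f => of (fun x => fderivWithin ℝ f.fn S x V)
        ((f.contDiffOn.fderivWithin hS.uniqueDiff (m := ∞) (by simp)).clm_apply contDiffOn_const)
      map_add' := fun f h => by
        ext x
        have e : Set.EqOn (f + h).fn (fun y => f.fn y + h.fn y) S := fun y hy => by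
          simp only [fn_apply' _ hy, map_add]
        simp only [evalAt_of, map_add]
        rw [fderivWithin_congr e (e x.2), fderivWithin_fun_add (hS.uniqueDiff x x.2)
          (f.differentiableWithinAt x) (h.differentiableWithinAt x)]
        rfl
      map_smul' := fun r f => by
        ext x
        have e : Set.EqOn (r • f).fn (fun y => r • f.fn y) S := fun y hy => by
          simp only [fn_apply' _ hy, map_smul]
        simp only [evalAt_of, map_smul, RingHom.id_apply]
        rw [fderivWithin_congr e (e x.2), fderivWithin_fun_const_smul (hS.uniqueDiff x x.2)
          (f.differentiableWithinAt x)]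
        rfl }
    (fun f h => by
      ext x
      have e : Set.EqOn (f * h).fn (fun y => f.fn y * h.fn y) S := fun y hy => by
        simp only [fn_apply' _ hy, map_mul]
      simp only [LinearMap.coe_mk, AddHom.coe_mk, evalAt_of, map_add, smul_eq_mul, map_mul]
      rw [fderivWithin_congr e (e x.2), fderivWithin_fun_mul (hS.uniqueDiff x x.2)
        (f.differentiableWithinAt x) (h.differentiableWithinAt x), fn_apply, fn_apply]
      simp)

theorem evalAt_dir (hS : IsRegularDomain S) (V : E) (f : SmoothFn S) (x : S) :
    evalAt x (dir hS V f) = fderivWithin ℝ f.fn S x V := rfl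

theorem fn_dir (hS : IsRegularDomain S) (V : E) (f : SmoothFn S) {x : E} (hx : x ∈ S) :
    (dir hS V f).fn x = fderivWithin ℝ f.fn S x V := fn_apply' _ hx

theorem dir_add (hS : IsRegularDomain S) (V W : E) (f : SmoothFn S) :
    dir hS (V + W) f = dir hS V f + dir hS W f := by
  ext x; simp only [evalAt_dir, map_add]

theorem dir_smul (hS : IsRegularDomain S) (r : ℝ) (V : E) (f : SmoothFn S) :
    dir hS (r • V) f = r • dir hS V f := by
  ext x; simp only [evalAt_dir, map_smul]

theorem dir_of (hS : IsRegularDomain S) (V : E) (F : E → ℝ) (hF : ContDiffOn ℝ ∞ F S) (x : S) :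
    evalAt x (dir hS V (of F hF)) = fderivWithin ℝ F S x V := by
  rw [evalAt_dir, fderivWithin_congr (fn_of F hF) (fn_of F hF x.2)]

/-- Second derivatives within a set are symmetric at points in the closure of its interior, which is
why `IsRegularDomain` asks for `subset_closure`. -/
theorem dir_comm (hS : IsRegularDomain S) (V W : E) (f : SmoothFn S) :
    dir hS V (dir hS W f) = dir hS W (dir hS V f) := by
  have h (V W : E) (x : S) : evalAt x (dir hS V (dir hS W f))
      = fderivWithin ℝ (fderivWithin ℝ f.fn S) S x V W := by
    have e : Set.EqOn (dir hS W f).fn (fun y => fderivWithin ℝ f.fn S y W) S := fun y hy =>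
      fn_dir hS W f hy
    rw [evalAt_dir, fderivWithin_congr e (e x.2)]
    have hd : DifferentiableWithinAt ℝ (fderivWithin ℝ f.fn S) S x :=
      (f.contDiffOn.fderivWithin hS.uniqueDiff (m := ∞) (by simp) x x.2).differentiableWithinAt
        (by simp)
    rw [fderivWithin_clm_apply (hS.uniqueDiff x x.2) hd (differentiableWithinAt_const _)]
    simp
  ext x
  rw [h, h]
  exact (f.contDiffOn x x.2).isSymmSndFDerivWithinAt
    (by rw [minSmoothness_of_isRCLikeNormedField]; exact (WithTop.coe_le_coe (b := (2 : ℕ∞))).2 le_top) hS.uniqueDiff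
    (hS.subset_closure x.2) x.2 V W

/-- The pullback of functions under a linear map. -/
def pull (ι : E' →L[ℝ] E) (h : Set.MapsTo ι S' S) : SmoothFn S →ₐ[ℝ] SmoothFn S' where
  toFun f := of (fun x => f.fn (ι x)) (f.contDiffOn.comp ι.contDiff.contDiffOn h)
  map_one' := by ext x; simp [fn_apply' _ (h x.2)]
  map_zero' := by ext x; simp [fn_apply' _ (h x.2)]
  map_mul' f g := by ext x; simp [fn_apply' _ (h x.2)]
  map_add' f g := by ext x; simp [fn_apply' _ (h x.2)]
  commutes' r := by ext x; simp [fn_apply' _ (h x.2)]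

theorem evalAt_pull (ι : E' →L[ℝ] E) (h : Set.MapsTo ι S' S) (f : SmoothFn S) (x : S') :
    evalAt x (pull ι h f) = evalAt ⟨ι x, h x.2⟩ f := fn_apply' _ _

theorem dir_pull (hS : IsRegularDomain S) (hS' : IsRegularDomain S') (ι : E' →L[ℝ] E)
    (h : Set.MapsTo ι S' S) (V : E') (f : SmoothFn S) :
    dir hS' V (pull ι h f) = pull ι h (dir hS (ι V) f) := by
  ext x
  rw [evalAt_pull, evalAt_dir, pull, AlgHom.coe_mk]
  change evalAt x (dir hS' V (of _ _)) = _
  rw [dir_of]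
  have := fderivWithin_comp (x := (x : E')) (g := f.fn) (t := S) (f := ι) (s := S')
    (f.differentiableWithinAt ⟨ι x, h x.2⟩) ι.differentiableAt.differentiableWithinAt h
    (hS'.uniqueDiff x x.2)
  rw [show (fun x => f.fn (ι x)) = f.fn ∘ ι from rfl, this,
    ι.fderivWithin (hS'.uniqueDiff x x.2)]
  rfl

/-- Functions that agree on a dense subset agree. -/
theorem eq_of_eq_on_dense {U : Set E} (hU : U ⊆ S) (hd : S ⊆ closure U) {f h : SmoothFn S}
    (H : ∀ x (hx : x ∈ U), evalAt ⟨x, hU hx⟩ f = evalAt ⟨x, hU hx⟩ h) : f = h := by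
  ext x
  rw [← fn_apply, ← fn_apply]
  have : Filter.NeBot (𝓝[U] (x : E)) := mem_closure_iff_nhdsWithin_neBot.1 (hd x.2)
  have h1 := (f.continuousOn x x.2).mono_left (nhdsWithin_mono _ hU)
  have h2 := (h.continuousOn x x.2).mono_left (nhdsWithin_mono _ hU)
  refine tendsto_nhds_unique (h1.congr' ?_) h2
  filter_upwards [self_mem_nhdsWithin] with y hy
  rw [fn_apply' _ (hU hy), fn_apply' _ (hU hy), H y hy]

end SmoothFn

end SmoothFunctions

end

/-! ### The Koszul formula and the behaviour of the curvature under homomorphisms. -/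

section

theorem algebraMap_half (A : Type*) [CommRing A] [Algebra ℝ A] :
    2 * algebraMap ℝ A (1 / 2) = 1 := by
  rw [← map_ofNat (algebraMap ℝ A) 2, ← map_mul, ← map_one (algebraMap ℝ A)]; norm_num

namespace Geometry

variable {A : Type*} [CommRing A] [Algebra ℝ A] {ι : Type*} [Fintype ι] [DecidableEq ι]
  (M : Geometry A ι)

/-- The formula for the Levi-Civita connection. -/
theorem koszul (κ μ ν : ι) : M.Γ κ μ ν = algebraMap ℝ A (1 / 2) * ∑ σ, M.gi κ σ *
    (M.D μ (M.g σ ν) + M.D ν (M.g σ μ) - M.D σ (M.g μ ν)) := by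
  have h (σ : ι) : M.D μ (M.g σ ν) + M.D ν (M.g σ μ) - M.D σ (M.g μ ν)
      = 2 * ∑ d, M.g σ d * M.Γ d μ ν := by
    simp only [M.compat, Finset.sum_add_distrib]
    have e1 : ∑ d, M.Γ d μ ν * M.g σ d = ∑ d, M.g σ d * M.Γ d μ ν :=
      Finset.sum_congr rfl fun d _ => mul_comm _ _
    have e2 : ∑ d, M.Γ d ν μ * M.g σ d = ∑ d, M.g σ d * M.Γ d μ ν :=
      Finset.sum_congr rfl fun d _ => by rw [M.Γ_symm, mul_comm]
    have e3 : ∑ d, M.Γ d σ ν * M.g μ d = ∑ d, M.Γ d ν σ * M.g d μ :=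
      Finset.sum_congr rfl fun d _ => by rw [M.Γ_symm, M.g_symm]
    have e4 : ∑ d, M.Γ d σ μ * M.g d ν = ∑ d, M.Γ d μ σ * M.g d ν :=
      Finset.sum_congr rfl fun d _ => by rw [M.Γ_symm]
    rw [e1, e2, e3, e4]
    ring
  simp only [h, mul_left_comm _ (2 : A), ← Finset.mul_sum]
  rw [← mul_assoc, algebraMap_half, one_mul]
  simp only [Finset.mul_sum, ← mul_assoc]
  exact (M.sum_gi_g_mul κ fun d => M.Γ d μ ν).symm

/-- The geometry of a metric. -/
def ofMetric (D : ι → Derivation ℝ A A) (g gi : ι → ι → A)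
    (comm : ∀ μ ν f, D μ (D ν f) = D ν (D μ f)) (g_symm : ∀ a b, g a b = g b a)
    (g_gi : ∀ a c, ∑ b, g a b * gi b c = if a = c then 1 else 0) : Geometry A ι where
  D := D
  g := g
  gi := gi
  Γ κ μ ν := algebraMap ℝ A (1 / 2) * ∑ σ, gi κ σ * (D μ (g σ ν) + D ν (g σ μ) - D σ (g μ ν))
  comm := comm
  g_symm := g_symm
  gi_symm := by
    have h1 : Matrix.of g * Matrix.of gi = 1 := by
      ext a c; simp [Matrix.mul_apply, g_gi, Matrix.one_apply]
    have h2 : (Matrix.of gi)ᵀ * Matrix.of g = 1 := by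
      have := congrArg Matrix.transpose h1
      rw [Matrix.transpose_mul, Matrix.transpose_one] at this
      have e : (Matrix.of g)ᵀ = Matrix.of g := by ext a b; exact g_symm b a
      rwa [e] at this
    have h3 : (Matrix.of gi)ᵀ = Matrix.of gi := by
      rw [← mul_one (Matrix.of gi)ᵀ, ← h1, ← mul_assoc, h2, one_mul]
    exact fun a b => congrFun (congrFun h3 b) a
  g_gi := g_gi
  Γ_symm a b c := by
    congr 1
    exact Finset.sum_congr rfl fun σ _ => by rw [g_symm b c]; ring
  compat := by
    have hs (a : ι) (f : ι → A) : ∑ d, (∑ σ, gi d σ * f σ) * g a d = f a := by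
      simp only [Finset.sum_mul]
      rw [Finset.sum_comm]
      have : ∀ σ, ∑ d, gi d σ * f σ * g a d = (if a = σ then 1 else 0) * f σ := fun σ => by
        rw [← g_gi, Finset.sum_mul]
        exact Finset.sum_congr rfl fun d _ => by ring
      simp [this]
    intro c a b
    rw [Finset.sum_add_distrib]
    have e (b : ι) (f : ι → A) : ∑ d, algebraMap ℝ A (1 / 2) * (∑ σ, gi d σ * f σ) * g b d
        = algebraMap ℝ A (1 / 2) * f b := by
      simp only [mul_assoc, ← Finset.mul_sum, hs]
    have e1 := e b fun σ => D c (g σ a) + D a (g σ c) - D σ (g c a)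
    have e2 := e a fun σ => D c (g σ b) + D b (g σ c) - D σ (g c b)
    refine Eq.trans ?_ (congrArg₂ (· + ·)
      (e1.symm.trans (Finset.sum_congr rfl fun d _ => by rw [g_symm b d])) e2.symm)
    simp only [g_symm a c, g_symm b c, g_symm a b]
    linear_combination (-D c (g b a)) * algebraMap_half A

section Map

variable {A' : Type*} [CommRing A'] [Algebra ℝ A'] (f : A →ₐ[ℝ] A')
  (D' : ι → Derivation ℝ A' A') (comm' : ∀ μ ν x, D' μ (D' ν x) = D' ν (D' μ x))
  (h : ∀ μ x, D' μ (f x) = f (M.D μ x))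

/-- The image of a geometry under a homomorphism. -/
def map : Geometry A' ι where
  D := D'
  g a b := f (M.g a b)
  gi a b := f (M.gi a b)
  Γ a b c := f (M.Γ a b c)
  comm := comm'
  g_symm a b := by rw [M.g_symm]
  gi_symm a b := by rw [M.gi_symm]
  g_gi a c := by
    simp only [← map_mul, ← map_sum, M.g_gi]
    split_ifs <;> simp
  Γ_symm a b c := by rw [M.Γ_symm]
  compat c a b := by simp only [h, M.compat, map_sum, map_add, map_mul]

theorem R_map (κ l μ ν : ι) : (M.map f D' comm' h).R κ l μ ν = f (M.R κ l μ ν) := by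
  simp only [R, map, h, map_add, map_sub, map_sum, map_mul]

theorem Rm_map (κ l μ ν : ι) : (M.map f D' comm' h).Rm κ l μ ν = f (M.Rm κ l μ ν) := by
  simp only [Rm, R_map, map_sum, map_mul]; rfl

theorem Ric_map (μ ν : ι) : (M.map f D' comm' h).Ric μ ν = f (M.Ric μ ν) := by
  simp only [Ric, R_map, map_sum]

theorem scal_map : (M.map f D' comm' h).scal = f M.scal := by
  simp only [scal, Ric_map, map_sum, map_mul]; rfl

theorem hess_map (s : A) (c b : ι) : (M.map f D' comm' h).hess (f s) c b = f (M.hess s c b) := by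
  simp only [hess, map, h, map_sub, map_sum, map_mul]

theorem gradSq_map (s : A) : (M.map f D' comm' h).gradSq (f s) = f (M.gradSq s) := by
  simp only [gradSq, map, h, map_sum, map_mul]

end Map

section Map4

variable (M : Geometry A (Fin 4)) {A' : Type*} [CommRing A'] [Algebra ℝ A'] (f : A →ₐ[ℝ] A')
  (D' : Fin 4 → Derivation ℝ A' A') (comm' : ∀ μ ν x, D' μ (D' ν x) = D' ν (D' μ x))
  (h : ∀ μ x, D' μ (f x) = f (M.D μ x))

theorem schouten_map (μ ν : Fin 4) :
    (M.map f D' comm' h).schouten μ ν = f (M.schouten μ ν) := by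
  simp only [schouten, Ric_map, scal_map, map_sub, map_mul, AlgHom.commutes]; rfl

theorem W_map (a b c d : Fin 4) : (M.map f D' comm' h).W a b c d = f (M.W a b c d) := by
  simp only [W, Rm_map, kn, schouten_map, map_sub, map_add, map_mul]; rfl

end Map4

end Geometry

end

/-! ### Charts of the spacetime and the components of the rescaled metric. -/

section

namespace SphereChart

variable (c : SphereChart)

/-- The coordinates of the spacetime with its boundary. -/
abbrev spacetime : Set (Coord 4) := c.region exteriorWithBoundary

/-- The coordinates of the interior of the spacetime. -/
abbrev bulk : Set (Coord 4) := c.region exteriorInterior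

/-- The coordinates of the boundary at positive times. -/
abbrev scri : Set (Coord 3) := {y | 0 < y 0 ∧ Fin.tail y ∈ c.dom}

theorem continuous_angles : Continuous angles :=
  continuous_pi fun A => continuous_apply (ang A)

theorem bulk_subset : c.bulk ⊆ c.spacetime := fun _ hx => ⟨⟨hx.1.1.le, hx.1.2.le⟩, hx.2⟩

theorem isOpen_bulk : IsOpen c.bulk := by
  refine IsOpen.inter ?_ (c.isOpen_dom.preimage continuous_angles)
  exact (isOpen_lt continuous_const (continuous_apply 1)).inter
    (isOpen_lt (continuous_apply 1) (continuous_apply 0))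

theorem isOpen_scri : IsOpen c.scri := by
  refine IsOpen.inter (isOpen_lt continuous_const (continuous_apply 0)) ?_
  exact c.isOpen_dom.preimage (continuous_pi fun A => continuous_apply _)

/-- A boundary point is the limit of interior points. -/
theorem spacetime_subset_closure : c.spacetime ⊆ closure c.bulk := by
  intro x hx
  -- The direction `2 ∂_u + ∂_v` enters the interior from every point, including the corner `u = v =
  -- 0`.
  have h : Filter.Tendsto (fun ε : ℝ => x + ε • (![2, 1, 0, 0] : Coord 4)) (𝓝[>] 0) (𝓝 x) := by
    have : Continuous fun ε : ℝ => x + ε • (![2, 1, 0, 0] : Coord 4) := by fun_prop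
    have h := this.tendsto 0
    simp only [zero_smul, add_zero] at h
    exact h.mono_left nhdsWithin_le_nhds
  refine mem_closure_of_tendsto h ?_
  filter_upwards [self_mem_nhdsWithin] with ε hε
  have hε : 0 < ε := hε
  obtain ⟨⟨h1, h2⟩, h3⟩ := hx
  simp only at h1 h2
  refine ⟨⟨?_, ?_⟩, ?_⟩
  · simp; linarith
  · simp; linarith
  · have : angles (x + ε • (![2, 1, 0, 0] : Coord 4)) = angles x := by
      ext A; fin_cases A <;> simp [angles, ang]
    rwa [this]

/-- A convex wedge with nonempty interior intersected with an open set. -/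
theorem regular_spacetime : IsRegularDomain c.spacetime where
  uniqueDiff := by
    have h : c.spacetime = {x : Coord 4 | 0 ≤ x 1 ∧ x 1 ≤ x 0} ∩ angles ⁻¹' c.dom := rfl
    rw [h]
    refine UniqueDiffOn.inter (uniqueDiffOn_convex ?_ ?_) (c.isOpen_dom.preimage continuous_angles)
    · intro x hx y hy a b ha hb _
      simp only [Set.mem_ofPred_eq, Pi.add_apply, Pi.smul_apply, smul_eq_mul] at *
      constructor <;> nlinarith
    · have ho : IsOpen {x : Coord 4 | 0 < x 1 ∧ x 1 < x 0} :=
        (isOpen_lt continuous_const (continuous_apply 1)).inter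
          (isOpen_lt (continuous_apply 1) (continuous_apply 0))
      refine ⟨![2, 1, 0, 0], interior_mono (s := {x : Coord 4 | 0 < x 1 ∧ x 1 < x 0})
        (t := {x : Coord 4 | 0 ≤ x 1 ∧ x 1 ≤ x 0}) (fun x hx => ⟨hx.1.le, hx.2.le⟩) ?_⟩
      rw [ho.interior_eq]
      constructor <;> simp
  subset_closure := c.spacetime_subset_closure.trans
    (closure_mono (interior_maximal c.bulk_subset c.isOpen_bulk))

theorem regular_bulk : IsRegularDomain c.bulk := .of_isOpen c.isOpen_bulk

theorem regular_scri : IsRegularDomain c.scri := .of_isOpen c.isOpen_scri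

theorem tangent_orthogonal {θ : Coord 2} (hθ : θ ∈ c.dom) (A : Fin 2) :
    inner ℝ (c.toSphere θ : E3) (c.tangent θ A) = 0 := by
  have hd : DifferentiableAt ℝ (fun ϑ => (c.toSphere ϑ : E3)) θ :=
    ((c.smooth θ hθ).contDiffAt (c.isOpen_dom.mem_nhds hθ)).differentiableAt (by simp)
  have h1 : (fun ϑ => inner ℝ (c.toSphere ϑ : E3) (c.toSphere ϑ : E3)) = fun _ => (1 : ℝ) := by
    ext ϑ
    rw [real_inner_self_eq_norm_sq, norm_eq_of_mem_sphere, one_pow]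
  have h2 := fderiv_inner_apply ℝ hd hd (Pi.single A 1)
  rw [h1] at h2
  simp only [fderiv_fun_const, Pi.zero_apply, _root_.zero_apply] at h2
  rw [real_inner_comm (c.toSphere θ : E3)] at h2
  rw [tangent]
  rw [real_inner_comm] at h2 ⊢
  linarith

theorem tangent_sum_orthogonal {θ : Coord 2} (hθ : θ ∈ c.dom) (X : Coord 2) :
    inner ℝ (c.toSphere θ : E3) (∑ A, X A • c.tangent θ A) = 0 := by
  simp only [Fin.sum_univ_two, inner_add_right, inner_smul_right, c.tangent_orthogonal hθ]
  ring

theorem tangent_sum_ne_zero {θ : Coord 2} (hθ : θ ∈ c.dom) {X : Coord 2} (hX : X ≠ 0) :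
    ∑ A, X A • c.tangent θ A ≠ 0 := fun h =>
  hX (funext (Fintype.linearIndependent_iff.1 (c.immersion θ hθ) X h))

theorem form_apply (h : ℝ → ℝ → S2 → LinearMap.BilinForm ℝ E3) (x : Coord 4) (X Y : Coord 2) :
    h (x 0) (x 1) (c.toSphere (angles x)) (∑ A, X A • c.tangent (angles x) A)
      (∑ A, Y A • c.tangent (angles x) A) = eval2 (c.form h x) X Y := by
  simp only [map_add, map_smul, LinearMap.add_apply, LinearMap.smul_apply, smul_eq_mul, eval2,
    form, Matrix.of_apply, Fin.sum_univ_two]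
  ring

theorem det_pos_of_posDef {h : Matrix (Fin 2) (Fin 2) ℝ} (hs : h 0 1 = h 1 0)
    (hp : ∀ X : Coord 2, X ≠ 0 → 0 < eval2 h X X) : 0 < h 0 0 * h 1 1 - h 0 1 * h 0 1 := by
  have h0 : 0 < h 0 0 := by
    have := hp ![1, 0] (fun H => by simpa using congrFun H 0)
    simpa [eval2] using this
  -- On this vector the form takes the value `h₀₀ det h`.
  have h1 := hp ![-h 0 1, h 0 0] (fun H => h0.ne' (by simpa using congrFun H 1))
  simp [eval2, ← hs] at h1
  nlinarith

end SphereChart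

namespace DoubleNullMetric

variable {g : DoubleNullMetric} (E : g.ConformalExtension) (c : SphereChart)

namespace ConformalExtension

theorem exterior_or {p : ℝ × ℝ} (h : p ∈ exteriorWithBoundary) :
    p ∈ exterior ∨ (p.1 = p.2 ∧ 0 ≤ p.1) := by
  rcases h.2.lt_or_eq with h1 | h1
  · exact Or.inl ⟨h.1, h1⟩
  · exact Or.inr ⟨h1.symm, h1 ▸ h.1⟩

theorem exterior_of_bulk {x : Coord 4} (hx : x ∈ c.bulk) : (x 0, x 1) ∈ exterior :=
  ⟨hx.1.1.le, hx.1.2⟩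

theorem lapse_pos' {x : Coord 4} (hx : x ∈ c.spacetime) : 0 < c.scalar E.lapse x := by
  rcases exterior_or hx.1 with h | ⟨h1, h2⟩
  · rw [SphereChart.scalar, E.lapse_eq _ _ _ h]
    have := g.Om_pos _ _ (c.toSphere (angles x)) h
    have h3 : (x 1 - x 0) ≠ 0 := sub_ne_zero.2 h.2.ne
    positivity
  · simp only at h1 h2
    rw [SphereChart.scalar, ← h1]
    exact E.lapse_pos _ _ h2

theorem form_h_pos {x : Coord 4} (hx : x ∈ c.spacetime) {X : Coord 2} (hX : X ≠ 0) :
    0 < eval2 (c.form E.h x) X X := by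
  have ho := c.tangent_sum_orthogonal hx.2 X
  have hn := c.tangent_sum_ne_zero hx.2 hX
  rw [← SphereChart.form_apply]
  rcases exterior_or hx.1 with h | ⟨h1, h2⟩
  · rw [E.h_eq _ _ _ _ _ h ho ho]
    have h3 := g.Om_pos _ _ (c.toSphere (angles x)) h
    have h4 := g.gs_pos _ _ _ _ h ho hn
    positivity
  · simp only at h1 h2
    rw [← h1]
    exact E.h_pos _ _ _ h2 ho hn

theorem form_h_eq {x : Coord 4} (hx : x ∈ c.bulk) (A B : Fin 2) :
    (c.gauge g).gs x A B = (c.gauge g).Om x ^ 2 * c.form E.h x A B := by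
  have hb := exterior_of_bulk c hx
  have h1 := E.h_eq (x 0) (x 1) (c.toSphere (angles x)) _ _ hb
    (c.tangent_orthogonal hx.2 A) (c.tangent_orthogonal hx.2 B)
  have h2 := g.Om_pos _ _ (c.toSphere (angles x)) hb
  simp only [SphereChart.gauge, SphereChart.form, SphereChart.scalar, Matrix.of_apply]
  rw [h1]
  field_simp

theorem shift_eq' {x : Coord 4} (hx : x ∈ c.bulk) : (c.gauge g).b x = c.vector E.shift x := by
  simp only [SphereChart.gauge, SphereChart.vector, E.shift_eq _ _ _ (exterior_of_bulk c hx)]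

theorem Om_pos' {x : Coord 4} (hx : x ∈ c.bulk) : 0 < (c.gauge g).Om x :=
  g.Om_pos _ _ _ (exterior_of_bulk c hx)

theorem lapse_eq' {x : Coord 4} (hx : x ∈ c.bulk) :
    c.scalar E.lapse x = rstar x ^ 2 * (c.gauge g).Om x ^ 2 :=
  E.lapse_eq _ _ _ (exterior_of_bulk c hx)

/-- The functions on the spacetime with its boundary. -/
abbrev Fn (c : SphereChart) : Type := SmoothFn c.spacetime

/-- The components of the metric on the spheres. -/
def hFn (A B : Fin 2) : Fn c := .of (fun x => c.form E.h x A B) (E.smooth_h c A B)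

/-- The components of the shift. -/
def bFn (A : Fin 2) : Fn c := .of (fun x => c.vector E.shift x A) (E.smooth_shift c A)

/-- The defining function of the boundary. -/
def rhoFn (c : SphereChart) : Fn c :=
  .of rstar ((contDiff_apply ℝ ℝ (1 : Fin 4)).sub (contDiff_apply ℝ ℝ (0 : Fin 4))).contDiffOn

/-- The quotient of the inverse lapse and the defining function of the boundary. -/
def psiFn : Fn c := .of (fun x => -(Real.sqrt (c.scalar E.lapse x))⁻¹)
  (((E.smooth_lapse c).sqrt fun _ hx => (E.lapse_pos' c hx).ne').inv fun _ hx =>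
    (Real.sqrt_pos.2 (E.lapse_pos' c hx)).ne').neg

/-- Symmetry of the extension at the boundary is not assumed; it follows from the interior by
density. -/
theorem hFn_symm (A B : Fin 2) : E.hFn c A B = E.hFn c B A := by
  refine SmoothFn.eq_of_eq_on_dense c.bulk_subset c.spacetime_subset_closure fun x hx => ?_
  have h1 := E.form_h_eq c hx A B
  have h2 := E.form_h_eq c hx B A
  have h3 : (c.gauge g).gs x A B = (c.gauge g).gs x B A :=
    g.gs_symm _ _ _ _ _ (exterior_of_bulk c hx) (c.tangent_orthogonal hx.2 A)
      (c.tangent_orthogonal hx.2 B)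
  rw [h1, h2] at h3
  exact mul_left_cancel₀ (pow_pos (Om_pos' c hx) 2).ne' h3

/-- The determinant of the metric on the spheres. -/
def detFn : Fn c := E.hFn c 0 0 * E.hFn c 1 1 - E.hFn c 0 1 * E.hFn c 0 1

theorem detFn_pos (x : c.spacetime) : 0 < SmoothFn.evalAt x (E.detFn c) := by
  have hs := congrArg (SmoothFn.evalAt x) (E.hFn_symm c 0 1)
  have := SphereChart.det_pos_of_posDef (h := c.form E.h x) hs
    fun X hX => E.form_h_pos c x.2 hX
  simpa [detFn, hFn] using this

theorem psiFn_neg (x : c.spacetime) : SmoothFn.evalAt x (E.psiFn c) < 0 := by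
  have := Real.sqrt_pos.2 (E.lapse_pos' c x.2)
  simp [psiFn, this]

/-- The components of the inverse metric on the spheres. -/
def HFn (A B : Fin 2) : Fn c :=
  (E.detFn c).inv (fun x => (E.detFn_pos c x).ne') *
    !![E.hFn c 1 1, -E.hFn c 0 1; -E.hFn c 0 1, E.hFn c 0 0] A B

theorem hFn_mul_HFn (A B : Fin 2) :
    ∑ C, E.hFn c A C * E.HFn c C B = if A = B then 1 else 0 := by
  have h := SmoothFn.mul_inv (E.detFn c) (fun x => (E.detFn_pos c x).ne')
  have hs := E.hFn_symm c 1 0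
  unfold HFn
  rw [Fin.sum_univ_two]
  conv at h => lhs; lhs; rw [detFn]
  fin_cases A <;> fin_cases B <;> simp [hs] <;> first | linear_combination h | ring1

end ConformalExtension

end DoubleNullMetric

end

/-! ### Coordinate curvature of a metric, and the algebraic form of the rescaled metric. -/

section

namespace Geometry

section Coordinates

variable {n : ℕ} {U : Set (Coord n)} (hU : IsOpen U)

theorem pd_eq {f : Coord n → ℝ} (F : SmoothFn U) (hf : ∀ x : U, f x = SmoothFn.evalAt x F)
    (μ : Fin n) (x : U) : pd μ f x
      = SmoothFn.evalAt x (SmoothFn.dir (.of_isOpen hU) (Pi.single μ 1) F) := by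
  rw [SmoothFn.evalAt_dir, fderivWithin_of_isOpen hU x.2, pd]
  congr 1
  refine Filter.EventuallyEq.fderiv_eq ?_
  filter_upwards [hU.mem_nhds x.2] with y hy
  rw [F.fn_apply' hy]
  exact hf ⟨y, hy⟩

variable (G : Geometry (SmoothFn U) (Fin n))
  (hD : ∀ μ, G.D μ = SmoothFn.dir (.of_isOpen hU) (Pi.single μ 1))
  (m : MetricField n) (hm : ∀ (x : U) a b, m x a b = SmoothFn.evalAt x (G.g a b))
include hm

theorem inv_eq (x : U) (a b : Fin n) : (m x)⁻¹ a b = SmoothFn.evalAt x (G.gi a b) := by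
  have h : m x * Matrix.of (fun a b => SmoothFn.evalAt x (G.gi a b)) = 1 := by
    ext a b
    have := congrArg (SmoothFn.evalAt x) (G.g_gi a b)
    simp only [map_sum, map_mul] at this
    simp only [Matrix.mul_apply, hm, Matrix.of_apply, this, Matrix.one_apply]
    split_ifs <;> simp
  rw [Matrix.inv_eq_right_inv h]
  rfl

include hD

theorem christoffel_eq (x : U) (κ μ ν : Fin n) :
    christoffel m κ μ ν x = SmoothFn.evalAt x (G.Γ κ μ ν) := by
  have hp (μ a b : Fin n) : pd μ (fun y => m y a b) x = SmoothFn.evalAt x (G.D μ (G.g a b)) := by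
    rw [hD, pd_eq hU (G.g a b) (fun x => hm x a b)]
  rw [koszul, christoffel]
  simp only [map_mul, map_sum, map_add, map_sub, AlgHom.commutes, inv_eq G m hm, hp]
  rfl

theorem riemannUp_eq (x : U) (κ l μ ν : Fin n) :
    riemannUp m κ l μ ν x = SmoothFn.evalAt x (G.R κ l μ ν) := by
  have hp (μ a b c : Fin n) : pd μ (christoffel m a b c) x
      = SmoothFn.evalAt x (G.D μ (G.Γ a b c)) := by
    rw [hD, pd_eq hU (G.Γ a b c) (fun x => christoffel_eq hU G hD m hm x a b c)]
  simp only [riemannUp, R, hp, christoffel_eq hU G hD m hm, map_add, map_sub, map_sum, map_mul]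

theorem riemann_eq (x : U) (κ l μ ν : Fin n) :
    riemann m κ l μ ν x = SmoothFn.evalAt x (G.Rm κ l μ ν) := by
  simp only [riemann, Rm, riemannUp_eq hU G hD m hm, map_sum, map_mul, hm]

end Coordinates

section Coordinates4

variable {U : Set (Coord 4)} (hU : IsOpen U) (G : Geometry (SmoothFn U) (Fin 4))
  (hD : ∀ μ, G.D μ = SmoothFn.dir (.of_isOpen hU) (Pi.single μ 1))
  (m : MetricField 4) (hm : ∀ (x : U) a b, m x a b = SmoothFn.evalAt x (G.g a b))
include hD hm

theorem ricci_eq (x : U) (μ ν : Fin 4) : ricci m μ ν x = SmoothFn.evalAt x (G.Ric μ ν) := by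
  simp only [ricci, Ric, riemannUp_eq hU G hD m hm, map_sum]

/-- With `Ric = -3 k² g` the scalar curvature is `-12 k²`, and the trace terms of the Weyl tensor
add up to the coefficient `3 k² - 2 k² = k²`. -/
theorem weyl_eq_of_einstein (k : ℝ) (x : U)
    (hE : ∀ μ ν, ricci m μ ν x = -3 * k ^ 2 * m x μ ν) (κ l μ ν : Fin 4) :
    weyl m κ l μ ν x = SmoothFn.evalAt x (G.Rm κ l μ ν)
      + k ^ 2 * (m x κ μ * m x l ν - m x κ ν * m x l μ) := by
  have hs : scalarCurvature m x = -12 * k ^ 2 := by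
    have := congrArg (SmoothFn.evalAt x) G.trace_g
    simp only [map_sum, map_mul, ← hm, ← inv_eq G m hm, map_ofNat] at this
    simp only [scalarCurvature, hE]
    simp only [mul_left_comm _ (-3 * k ^ 2), ← Finset.mul_sum, this]
    ring
  rw [weyl, hs, riemann_eq hU G hD m hm]
  simp only [hE]
  ring

end Coordinates4

section DoubleNull

variable {A : Type*} [CommRing A]

/-- The metric `dρ² - dt² + h (dθ + b (dρ - dt)) (dθ + b (dρ - dt))`. -/
def slabMetric (h : Fin 2 → Fin 2 → A) (b : Fin 2 → A) : Matrix (Fin 4) (Fin 4) A :=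
  let p A := ∑ B, h A B * b B
  let q := ∑ A, b A * p A
  !![1 + q, -q, p 0, p 1; -q, q - 1, -p 0, -p 1; p 0, -p 0, h 0 0, h 0 1; p 1, -p 1, h 1 0, h 1 1]

/-- The inverse of `slabMetric`. -/
def slabInverse (H : Fin 2 → Fin 2 → A) (b : Fin 2 → A) : Matrix (Fin 4) (Fin 4) A :=
  !![1, 0, -b 0, -b 1; 0, -1, -b 0, -b 1; -b 0, -b 0, H 0 0, H 0 1; -b 1, -b 1, H 1 0, H 1 1]

theorem slab_mul (h H : Fin 2 → Fin 2 → A) (b : Fin 2 → A) (hs : ∀ a b, h a b = h b a)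
    (hH : ∀ a c, ∑ b, h a b * H b c = if a = c then 1 else 0) (a c : Fin 4) :
    ∑ b', slabMetric h b a b' * slabInverse H b b' c = if a = c then 1 else 0 := by
  have h00 := hH 0 0
  have h01 := hH 0 1
  have h10 := hH 1 0
  have h11 := hH 1 1
  simp only [Fin.sum_univ_two, hs 1 0] at h00 h01 h10 h11
  norm_num at h00 h01 h10 h11
  rw [Fin.sum_univ_four]
  fin_cases a <;> fin_cases c <;> simp [slabMetric, slabInverse, Fin.sum_univ_two, hs 1 0] <;>
    first
      | ring1
      | linear_combination h00
      | linear_combination h01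
      | linear_combination h10
      | linear_combination h11
      | linear_combination b 0 * h00 + b 1 * h10
      | linear_combination b 0 * h01 + b 1 * h11
      | linear_combination -b 0 * h00 - b 1 * h10
      | linear_combination -b 0 * h01 - b 1 * h11

theorem slabMetric_symm (h : Fin 2 → Fin 2 → A) (b : Fin 2 → A) (hs : ∀ a b, h a b = h b a)
    (a c : Fin 4) : slabMetric h b a c = slabMetric h b c a := by
  fin_cases a <;> fin_cases c <;> simp [slabMetric, hs 1 0]

end DoubleNull

end Geometry

end

/-! ### The rescaled metric up to the boundary and the spacetime metric in the interior. -/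

section

/-- The derivatives in the coordinates `(r⋆, t, θ)` in terms of those in the coordinates
`(u, v, θ)`. -/
def slabFrame : Matrix (Fin 4) (Fin 4) ℝ :=
  !![-(1 / 2), 1 / 2, 0, 0; 1 / 2, 1 / 2, 0, 0; 0, 0, 1, 0; 0, 0, 0, 1]

/-- The coordinate vectors of the coordinates `(r⋆, t, θ)`. -/
def slabVec (a : Fin 4) : Coord 4 := fun b => slabFrame a b

/-- The derivatives in the coordinates `(u, v, θ)` in terms of those in the coordinates
`(r⋆, t, θ)`. -/
def nullFrame : Matrix (Fin 4) (Fin 4) ℝ :=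
  !![-1, 1, 0, 0; 1, 1, 0, 0; 0, 0, 1, 0; 0, 0, 0, 1]

theorem nullFrame_mul_slabFrame : nullFrame * slabFrame = 1 := by
  ext a b
  fin_cases a <;> fin_cases b <;>
    simp [nullFrame, slabFrame, Matrix.mul_apply, Fin.sum_univ_four] <;> norm_num

theorem sum_nullFrame_smul (μ : Fin 4) :
    ∑ a, nullFrame μ a • slabVec a = Pi.single μ 1 := by
  ext b
  have := congrFun (congrFun nullFrame_mul_slabFrame μ) b
  rw [Matrix.mul_apply, Matrix.one_apply] at this
  simp only [Finset.sum_apply, Pi.smul_apply, smul_eq_mul, slabVec, this, Pi.single_apply, eq_comm]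

namespace DoubleNullMetric

variable {g : DoubleNullMetric} (E : g.ConformalExtension) (c : SphereChart)

namespace ConformalExtension

/-- Half of the shift. -/
def halfShift (A : Fin 2) : Fn c := algebraMap ℝ _ (1 / 2) * E.bFn c A

/-- The rescaled metric in the coordinates `(r⋆, t, θ)`. -/
def hat : Geometry (Fn c) (Fin 4) :=
  .ofMetric (fun a => SmoothFn.dir c.regular_spacetime (slabVec a))
    (fun a b => Geometry.slabMetric (E.hFn c) (E.halfShift c) a b)
    (fun a b => Geometry.slabInverse (E.HFn c) (E.halfShift c) a b)
    (fun _ _ _ => SmoothFn.dir_comm _ _ _ _)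
    (Geometry.slabMetric_symm _ _ (E.hFn_symm c))
    (Geometry.slab_mul _ _ _ (E.hFn_symm c) (E.hFn_mul_HFn c))

theorem mapsTo_bulk : Set.MapsTo (ContinuousLinearMap.id ℝ (Coord 4)) c.bulk c.spacetime :=
  fun _ hx => c.bulk_subset hx

/-- The restriction to the interior of the spacetime. -/
def res (c : SphereChart) : Fn c →ₐ[ℝ] SmoothFn c.bulk :=
  SmoothFn.pull _ (mapsTo_bulk c)

theorem evalAt_res (f : Fn c) (x : c.bulk) :
    SmoothFn.evalAt x (res c f) = SmoothFn.evalAt ⟨x.1, c.bulk_subset x.2⟩ f :=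
  SmoothFn.evalAt_pull _ _ _ _

/-- By density of the interior. Identities between functions that are smooth up to the boundary need
only be proved where the spacetime metric is defined. -/
theorem res_injective : Function.Injective (res c) := fun f h H =>
  SmoothFn.eq_of_eq_on_dense c.bulk_subset c.spacetime_subset_closure fun x hx => by
    have := congrArg (SmoothFn.evalAt (⟨x, hx⟩ : c.bulk)) H
    rwa [evalAt_res, evalAt_res] at this

theorem dir_res (a : Fin 4) (f : Fn c) :
    SmoothFn.dir c.regular_bulk (slabVec a) (res c f) = res c ((E.hat c).D a f) :=
  SmoothFn.dir_pull c.regular_spacetime c.regular_bulk _ (mapsTo_bulk c) _ _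

/-- The rescaled metric in the interior of the spacetime. -/
def hatBulk : Geometry (SmoothFn c.bulk) (Fin 4) :=
  (E.hat c).map (res c) (fun a => SmoothFn.dir c.regular_bulk (slabVec a))
    (fun _ _ _ => SmoothFn.dir_comm _ _ _ _) (E.dir_res c)

theorem hess_hatBulk (f : Fn c) (a b : Fin 4) :
    (E.hatBulk c).hess (res c f) a b = res c ((E.hat c).hess f a b) := Geometry.hess_map ..

theorem gradSq_hatBulk (f : Fn c) :
    (E.hatBulk c).gradSq (res c f) = res c ((E.hat c).gradSq f) := Geometry.gradSq_map ..

theorem schouten_hatBulk (a b : Fin 4) :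
    (E.hatBulk c).schouten a b = res c ((E.hat c).schouten a b) := Geometry.schouten_map ..

theorem W_hatBulk (a b c' d : Fin 4) :
    (E.hatBulk c).W a b c' d = res c ((E.hat c).W a b c' d) := Geometry.W_map ..

theorem evalAt_psiFn (x : c.spacetime) :
    SmoothFn.evalAt x (E.psiFn c) = -(Real.sqrt (c.scalar E.lapse x))⁻¹ := rfl

theorem evalAt_rhoFn (x : c.spacetime) : SmoothFn.evalAt x (rhoFn c) = rstar x := rfl

theorem evalAt_hFn (x : c.spacetime) (A B : Fin 2) :
    SmoothFn.evalAt x (E.hFn c A B) = c.form E.h x A B := rfl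

theorem evalAt_bFn (x : c.spacetime) (A : Fin 2) :
    SmoothFn.evalAt x (E.bFn c A) = c.vector E.shift x A := rfl

theorem evalAt_halfShift (x : c.spacetime) (A : Fin 2) :
    SmoothFn.evalAt x (E.halfShift c A) = 1 / 2 * c.vector E.shift x A := by
  rw [halfShift, map_mul, AlgHom.commutes, evalAt_bFn]; rfl

/-- The inverse of the lapse `Ω`. -/
def sFn : Fn c := E.psiFn c * rhoFn c

/-- The lapse `Ω` in the interior of the spacetime. -/
def OmFn (_E : g.ConformalExtension) (c : SphereChart) : SmoothFn c.bulk := .of (c.scalar g.Om)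
  ((g.smooth_Om c).mono fun _ hx => ⟨exterior_of_bulk c hx, hx.2⟩)

/-- In the interior `r⋆ < 0`, so the root of the rescaled lapse is `-r⋆ Ω`; the minus sign in
`psiFn` makes `s = ψ ρ` the positive function `Ω⁻¹`. -/
theorem evalAt_sFn (x : c.bulk) :
    SmoothFn.evalAt x (res c (E.sFn c)) = ((c.gauge g).Om x)⁻¹ := by
  have h1 := E.lapse_eq' c x.2
  have h2 := Om_pos' (g := g) c x.2
  have h3 : rstar x < 0 := sub_neg.2 x.2.1.2
  have h4 : Real.sqrt (c.scalar E.lapse x) = -rstar x * (c.gauge g).Om x := by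
    rw [h1, ← mul_pow, Real.sqrt_sq_eq_abs, abs_mul, abs_of_neg h3, abs_of_pos h2]
  rw [evalAt_res, sFn, map_mul, evalAt_psiFn, evalAt_rhoFn, h4]
  have := h3.ne
  field_simp

theorem res_sFn_mul : res c (E.sFn c) * E.OmFn c = 1 := by
  ext x
  rw [map_mul, evalAt_sFn, OmFn, SmoothFn.evalAt_of, map_one]
  exact inv_mul_cancel₀ (Om_pos' (g := g) c x.2).ne'

/-- The spacetime metric in the coordinates `(r⋆, t, θ)`. -/
def physSlab : Geometry (SmoothFn c.bulk) (Fin 4) :=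
  (E.hatBulk c).conformal (res c (E.sFn c)) (E.OmFn c) (E.res_sFn_mul c)

/-- The spacetime metric in the coordinates `(u, v, θ)`. -/
def phys : Geometry (SmoothFn c.bulk) (Fin 4) :=
  (E.physSlab c).change nullFrame slabFrame nullFrame_mul_slabFrame

theorem phys_D (μ : Fin 4) :
    (E.phys c).D μ = SmoothFn.dir (.of_isOpen c.isOpen_bulk) (Pi.single μ 1) := by
  ext1 f
  change Geometry.combD (fun a => SmoothFn.dir c.regular_bulk (slabVec a)) (nullFrame μ) f = _
  rw [Geometry.combD_apply, ← sum_nullFrame_smul]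
  simp only [Fin.sum_univ_four, SmoothFn.dir_add, SmoothFn.dir_smul]

theorem phys_g (μ ν : Fin 4) : (E.phys c).g μ ν
    = ∑ a, ∑ b, (nullFrame μ a * nullFrame ν b) • (E.physSlab c).g a b :=
  Geometry.conj_apply _ _ _ _

theorem evalAt_physSlab_g (x : c.bulk) (a b : Fin 4) :
    SmoothFn.evalAt x ((E.physSlab c).g a b)
      = (c.gauge g).Om x ^ 2 * SmoothFn.evalAt (⟨x.1, c.bulk_subset x.2⟩ : c.spacetime)
        (Geometry.slabMetric (E.hFn c) (E.halfShift c) a b) := by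
  rw [← evalAt_res]
  change SmoothFn.evalAt x (E.OmFn c ^ 2 * _) = _
  rw [map_mul, map_pow]
  rfl

theorem evalAt_phys_g (x : c.bulk) (μ ν : Fin 4) : SmoothFn.evalAt x ((E.phys c).g μ ν)
    = ∑ a, ∑ b, nullFrame μ a * nullFrame ν b * ((c.gauge g).Om x ^ 2 *
      SmoothFn.evalAt (⟨x.1, c.bulk_subset x.2⟩ : c.spacetime)
        (Geometry.slabMetric (E.hFn c) (E.halfShift c) a b)) := by
  simp only [phys_g, map_sum, map_smul, evalAt_physSlab_g, smul_eq_mul]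

/-- The link between the concrete metric of the statement and the abstract geometries: rescaling by
`Ω²` and passing from `(r⋆, t, θ)` to `(u, v, θ)` recovers the double null form. -/
theorem metric_eq_phys_g (x : c.bulk) (μ ν : Fin 4) : (c.gauge g).metric x.1 μ ν
    = SmoothFn.evalAt x ((E.phys c).g μ ν) := by
  have hs := congrArg (SmoothFn.evalAt (⟨x.1, c.bulk_subset x.2⟩ : c.spacetime)) (E.hFn_symm c 0 1)
  simp only [evalAt_hFn] at hs
  rw [evalAt_phys_g]
  simp only [Fin.sum_univ_four]
  fin_cases μ <;> fin_cases ν <;>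
    simp [NullGauge.metric, eval2, NullGauge.proj, Geometry.slabMetric, nullFrame,
      E.form_h_eq c x.2, E.shift_eq' c x.2, ang, Fin.sum_univ_two, evalAt_hFn, evalAt_halfShift,
      hs] <;>
    ring1

end ConformalExtension

end DoubleNullMetric

end

/-! ### The Einstein equations up to the boundary. -/

section

namespace Geometry

section

variable {A : Type*} [CommRing A] [Algebra ℝ A] {ι : Type*} [Fintype ι] [DecidableEq ι]

theorem conj_injective {J Ji : Matrix ι ι ℝ} (h : J * Ji = 1) {X Y : Matrix ι ι A}
    (H : J.map (algebraMap ℝ A) * X * Jᵀ.map (algebraMap ℝ A)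
      = J.map (algebraMap ℝ A) * Y * Jᵀ.map (algebraMap ℝ A)) : X = Y := by
  have e' : Ji.map (algebraMap ℝ A) * J.map (algebraMap ℝ A) = 1 :=
    map_mul_map_eq_one (mul_eq_one_comm.1 h)
  have e'' : Jᵀ.map (algebraMap ℝ A) * Jiᵀ.map (algebraMap ℝ A) = 1 :=
    map_mul_map_eq_one (by rw [← Matrix.transpose_mul, mul_eq_one_comm.1 h,
      Matrix.transpose_one])
  have key (X : Matrix ι ι A) : X = Ji.map (algebraMap ℝ A) * (J.map (algebraMap ℝ A) * X *
      Jᵀ.map (algebraMap ℝ A)) * Jiᵀ.map (algebraMap ℝ A) := by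
    calc X = Ji.map (algebraMap ℝ A) * J.map (algebraMap ℝ A) * X *
          (Jᵀ.map (algebraMap ℝ A) * Jiᵀ.map (algebraMap ℝ A)) := by simp [e', e'']
      _ = _ := by simp only [mul_assoc]
  rw [key X, H, ← key Y]

/-- The Ricci tensor and the metric transform by the same invertible conjugation. -/
theorem Ric_of_change (M : Geometry A ι) {J Ji : Matrix ι ι ℝ} (h : J * Ji = 1) (r : A)
    (H : ∀ b d, (M.change J Ji h).Ric b d = r * (M.change J Ji h).g b d) (b d : ι) :
    M.Ric b d = r * M.g b d := by
  have e : Matrix.of M.Ric = r • M.gMat := by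
    refine conj_injective h ?_
    ext b d
    have := H b d
    rw [Ric_change] at this
    rw [conj_apply]
    refine this.trans ?_
    rw [Matrix.mul_smul, Matrix.smul_mul]
    rfl
  exact congrFun (congrFun e b) d

end

section

variable {A : Type*} [CommRing A] [Algebra ℝ A] (M : Geometry A (Fin 4))

/-- The trace of the equation for the conformal factor of an Einstein metric. -/
def conformalTrace (s : A) : A :=
  algebraMap ℝ A (1 / 4) * ∑ a, ∑ e, M.gi a e * (M.hess s a e + s * M.schouten a e)

/-- Recovers `φ` as a trace of `∇²s + s P`. The formula for `φ` in `conformal_einstein` contains `Ω`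
and makes sense in the interior only, whereas this expression is smooth up to the boundary. -/
theorem conformalTrace_eq {s φ : A} (h : ∀ c b, M.hess s c b = φ * M.g c b - s * M.schouten c b) :
    M.conformalTrace s = φ := by
  have h4 : 4 * algebraMap ℝ A (1 / 4) = 1 := by
    rw [← map_ofNat (algebraMap ℝ A) 4, ← map_mul, ← map_one (algebraMap ℝ A)]; norm_num
  have h1 : ∑ a, ∑ e, M.gi a e * (M.hess s a e + s * M.schouten a e)
      = φ * ∑ a, ∑ e, M.gi a e * M.g a e := by
    simp only [h, sub_add_cancel, Finset.mul_sum]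
    exact Finset.sum_congr rfl fun a _ => Finset.sum_congr rfl fun e _ => by ring
  rw [conformalTrace, h1, M.trace_g]
  linear_combination φ * h4

variable {A' : Type*} [CommRing A'] [Algebra ℝ A'] (f : A →ₐ[ℝ] A')
  (D' : Fin 4 → Derivation ℝ A' A') (comm' : ∀ μ ν x, D' μ (D' ν x) = D' ν (D' μ x))
  (h : ∀ μ x, D' μ (f x) = f (M.D μ x))

theorem conformalTrace_map (s : A) :
    (M.map f D' comm' h).conformalTrace (f s) = f (M.conformalTrace s) := by
  simp only [conformalTrace, hess_map, schouten_map, map_mul, map_sum, map_add, AlgHom.commutes]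
  rfl

end

end Geometry

namespace DoubleNullMetric

namespace ConformalExtension

variable {g : DoubleNullMetric} (E : g.ConformalExtension) (c : SphereChart)
  {k : ℝ} (hE : g.IsEinstein k)
include hE

theorem Ric_phys (μ ν : Fin 4) :
    (E.phys c).Ric μ ν = algebraMap ℝ _ (-3 * k ^ 2) * (E.phys c).g μ ν := by
  ext x
  rw [← Geometry.ricci_eq c.isOpen_bulk (E.phys c) (E.phys_D c) _ (E.metric_eq_phys_g c),
    hE c x x.2, E.metric_eq_phys_g, map_mul, AlgHom.commutes]
  rfl

theorem Ric_physSlab (μ ν : Fin 4) : (E.physSlab c).Ric μ ν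
    = algebraMap ℝ _ (-3 * k ^ 2) * (E.OmFn c ^ 2 * (E.hatBulk c).g μ ν) :=
  (E.physSlab c).Ric_of_change nullFrame_mul_slabFrame _ (E.Ric_phys c hE) μ ν

/-- Both equations hold in the interior and all their terms are smooth up to the boundary, so
`res_injective` applies. -/
theorem hat_equations :
    (∀ a b, (E.hat c).hess (E.sFn c) a b = (E.hat c).conformalTrace (E.sFn c) * (E.hat c).g a b
      - E.sFn c * (E.hat c).schouten a b) ∧
    (E.hat c).gradSq (E.sFn c) = algebraMap ℝ _ (k ^ 2)
      + 2 * E.sFn c * (E.hat c).conformalTrace (E.sFn c) := by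
  obtain ⟨φ, h1, h2, -⟩ := (E.hatBulk c).conformal_einstein _ _ (E.res_sFn_mul c) k
    (E.Ric_physSlab c hE)
  have h3 : res c ((E.hat c).conformalTrace (E.sFn c)) = φ := by
    rw [← (E.hatBulk c).conformalTrace_eq h1]
    exact ((E.hat c).conformalTrace_map ..).symm
  refine ⟨fun a b => res_injective c ?_, res_injective c ?_⟩
  · rw [map_sub, map_mul, map_mul, h3]
    have := h1 a b
    rw [hess_hatBulk, schouten_hatBulk] at this
    exact this
  · rw [map_add, map_mul, map_mul, h3, AlgHom.commutes, map_ofNat]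
    have := h2
    rw [gradSq_hatBulk] at this
    exact this

theorem Rm_physSlab (a b c' d : Fin 4) : (E.physSlab c).Rm a b c' d
    = E.OmFn c ^ 2 * res c ((E.hat c).W a b c' d)
      - algebraMap ℝ _ (k ^ 2) * ((E.physSlab c).g a c' * (E.physSlab c).g b d
        - (E.physSlab c).g a d * (E.physSlab c).g b c') := by
  obtain ⟨φ, -, -, h⟩ := (E.hatBulk c).conformal_einstein _ _ (E.res_sFn_mul c) k
    (E.Ric_physSlab c hE)
  have := h a b c' d
  rw [W_hatBulk] at this
  exact this

end ConformalExtension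

end DoubleNullMetric

/-- The embedding of the boundary. -/
def scriEmbedding : Coord 3 →L[ℝ] Coord 4 := ContinuousLinearMap.pi
  ![(1 / 2 : ℝ) • ContinuousLinearMap.proj 0, (1 / 2 : ℝ) • ContinuousLinearMap.proj 0,
    ContinuousLinearMap.proj 1, ContinuousLinearMap.proj 2]

theorem scriEmbedding_apply (y : Coord 3) : scriEmbedding y = ![y 0 / 2, y 0 / 2, y 1, y 2] := by
  ext i
  fin_cases i <;> simp [scriEmbedding] <;> ring

theorem scriEmbedding_single (i : Fin 3) :
    scriEmbedding (Pi.single i 1) = slabVec i.succ := by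
  rw [scriEmbedding_apply]
  ext j
  fin_cases i <;> fin_cases j <;> simp [slabVec, slabFrame]

theorem angles_scriEmbedding (y : Coord 3) : angles (scriEmbedding y) = Fin.tail y := by
  rw [scriEmbedding_apply]
  ext A
  fin_cases A <;> simp [angles, ang, Fin.tail]

namespace SphereChart

variable (c : SphereChart)

theorem mapsTo_scri : Set.MapsTo scriEmbedding c.scri c.spacetime := by
  intro y hy
  refine ⟨?_, ?_⟩
  · rw [scriEmbedding_apply]
    exact ⟨(half_pos hy.1).le, le_rfl⟩
  · rw [angles_scriEmbedding]
    exact hy.2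

/-- The restriction to the boundary. -/
def bdry : SmoothFn c.spacetime →ₐ[ℝ] SmoothFn c.scri := SmoothFn.pull _ c.mapsTo_scri

theorem evalAt_bdry (f : SmoothFn c.spacetime) (y : c.scri) :
    SmoothFn.evalAt y (c.bdry f) = SmoothFn.evalAt ⟨scriEmbedding y, c.mapsTo_scri y.2⟩ f :=
  SmoothFn.evalAt_pull _ _ _ _

end SphereChart

namespace DoubleNullMetric

namespace ConformalExtension

variable {g : DoubleNullMetric} (E : g.ConformalExtension) (c : SphereChart)

theorem hat_D_rho (a : Fin 4) : (E.hat c).D a (rhoFn c) = if a = 0 then 1 else 0 := by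
  ext x
  change SmoothFn.evalAt x (SmoothFn.dir c.regular_spacetime (slabVec a) (rhoFn c)) = _
  refine (SmoothFn.dir_of ..).trans ?_
  let l : Coord 4 →L[ℝ] ℝ :=
    ContinuousLinearMap.proj (R := ℝ) (φ := fun _ : Fin 4 => ℝ) 1 - ContinuousLinearMap.proj 0
  have e : rstar = l := by ext y; simp [rstar, l]
  rw [e, ContinuousLinearMap.fderivWithin _ (c.regular_spacetime.uniqueDiff x x.2)]
  fin_cases a <;> simp [slabVec, slabFrame, l]; norm_num

/-- `s` is invertible in the interior, with inverse `Ω`, and the interior is dense. -/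
theorem sFn_regular (f : Fn c) (h : E.sFn c * f = 0) : f = 0 := by
  refine res_injective c ?_
  have h1 := congrArg (fun f => E.OmFn c * res c f) h
  simp only [map_mul, map_zero, mul_zero] at h1 ⊢
  linear_combination h1 - res c f * E.res_sFn_mul c

/-- The collar of the boundary at infinity. -/
def collar {k : ℝ} (hE : g.IsEinstein k) : Collar (E.hat c) (SmoothFn c.scri) where
  β := (c.bdry : Fn c →+* SmoothFn c.scri)
  δ i := SmoothFn.dir c.regular_scri (Pi.single i 1)
  ρ := rhoFn c
  ψ := E.psiFn c
  ψi := (E.psiFn c).inv fun x => (E.psiFn_neg c x).ne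
  φ := (E.hat c).conformalTrace (E.sFn c)
  κ := k ^ 2
  β_D i f := by
    have := SmoothFn.dir_pull c.regular_spacetime c.regular_scri scriEmbedding c.mapsTo_scri
      (Pi.single i 1) f
    rw [scriEmbedding_single] at this
    exact this.symm
  δ_comm _ _ _ := SmoothFn.dir_comm _ _ _ _
  gi_zero_zero := rfl
  gi_zero_one := rfl
  gi_sub a := by
    change Geometry.slabInverse _ _ 0 a - Geometry.slabInverse _ _ 1 a = _
    fin_cases a <;> simp [Geometry.slabInverse]
  β_ρ := by
    ext y
    have : rstar (scriEmbedding y) = 0 := by rw [scriEmbedding_apply]; simp [rstar]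
    rw [map_zero, ← this]
    exact c.evalAt_bdry _ _
  D_ρ := E.hat_D_rho c
  ψ_mul := SmoothFn.mul_inv _ _
  regular := E.sFn_regular c
  hess_eq := (E.hat_equations c hE).1
  gradSq_eq := (E.hat_equations c hE).2

end ConformalExtension

end DoubleNullMetric

end

/-! ### Conformal flatness of the boundary as an immersion into the light cone. -/

section

namespace SphereChart

variable (c : SphereChart)

theorem round_mulVec (θ : Coord 2) (a : Coord 2) :
    (c.round θ).mulVec a = fun B => inner ℝ (c.tangent θ B) (∑ A, a A • c.tangent θ A) := by
  ext B
  simp [Matrix.mulVec, dotProduct, round, inner_add_right, inner_smul_right, mul_comm]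

theorem isUnit_det_round {θ : Coord 2} (hθ : θ ∈ c.dom) : IsUnit (c.round θ).det := by
  rw [← Matrix.isUnit_iff_isUnit_det, ← Matrix.mulVec_injective_iff_isUnit]
  refine (injective_iff_map_eq_zero (Matrix.mulVecLin (c.round θ))).2 fun a ha => ?_
  by_contra h
  refine c.tangent_sum_ne_zero hθ h ?_
  rw [Matrix.mulVecLin_apply, round_mulVec] at ha
  rw [← inner_self_eq_zero (𝕜 := ℝ), sum_inner]
  refine Finset.sum_eq_zero fun B _ => ?_
  rw [inner_smul_left, congrFun ha B]
  simp

/-- The two coordinate vectors are independent and lie in the plane orthogonal to the point, hence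
span it. -/
theorem sum_vecComp {θ : Coord 2} (hθ : θ ∈ c.dom) {w : E3}
    (hw : inner ℝ (c.toSphere θ : E3) w = 0) : ∑ A, c.vecComp θ w A • c.tangent θ A = w := by
  have hle : Submodule.span ℝ (Set.range (c.tangent θ)) ≤ (ℝ ∙ (c.toSphere θ : E3))ᗮ := by
    rw [Submodule.span_le]
    rintro _ ⟨A, rfl⟩
    exact Submodule.mem_orthogonal_singleton_iff_inner_right.2 (c.tangent_orthogonal hθ A)
  have hne : (c.toSphere θ : E3) ≠ 0 := ne_zero_of_mem_unit_sphere _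
  have : Fact (Module.finrank ℝ E3 = 2 + 1) := ⟨by simp⟩
  have hli : LinearIndependent ℝ (c.tangent θ) := c.immersion θ hθ
  have heq := Submodule.eq_of_le_of_finrank_eq hle (by
    rw [finrank_span_eq_card hli, Submodule.finrank_orthogonal_span_singleton (n := 2) hne]
    simp)
  have hm : w ∈ Submodule.span ℝ (Set.range (c.tangent θ)) := by
    rw [heq]; exact Submodule.mem_orthogonal_singleton_iff_inner_right.2 hw
  obtain ⟨a, rfl⟩ := (Submodule.mem_span_range_iff_exists_fun ℝ).1 hm
  have : c.vecComp θ (∑ A, a A • c.tangent θ A) = a := by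
    rw [vecComp, ← round_mulVec, Matrix.mulVec_mulVec, Matrix.nonsing_inv_mul _
      (c.isUnit_det_round hθ), Matrix.one_mulVec]
  rw [this]

end SphereChart

/-- On the cone `⟨z, z⟩ = 0` and therefore `⟨z, dz⟩ = 0`, so derivatives of the factor do not
contribute: rescaling along the cone is a conformal change of the induced metric. -/
theorem diagForm_vecD_smul {B : Type*} [CommRing B] [Algebra ℝ B] {V : Type*} [Fintype V]
    {η : V → ℝ} {z : V → B} (hz : diagForm η z z = 0) (μ : B) (d d' : Derivation ℝ B B) :
    diagForm η (vecD d (μ • z)) (vecD d' (μ • z))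
      = μ * μ * diagForm η (vecD d z) (vecD d' z) := by
  have h (d : Derivation ℝ B B) : diagForm η z (vecD d z) = 0 := by
    have := derivation_diagForm η d z z
    rw [hz, map_zero, diagForm_comm η (vecD d z)] at this
    apply two_mul_cancel
    linear_combination -this
  have h' (X : V → B) : diagForm η (d μ • z + μ • vecD d z) X
      = d μ * diagForm η z X + μ * diagForm η (vecD d z) X := by
    rw [diagForm_comm, diagForm_add, diagForm_smul, diagForm_smul, diagForm_comm η X,
      diagForm_comm η X]
  rw [vecD_smul, vecD_smul, h', diagForm_add, diagForm_add, diagForm_smul, diagForm_smul,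
    diagForm_smul, diagForm_smul, hz, h, diagForm_comm η (vecD d z) z, h]
  ring

namespace DoubleNullMetric

namespace ConformalExtension

variable {g : DoubleNullMetric} (E : g.ConformalExtension) (c : SphereChart)

theorem boundaryMetric_eq (y : c.scri) (V V₁ : Coord 3) :
    E.boundaryMetric (y.1 0) (c.toSphere (Fin.tail y.1))
      (V 0) (∑ A, Fin.tail V A • c.tangent (Fin.tail y.1) A)
      (V₁ 0) (∑ A, Fin.tail V₁ A • c.tangent (Fin.tail y.1) A)
    = -(V 0 * V₁ 0) + eval2 (c.form E.h (scriEmbedding y.1))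
      (fun A => Fin.tail V A - V 0 / 2 * c.vector E.shift (scriEmbedding y.1) A)
      (fun A => Fin.tail V₁ A - V₁ 0 / 2 * c.vector E.shift (scriEmbedding y.1) A) := by
  have h0 : (scriEmbedding y.1) 0 = y.1 0 / 2 := by rw [scriEmbedding_apply]; rfl
  have h1 : (scriEmbedding y.1) 1 = y.1 0 / 2 := by rw [scriEmbedding_apply]; rfl
  have hs := c.sum_vecComp y.2.2
    (E.shift_tangent (y.1 0 / 2) (c.toSphere (Fin.tail y.1)) (half_pos y.2.1).le)
  have hX (V : Coord 3) : ∑ A, Fin.tail V A • c.tangent (Fin.tail y.1) A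
      - (V 0 / 2) • E.shift (y.1 0 / 2) (y.1 0 / 2) (c.toSphere (Fin.tail y.1))
      = ∑ A, (Fin.tail V A - V 0 / 2 * c.vector E.shift (scriEmbedding y.1) A) •
        c.tangent (Fin.tail y.1) A := by
    conv_lhs => rw [← hs]
    rw [Finset.smul_sum, ← Finset.sum_sub_distrib]
    refine Finset.sum_congr rfl fun A _ => ?_
    rw [sub_smul, mul_smul, SphereChart.vector, angles_scriEmbedding, h0, h1]
  rw [boundaryMetric, hX, hX, ← SphereChart.form_apply, angles_scriEmbedding, h0, h1]

/-- The tangential components of the rescaled metric at `ρ = 0` are those of the boundary metric in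
the hypothesis on conformal flatness. -/
theorem evalAt_boundary_g {k : ℝ} (hE : g.IsEinstein k) (y : c.scri) (i j : Fin 3) :
    SmoothFn.evalAt y ((E.collar c hE).β ((E.hat c).g i.succ j.succ))
      = E.boundaryMetric (y.1 0) (c.toSphere (Fin.tail y.1))
      ((Pi.single i 1 : Coord 3) 0)
      (∑ A, Fin.tail (Pi.single i 1 : Coord 3) A • c.tangent (Fin.tail y.1) A)
      ((Pi.single j 1 : Coord 3) 0)
      (∑ A, Fin.tail (Pi.single j 1 : Coord 3) A • c.tangent (Fin.tail y.1) A) := by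
  have hs := congrArg (SmoothFn.evalAt (⟨_, c.mapsTo_scri y.2⟩ : c.spacetime)) (E.hFn_symm c 0 1)
  simp only [evalAt_hFn] at hs
  rw [boundaryMetric_eq]
  refine (c.evalAt_bdry _ _).trans ?_
  change SmoothFn.evalAt _ (Geometry.slabMetric (E.hFn c) (E.halfShift c) _ _) = _
  fin_cases i <;> fin_cases j <;>
    simp [Geometry.slabMetric, evalAt_hFn, evalAt_halfShift, eval2, Fin.tail, hs,
      Fin.sum_univ_two] <;> ring1

/-- The conformal immersion of the boundary into the light cone. -/
theorem nonempty_cone {k : ℝ} (hE : g.IsEinstein k) (hC : E.ConformalToCylinder k) :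
    Nonempty (E.collar c hE).Cone := by
  obtain ⟨F, Q, lam, hlam, H⟩ := hC
  obtain ⟨hF, hQ, hm⟩ := H c
  set Fc : Coord 3 → ℝ := fun y => F (y 0) (c.toSphere (Fin.tail y)) with hFc
  set Qc : Coord 3 → E3 := fun y => (Q (y 0) (c.toSphere (Fin.tail y)) : E3) with hQc
  set K := E.collar c hE with hK
  have dF (y : c.scri) : DifferentiableAt ℝ Fc y :=
    ((hF y y.2).contDiffAt (c.isOpen_scri.mem_nhds y.2)).differentiableAt (by simp)
  have dQ (y : c.scri) : DifferentiableAt ℝ Qc y :=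
    ((hQ y y.2).contDiffAt (c.isOpen_scri.mem_nhds y.2)).differentiableAt (by simp)
  have hδ (i : Fin 3) (f : Coord 3 → ℝ) (hf : ContDiffOn ℝ ∞ f c.scri) (y : c.scri) :
      SmoothFn.evalAt y (K.δ i (.of f hf)) = fderiv ℝ f y (Pi.single i 1) :=
    (SmoothFn.dir_of c.regular_scri ..).trans (by rw [fderivWithin_of_isOpen c.isOpen_scri y.2])
  -- The map `(cos kF, sin kF, Q)` takes values in the light cone of signature `(2, 3)` because `|Q|
  -- = 1`, and it induces the pullback of `-k² dt² + γ`.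
  let C : SmoothFn c.scri := .of (fun y => Real.cos (k * Fc y)) (contDiffOn_const.mul hF).cos
  let Sn : SmoothFn c.scri := .of (fun y => Real.sin (k * Fc y)) (contDiffOn_const.mul hF).sin
  let q (v : Fin 3) : SmoothFn c.scri := .of (fun y => Qc y v) (contDiffOn_euclidean.1 hQ v)
  let η : Fin 2 ⊕ Fin 3 → ℝ := Sum.elim (fun _ => -1) (fun _ => 1)
  let z : Fin 2 ⊕ Fin 3 → SmoothFn c.scri := Sum.elim ![C, Sn] q
  have hz : diagForm η z z = 0 := by
    ext y
    have h1 : ∑ v, Qc y v * Qc y v = 1 := by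
      have : inner ℝ (Qc y) (Qc y) = 1 := by
        rw [real_inner_self_eq_norm_sq, hQc, norm_eq_of_mem_sphere, one_pow]
      rw [← this, PiLp.inner_apply]
      rfl
    simp [diagForm, η, z, C, Sn, q, h1, Fin.sum_univ_two]
    linarith [Real.sin_sq_add_cos_sq (k * Fc y)]
  let p (i j : Fin 3) : SmoothFn c.scri := diagForm η (vecD (K.δ i) z) (vecD (K.δ j) z)
  have hp (i j : Fin 3) (y : c.scri) : SmoothFn.evalAt y (p i j)
      = -k ^ 2 * (fderiv ℝ Fc y (Pi.single i 1) * fderiv ℝ Fc y (Pi.single j 1))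
        + inner ℝ (fderiv ℝ Qc y (Pi.single i 1)) (fderiv ℝ Qc y (Pi.single j 1)) := by
    have hc (i : Fin 3) : SmoothFn.evalAt y (K.δ i C)
        = -Real.sin (k * Fc y) * (k * fderiv ℝ Fc y (Pi.single i 1)) := by
      rw [hδ, (((dF y).hasFDerivAt.const_mul k).cos).fderiv]
      simp
    have hs (i : Fin 3) : SmoothFn.evalAt y (K.δ i Sn)
        = Real.cos (k * Fc y) * (k * fderiv ℝ Fc y (Pi.single i 1)) := by
      rw [hδ, (((dF y).hasFDerivAt.const_mul k).sin).fderiv]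
      simp
    have hq (i v : Fin 3) : SmoothFn.evalAt y (K.δ i (q v))
        = (fderiv ℝ Qc y (Pi.single i 1)) v := by
      have := ((EuclideanSpace.proj v : E3 →L[ℝ] ℝ).hasFDerivAt.comp _ (dQ y).hasFDerivAt).fderiv
      refine (hδ i _ _ y).trans ?_
      have h2 : (fun y => Qc y v) = (EuclideanSpace.proj v : E3 →L[ℝ] ℝ) ∘ Qc := rfl
      rw [h2, this]
      rfl
    have hi : inner ℝ (fderiv ℝ Qc y (Pi.single i 1)) (fderiv ℝ Qc y (Pi.single j 1))
        = ∑ v, (fderiv ℝ Qc y (Pi.single i 1)) v * (fderiv ℝ Qc y (Pi.single j 1)) v := by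
      rw [PiLp.inner_apply]
      exact Finset.sum_congr rfl fun v _ => mul_comm _ _
    rw [hi]
    simp [p, diagForm, η, z, vecD, hc, hs, hq, Fin.sum_univ_two]
    linear_combination (-k ^ 2 * (fderiv ℝ Fc y (Pi.single i 1)) *
      (fderiv ℝ Fc y (Pi.single j 1))) * Real.sin_sq_add_cos_sq (k * Fc y)
  have hpg (i j : Fin 3) (y : c.scri) :
      SmoothFn.evalAt y (K.β ((E.hat c).g i.succ j.succ))
        = lam (y.1 0) (c.toSphere (Fin.tail y.1)) * SmoothFn.evalAt y (p i j) := by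
    rw [hp, hK, evalAt_boundary_g, hm y.1 y.2]
  -- No regularity of `lam` is assumed. The trace of the pulled back metric with respect to the
  -- boundary metric is smooth and equals `3 / lam`, which shows that `lam` is smooth and makes its
  -- square root available as the rescaling factor.
  let S : SmoothFn c.scri := ∑ i, ∑ j, K.γ i j * p i j
  have hS (y : c.scri) : lam (y.1 0) (c.toSphere (Fin.tail y.1)) * SmoothFn.evalAt y S = 3 := by
    have h1 : ∑ i, ∑ j, K.β ((E.hat c).g i.succ j.succ) * K.γ j i = 3 := by
      simp [K.g_γ]
    have h2 := congrArg (SmoothFn.evalAt y) h1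
    simp only [map_sum, map_mul, hpg, map_ofNat] at h2
    rw [← h2]
    simp only [S, map_sum, map_mul, Finset.mul_sum]
    exact Finset.sum_congr rfl fun i _ => Finset.sum_congr rfl fun j _ => by
      rw [K.γ_symm]; ring
  have hSpos (y : c.scri) : 0 < SmoothFn.evalAt y S := by
    have h1 := hlam (y.1 0) (c.toSphere (Fin.tail y.1)) y.2.1
    by_contra h
    have := mul_nonpos_of_nonneg_of_nonpos h1.le (not_lt.1 h)
    linarith [hS y]
  have hSfn (y : Coord 3) (hy : y ∈ c.scri) : 0 < S.fn y := by
    rw [S.fn_apply' hy]; exact hSpos _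
  let μ : SmoothFn c.scri := .of (fun y => Real.sqrt (3 / S.fn y))
    ((contDiffOn_const.div S.contDiffOn fun y hy => (hSfn y hy).ne').sqrt
      fun y hy => (div_pos three_pos (hSfn y hy)).ne')
  have hμ (y : c.scri) : SmoothFn.evalAt y μ * SmoothFn.evalAt y μ
      = lam (y.1 0) (c.toSphere (Fin.tail y.1)) := by
    change Real.sqrt (3 / S.fn y) * Real.sqrt (3 / S.fn y) = _
    rw [Real.mul_self_sqrt (div_pos three_pos (hSfn y y.2)).le, ← hS y, S.fn_apply]
    field_simp [(hSpos y).ne']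
  refine ⟨⟨η, μ • z, ?_, ?_, ?_⟩⟩
  · rintro (v | v) <;> simp [η]
  · rw [diagForm_smul, diagForm_comm, diagForm_smul, hz, mul_zero, mul_zero]
  · intro i j
    ext y
    rw [diagForm_vecD_smul hz, map_mul, map_mul, hμ]
    exact (hpg i j y).symm

end ConformalExtension

end DoubleNullMetric

end

/-! ### Limits at infinity along radial segments. -/

section

namespace SphereChart

variable (c : SphereChart)

/-- The boundary points. -/
abbrev infinity : Set (Coord 4) := {z | z 1 = z 0 ∧ 0 ≤ z 0 ∧ angles z ∈ c.dom}

theorem infinity_subset : c.infinity ⊆ c.spacetime := by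
  rintro z ⟨h1, h2, h3⟩
  exact ⟨⟨h1.symm ▸ h2, h1.le⟩, h3⟩

variable {c}

/-- A function that vanishes on the boundary at positive times vanishes on the boundary. -/
theorem evalAt_eq_zero_of_bdry {f : SmoothFn c.spacetime} (hf : c.bdry f = 0) {z : Coord 4}
    (hz : z ∈ c.infinity) : SmoothFn.evalAt ⟨z, c.infinity_subset hz⟩ f = 0 := by
  -- Approach `z` inside the boundary from later times; this covers the point `t = 0`.
  let p (ε : ℝ) : Coord 4 := z + ε • (![1, 1, 0, 0] : Coord 4)
  let y (ε : ℝ) : Coord 3 := ![2 * (z 0 + ε), z 2, z 3]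
  have hy (ε : ℝ) : scriEmbedding (y ε) = p ε := by
    rw [scriEmbedding_apply]
    have hz1 : z 1 = z 0 := hz.1
    have e (i : Fin 4) : p ε i = z i + ε * (![1, 1, 0, 0] : Coord 4) i := rfl
    ext i
    rw [e]
    fin_cases i
    · change 2 * (z 0 + ε) / 2 = z 0 + ε * 1
      ring
    · change 2 * (z 0 + ε) / 2 = z 1 + ε * 1
      rw [hz1]; ring
    · change z 2 = z 2 + ε * 0
      ring
    · change z 3 = z 3 + ε * 0
      ring
  have ha (ε : ℝ) : Fin.tail (y ε) = angles z := by
    ext A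
    fin_cases A <;> simp [y, Fin.tail, angles, ang]
  have hm (ε : ℝ) (hε : 0 < ε) : y ε ∈ c.scri := by
    refine ⟨?_, by rw [ha]; exact hz.2.2⟩
    have : 0 ≤ z 0 := hz.2.1
    simp only [y, Matrix.cons_val_zero]
    linarith
  have hp : Filter.Tendsto p (𝓝[>] 0) (𝓝[c.spacetime] z) := by
    refine tendsto_nhdsWithin_iff.2 ⟨?_, ?_⟩
    · have : Continuous p := by fun_prop
      have h := this.tendsto 0
      simp only [p, zero_smul, add_zero] at h
      exact h.mono_left nhdsWithin_le_nhds
    · filter_upwards [self_mem_nhdsWithin] with ε hε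
      rw [← hy]
      exact c.mapsTo_scri (hm ε hε)
  rw [← SmoothFn.fn_apply]
  refine tendsto_nhds_unique ((f.continuousOn z (c.infinity_subset hz)).tendsto.comp hp) ?_
  refine tendsto_const_nhds.congr' ?_
  filter_upwards [self_mem_nhdsWithin] with ε hε
  have := congrArg (SmoothFn.evalAt ⟨y ε, hm ε hε⟩) hf
  rw [evalAt_bdry, map_zero, ← SmoothFn.fn_apply] at this
  rw [Function.comp_apply, ← hy]
  exact this.symm

/-- The radial derivative. -/
abbrev radial (c : SphereChart) :
    Derivation ℝ (SmoothFn c.spacetime) (SmoothFn c.spacetime) :=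
  SmoothFn.dir c.regular_spacetime (slabVec 0)

/-- The mean value theorem on the radial segments that end on the boundary. -/
theorem exists_radial_mean_value {f p : SmoothFn c.spacetime} (hf : c.bdry f = 0)
    (hp : c.bdry p = 0) {x : Coord 4} (hx : x ∈ c.bulk) :
    ∃ τ ∈ Set.Ioo 0 (-rstar x), x + τ • slabVec 0 ∈ c.bulk ∧
      p.fn x * (c.radial f).fn (x + τ • slabVec 0) = f.fn x * (c.radial p).fn (x + τ • slabVec 0) := by
  have h0 (τ : ℝ) : (x + τ • slabVec 0) 0 = x 0 - τ / 2 := by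
    simp [slabVec, slabFrame]; ring
  have h1 (τ : ℝ) : (x + τ • slabVec 0) 1 = x 1 + τ / 2 := by
    simp [slabVec, slabFrame]; ring
  have ha (τ : ℝ) : angles (x + τ • slabVec 0) = angles x := by
    ext A; fin_cases A <;> simp [slabVec, slabFrame, angles, ang]
  have hx1 : 0 < x 1 := hx.1.1
  have hx2 : x 1 < x 0 := hx.1.2
  have hr : 0 < -rstar x := by rw [rstar]; linarith
  have hbulk (τ : ℝ) (hτ : τ ∈ Set.Ico 0 (-rstar x)) : x + τ • slabVec 0 ∈ c.bulk := by
    obtain ⟨h3, h4⟩ := hτ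
    rw [rstar] at h4
    refine ⟨⟨?_, ?_⟩, by rw [ha]; exact hx.2⟩
    · simp only [h1]; linarith
    · simp only [h0, h1]; linarith
  have hinf : x + (-rstar x) • slabVec 0 ∈ c.infinity := by
    refine ⟨?_, ?_, by rw [ha]; exact hx.2⟩
    · rw [h0, h1, rstar]; ring
    · rw [h0, rstar]; linarith
  have hmem (τ : ℝ) (hτ : τ ∈ Set.Icc 0 (-rstar x)) : x + τ • slabVec 0 ∈ c.spacetime := by
    rcases hτ.2.lt_or_eq with h | h
    · exact c.bulk_subset (hbulk τ ⟨hτ.1, h⟩)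
    · exact h ▸ c.infinity_subset hinf
  have hcont (f : SmoothFn c.spacetime) :
      ContinuousOn (fun τ : ℝ => f.fn (x + τ • slabVec 0)) (Set.Icc 0 (-rstar x)) :=
    f.continuousOn.comp (by fun_prop) hmem
  have hder (f : SmoothFn c.spacetime) (τ : ℝ) (hτ : τ ∈ Set.Ioo 0 (-rstar x)) :
      HasDerivAt (fun τ : ℝ => f.fn (x + τ • slabVec 0)) ((c.radial f).fn (x + τ • slabVec 0)) τ := by
    have hb := hbulk τ ⟨hτ.1.le, hτ.2⟩
    have hn : c.spacetime ∈ 𝓝 (x + τ • slabVec 0) :=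
      Filter.mem_of_superset (c.isOpen_bulk.mem_nhds hb) c.bulk_subset
    rw [SmoothFn.fn_dir _ _ _ (c.bulk_subset hb), fderivWithin_of_mem_nhds hn]
    have hd : DifferentiableAt ℝ f.fn (x + τ • slabVec 0) :=
      (f.differentiableWithinAt ⟨_, c.bulk_subset hb⟩).differentiableAt hn
    have hl : HasDerivAt (fun τ : ℝ => x + τ • slabVec 0) (slabVec 0) τ := by
      simpa using ((hasDerivAt_id τ).smul_const (slabVec 0)).const_add x
    exact hd.hasFDerivAt.comp_hasDerivAt τ hl
  -- Cauchy's mean value theorem on the segment from `x` to infinity, where both functions vanish.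
  obtain ⟨τ, hτ, h⟩ := exists_ratio_hasDerivAt_eq_ratio_slope _ _ hr (hcont f) (hder f) _ _
    (hcont p) (hder p)
  have hv (f : SmoothFn c.spacetime) (hf : c.bdry f = 0) : f.fn (x + (-rstar x) • slabVec 0) = 0 := by
    rw [f.fn_apply' (c.infinity_subset hinf)]
    exact evalAt_eq_zero_of_bdry hf hinf
  refine ⟨τ, hτ, hbulk τ ⟨hτ.1.le, hτ.2⟩, ?_⟩
  simp only [hv f hf, hv p hp, zero_smul, add_zero, zero_sub] at h
  linarith

theorem approach_le (z : Coord 4) : approach c z ≤ 𝓝[c.spacetime] z :=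
  nhdsWithin_mono _ c.bulk_subset

theorem tendsto_fn (f : SmoothFn c.spacetime) {z : Coord 4} (hz : z ∈ c.infinity) :
    Filter.Tendsto f.fn (approach c z) (𝓝 (SmoothFn.evalAt ⟨z, c.infinity_subset hz⟩ f)) := by
  rw [← SmoothFn.fn_apply]
  exact (f.continuousOn z (c.infinity_subset hz)).mono_left (c.approach_le z)

/-- A function with values on radial segments converges. -/
theorem tendsto_of_radial (f : SmoothFn c.spacetime) {z : Coord 4} (hz : z ∈ c.infinity)
    {F : Coord 4 → ℝ} (h : ∀ x ∈ c.bulk, ∃ τ ∈ Set.Ioo 0 (-rstar x), x + τ • slabVec 0 ∈ c.bulk ∧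
      F x = f.fn (x + τ • slabVec 0)) :
    Filter.Tendsto F (approach c z) (𝓝 (SmoothFn.evalAt ⟨z, c.infinity_subset hz⟩ f)) := by
  choose! τ hτ hm hF using h
  have hr : Filter.Tendsto (fun x => -rstar x) (approach c z) (𝓝 0) := by
    have : Continuous fun x => -rstar x := by unfold rstar; fun_prop
    have h := this.tendsto z
    simp only [rstar, hz.1, sub_self, neg_zero] at h
    exact h.mono_left nhdsWithin_le_nhds
  have ht : Filter.Tendsto τ (approach c z) (𝓝 0) := by
    refine tendsto_of_tendsto_of_tendsto_of_le_of_le' tendsto_const_nhds hr ?_ ?_ <;>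
    filter_upwards [self_mem_nhdsWithin] with x hx
    · exact (hτ x hx).1.le
    · exact (hτ x hx).2.le
  have hξ : Filter.Tendsto (fun x => x + τ x • slabVec 0) (approach c z) (approach c z) := by
    refine tendsto_nhdsWithin_iff.2 ⟨?_, ?_⟩
    · have := (Filter.tendsto_id.mono_left (nhdsWithin_le_nhds (a := z) (s := c.bulk))).add
        (ht.smul_const (slabVec 0))
      simp only [id_eq, zero_smul, add_zero] at this
      exact this
    · filter_upwards [self_mem_nhdsWithin] with x hx
      exact hm x hx
  refine ((tendsto_fn f hz).comp hξ).congr' ?_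
  filter_upwards [self_mem_nhdsWithin] with x hx
  exact (hF x hx).symm

end SphereChart

namespace DoubleNullMetric

namespace ConformalExtension

variable {c : SphereChart}

theorem bdry_rhoFn : c.bdry (rhoFn c) = 0 := by
  ext y
  have : rstar (scriEmbedding y) = 0 := by rw [scriEmbedding_apply]; simp [rstar]
  rw [map_zero, ← this]
  exact c.evalAt_bdry _ _

theorem fn_rhoFn {x : Coord 4} (hx : x ∈ c.bulk) : (rhoFn c).fn x = rstar x :=
  SmoothFn.fn_of _ _ (c.bulk_subset hx)

theorem rstar_ne_zero {x : Coord 4} (hx : x ∈ c.bulk) : rstar x ≠ 0 :=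
  (sub_neg.2 hx.1.2).ne

theorem radial_rhoFn : c.radial (rhoFn c) = 1 := by
  ext x
  refine (SmoothFn.dir_of ..).trans ?_
  let l : Coord 4 →L[ℝ] ℝ :=
    ContinuousLinearMap.proj (R := ℝ) (φ := fun _ : Fin 4 => ℝ) 1 - ContinuousLinearMap.proj 0
  have e : rstar = l := by ext y; simp [rstar, l]
  rw [e, ContinuousLinearMap.fderivWithin _ (c.regular_spacetime.uniqueDiff x x.2)]
  simp [slabVec, slabFrame, l]; norm_num

theorem fn_mul (f h : Fn c) {x : Coord 4} (hx : x ∈ c.bulk) :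
    (f * h).fn x = f.fn x * h.fn x := by
  simp only [SmoothFn.fn_apply' _ (c.bulk_subset hx), map_mul]

theorem fn_sub (f h : Fn c) {x : Coord 4} (hx : x ∈ c.bulk) :
    (f - h).fn x = f.fn x - h.fn x := by
  simp only [SmoothFn.fn_apply' _ (c.bulk_subset hx), map_sub]

/-- The limit of the quotient by the defining function of the boundary. -/
theorem tendsto_div_rstar {f : Fn c} (hf : c.bdry f = 0) {z : Coord 4} (hz : z ∈ c.infinity) :
    Filter.Tendsto (fun x => (rstar x)⁻¹ * f.fn x) (approach c z)
      (𝓝 (SmoothFn.evalAt ⟨z, c.infinity_subset hz⟩ (c.radial f))) := by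
  refine SphereChart.tendsto_of_radial _ hz fun x hx => ?_
  obtain ⟨τ, hτ, hm, h⟩ := SphereChart.exists_radial_mean_value hf bdry_rhoFn hx
  refine ⟨τ, hτ, hm, ?_⟩
  have hr := rstar_ne_zero hx
  rw [radial_rhoFn, fn_rhoFn hx, SmoothFn.fn_apply' 1 (c.bulk_subset hm), map_one, mul_one] at h
  rw [← h]
  field_simp

/-- The limit of the radial derivative of the quotient by the defining function of the boundary. -/
theorem tendsto_radial_div_rstar {f : Fn c} (hf : c.bdry f = 0) {z : Coord 4}
    (hz : z ∈ c.infinity) :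
    Filter.Tendsto (fun x => (rstar x)⁻¹ * (c.radial f).fn x - (rstar x ^ 2)⁻¹ * f.fn x)
      (approach c z)
      (𝓝 (1 / 2 * SmoothFn.evalAt ⟨z, c.infinity_subset hz⟩ (c.radial (c.radial f)))) := by
  have h2 : Filter.Tendsto (fun x => 2 * ((rstar x)⁻¹ * (c.radial f).fn x
      - (rstar x ^ 2)⁻¹ * f.fn x)) (approach c z)
      (𝓝 (SmoothFn.evalAt ⟨z, c.infinity_subset hz⟩ (c.radial (c.radial f)))) := by
    refine SphereChart.tendsto_of_radial _ hz fun x hx => ?_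
    -- The quantity is `(ρ ∂_ρ f - f) / ρ²`. Numerator and denominator vanish at infinity and their
    -- radial derivatives are `ρ ∂_ρ² f` and `2 ρ`, which explains the factor `1/2`.
    have h0 : c.bdry (rhoFn c * c.radial f - f) = 0 := by
      rw [map_sub, map_mul, bdry_rhoFn, hf, zero_mul, sub_zero]
    have h1 : c.bdry (rhoFn c * rhoFn c) = 0 := by rw [map_mul, bdry_rhoFn, zero_mul]
    obtain ⟨τ, hτ, hm, h⟩ := SphereChart.exists_radial_mean_value h0 h1 hx
    refine ⟨τ, hτ, hm, ?_⟩
    have hr := rstar_ne_zero hx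
    have hr' := rstar_ne_zero hm
    have e1 : c.radial (rhoFn c * c.radial f - f) = rhoFn c * c.radial (c.radial f) := by
      rw [map_sub, Derivation.leibniz, radial_rhoFn]; simp
    have e2 : c.radial (rhoFn c * rhoFn c) = rhoFn c + rhoFn c := by
      rw [Derivation.leibniz, radial_rhoFn]; simp
    rw [e1, e2, fn_mul _ _ hm, fn_mul _ _ hx, fn_sub _ _ hx, fn_mul _ _ hx,
      SmoothFn.fn_apply' (rhoFn c + rhoFn c) (c.bulk_subset hm), map_add,
      ← SmoothFn.fn_apply' (rhoFn c) (c.bulk_subset hm), fn_rhoFn hx, fn_rhoFn hm] at h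
    have h3 : rstar x ^ 2 * (c.radial (c.radial f)).fn (x + τ • slabVec 0)
        = 2 * (rstar x * (c.radial f).fn x - f.fn x) :=
      mul_left_cancel₀ hr' (by linear_combination h)
    field_simp
    linear_combination -h3
  have := h2.const_mul (1 / 2 : ℝ)
  refine this.congr fun x => ?_
  ring

end ConformalExtension

end DoubleNullMetric

end

/-! ### Null components of the spacetime Weyl tensor in terms of the rescaled one. -/

section

section FourfoldSums

variable {ι : Type*} [Fintype ι]

theorem sum_pull (f : ι → ι → ι → ι → ι → ℝ) :
    ∑ κ, ∑ l, ∑ μ, ∑ ν, ∑ a, f κ l μ ν a = ∑ a, ∑ κ, ∑ l, ∑ μ, ∑ ν, f κ l μ ν a := by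
  calc _ = ∑ κ, ∑ l, ∑ μ, ∑ a, ∑ ν, f κ l μ ν a :=
        Finset.sum_congr rfl fun κ _ => Finset.sum_congr rfl fun l _ =>
          Finset.sum_congr rfl fun μ _ => Finset.sum_comm
    _ = ∑ κ, ∑ l, ∑ a, ∑ μ, ∑ ν, f κ l μ ν a :=
        Finset.sum_congr rfl fun κ _ => Finset.sum_congr rfl fun l _ => Finset.sum_comm
    _ = ∑ κ, ∑ a, ∑ l, ∑ μ, ∑ ν, f κ l μ ν a :=
        Finset.sum_congr rfl fun κ _ => Finset.sum_comm
    _ = _ := Finset.sum_comm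

theorem sum_pull_four (f : ι → ι → ι → ι → ι → ι → ι → ι → ℝ) :
    ∑ κ, ∑ l, ∑ μ, ∑ ν, ∑ a, ∑ b, ∑ c, ∑ d, f κ l μ ν a b c d
      = ∑ a, ∑ b, ∑ c, ∑ d, ∑ κ, ∑ l, ∑ μ, ∑ ν, f κ l μ ν a b c d := by
  rw [sum_pull]
  refine Finset.sum_congr rfl fun a _ => ?_
  rw [sum_pull]
  refine Finset.sum_congr rfl fun b _ => ?_
  rw [sum_pull]
  refine Finset.sum_congr rfl fun c _ => ?_
  rw [sum_pull]

theorem sum_prod_four (r : ℝ) (f g h k : ι → ℝ) :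
    ∑ κ, ∑ l, ∑ μ, ∑ ν, r * f κ * g l * h μ * k ν
      = r * (∑ κ, f κ) * (∑ l, g l) * (∑ μ, h μ) * ∑ ν, k ν := by
  simp only [← Finset.mul_sum, ← Finset.sum_mul]

theorem sum_prod_two (n m p q : ι → ℝ) (G : ι → ι → ℝ) :
    ∑ a, ∑ b, ∑ c, ∑ d, n a * m b * p c * q d * (G a c * G b d)
      = (∑ a, ∑ c, n a * p c * G a c) * ∑ b, ∑ d, m b * q d * G b d := by
  simp only [Finset.sum_mul_sum]
  exact Finset.sum_congr rfl fun a _ => Finset.sum_congr rfl fun b _ =>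
    Finset.sum_congr rfl fun c _ => Finset.sum_congr rfl fun d _ => by ring

theorem sum_prod_two' (n m p q : ι → ℝ) (G : ι → ι → ℝ) :
    ∑ a, ∑ b, ∑ c, ∑ d, n a * m b * p c * q d * (G a d * G b c)
      = (∑ a, ∑ d, n a * q d * G a d) * ∑ b, ∑ c, m b * p c * G b c := by
  simp only [Finset.sum_mul_sum]
  refine Finset.sum_congr rfl fun a _ => Finset.sum_congr rfl fun b _ => ?_
  rw [Finset.sum_comm]
  exact Finset.sum_congr rfl fun d _ => Finset.sum_congr rfl fun c _ => by ring

end FourfoldSums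

/-- The components of a vector in the coordinates `(r⋆, t, θ)`. -/
def slabComp (X : Coord 4) (a : Fin 4) : ℝ := ∑ κ, X κ * nullFrame κ a

namespace DoubleNullMetric

namespace ConformalExtension

variable {g : DoubleNullMetric} (E : g.ConformalExtension) (c : SphereChart)

/-- A point of the interior as a point of the spacetime. -/
abbrev toSpacetime {c : SphereChart} (x : c.bulk) : c.spacetime := ⟨x.1, c.bulk_subset x.2⟩

theorem evalAt_OmFn (x : c.bulk) : SmoothFn.evalAt x (E.OmFn c) = (c.gauge g).Om x.1 := rfl

/-- The constant curvature part of the Einstein metric cancels the trace terms, which leaves the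
conformally covariant `Ω² Ŵ`. -/
theorem weyl_eq {k : ℝ} (hE : g.IsEinstein k) (x : c.bulk) (κ l μ ν : Fin 4) :
    weyl (c.gauge g).metric κ l μ ν x.1 = (c.gauge g).Om x.1 ^ 2 * ∑ a, ∑ b, ∑ c', ∑ d,
      nullFrame κ a * nullFrame l b * nullFrame μ c' * nullFrame ν d *
        SmoothFn.evalAt (toSpacetime x) ((E.hat c).W a b c' d) := by
  rw [Geometry.weyl_eq_of_einstein c.isOpen_bulk (E.phys c) (E.phys_D c) _ (E.metric_eq_phys_g c) k
    x (hE c x.1 x.2), metric_eq_phys_g E c x, metric_eq_phys_g E c x, metric_eq_phys_g E c x,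
    metric_eq_phys_g E c x]
  have h := (E.physSlab c).Rm_change nullFrame_mul_slabFrame κ l μ ν
  have h' : SmoothFn.evalAt x ((E.phys c).Rm κ l μ ν) = ∑ a, ∑ b, ∑ c', ∑ d,
      nullFrame κ a * nullFrame l b * nullFrame μ c' * nullFrame ν d *
        SmoothFn.evalAt x ((E.physSlab c).Rm a b c' d) := by
    rw [phys, h]
    simp only [map_sum, map_smul, smul_eq_mul]
  rw [h']
  simp only [E.Rm_physSlab c hE, map_sub, map_mul, map_pow, evalAt_OmFn, evalAt_res,
    AlgHom.commutes, phys_g, map_sum, map_smul, smul_eq_mul]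
  simp only [Algebra.algebraMap_self, RingHom.id_apply]
  rw [← sum_prod_two, ← sum_prod_two']
  simp only [Finset.mul_sum, ← Finset.sum_sub_distrib, ← Finset.sum_add_distrib]
  exact Finset.sum_congr rfl fun a _ => Finset.sum_congr rfl fun b _ =>
    Finset.sum_congr rfl fun c' _ => Finset.sum_congr rfl fun d _ => by ring

theorem W_eq {k : ℝ} (hE : g.IsEinstein k) (x : c.bulk) (X Y Z V : Coord 4) :
    (c.gauge g).W x.1 X Y Z V = (c.gauge g).Om x.1 ^ 2 * ∑ a, ∑ b, ∑ c', ∑ d,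
      SmoothFn.evalAt (toSpacetime x) ((E.hat c).W a b c' d)
        * slabComp X a * slabComp Y b * slabComp Z c' * slabComp V d := by
  simp only [NullGauge.W, eval4, E.weyl_eq c hE, slabComp, ← sum_prod_four]
  rw [← sum_pull_four]
  simp only [Finset.mul_sum, Finset.sum_mul]
  exact Finset.sum_congr rfl fun κ _ => Finset.sum_congr rfl fun l _ =>
    Finset.sum_congr rfl fun μ _ => Finset.sum_congr rfl fun ν _ =>
    Finset.sum_congr rfl fun a _ => Finset.sum_congr rfl fun b _ =>
    Finset.sum_congr rfl fun c' _ => Finset.sum_congr rfl fun d _ => by ring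

/-- The Weyl tensor of the spacetime in terms of the Weyl tensor of the rescaled metric. -/
theorem W_eq_Wv {k : ℝ} (hE : g.IsEinstein k) (x : c.bulk) {X Y Z V : Coord 4}
    {X' Y' Z' V' : Fin 4 → Fn c} {p q r s : ℝ}
    (hX : ∀ a, slabComp X a = p * SmoothFn.evalAt (toSpacetime x) (X' a))
    (hY : ∀ a, slabComp Y a = q * SmoothFn.evalAt (toSpacetime x) (Y' a))
    (hZ : ∀ a, slabComp Z a = r * SmoothFn.evalAt (toSpacetime x) (Z' a))
    (hV : ∀ a, slabComp V a = s * SmoothFn.evalAt (toSpacetime x) (V' a)) :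
    (c.gauge g).W x.1 X Y Z V = (c.gauge g).Om x.1 ^ 2 * (p * q * r * s) *
      SmoothFn.evalAt (toSpacetime x) ((E.hat c).Wv X' Y' Z' V') := by
  rw [W_eq E c hE, Geometry.Wv, contr4, mul_assoc]
  congr 1
  simp only [map_sum, map_mul, hX, hY, hZ, hV, Finset.mul_sum]
  exact Finset.sum_congr rfl fun a _ => Finset.sum_congr rfl fun b _ =>
    Finset.sum_congr rfl fun c' _ => Finset.sum_congr rfl fun d _ => by ring

theorem slabComp_eA (x : c.bulk) (A : Fin 2) (a : Fin 4) : slabComp (NullGauge.eA A) a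
    = 1 * SmoothFn.evalAt (toSpacetime x) ((Geometry.ev A.succ.succ : Fin 4 → Fn c) a) := by
  fin_cases A <;> fin_cases a <;>
    simp [slabComp, NullGauge.eA, Fin.sum_univ_four, nullFrame, Geometry.ev, ang]

theorem evalAt_nullOut (x : c.spacetime) (a : Fin 4) :
    SmoothFn.evalAt x ((E.hat c).nullOut a) = ![1, 1, 0, 0] a := by
  change SmoothFn.evalAt x (-(Geometry.slabInverse (E.HFn c) (E.halfShift c)) 1 a
    + (Geometry.slabInverse (E.HFn c) (E.halfShift c)) 0 a) = _
  fin_cases a <;> simp [Geometry.slabInverse]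

theorem evalAt_nullIn (x : c.spacetime) (a : Fin 4) :
    SmoothFn.evalAt x ((E.hat c).nullIn a)
      = ![-1, 1, c.vector E.shift x 0, c.vector E.shift x 1] a := by
  change SmoothFn.evalAt x (-(Geometry.slabInverse (E.HFn c) (E.halfShift c)) 1 a
    + -(Geometry.slabInverse (E.HFn c) (E.halfShift c)) 0 a) = _
  fin_cases a <;> simp [Geometry.slabInverse, evalAt_halfShift] <;> ring1

theorem slabComp_e4 (x : c.bulk) (a : Fin 4) : slabComp ((c.gauge g).e4 x.1) a
    = ((c.gauge g).Om x.1)⁻¹ * SmoothFn.evalAt (toSpacetime x) ((E.hat c).nullOut a) := by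
  rw [evalAt_nullOut]
  fin_cases a <;> simp [slabComp, NullGauge.e4, Fin.sum_univ_four, nullFrame]

theorem slabComp_e3 (x : c.bulk) (a : Fin 4) : slabComp ((c.gauge g).e3 x.1) a
    = ((c.gauge g).Om x.1)⁻¹ * SmoothFn.evalAt (toSpacetime x) ((E.hat c).nullIn a) := by
  rw [evalAt_nullIn]
  fin_cases a <;> simp [slabComp, NullGauge.e3, Fin.sum_univ_four, nullFrame, E.shift_eq' c x.2]

/-- The component `α` of the rescaled Weyl tensor. -/
def outgoing (A B : Fin 2) : Fn c :=
  (E.hat c).Wv (Geometry.ev A.succ.succ) (E.hat c).nullOut (Geometry.ev B.succ.succ) (E.hat c).nullOut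

/-- The component `α̲` of the rescaled Weyl tensor. -/
def ingoing (A B : Fin 2) : Fn c :=
  (E.hat c).Wv (Geometry.ev A.succ.succ) (E.hat c).nullIn (Geometry.ev B.succ.succ) (E.hat c).nullIn

variable {k : ℝ} (hE : g.IsEinstein k)
include hE

/-- The factor `Ω²` of the lowered Weyl tensor is compensated by the two factors `Ω⁻¹` of `e₄`, so
`α` extends to infinity as it stands. -/
theorem alpha_eq (x : c.bulk) (A B : Fin 2) : (c.gauge g).alpha x.1 A B
    = SmoothFn.evalAt (toSpacetime x) (E.outgoing c A B) := by
  have h := (Om_pos' (g := g) c x.2).ne'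
  refine (E.W_eq_Wv c hE x (slabComp_eA c x A) (E.slabComp_e4 c x) (slabComp_eA c x B)
    (E.slabComp_e4 c x)).trans ?_
  rw [outgoing]
  field_simp

theorem alphaBar_eq (x : c.bulk) (A B : Fin 2) : (c.gauge g).alphaBar x.1 A B
    = SmoothFn.evalAt (toSpacetime x) (E.ingoing c A B) := by
  have h := (Om_pos' (g := g) c x.2).ne'
  refine (E.W_eq_Wv c hE x (slabComp_eA c x A) (E.slabComp_e3 c x) (slabComp_eA c x B)
    (E.slabComp_e3 c x)).trans ?_
  rw [ingoing]
  field_simp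

/-- Three null vectors against `Ω²` leave one factor `Ω⁻¹ = ψ r⋆`, which matches the single frame
vector that `β` is evaluated on. -/
theorem beta_eq (x : c.bulk) (A : Fin 2) : (c.gauge g).beta x.1 A
    = 1 / 2 * ((c.gauge g).Om x.1)⁻¹ * SmoothFn.evalAt (toSpacetime x)
      ((E.hat c).Wv (Geometry.ev A.succ.succ) (E.hat c).nullOut (E.hat c).nullIn
        (E.hat c).nullOut) := by
  have h := (Om_pos' (g := g) c x.2).ne'
  rw [NullGauge.beta, E.W_eq_Wv c hE x (slabComp_eA c x A) (E.slabComp_e4 c x)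
    (E.slabComp_e3 c x) (E.slabComp_e4 c x)]
  field_simp

theorem betaBar_eq (x : c.bulk) (A : Fin 2) : (c.gauge g).betaBar x.1 A
    = 1 / 2 * ((c.gauge g).Om x.1)⁻¹ * SmoothFn.evalAt (toSpacetime x)
      ((E.hat c).Wv (Geometry.ev A.succ.succ) (E.hat c).nullIn (E.hat c).nullIn
        (E.hat c).nullOut) := by
  have h := (Om_pos' (g := g) c x.2).ne'
  rw [NullGauge.betaBar, E.W_eq_Wv c hE x (slabComp_eA c x A) (E.slabComp_e3 c x)
    (E.slabComp_e3 c x) (E.slabComp_e4 c x)]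
  field_simp

end ConformalExtension

end DoubleNullMetric

end

/-! ### The Hodge dual of the Weyl tensor in the null directions. -/

section

theorem sum_mul_sum_two {ι : Type*} [Fintype ι] (F H : ι → ι → ℝ) :
    (∑ κ, ∑ l, F κ l) * ∑ μ, ∑ ν, H μ ν = ∑ κ, ∑ l, ∑ μ, ∑ ν, F κ l * H μ ν := by
  rw [Finset.sum_mul]
  refine Finset.sum_congr rfl fun κ _ => ?_
  rw [Finset.sum_mul]
  refine Finset.sum_congr rfl fun l _ => ?_
  rw [Finset.mul_sum]
  exact Finset.sum_congr rfl fun μ _ => Finset.mul_sum _ _ _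

theorem W_single (N : NullGauge) (x : Coord 4) (σ τ : Fin 4) (Z V : Coord 4) :
    N.W x (Pi.single σ 1) (Pi.single τ 1) Z V
      = ∑ μ, ∑ ν, weyl N.metric σ τ μ ν x * Z μ * V ν := by
  have h (κ l : Fin 4) : ∑ μ, ∑ ν, weyl N.metric κ l μ ν x * (Pi.single σ 1 : Coord 4) κ
      * (Pi.single τ 1 : Coord 4) l * Z μ * V ν
      = (if κ = σ then 1 else 0) * ((if l = τ then 1 else 0) *
        ∑ μ, ∑ ν, weyl N.metric κ l μ ν x * Z μ * V ν) := by
    simp only [Finset.mul_sum, Pi.single_apply]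
    exact Finset.sum_congr rfl fun μ _ => Finset.sum_congr rfl fun ν _ => by ring
  simp only [NullGauge.W, eval4, h]
  simp only [← Finset.mul_sum]
  simp only [ite_mul, one_mul, zero_mul, Finset.sum_ite_eq', Finset.mem_univ, if_true]

theorem starW_eq (N : NullGauge) (x X Y Z V : Coord 4) : N.starW x X Y Z V
    = 1 / 2 * Real.sqrt |(N.metric x).det| * ∑ σ, ∑ τ,
      (∑ σ₁, ∑ τ₁, (∑ κ, ∑ l, leviCivitaSymbol κ l σ₁ τ₁ * X κ * Y l)
        * (N.metric x)⁻¹ σ₁ σ * (N.metric x)⁻¹ τ₁ τ)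
      * N.W x (Pi.single σ 1) (Pi.single τ 1) Z V := by
  have h (σ τ σ₁ τ₁ : Fin 4) : (∑ κ, ∑ l, leviCivitaSymbol κ l σ₁ τ₁ * X κ * Y l)
      * (N.metric x)⁻¹ σ₁ σ * (N.metric x)⁻¹ τ₁ τ
      * N.W x (Pi.single σ 1) (Pi.single τ 1) Z V
      = ∑ κ, ∑ l, ∑ μ, ∑ ν, (N.metric x)⁻¹ σ₁ σ * (N.metric x)⁻¹ τ₁ τ *
        ((leviCivitaSymbol κ l σ₁ τ₁ * X κ * Y l) * (weyl N.metric σ τ μ ν x * Z μ * V ν)) := by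
    rw [W_single, mul_assoc _ ((N.metric x)⁻¹ σ₁ σ), mul_right_comm, sum_mul_sum_two]
    simp only [Finset.sum_mul]
    exact Finset.sum_congr rfl fun κ _ => Finset.sum_congr rfl fun l _ =>
      Finset.sum_congr rfl fun μ _ => Finset.sum_congr rfl fun ν _ => by ring
  simp only [Finset.sum_mul _ _ (N.W x _ _ Z V), h]
  rw [← sum_pull_four]
  simp only [NullGauge.starW, eval4, weylDual, volumeForm, Finset.mul_sum, Finset.sum_mul]
  exact Finset.sum_congr rfl fun κ _ => Finset.sum_congr rfl fun l _ =>
    Finset.sum_congr rfl fun μ _ => Finset.sum_congr rfl fun ν _ =>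
    Finset.sum_congr rfl fun σ _ => Finset.sum_congr rfl fun τ _ =>
    Finset.sum_congr rfl fun σ₁ _ => Finset.sum_congr rfl fun τ₁ _ => by ring

/-- Over the integers the determinants can be evaluated by `decide`. -/
theorem leviCivitaSymbol_eq_cast (i j k l : Fin 4) : leviCivitaSymbol i j k l
    = ((Matrix.det (Matrix.of fun a b : Fin 4 => if ![i, j, k, l] a = b then (1 : ℤ) else 0) : ℤ) :
      ℝ) := by
  rw [leviCivitaSymbol, Int.cast_det]
  congr 1
  ext a b
  simp

/-- The contraction of the volume element with the null directions. -/
theorem sum_leviCivita (r b₀ b₁ : ℝ) (σ τ : Fin 4) :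
    ∑ κ, ∑ l, leviCivitaSymbol κ l σ τ * (r • ![0, 1, 0, 0] : Coord 4) κ
      * (r • ![1, 0, b₀, b₁] : Coord 4) l
    = r ^ 2 * (!![0, 0, -b₁, b₀; 0, 0, 0, 0; b₁, 0, 0, -1; -b₀, 0, 1, 0] :
        Matrix (Fin 4) (Fin 4) ℝ) σ τ := by
  have h : ∑ κ, ∑ l, leviCivitaSymbol κ l σ τ * (r • ![0, 1, 0, 0] : Coord 4) κ
      * (r • ![1, 0, b₀, b₁] : Coord 4) l = r ^ 2 * (leviCivitaSymbol 1 0 σ τ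
        + b₀ * leviCivitaSymbol 1 2 σ τ + b₁ * leviCivitaSymbol 1 3 σ τ) := by
    simp only [Fin.sum_univ_four]
    simp
    ring
  have h0 : ∀ σ τ : Fin 4,
      Matrix.det (Matrix.of fun a b : Fin 4 => if ![1, 0, σ, τ] a = b then (1 : ℤ) else 0)
        = ![![0, 0, 0, 0], ![0, 0, 0, 0], ![0, 0, 0, -1], ![0, 0, 1, 0]] σ τ := by decide +kernel
  have h2 : ∀ σ τ : Fin 4,
      Matrix.det (Matrix.of fun a b : Fin 4 => if ![1, 2, σ, τ] a = b then (1 : ℤ) else 0)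
        = ![![0, 0, 0, 1], ![0, 0, 0, 0], ![0, 0, 0, 0], ![-1, 0, 0, 0]] σ τ := by decide +kernel
  have h3 : ∀ σ τ : Fin 4,
      Matrix.det (Matrix.of fun a b : Fin 4 => if ![1, 3, σ, τ] a = b then (1 : ℤ) else 0)
        = ![![0, 0, -1, 0], ![0, 0, 0, 0], ![1, 0, 0, 0], ![0, 0, 0, 0]] σ τ := by decide +kernel
  rw [h, leviCivitaSymbol_eq_cast, leviCivitaSymbol_eq_cast, leviCivitaSymbol_eq_cast, h0, h2, h3]
  congr 1
  fin_cases σ <;> fin_cases τ <;> simp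

/-- Raising the indices of the volume form contracted with the null directions produces a bivector
tangent to the spheres; the terms with the shift cancel. -/
theorem contract_area (w q b₀ b₁ : ℝ) (H : Fin 2 → Fin 2 → ℝ) (σ τ : Fin 4) :
    let m : Matrix (Fin 4) (Fin 4) ℝ :=
      !![0, w, 0, 0; w, 0, w * b₀, w * b₁; 0, w * b₀, q * H 0 0, q * H 0 1;
        0, w * b₁, q * H 1 0, q * H 1 1]
    ∑ σ₁, ∑ τ₁, (!![0, 0, -b₁, b₀; 0, 0, 0, 0; b₁, 0, 0, -1; -b₀, 0, 1, 0] :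
        Matrix (Fin 4) (Fin 4) ℝ) σ₁ τ₁ * m σ₁ σ * m τ₁ τ
      = -(q ^ 2 * (H 0 0 * H 1 1 - H 1 0 * H 0 1)) * ((if σ = 2 then 1 else 0) *
          (if τ = 3 then 1 else 0) - (if σ = 3 then 1 else 0) * (if τ = 2 then 1 else 0)) := by
  intro m
  simp only [Fin.sum_univ_four, m]
  fin_cases σ <;> fin_cases τ <;> simp <;> ring

end

/-! ### Determinant and inverse of the spacetime metric, and the component `σ`. -/

section

theorem det_nullMetric (w b₀ b₁ p q r : ℝ) :
    (!![b₀ ^ 2 * p + 2 * b₀ * b₁ * q + b₁ ^ 2 * r, -2 * w, -(b₀ * p + b₁ * q), -(b₀ * q + b₁ * r);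
        -2 * w, 0, 0, 0; -(b₀ * p + b₁ * q), 0, p, q; -(b₀ * q + b₁ * r), 0, q, r] :
      Matrix (Fin 4) (Fin 4) ℝ).det = -4 * w ^ 2 * (p * r - q ^ 2) := by
  rw [Matrix.det_succ_row _ 1]
  simp [Fin.sum_univ_four, Matrix.det_fin_three, Fin.succAbove, Matrix.submatrix]
  ring

namespace DoubleNullMetric

namespace ConformalExtension

variable {g : DoubleNullMetric} (E : g.ConformalExtension) (c : SphereChart)

theorem det_metric (x : c.bulk) : ((c.gauge g).metric x.1).det
    = -4 * (c.gauge g).Om x.1 ^ 8 * SmoothFn.evalAt (toSpacetime x) (E.detFn c) := by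
  have hs := congrArg (SmoothFn.evalAt (toSpacetime x)) (E.hFn_symm c 0 1)
  simp only [evalAt_hFn] at hs
  set Om := (c.gauge g).Om x.1 with hOm
  set h := c.form E.h x.1 with hh
  set b := c.vector E.shift x.1 with hb
  have hm : (c.gauge g).metric x.1 =
      !![b 0 ^ 2 * (Om ^ 2 * h 0 0) + 2 * b 0 * b 1 * (Om ^ 2 * h 0 1) + b 1 ^ 2 * (Om ^ 2 * h 1 1),
          -2 * Om ^ 2, -(b 0 * (Om ^ 2 * h 0 0) + b 1 * (Om ^ 2 * h 0 1)),
          -(b 0 * (Om ^ 2 * h 0 1) + b 1 * (Om ^ 2 * h 1 1));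
        -2 * Om ^ 2, 0, 0, 0;
        -(b 0 * (Om ^ 2 * h 0 0) + b 1 * (Om ^ 2 * h 0 1)), 0, Om ^ 2 * h 0 0, Om ^ 2 * h 0 1;
        -(b 0 * (Om ^ 2 * h 0 1) + b 1 * (Om ^ 2 * h 1 1)), 0, Om ^ 2 * h 0 1, Om ^ 2 * h 1 1] := by
    ext μ ν
    change h 0 1 = h 1 0 at hs
    fin_cases μ <;> fin_cases ν <;>
      simp [NullGauge.metric, eval2, NullGauge.proj, ← hOm, ← hh, ← hb,
        E.form_h_eq c x.2, E.shift_eq' c x.2, ang, Fin.sum_univ_two, ← hs] <;> ring1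
  rw [hm, det_nullMetric]
  have hd : SmoothFn.evalAt (toSpacetime x) (E.detFn c) = h 0 0 * h 1 1 - h 0 1 * h 0 1 := by
    simp only [detFn, map_sub, map_mul, evalAt_hFn, hh]
  rw [hd]
  ring

theorem phys_gi (μ ν : Fin 4) : (E.phys c).gi μ ν
    = ∑ a, ∑ b, (slabFrame a μ * slabFrame b ν) • (E.physSlab c).gi a b :=
  Geometry.conj_apply slabFrameᵀ _ _ _

theorem evalAt_physSlab_gi (x : c.bulk) (a b : Fin 4) :
    SmoothFn.evalAt x ((E.physSlab c).gi a b)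
      = ((c.gauge g).Om x.1)⁻¹ ^ 2 * SmoothFn.evalAt (toSpacetime x)
        (Geometry.slabInverse (E.HFn c) (E.halfShift c) a b) := by
  rw [← evalAt_res]
  change SmoothFn.evalAt x (res c (E.sFn c) ^ 2 * _) = _
  rw [map_mul, map_pow, evalAt_sFn]
  rfl

theorem inv_metric (x : c.bulk) (μ ν : Fin 4) : ((c.gauge g).metric x.1)⁻¹ μ ν
    = (let w := -(((c.gauge g).Om x.1)⁻¹ ^ 2 / 2)
       let q := ((c.gauge g).Om x.1)⁻¹ ^ 2
       let b := c.vector E.shift x.1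
       let H A B := SmoothFn.evalAt (toSpacetime x) (E.HFn c A B)
       !![0, w, 0, 0; w, 0, w * b 0, w * b 1; 0, w * b 0, q * H 0 0, q * H 0 1;
        0, w * b 1, q * H 1 0, q * H 1 1]) μ ν := by
  dsimp only
  rw [Geometry.inv_eq (E.phys c) _ (E.metric_eq_phys_g c) x, phys_gi]
  simp only [map_sum, map_smul, evalAt_physSlab_gi, smul_eq_mul]
  simp only [Fin.sum_univ_four]
  fin_cases μ <;> fin_cases ν <;>
    simp [slabFrame, Geometry.slabInverse, evalAt_halfShift] <;> ring1

/-- The determinant of the inverse metric on the spheres. -/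
def detInvFn : Fn c := E.HFn c 0 0 * E.HFn c 1 1 - E.HFn c 1 0 * E.HFn c 0 1

/-- The dual in the first pair `e₄, e₃` is the angular pair, so `σ` is a multiple of `W(∂₁, ∂₂, e₄,
e₃)`. The powers of `Ω` from the volume form, the two inverse metrics and the null vectors combine
to `Ω⁻²`. -/
theorem sigma_eq {k : ℝ} (hE : g.IsEinstein k) (x : c.bulk) : (c.gauge g).sigma x.1
    = -(1 / 4) * Real.sqrt ((E.detFn c).fn x.1) * (E.detInvFn c).fn x.1
      * ((c.gauge g).Om x.1)⁻¹ ^ 2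
      * (SmoothFn.evalAt (toSpacetime x) ((E.hat c).Wv (Geometry.ev (0 : Fin 2).succ.succ)
          (Geometry.ev (1 : Fin 2).succ.succ) (E.hat c).nullOut (E.hat c).nullIn)
        - SmoothFn.evalAt (toSpacetime x) ((E.hat c).Wv (Geometry.ev (1 : Fin 2).succ.succ)
          (Geometry.ev (0 : Fin 2).succ.succ) (E.hat c).nullOut (E.hat c).nullIn)) := by
  have hO := (Om_pos' (g := g) c x.2)
  have hW (A B : Fin 2) := E.W_eq_Wv c hE x (slabComp_eA c x A) (slabComp_eA c x B)
    (E.slabComp_e4 c x) (E.slabComp_e3 c x)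
  have hd := E.detFn_pos c (toSpacetime x)
  have hsq : Real.sqrt |((c.gauge g).metric x.1).det|
      = 2 * (c.gauge g).Om x.1 ^ 4 * Real.sqrt ((E.detFn c).fn x.1) := by
    rw [det_metric, SmoothFn.fn_apply' _ (c.bulk_subset x.2)]
    have : |-4 * (c.gauge g).Om x.1 ^ 8 * SmoothFn.evalAt (toSpacetime x) (E.detFn c)|
        = (2 * (c.gauge g).Om x.1 ^ 4) ^ 2 * SmoothFn.evalAt (toSpacetime x) (E.detFn c) := by
      rw [abs_mul, abs_mul, abs_of_pos hd, abs_of_pos (pow_pos hO 8), abs_neg, abs_of_pos four_pos]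
      ring
    rw [this, Real.sqrt_mul (sq_nonneg _), Real.sqrt_sq (by positivity)]
  have hv (σ τ : Fin 4) : ∑ σ₁, ∑ τ₁, (∑ κ, ∑ l, leviCivitaSymbol κ l σ₁ τ₁ *
        (c.gauge g).e4 x.1 κ * (c.gauge g).e3 x.1 l)
        * ((c.gauge g).metric x.1)⁻¹ σ₁ σ * ((c.gauge g).metric x.1)⁻¹ τ₁ τ
      = ((c.gauge g).Om x.1)⁻¹ ^ 2 * (-((((c.gauge g).Om x.1)⁻¹ ^ 2) ^ 2 *
          (E.detInvFn c).fn x.1) * ((if σ = 2 then 1 else 0) *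
          (if τ = 3 then 1 else 0) - (if σ = 3 then 1 else 0) * (if τ = 2 then 1 else 0))) := by
    have hb := E.shift_eq' c x.2
    simp only [NullGauge.e4, NullGauge.e3, sum_leviCivita, inv_metric E c x, hb]
    have := contract_area (-(((c.gauge g).Om x.1)⁻¹ ^ 2 / 2)) (((c.gauge g).Om x.1)⁻¹ ^ 2)
      (c.vector E.shift x.1 0) (c.vector E.shift x.1 1)
      (fun A B => SmoothFn.evalAt (toSpacetime x) (E.HFn c A B)) σ τ
    have hdi : (E.detInvFn c).fn x.1 = SmoothFn.evalAt (toSpacetime x) (E.HFn c 0 0)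
        * SmoothFn.evalAt (toSpacetime x) (E.HFn c 1 1)
        - SmoothFn.evalAt (toSpacetime x) (E.HFn c 1 0)
        * SmoothFn.evalAt (toSpacetime x) (E.HFn c 0 1) := by
      rw [SmoothFn.fn_apply' _ (c.bulk_subset x.2), detInvFn, map_sub, map_mul, map_mul]
    rw [hdi, ← this, Finset.mul_sum]
    refine Finset.sum_congr rfl fun σ₁ _ => ?_
    rw [Finset.mul_sum]
    exact Finset.sum_congr rfl fun τ₁ _ => by ring
  have hsum (f : Fin 4 → Fin 4 → ℝ) (r : ℝ) : ∑ σ, ∑ τ, r * ((if σ = 2 then 1 else 0) *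
      (if τ = 3 then 1 else 0) - (if σ = 3 then 1 else 0) * (if τ = 2 then 1 else 0)) * f σ τ
      = r * (f 2 3 - f 3 2) := by
    simp [Fin.sum_univ_four]
    ring
  rw [NullGauge.sigma, starW_eq, hsq]
  simp only [hv]
  simp only [← mul_assoc (((c.gauge g).Om x.1)⁻¹ ^ 2)]
  rw [hsum]
  have h23 := hW 0 1
  have h32 := hW 1 0
  simp only [NullGauge.eA, ang, Matrix.cons_val_zero, Matrix.cons_val_one] at h23 h32
  rw [h23, h32]
  field_simp

end ConformalExtension

end DoubleNullMetric

end

/-! ### The projected derivative in the normal direction. -/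

section

namespace Geometry

variable {A : Type*} [CommRing A] [Algebra ℝ A] (M : Geometry A (Fin 4))

/-- The derivative in the direction normal to the surfaces `ρ = const`. -/
def normalDeriv (f : A) : A := ∑ e, M.gi 0 e * M.D e f

theorem sum_gi_confΓ (s si : A) (a q : Fin 4) : ∑ μ, M.gi 0 μ * M.confΓ s si a μ q
    = -si * (M.gi 0 a * M.D q s + (if a = q then 1 else 0) * M.normalDeriv s
      - (if 0 = q then 1 else 0) * M.grad s a) := by
  have h1 := M.gi_g 0 q
  have h2 (μ : Fin 4) : M.gi 0 μ * M.confΓ s si a μ q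
      = -si * ((if a = μ then 1 else 0) * M.gi 0 μ * M.D q s
        + (if a = q then 1 else 0) * (M.gi 0 μ * M.D μ s)
        - (M.gi 0 μ * M.g μ q) * M.grad s a) := by
    rw [confΓ]; ring
  simp only [h2, ← Finset.mul_sum, Finset.sum_sub_distrib, Finset.sum_add_distrib,
    ← Finset.sum_mul, h1]
  simp [normalDeriv]

end Geometry

theorem proj_covA_sub (N : NullGauge) (x : Coord 4) (r : ℝ) (X Y : Coord 4) (A C : Fin 2) :
    N.proj x (N.covA x (r • X - r • Y) A) C
      = r * N.proj x (N.covA x X A) C - r * N.proj x (N.covA x Y A) C := by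
  simp only [NullGauge.proj, NullGauge.covA, Pi.sub_apply, Pi.smul_apply, smul_eq_mul, sub_mul,
    Finset.sum_sub_distrib, mul_assoc, ← Finset.mul_sum]
  ring

/-- The vector `Ω e₄ - Ω e₃`. -/
def nullDiff (N : NullGauge) (x : Coord 4) : Coord 4 := N.Om x • N.e4 x - N.Om x • N.e3 x

theorem nabla43_apply (N : NullGauge) (θ : Coord 4 → Matrix (Fin 2) (Fin 2) ℝ) (x : Coord 4)
    (A B : Fin 2) : N.nabla43 θ x A B = fderiv ℝ (fun y => θ y A B) x (nullDiff N x)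
      - ∑ C, N.proj x (N.covA x (nullDiff N x) A) C * θ x C B
      - ∑ C, N.proj x (N.covA x (nullDiff N x) B) C * θ x A C := by
  simp only [nullDiff, proj_covA_sub, map_sub, map_smul, smul_eq_mul, NullGauge.nabla43,
    NullGauge.slashNabla, Matrix.sub_apply, Matrix.smul_apply, Matrix.of_apply, Fin.sum_univ_two]
  ring

theorem eq_sum_slabVec (X : Coord 4) : X = ∑ a, slabComp X a • slabVec a := by
  ext b
  simp only [Fin.sum_univ_four, slabComp]
  fin_cases b <;> simp [nullFrame, slabVec, slabFrame] <;> ring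

namespace DoubleNullMetric

namespace ConformalExtension

variable {g : DoubleNullMetric} (E : g.ConformalExtension) (c : SphereChart)

theorem evalAt_gi (x : c.spacetime) (a b : Fin 4) : SmoothFn.evalAt x ((E.hat c).gi a b)
    = SmoothFn.evalAt x (Geometry.slabInverse (E.HFn c) (E.halfShift c) a b) := rfl

/-- `Ω e₄ - Ω e₃ = ∂_v - ∂_u - b` is twice the unit normal of the surfaces `r⋆ = const` for the
rescaled metric. -/
theorem slabComp_nullDiff (x : c.bulk) (a : Fin 4) : slabComp (nullDiff (c.gauge g) x.1) a
    = 2 * SmoothFn.evalAt (toSpacetime x) ((E.hat c).gi 0 a) := by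
  have h := (Om_pos' (g := g) c x.2).ne'
  rw [evalAt_gi]
  have h4 : (c.gauge g).Om x.1 • (c.gauge g).e4 x.1 = ![0, 1, 0, 0] := by
    rw [NullGauge.e4, smul_smul, mul_inv_cancel₀ h, one_smul]
  have h3 : (c.gauge g).Om x.1 • (c.gauge g).e3 x.1
      = ![1, 0, c.vector E.shift x.1 0, c.vector E.shift x.1 1] := by
    rw [NullGauge.e3, smul_smul, mul_inv_cancel₀ h, one_smul, E.shift_eq' c x.2]
  rw [nullDiff, h3, h4]
  fin_cases a <;> simp [slabComp, Fin.sum_univ_four, nullFrame, Geometry.slabInverse,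
    evalAt_halfShift] <;> ring1

theorem fderiv_nullDiff (f : Fn c) (x : c.bulk) :
    fderiv ℝ f.fn x.1 (nullDiff (c.gauge g) x.1)
      = 2 * SmoothFn.evalAt (toSpacetime x) ((E.hat c).normalDeriv f) := by
  have hn : c.spacetime ∈ 𝓝 x.1 :=
    Filter.mem_of_superset (c.isOpen_bulk.mem_nhds x.2) c.bulk_subset
  have hD (a : Fin 4) : fderiv ℝ f.fn x.1 (slabVec a)
      = SmoothFn.evalAt (toSpacetime x) ((E.hat c).D a f) := by
    refine Eq.trans ?_ (SmoothFn.evalAt_dir c.regular_spacetime (slabVec a) f (toSpacetime x)).symm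
    rw [fderivWithin_of_mem_nhds hn]
  rw [eq_sum_slabVec (nullDiff (c.gauge g) x.1)]
  simp only [map_sum, map_smul, smul_eq_mul, slabComp_nullDiff E c x, hD, Geometry.normalDeriv,
    map_mul, Finset.mul_sum, mul_assoc]

theorem phys_Γ (κ a b : Fin 4) : (E.phys c).Γ κ a b
    = ∑ μ, nullFrame a μ • ∑ q, ∑ p, (slabFrame p κ * nullFrame b q) • (E.physSlab c).Γ p μ q := by
  change (E.physSlab c).changeΓ nullFrame slabFrame a κ b = _
  simp only [Geometry.changeΓ, Matrix.sum_apply, Matrix.smul_apply]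
  refine Finset.sum_congr rfl fun μ _ => ?_
  congr 1
  simp only [Matrix.mul_apply, Matrix.map_apply, Matrix.transpose_apply, Finset.sum_mul,
    Algebra.smul_def, map_mul, Geometry.ΓMat, Matrix.of_apply]
  exact Finset.sum_congr rfl fun q _ => Finset.sum_congr rfl fun p _ => by ring

/-- The projected connection coefficients of the rescaled metric in the normal direction. -/
def conn (A C : Fin 2) : Fn c := ∑ μ, (E.hat c).gi 0 μ * ((E.hat c).Γ C.succ.succ μ A.succ.succ
  + E.halfShift c C * ((E.hat c).Γ 0 μ A.succ.succ - (E.hat c).Γ 1 μ A.succ.succ))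

/-- The projection to the spheres annihilates the normal, and the gradient term is absent for
angular indices. The conformal change of the connection thus contributes only the scalar `-Ω N(s)`
on the diagonal. -/
theorem sum_gi_physSlab_Γ (A C : Fin 2) : ∑ μ, res c ((E.hat c).gi 0 μ) *
    ((E.physSlab c).Γ C.succ.succ μ A.succ.succ + res c (E.halfShift c C) *
      ((E.physSlab c).Γ 0 μ A.succ.succ - (E.physSlab c).Γ 1 μ A.succ.succ))
    = res c (E.conn c A C) - E.OmFn c * ((if C = A then 1 else 0) *
      res c ((E.hat c).normalDeriv (E.sFn c))) := by
  have hN : (E.hatBulk c).normalDeriv (res c (E.sFn c))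
      = res c ((E.hat c).normalDeriv (E.sFn c)) := by
    simp only [Geometry.normalDeriv, map_sum, map_mul]
    exact Finset.sum_congr rfl fun e _ => congrArg _ (E.dir_res c e _)
  have hΓ (p μ q : Fin 4) : (E.physSlab c).Γ p μ q = res c ((E.hat c).Γ p μ q)
      + (E.hatBulk c).confΓ (res c (E.sFn c)) (E.OmFn c) p μ q := rfl
  have hc (p q : Fin 4) := (E.hatBulk c).sum_gi_confΓ (res c (E.sFn c)) (E.OmFn c) p q
  change ∀ p q, ∑ μ, res c ((E.hat c).gi 0 μ) * _ = -E.OmFn c *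
    (res c ((E.hat c).gi 0 p) * _ + _ - _) at hc
  have h0 : (E.hat c).gi 0 0 = 1 := rfl
  have h1 : (E.hat c).gi 0 1 = 0 := rfl
  have h2 : (E.hat c).gi 0 C.succ.succ = -E.halfShift c C := by fin_cases C <;> rfl
  have hsplit (μ : Fin 4) : res c ((E.hat c).gi 0 μ) *
      ((E.physSlab c).Γ C.succ.succ μ A.succ.succ + res c (E.halfShift c C) *
        ((E.physSlab c).Γ 0 μ A.succ.succ - (E.physSlab c).Γ 1 μ A.succ.succ))
      = res c ((E.hat c).gi 0 μ * ((E.hat c).Γ C.succ.succ μ A.succ.succ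
        + E.halfShift c C * ((E.hat c).Γ 0 μ A.succ.succ - (E.hat c).Γ 1 μ A.succ.succ)))
      + (res c ((E.hat c).gi 0 μ)
          * (E.hatBulk c).confΓ (res c (E.sFn c)) (E.OmFn c) C.succ.succ μ A.succ.succ
        + res c (E.halfShift c C) * (res c ((E.hat c).gi 0 μ)
          * (E.hatBulk c).confΓ (res c (E.sFn c)) (E.OmFn c) 0 μ A.succ.succ
        - res c ((E.hat c).gi 0 μ)
          * (E.hatBulk c).confΓ (res c (E.sFn c)) (E.OmFn c) 1 μ A.succ.succ)) := by
    simp only [hΓ, map_add, map_mul, map_sub]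
    ring
  simp only [hsplit, Finset.sum_add_distrib, ← Finset.mul_sum, Finset.sum_sub_distrib, hc, hN,
    ← map_sum, h0, h1, h2]
  rw [conn]
  have e0 : (0 : Fin 4) ≠ A.succ.succ := by fin_cases A <;> decide
  have e1 : (1 : Fin 4) ≠ A.succ.succ := by fin_cases A <;> decide
  simp only [e0, e1, Fin.succ_inj, if_false, map_one, map_zero, map_neg]
  ring

theorem proj_covA (x : c.bulk) (A C : Fin 2) :
    (c.gauge g).proj x.1 ((c.gauge g).covA x.1 (nullDiff (c.gauge g) x.1) A) C
      = 2 * (SmoothFn.evalAt (toSpacetime x) (E.conn c A C) - (c.gauge g).Om x.1 *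
        ((if C = A then 1 else 0) *
          SmoothFn.evalAt (toSpacetime x) ((E.hat c).normalDeriv (E.sFn c)))) := by
  have h1 (κ : Fin 4) : (c.gauge g).covA x.1 (nullDiff (c.gauge g) x.1) A κ
      = ∑ μ, slabComp (nullDiff (c.gauge g) x.1) μ *
        ∑ p, slabFrame p κ * SmoothFn.evalAt x ((E.physSlab c).Γ p μ A.succ.succ) := by
    have h2 (μ : Fin 4) : ∑ q, ∑ p, slabFrame p κ * nullFrame (ang A) q
          * SmoothFn.evalAt x ((E.physSlab c).Γ p μ q)
        = ∑ p, slabFrame p κ * SmoothFn.evalAt x ((E.physSlab c).Γ p μ A.succ.succ) := by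
      rw [Finset.sum_comm]
      refine Finset.sum_congr rfl fun p _ => ?_
      fin_cases A <;> simp [Fin.sum_univ_four, nullFrame, ang]
    simp only [NullGauge.covA, Geometry.christoffel_eq c.isOpen_bulk (E.phys c) (E.phys_D c) _
      (E.metric_eq_phys_g c) x, phys_Γ, map_sum, map_smul, smul_eq_mul, h2, slabComp,
      Finset.sum_mul, Finset.mul_sum]
    rw [Finset.sum_comm]
    refine Finset.sum_congr rfl fun μ _ => ?_
    rw [Finset.sum_comm]
    exact Finset.sum_congr rfl fun p _ => Finset.sum_congr rfl fun κ' _ => by ring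
  have h3 := congrArg (SmoothFn.evalAt x) (E.sum_gi_physSlab_Γ c A C)
  simp only [map_sum, map_sub, map_mul, map_add, evalAt_res, evalAt_OmFn] at h3
  have h4 : SmoothFn.evalAt x (if C = A then (1 : SmoothFn c.bulk) else 0)
      = if C = A then 1 else 0 := by split_ifs <;> simp
  rw [h4] at h3
  rw [← h3, NullGauge.proj, h1, h1, Finset.mul_sum, Finset.mul_sum, ← Finset.sum_sub_distrib]
  refine Finset.sum_congr rfl fun μ _ => ?_
  rw [slabComp_nullDiff E c x, E.shift_eq' c x.2, evalAt_halfShift]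
  have h5 : ∑ p, slabFrame p (ang C) * SmoothFn.evalAt x ((E.physSlab c).Γ p μ A.succ.succ)
      = SmoothFn.evalAt x ((E.physSlab c).Γ C.succ.succ μ A.succ.succ) := by
    fin_cases C <;> simp [Fin.sum_univ_four, slabFrame, ang]
  have h6 : ∑ p, slabFrame p 0 * SmoothFn.evalAt x ((E.physSlab c).Γ p μ A.succ.succ)
      = 1 / 2 * SmoothFn.evalAt x ((E.physSlab c).Γ 1 μ A.succ.succ)
        - 1 / 2 * SmoothFn.evalAt x ((E.physSlab c).Γ 0 μ A.succ.succ) := by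
    simp [Fin.sum_univ_four, slabFrame]; ring
  rw [h5, h6]
  ring

end ConformalExtension

end DoubleNullMetric

end

/-! ### The limit of `Ω∇̸₄ - Ω∇̸₃`. -/

section

/-- The shift correction disappears at the boundary: `Γ⁰` vanishes there, and so does the
contraction of `Γ¹` with the normal, by `sum_N_Γ_ang`. -/
theorem Collar.β_conn {A : Type*} [CommRing A] [Algebra ℝ A] {M : Geometry A (Fin 4)}
    {B : Type*} [CommRing B] [Algebra ℝ B] (K : Collar M B) (C F : Fin 2) (b : A) :
    K.β (∑ μ, M.gi 0 μ * (M.Γ F.succ.succ μ C.succ.succ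
      + b * (M.Γ 0 μ C.succ.succ - M.Γ 1 μ C.succ.succ))) = K.G C F := by
  have h := K.sum_N_Γ_ang C fun f => if f = 1 then 1 else 0
  have e1 (F : Fin 2) : F.succ.succ ≠ (1 : Fin 4) := by fin_cases F <;> decide
  simp only [mul_ite, mul_one, mul_zero, Finset.sum_ite_eq', Finset.mem_univ, if_true, e1, if_false,
    Finset.sum_const_zero] at h
  simp only [map_sum, map_mul, map_add, map_sub, K.β_Γ_zero]
  have e (μ : Fin 4) : K.β (M.gi 0 μ) * (K.β (M.Γ F.succ.succ μ C.succ.succ)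
      + K.β b * (0 - K.β (M.Γ 1 μ C.succ.succ))) = K.N μ * K.β (M.Γ F.succ.succ μ C.succ.succ)
        - K.β b * (K.N μ * K.β (M.Γ 1 μ C.succ.succ)) := by
    rw [Collar.N]; ring
  rw [Finset.sum_congr rfl fun μ _ => e μ, Finset.sum_sub_distrib, ← Finset.mul_sum, h, mul_zero,
    sub_zero, Collar.G]

namespace DoubleNullMetric

namespace ConformalExtension

variable {g : DoubleNullMetric} (E : g.ConformalExtension) (c : SphereChart)

/-- The inverse of the function `ψ`. -/
def psiInv : Fn c := (E.psiFn c).inv fun x => (E.psiFn_neg c x).ne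

theorem evalAt_psiInv (x : c.spacetime) :
    SmoothFn.evalAt x (E.psiInv c) = (SmoothFn.evalAt x (E.psiFn c))⁻¹ := by
  have h := congrArg (SmoothFn.evalAt x) (SmoothFn.mul_inv (E.psiFn c) fun x => (E.psiFn_neg c x).ne)
  rw [map_mul, map_one] at h
  exact eq_inv_of_mul_eq_one_right h

theorem evalAt_OmInv (x : c.bulk) : ((c.gauge g).Om x.1)⁻¹
    = SmoothFn.evalAt (toSpacetime x) (E.psiFn c) * rstar x.1 := by
  rw [← E.evalAt_sFn c x, evalAt_res, sFn, map_mul, evalAt_rhoFn]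

theorem normalDeriv_mul (f h : Fn c) : (E.hat c).normalDeriv (f * h)
    = f * (E.hat c).normalDeriv h + h * (E.hat c).normalDeriv f := by
  simp only [Geometry.normalDeriv, Derivation.leibniz, smul_eq_mul, Finset.mul_sum,
    ← Finset.sum_add_distrib]
  exact Finset.sum_congr rfl fun e _ => by ring

theorem normalDeriv_rhoFn : (E.hat c).normalDeriv (rhoFn c) = 1 := by
  have h0 : (E.hat c).gi 0 0 = 1 := rfl
  simp [Geometry.normalDeriv, E.hat_D_rho, h0]

include E in
theorem fderiv_rstar_nullDiff (x : c.bulk) :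
    fderiv ℝ rstar x.1 (nullDiff (c.gauge g) x.1) = 2 := by
  have h := E.fderiv_nullDiff c (rhoFn c) x
  rw [normalDeriv_rhoFn, map_one, mul_one] at h
  rw [← h]
  have e : (rhoFn c).fn =ᶠ[𝓝 x.1] rstar :=
    Filter.mem_of_superset (c.isOpen_bulk.mem_nhds x.2) fun y hy => fn_rhoFn hy
  rw [e.fderiv_eq]

/-- Here `Ω N(s) = 1/ρ + ψ⁻¹ N(ψ)`. Differentiating `ρ⁻³` contributes `-6/ρ²` and the two tensor
slots contribute `+4/ρ²`; the remaining `-2/ρ²` is what turns `2 N(Y)/ρ` into `2 N(Y/ρ)`. -/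
theorem nabla43_eq (Y : Fin 2 → Fin 2 → Fn c) (θ : Coord 4 → Matrix (Fin 2) (Fin 2) ℝ)
    (hθ : ∀ (x : c.bulk) A B, θ x.1 A B = SmoothFn.evalAt (toSpacetime x) (Y A B))
    (x : c.bulk) (A B : Fin 2) :
    rstar x.1 ^ 2 * (c.gauge g).nabla43 (fun y => (rstar y ^ 3)⁻¹ • θ y) x.1 A B
      = 2 * (rstar x.1)⁻¹ * SmoothFn.evalAt (toSpacetime x) ((E.hat c).normalDeriv (Y A B))
        - 2 * (rstar x.1 ^ 2)⁻¹ * SmoothFn.evalAt (toSpacetime x) (Y A B)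
        + 4 * SmoothFn.evalAt (toSpacetime x) (E.psiInv c * (E.hat c).normalDeriv (E.psiFn c))
          * ((rstar x.1)⁻¹ * SmoothFn.evalAt (toSpacetime x) (Y A B))
        - 2 * ∑ C, (SmoothFn.evalAt (toSpacetime x) (E.conn c A C)
            * ((rstar x.1)⁻¹ * SmoothFn.evalAt (toSpacetime x) (Y C B))
          + SmoothFn.evalAt (toSpacetime x) (E.conn c B C)
            * ((rstar x.1)⁻¹ * SmoothFn.evalAt (toSpacetime x) (Y A C))) := by
  have hr := rstar_ne_zero x.2
  have hψ := (E.psiFn_neg c (toSpacetime x)).ne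
  have hOm : (c.gauge g).Om x.1 = (SmoothFn.evalAt (toSpacetime x) (E.psiFn c) * rstar x.1)⁻¹ := by
    rw [← E.evalAt_OmInv, inv_inv]
  have hs : SmoothFn.evalAt (toSpacetime x) ((E.hat c).normalDeriv (E.sFn c))
      = SmoothFn.evalAt (toSpacetime x) (E.psiFn c)
        + rstar x.1 * SmoothFn.evalAt (toSpacetime x) ((E.hat c).normalDeriv (E.psiFn c)) := by
    rw [sFn, normalDeriv_mul, normalDeriv_rhoFn, mul_one, map_add, map_mul, evalAt_rhoFn]
  have hd : fderiv ℝ (fun y => ((rstar y ^ 3)⁻¹ • θ y) A B) x.1 (nullDiff (c.gauge g) x.1)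
      = (rstar x.1 ^ 3)⁻¹ * (2 * SmoothFn.evalAt (toSpacetime x) ((E.hat c).normalDeriv (Y A B)))
        - 6 * (rstar x.1 ^ 4)⁻¹ * SmoothFn.evalAt (toSpacetime x) (Y A B) := by
    have e : (fun y => ((rstar y ^ 3)⁻¹ • θ y) A B) =ᶠ[𝓝 x.1]
        fun y => (rstar y ^ 3)⁻¹ * (Y A B).fn y := by
      filter_upwards [c.isOpen_bulk.mem_nhds x.2] with y hy
      rw [Matrix.smul_apply, smul_eq_mul, hθ ⟨y, hy⟩, SmoothFn.fn_apply' _ (c.bulk_subset hy)]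
    have hn : c.spacetime ∈ 𝓝 x.1 :=
      Filter.mem_of_superset (c.isOpen_bulk.mem_nhds x.2) c.bulk_subset
    have hY : HasFDerivAt (Y A B).fn (fderiv ℝ (Y A B).fn x.1) x.1 :=
      (((Y A B).differentiableWithinAt (toSpacetime x)).differentiableAt hn).hasFDerivAt
    have hρ : HasFDerivAt rstar (fderiv ℝ rstar x.1) x.1 := by
      have : Differentiable ℝ rstar := by unfold rstar; fun_prop
      exact (this x.1).hasFDerivAt
    have hp : HasDerivAt (fun t : ℝ => (t ^ 3)⁻¹) (-3 * (rstar x.1 ^ 4)⁻¹) (rstar x.1) := by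
      have := (hasDerivAt_pow 3 (rstar x.1)).inv (pow_ne_zero 3 hr)
      refine this.congr_deriv ?_
      field_simp
      push_cast
      ring
    have h1 := (hp.comp_hasFDerivAt x.1 hρ).mul hY
    rw [e.fderiv_eq]
    have h2 := congrArg (fun l => l (nullDiff (c.gauge g) x.1)) h1.fderiv
    refine h2.trans ?_
    simp only [add_apply, smul_apply, smul_eq_mul,
      E.fderiv_nullDiff c (Y A B) x, E.fderiv_rstar_nullDiff c x, Function.comp_apply]
    rw [SmoothFn.fn_apply' _ (c.bulk_subset x.2)]
    ring
  rw [nabla43_apply, hd]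
  simp only [Matrix.smul_apply, smul_eq_mul, hθ x, E.proj_covA c x, hs, map_mul, evalAt_psiInv, hOm,
    Fin.sum_univ_two]
  fin_cases A <;> fin_cases B <;>
  · simp only [Fin.zero_eta, Fin.mk_one, if_true, one_ne_zero, zero_ne_one, if_false]
    field_simp
    ring1

/-- The boundary value of the derivative `Ω ∇̸₄ - Ω ∇̸₃` of a component of the Weyl tensor. -/
def limitDeriv (Y : Fin 2 → Fin 2 → Fn c) (A B : Fin 2) : Fn c :=
  2 * ∑ e, (E.hat c).gi 0 e * (E.hat c).D e ((E.hat c).D 0 (Y A B))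
    - (E.hat c).D 0 ((E.hat c).D 0 (Y A B))
    + 4 * (E.psiInv c * (E.hat c).normalDeriv (E.psiFn c)) * (E.hat c).D 0 (Y A B)
    - 2 * ∑ C, (E.conn c A C * (E.hat c).D 0 (Y C B) + E.conn c B C * (E.hat c).D 0 (Y A C))

theorem bdry_D {k : ℝ} (hE : g.IsEinstein k) {f : Fn c} (hf : c.bdry f = 0) (i : Fin 3) :
    c.bdry ((E.hat c).D i.succ f) = 0 := by
  refine ((E.collar c hE).β_D i f).trans ?_
  change (E.collar c hE).δ i (c.bdry f) = 0
  rw [hf, map_zero]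

/-- Only the `ρ`-derivative needs the second-order quotient limit. Tangential derivatives of `Y`
vanish at the boundary themselves and are divided by `ρ` directly. -/
theorem tendsto_nabla43 {k : ℝ} (hE : g.IsEinstein k) (Y : Fin 2 → Fin 2 → Fn c)
    (θ : Coord 4 → Matrix (Fin 2) (Fin 2) ℝ)
    (hθ : ∀ (x : c.bulk) A B, θ x.1 A B = SmoothFn.evalAt (toSpacetime x) (Y A B))
    (hY : ∀ A B, c.bdry (Y A B) = 0) {z : Coord 4} (hz : z ∈ c.infinity) (A B : Fin 2) :
    Filter.Tendsto
      (fun x => rstar x ^ 2 * (c.gauge g).nabla43 (fun y => (rstar y ^ 3)⁻¹ • θ y) x A B)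
      (approach c z) (𝓝 (SmoothFn.evalAt ⟨z, c.infinity_subset hz⟩ (E.limitDeriv c Y A B))) := by
  have t1 := (tendsto_radial_div_rstar (hY A B) hz).const_mul 2
  have t2 (i : Fin 3) := ((SphereChart.tendsto_fn ((E.hat c).gi 0 i.succ) hz).mul
    (tendsto_div_rstar (E.bdry_D c hE (hY A B) i) hz)).const_mul 2
  have t3 := ((SphereChart.tendsto_fn (E.psiInv c * (E.hat c).normalDeriv (E.psiFn c)) hz).const_mul
    4).mul (tendsto_div_rstar (hY A B) hz)
  have t4 (A C D F : Fin 2) := (SphereChart.tendsto_fn (E.conn c A C) hz).mul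
    (tendsto_div_rstar (hY D F) hz)
  have t5 := tendsto_finsetSum Finset.univ fun i _ => t2 i
  have t6 := (tendsto_finsetSum Finset.univ fun C _ => (t4 A C C B).add (t4 B C A C)).const_mul 2
  have t := ((t1.add t5).add t3).sub t6
  have h0 : (E.hat c).gi 0 0 = 1 := rfl
  -- The limit of `∂_i Y / ρ` is `∂_ρ ∂_i Y`, to be read as `∂_i ∂_ρ Y`.
  have hcomm (i : Fin 3) : c.radial ((E.hat c).D i.succ (Y A B))
      = (E.hat c).D i.succ ((E.hat c).D 0 (Y A B)) := (E.hat c).comm 0 i.succ _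
  have hrad (f : Fn c) : c.radial f = (E.hat c).D 0 f := rfl
  refine (congrArg (fun r => Filter.Tendsto _ (approach c z) (𝓝 r)) ?_).mp (t.congr' ?_)
  · simp only [hcomm]
    simp only [limitDeriv, map_add, map_sub, map_mul, map_sum, map_ofNat,
      Fin.sum_univ_succ (n := 3), h0, map_one, mul_add, Finset.mul_sum, hrad]
    ring
  · filter_upwards [self_mem_nhdsWithin] with x hx
    rw [E.nabla43_eq c Y θ hθ ⟨x, hx⟩]
    have hn : SmoothFn.evalAt (toSpacetime ⟨x, hx⟩) ((E.hat c).normalDeriv (Y A B))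
        = SmoothFn.evalAt (toSpacetime ⟨x, hx⟩) ((E.hat c).D 0 (Y A B))
          + ∑ i : Fin 3, SmoothFn.evalAt (toSpacetime ⟨x, hx⟩) ((E.hat c).gi 0 i.succ)
            * SmoothFn.evalAt (toSpacetime ⟨x, hx⟩) ((E.hat c).D i.succ (Y A B)) := by
      simp only [Geometry.normalDeriv, map_add, map_sum, map_mul, Fin.sum_univ_succ (n := 3), h0, one_mul]
    simp only [hn, SmoothFn.fn_apply' _ (c.bulk_subset hx), mul_add, Finset.mul_sum, hrad]
    ring_nf

theorem bdry_conn {k : ℝ} (hE : g.IsEinstein k) (A C : Fin 2) :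
    c.bdry (E.conn c A C) = (E.collar c hE).G A C :=
  (E.collar c hE).β_conn A C (E.halfShift c C)

/-- The term with `N(ψ)` drops because `dψ = 0` on the boundary. What remains is the defect in the
transport equation of `Cone.normalD_out_add_in`. -/
theorem bdry_limitDeriv {k : ℝ} (hE : g.IsEinstein k) (Y : Fin 2 → Fin 2 → Fn c) (A B : Fin 2) :
    c.bdry (E.limitDeriv c Y A B) = (E.collar c hE).normalD (Y A B)
      - 2 * (∑ C, (E.collar c hE).G A C * c.bdry ((E.hat c).D 0 (Y C B))
        + ∑ C, (E.collar c hE).G B C * c.bdry ((E.hat c).D 0 (Y A C))) := by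
  have hψ (e : Fin 4) : c.bdry ((E.hat c).D e (E.psiFn c)) = 0 := (E.collar c hE).β_D_ψ e
  have hN : (E.collar c hE).normalD (Y A B)
      = 2 * ∑ e, c.bdry ((E.hat c).gi 0 e) * c.bdry ((E.hat c).D e ((E.hat c).D 0 (Y A B)))
        - c.bdry ((E.hat c).D 0 ((E.hat c).D 0 (Y A B))) := rfl
  rw [hN]
  simp only [limitDeriv, Geometry.normalDeriv, map_add, map_sub, map_mul, map_sum, map_ofNat, hψ,
    E.bdry_conn c hE, mul_zero, Finset.sum_const_zero, zero_mul, add_zero, Finset.sum_add_distrib]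

theorem bdry_limitDeriv_add {k : ℝ} (hE : g.IsEinstein k) (hC : E.ConformalToCylinder k)
    (A B : Fin 2) :
    c.bdry (E.limitDeriv c (E.outgoing c) A B + E.limitDeriv c (E.ingoing c) A B) = 0 := by
  obtain ⟨L⟩ := E.nonempty_cone c hE hC
  have h := L.normalD_out_add_in (fun C F => E.outgoing c C F + E.ingoing c C F)
    (fun _ _ => rfl) A B
  have hβ (f : Fn c) : (E.collar c hE).β f = c.bdry f := rfl
  simp only [Collar.normalD_add, map_add, hβ] at h
  rw [map_add, E.bdry_limitDeriv c hE, E.bdry_limitDeriv c hE]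
  simp only [mul_add, Finset.sum_add_distrib] at h ⊢
  linear_combination h

end ConformalExtension

end DoubleNullMetric

end

/-! ### Limits in a regular orthonormal frame. -/

section

theorem IsRegularFrame.exists_tendsto {c : SphereChart} {g : DoubleNullMetric}
    {e : Coord 4 → Fin 2 → Coord 2} (he : IsRegularFrame c g e) {z : Coord 4}
    (hz : z ∈ c.infinity) : ∃ f : Coord 4 → Fin 2 → Coord 2, ∃ w : Fin 2 → Coord 2,
      (∀ a A, Filter.Tendsto (fun x => f x a A) (approach c z) (𝓝 (w a A))) ∧
      ∀ x ∈ c.bulk, ∀ a A, e x a A = rstar x * f x a A := by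
  obtain ⟨-, f, hf, hef⟩ := he
  refine ⟨f, f z, fun a A => ?_, fun x hx a A => ?_⟩
  · have h := (hf z (c.infinity_subset hz)).mono_left (c.approach_le z)
    exact ((continuous_apply_apply a A).tendsto (f z)).comp h
  · rw [hef x hx]
    rfl

theorem tendsto_eval2 {l : Filter (Coord 4)} {T : Coord 4 → Matrix (Fin 2) (Fin 2) ℝ}
    {X Y : Coord 4 → Coord 2} {T₀ : Fin 2 → Fin 2 → ℝ} {X₀ Y₀ : Coord 2}
    (hT : ∀ A B, Filter.Tendsto (fun x => T x A B) l (𝓝 (T₀ A B)))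
    (hX : ∀ A, Filter.Tendsto (fun x => X x A) l (𝓝 (X₀ A)))
    (hY : ∀ A, Filter.Tendsto (fun x => Y x A) l (𝓝 (Y₀ A))) :
    Filter.Tendsto (fun x => eval2 (T x) (X x) (Y x)) l (𝓝 (∑ A, ∑ B, T₀ A B * X₀ A * Y₀ B)) :=
  tendsto_finsetSum _ fun A _ => tendsto_finsetSum _ fun B _ => ((hT A B).mul (hX A)).mul (hY B)

theorem eval2_scale {r : ℝ} {X Y X' Y' : Coord 2} (hX : ∀ A, X A = r * X' A)
    (hY : ∀ A, Y A = r * Y' A) (T : Matrix (Fin 2) (Fin 2) ℝ) :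
    eval2 T X Y = eval2 (r ^ 2 • T) X' Y' := by
  simp only [eval2, hX, hY, Matrix.smul_apply, smul_eq_mul]
  exact Finset.sum_congr rfl fun A _ => Finset.sum_congr rfl fun B _ => by ring

namespace DoubleNullMetric

namespace ConformalExtension

variable {g : DoubleNullMetric} (E : g.ConformalExtension) {c : SphereChart}

theorem bdry_Wv {k : ℝ} (hE : g.IsEinstein k) (X Y Z V : Fin 4 → Fn c) :
    c.bdry ((E.hat c).Wv X Y Z V) = 0 := (E.collar c hE).β_Wv X Y Z V

/-- The limit of a tensor whose components are smooth functions vanishing at infinity. -/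
theorem tendsto_eval2_frame {Y : Fin 2 → Fin 2 → Fn c} {θ : Coord 4 → Matrix (Fin 2) (Fin 2) ℝ}
    (hθ : ∀ (x : c.bulk) A B, θ x.1 A B = SmoothFn.evalAt (toSpacetime x) (Y A B))
    (hY : ∀ A B, c.bdry (Y A B) = 0) {z : Coord 4} (hz : z ∈ c.infinity)
    {e f : Coord 4 → Fin 2 → Coord 2} {w : Fin 2 → Coord 2}
    (hf : ∀ a A, Filter.Tendsto (fun x => f x a A) (approach c z) (𝓝 (w a A)))
    (he : ∀ x ∈ c.bulk, ∀ a A, e x a A = rstar x * f x a A) (a a₁ : Fin 2) :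
    Filter.Tendsto (fun x => (rstar x ^ 3)⁻¹ * eval2 (θ x) (e x a) (e x a₁)) (approach c z)
      (𝓝 (∑ A, ∑ B, SmoothFn.evalAt ⟨z, c.infinity_subset hz⟩ (c.radial (Y A B)) * w a A
        * w a₁ B)) := by
  refine (tendsto_eval2 (T := fun x => Matrix.of fun A B => (rstar x)⁻¹ * (Y A B).fn x)
    (fun A B => tendsto_div_rstar (hY A B) hz) (hf a) (hf a₁)).congr' ?_
  filter_upwards [self_mem_nhdsWithin] with x hx
  have hr := rstar_ne_zero hx
  rw [eval2_scale (he x hx a) (he x hx a₁)]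
  simp only [eval2, Finset.mul_sum, Matrix.of_apply, Matrix.smul_apply, smul_eq_mul, hθ ⟨x, hx⟩,
    SmoothFn.fn_apply' _ (c.bulk_subset hx)]
  refine Finset.sum_congr rfl fun A _ => Finset.sum_congr rfl fun B _ => ?_
  field_simp

theorem tendsto_nabla43_frame {k : ℝ} (hE : g.IsEinstein k) {Y : Fin 2 → Fin 2 → Fn c}
    {θ : Coord 4 → Matrix (Fin 2) (Fin 2) ℝ}
    (hθ : ∀ (x : c.bulk) A B, θ x.1 A B = SmoothFn.evalAt (toSpacetime x) (Y A B))
    (hY : ∀ A B, c.bdry (Y A B) = 0) {z : Coord 4} (hz : z ∈ c.infinity)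
    {e f : Coord 4 → Fin 2 → Coord 2} {w : Fin 2 → Coord 2}
    (hf : ∀ a A, Filter.Tendsto (fun x => f x a A) (approach c z) (𝓝 (w a A)))
    (he : ∀ x ∈ c.bulk, ∀ a A, e x a A = rstar x * f x a A) (a a₁ : Fin 2) :
    Filter.Tendsto (fun x => eval2 ((c.gauge g).nabla43 (fun y => (rstar y ^ 3)⁻¹ • θ y) x)
      (e x a) (e x a₁)) (approach c z)
      (𝓝 (∑ A, ∑ B, SmoothFn.evalAt ⟨z, c.infinity_subset hz⟩ (E.limitDeriv c Y A B) * w a A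
        * w a₁ B)) := by
  refine (tendsto_eval2
    (T := fun x => rstar x ^ 2 • (c.gauge g).nabla43 (fun y => (rstar y ^ 3)⁻¹ • θ y) x)
    (fun A B => E.tendsto_nabla43 c hE Y θ hθ hY hz A B) (hf a) (hf a₁)).congr' ?_
  filter_upwards [self_mem_nhdsWithin] with x hx
  rw [eval2_scale (he x hx a) (he x hx a₁)]

/-- The limit of a one-form of weight one whose components vanish at infinity. -/
theorem tendsto_eval1_frame {Y : Fin 2 → Fn c} {ξ : Coord 4 → Coord 2}
    (hξ : ∀ (x : c.bulk) A, ξ x.1 A = 1 / 2 * ((c.gauge g).Om x.1)⁻¹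
      * SmoothFn.evalAt (toSpacetime x) (Y A))
    (hY : ∀ A, c.bdry (Y A) = 0) {z : Coord 4} (hz : z ∈ c.infinity)
    {e f : Coord 4 → Fin 2 → Coord 2} {w : Fin 2 → Coord 2}
    (hf : ∀ a A, Filter.Tendsto (fun x => f x a A) (approach c z) (𝓝 (w a A)))
    (he : ∀ x ∈ c.bulk, ∀ a A, e x a A = rstar x * f x a A) (a : Fin 2) :
    Filter.Tendsto (fun x => (rstar x ^ 3)⁻¹ * eval1 (ξ x) (e x a)) (approach c z)
      (𝓝 (∑ A, 1 / 2 * SmoothFn.evalAt ⟨z, c.infinity_subset hz⟩ (E.psiFn c)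
        * SmoothFn.evalAt ⟨z, c.infinity_subset hz⟩ (c.radial (Y A)) * w a A)) := by
  have h := tendsto_finsetSum Finset.univ fun A _ =>
    (((SphereChart.tendsto_fn (E.psiFn c) hz).const_mul (1 / 2)).mul
      (tendsto_div_rstar (hY A) hz)).mul (hf a A)
  refine h.congr' ?_
  filter_upwards [self_mem_nhdsWithin] with x hx
  have hr := rstar_ne_zero hx
  simp only [eval1, Finset.mul_sum, hξ ⟨x, hx⟩, E.evalAt_OmInv c ⟨x, hx⟩, he x hx,
    SmoothFn.fn_apply' _ (c.bulk_subset hx)]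
  refine Finset.sum_congr rfl fun A _ => ?_
  field_simp

/-- In `σ` the factor `Ω⁻² = ψ² ρ²` leaves one power `ρ⁻¹` of `ρ⁻³`, and the angular component of
`W/ρ` tends to zero since it has a single normal slot. -/
theorem tendsto_sigma {k : ℝ} (hE : g.IsEinstein k) (hC : E.ConformalToCylinder k) {z : Coord 4}
    (hz : z ∈ c.infinity) :
    Filter.Tendsto (fun x => (rstar x ^ 3)⁻¹ * (c.gauge g).sigma x) (approach c z) (𝓝 0) := by
  obtain ⟨L⟩ := E.nonempty_cone c hE hC
  have h0 (A B : Fin 2) : Filter.Tendsto (fun x => (rstar x)⁻¹ * ((E.hat c).Wv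
      (Geometry.ev A.succ.succ) (Geometry.ev B.succ.succ) (E.hat c).nullOut
      (E.hat c).nullIn).fn x) (approach c z) (𝓝 0) := by
    have h1 := tendsto_div_rstar (E.bdry_Wv hE (Geometry.ev A.succ.succ) (Geometry.ev B.succ.succ)
      (E.hat c).nullOut (E.hat c).nullIn) hz
    have h2 : c.bdry (c.radial ((E.hat c).Wv (Geometry.ev A.succ.succ) (Geometry.ev B.succ.succ)
        (E.hat c).nullOut (E.hat c).nullIn)) = 0 := by
      rw [Geometry.Wv_swap_right, map_neg, map_neg, neg_eq_zero]
      exact L.κ_ang_ang A B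
    rwa [SphereChart.evalAt_eq_zero_of_bdry h2 hz] at h1
  have hd := (SphereChart.tendsto_fn (E.detFn c) hz).sqrt
  have h := ((((hd.const_mul (-(1 / 4))).mul (SphereChart.tendsto_fn (E.detInvFn c) hz)).mul
    ((SphereChart.tendsto_fn (E.psiFn c) hz).pow 2)).mul ((h0 0 1).sub (h0 1 0)))
  rw [sub_zero, mul_zero] at h
  refine h.congr' ?_
  filter_upwards [self_mem_nhdsWithin] with x hx
  have hr := rstar_ne_zero hx
  rw [E.sigma_eq c hE ⟨x, hx⟩, E.evalAt_OmInv c ⟨x, hx⟩]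
  simp only [SmoothFn.fn_apply' _ (c.bulk_subset hx)]
  field_simp

end ConformalExtension

end DoubleNullMetric

end

end AAdS

end

/-! ### Assembly of the limits. -/

theorem proposition2p2 (k : ℝ) (hk : 0 < k) (g : AAdS.DoubleNullMetric)
    (hEinstein : g.IsEinstein k)
    (E : g.ConformalExtension) (hE : E.ConformalToCylinder k)
    (c : AAdS.SphereChart) (e : AAdS.Coord 4 → Fin 2 → AAdS.Coord 2)
    (he : AAdS.IsRegularFrame c g e)
    (z : AAdS.Coord 4) (hz : 0 ≤ z 0) (hzI : z 1 = z 0) (hzc : AAdS.angles z ∈ c.dom) :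
    (∀ a a₁ : Fin 2, ∃ L : ℝ,
      Filter.Tendsto (fun x => (AAdS.rstar x ^ 3)⁻¹ *
        AAdS.eval2 ((c.gauge g).alpha x) (e x a) (e x a₁)) (AAdS.approach c z) (nhds L) ∧
      Filter.Tendsto (fun x => (AAdS.rstar x ^ 3)⁻¹ *
        AAdS.eval2 ((c.gauge g).alphaBar x) (e x a) (e x a₁)) (AAdS.approach c z) (nhds L)) ∧
    (∀ a : Fin 2, ∃ L : ℝ,
      Filter.Tendsto (fun x => (AAdS.rstar x ^ 3)⁻¹ *
        AAdS.eval1 ((c.gauge g).beta x) (e x a)) (AAdS.approach c z) (nhds L) ∧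
      Filter.Tendsto (fun x => (AAdS.rstar x ^ 3)⁻¹ *
        AAdS.eval1 ((c.gauge g).betaBar x) (e x a)) (AAdS.approach c z) (nhds (-L))) ∧
    Filter.Tendsto (fun x => (AAdS.rstar x ^ 3)⁻¹ * (c.gauge g).sigma x)
      (AAdS.approach c z) (nhds 0) ∧
    (∀ a a₁ : Fin 2, ∃ L : ℝ,
      Filter.Tendsto (fun x => AAdS.eval2 ((c.gauge g).nabla43
          (fun y => (AAdS.rstar y ^ 3)⁻¹ • (c.gauge g).alpha y) x) (e x a) (e x a₁))
        (AAdS.approach c z) (nhds L) ∧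
      Filter.Tendsto (fun x => AAdS.eval2 ((c.gauge g).nabla43
          (fun y => (AAdS.rstar y ^ 3)⁻¹ • (c.gauge g).alphaBar y) x) (e x a) (e x a₁))
        (AAdS.approach c z) (nhds (-L))) := by
  have hz' : z ∈ c.infinity := ⟨hzI, hz, hzc⟩
  obtain ⟨f, w, hf, hef⟩ := he.exists_tendsto hz'
  obtain ⟨L⟩ := E.nonempty_cone c hEinstein hE
  have hout (A B : Fin 2) : c.bdry (E.outgoing c A B) = 0 := E.bdry_Wv hEinstein _ _ _ _
  have hin (A B : Fin 2) : c.bdry (E.ingoing c A B) = 0 := E.bdry_Wv hEinstein _ _ _ _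
  refine ⟨fun a a₁ => ?_, fun a => ?_, E.tendsto_sigma hEinstein hE hz', fun a a₁ => ?_⟩
  · have h (A B : Fin 2) : AAdS.SmoothFn.evalAt ⟨z, c.infinity_subset hz'⟩ (c.radial (E.ingoing c A B))
        = AAdS.SmoothFn.evalAt ⟨z, c.infinity_subset hz'⟩ (c.radial (E.outgoing c A B)) := by
      -- The equality is available on the boundary at `t > 0`; `evalAt_eq_zero_of_bdry` carries it
      -- to `z`, also when `t = 0`.
      have h0 : c.bdry (c.radial (E.ingoing c A B) - c.radial (E.outgoing c A B)) = 0 := by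
        rw [map_sub, sub_eq_zero]
        exact (L.κ_out_eq_in A B).symm
      have := AAdS.SphereChart.evalAt_eq_zero_of_bdry h0 hz'
      rwa [map_sub, sub_eq_zero] at this
    have h1 := AAdS.DoubleNullMetric.ConformalExtension.tendsto_eval2_frame
      (E.alpha_eq c hEinstein) hout hz' hf hef a a₁
    have h2 := AAdS.DoubleNullMetric.ConformalExtension.tendsto_eval2_frame
      (E.alphaBar_eq c hEinstein) hin hz' hf hef a a₁
    simp only [h] at h2
    exact ⟨_, h1, h2⟩
  · have h1 := E.tendsto_eval1_frame (E.beta_eq c hEinstein) (fun A => E.bdry_Wv hEinstein _ _ _ _)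
      hz' hf hef a
    have h2 := E.tendsto_eval1_frame (E.betaBar_eq c hEinstein)
      (fun A => E.bdry_Wv hEinstein _ _ _ _) hz' hf hef a
    refine ⟨_, h1, ?_⟩
    convert h2 using 2
    rw [← Finset.sum_neg_distrib]
    refine Finset.sum_congr rfl fun A _ => ?_
    have h0 : c.bdry (c.radial ((E.hat c).Wv (AAdS.Geometry.ev A.succ.succ) (E.hat c).nullOut
          (E.hat c).nullIn (E.hat c).nullOut) + c.radial ((E.hat c).Wv (AAdS.Geometry.ev A.succ.succ)
          (E.hat c).nullIn (E.hat c).nullIn (E.hat c).nullOut)) = 0 := by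
      rw [map_add, ← eq_neg_iff_add_eq_zero]
      exact L.κ_out_in_out A
    have := AAdS.SphereChart.evalAt_eq_zero_of_bdry h0 hz'
    rw [map_add, ← eq_neg_iff_add_eq_zero] at this
    rw [this]
    ring
  · have h1 := E.tendsto_nabla43_frame hEinstein (E.alpha_eq c hEinstein) hout hz' hf hef a a₁
    have h2 := E.tendsto_nabla43_frame hEinstein (E.alphaBar_eq c hEinstein) hin hz' hf hef a a₁
    refine ⟨_, h1, ?_⟩
    convert h2 using 2
    simp only [← Finset.sum_neg_distrib]
    refine Finset.sum_congr rfl fun A _ => Finset.sum_congr rfl fun B _ => ?_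
    -- The transport equation for `α + α̲`: the two limits are opposite.
    have := AAdS.SphereChart.evalAt_eq_zero_of_bdry (E.bdry_limitDeriv_add c hEinstein hE A B) hz'
    rw [map_add, ← eq_neg_iff_add_eq_zero] at this
    rw [this]
    ring
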